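/- **Setting.** $\mathbb R^{2,3}$ is $\mathbb R^5$ with $\langle X,Y\rangle=-(X^0Y^4+X^4Y^0)-X^1Y^1+X^2Y^2+X^3Y^3$ and standard basis $E_0,\dots,E_4$; put $h=(\langle E_i,E_j\rangle)$, $P_0=\frac{E_0+E_4}{\sqrt2}$, $P_1=E_1$, $P_2=E_2$, $P_3=E_3$, $P_4=\frac{E_4-E_0}{\sqrt2}$. The Einstein universe $\mathcal E^{1,2}$ is the manifold of null rays $[V]$, realized as the product of the unit circle of $\mathrm{span}(P_0,P_1)$ and the unit sphere of $\mathrm{span}(P_2,P_3,P_4)$, with the induced Lorentz metric; $S^{2,2}=\{\langle S,S\rangle=1\}$. An isotropic bivector $V\wedge W\ne0$ is *future-directed* if $\langle X,V\rangle\langle Y,W\rangle-\langle Y,V\rangle\langle X,W\rangle>0$ whenever $\mathrm{span}(X,Y)$ is negative definite and $\det(X,Y,P_2,P_3,P_4)>0$. A *lightcone basis* is a positively oriented basis $(F_0,\dots,F_4)$ with Gram matrix $h$ and with $F_0\wedge(F_1+F_2)$ future-directed. **Timelike immersions.** Let $X$ be an oriented surface and $f:X\to\mathcal E^{1,2}$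 a smooth immersion that is *timelike*: $g=f^*g_{\mathcal E}$ is Lorentzian. For a local smooth field $F$ of lightcone bases with $[F_0]=f$ put $dF_j=\sum_i\phi^i_jF_i$. $F$ is of *second order* if $\phi^3_0=0$, $\phi^1_0\wedge\phi^2_0>0$ and $\phi^3_1\wedge\phi^2_0+\phi^3_2\wedge\phi^1_0=0$; the *conformal Gauss map* is $\mathcal N_f=F_3:X\to S^{2,2}$ for such $F$. A point is *umbilical* if $f\wedge d\mathcal N_f=0$ there, and *quasi-umbilical* if $\langle d\mathcal N_f,d\mathcal N_f\rangle=0$ and $f\wedge d\mathcal N_f\neq0$ there; $f$ is *quasi-umbilical* if all points are. View then $d\mathcal N_f$ as an endomorphism of $T_xX\cong\mathrm{span}(f,df(T_xX))/\mathrm{span}(f)$. For $0\ne V\in\mathrm{Im}\,d\mathcal N_f$ and $V_*$ null with $g(V,V_*)=-1$, the pairs $(V,V_*)$ are positive for exactly one orientation, the *canonical* one, with which $X$ is always equipped when $f$ is quasi-umbilical; the *helicity* $\varepsilon_f=\pm1$ is the sign of $-g(d\mathcal N_f(V_*),V_*)$. A second order frame field is *adapted* if $\phi^3_1=\phi^3_2=\varepsilon_f(\phi^1_0+\phi^2_0)$,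 $\phi^3_4=\phi^0_0-2\phi^2_1=0$ and $(\phi^1_4+\phi^2_4)\wedge(\phi^1_0+\phi^2_0)=0$; the *dual map* is $f^\sharp=[F_4]$ for adapted $F$. $f$ is *exceptional* if $\langle d\mathcal N_f,df^\sharp\rangle\equiv0$, and *regular* if the leaf space $\Lambda$ of $\mathrm{Ker}\,d\mathcal N_f$ is Hausdorff. **Biisotropic curves.** Let $\Lambda$ be a connected 1-manifold; primes are derivatives with respect to a nowhere zero 1-form $\zeta$. A smooth curve $\Gamma:\Lambda\to S^{2,2}$ is *biisotropic* if $\langle\Gamma',\Gamma'\rangle=\langle\Gamma'',\Gamma''\rangle=0$ and $\Gamma'\wedge\Gamma''\ne0$ everywhere, for some (equivalently every) $\zeta$. *Calibrated data* $(\delta,\zeta,C)$ for $\Gamma$ consist of a sign $\delta=\pm1$, a form $\zeta$ and a lightcone basis $C$ such that $$\Gamma=\delta C_3+x(C_1-C_2)+yC_4,\qquad x'y''-x''y'=1 .$$ Put $\upsilon^2=x'^2+y'^2$, $\mu=xy'-x'y$ and $$R=-x'C_0+\tfrac12y'(C_1+C_2)+\tfrac{\mu^2}{2\upsilon^2}y'(C_1-C_2)+\delta\mu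 C_3-\tfrac{\mu^2}{2\upsilon^2}x'C_4 .$$ The *normal tube* is $\mathbb T_\Gamma=\{(\tau,[V]): 0\neq V\in\mathrm{span}(R(\tau),\Gamma'(\tau))\}$, identified with $\Lambda\times S^1$ by $(\tau,\theta)\mapsto(\tau,[\cos\theta\,R(\tau)+\frac12\sin\theta\,\Gamma'(\tau)])$; $\pi_\Lambda(\tau,[V])=\tau$; $f_\Gamma(\tau,[V])=[V]$ is the *tautological map*; $C_\pm=\{\theta=\pm\pi/2\}$; $\mathbb T^\pm_\Gamma=\{\mathrm{sgn}(\cos\theta)=\pm1\}$; $f^\pm_\Gamma=f_\Gamma|_{\mathbb T_\Gamma^\pm}$. **Theorem B.** *(1)* Let $\Gamma:\Lambda\to S^{2,2}$ be biisotropic. Calibrated data exist. For all calibrated data $(\delta,\zeta,C)$ the identification $\Lambda\times S^1\to\mathbb T_\Gamma$ is bijective, $f_\Gamma$ is a timelike immersion, and $\mathbb T_\Gamma$ has an orientation $o$ with respect to which its conformal Gauss map is $\Gamma\circ\pi_\Lambda$; its umbilic locus is $C_+\cup C_-$. The maps $f^\pm_\Gamma$ are exceptional quasi-umbilical immersions,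 with canonical orientation $\delta o$, helicity $\pm\delta$ and dual map $[\mp\Gamma''\circ\pi_\Lambda]$. In particular, if $\delta=1$, then $o$ is the canonical orientation on $\mathbb T^\pm_\Gamma$ and $f_\Gamma^\pm$ has helicity $\pm1$. *(2)* Conversely, let $X$ be a connected surface and $f:X\to\mathcal E^{1,2}$ a regular exceptional quasi-umbilical immersion with helicity $\varepsilon=\pm1$. Then its leaf space $\Lambda$ is a (connected) 1-manifold for which the projection $\pi:X\to\Lambda$ is a smooth submersion, $\mathcal N_f=\Gamma\circ\pi$ for a biisotropic curve $\Gamma:\Lambda\to S^{2,2}$ (the directrix curve), all calibrated data of $\Gamma$ have $\delta=1$ (and such data exist), and $f(X)\subset f^{+}_\Gamma(\mathbb T^{+}_\Gamma)$ if $\varepsilon=1$, $f(X)\subset f^-_\Gamma(\mathbb T^-_\Gamma)$ if $\varepsilon=-1$. -/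

import Mathlib

open Set Topology
open scoped Manifold ContDiff

noncomputable section

namespace Einstein

/-! ### The pseudo-Euclidean space of signature (2,3) and the Einstein universe -/

/-- The vector space underlying `ℝ^{2,3}` (the norm plays no role beyond the topology). -/
abbrev R23 : Type := Fin 5 → ℝ

/-- The scalar product `-(X⁰Y⁴+X⁴Y⁰) - X¹Y¹ + X²Y² + X³Y³`. -/
def sp (X Y : R23) : ℝ :=
  -(X 0 * Y 4 + X 4 * Y 0) - X 1 * Y 1 + X 2 * Y 2 + X 3 * Y 3

/-- The Gram matrix of `sp` in the standard basis. -/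
def gram : Matrix (Fin 5) (Fin 5) ℝ :=
  !![0, 0, 0, 0, -1;
     0, -1, 0, 0, 0;
     0, 0, 1, 0, 0;
     0, 0, 0, 1, 0;
     -1, 0, 0, 0, 0]

/-- The matrix whose columns are the vectors `F 0, …, F 4`. -/
def colMatrix (F : Fin 5 → R23) : Matrix (Fin 5) (Fin 5) ℝ :=
  Matrix.of fun i j => F j i

/-- The standard pseudo-orthogonal basis `P₀, …, P₄`; `P₀, P₁` span the negative definite plane
and `P₂, P₃, P₄` the spacelike 3-space of the fixed splitting. -/
def stdP : Fin 5 → R23 :=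
  ![![1 / √2, 0, 0, 0, 1 / √2],
    ![0, 1, 0, 0, 0],
    ![0, 0, 1, 0, 0],
    ![0, 0, 0, 1, 0],
    ![-(1 / √2), 0, 0, 0, 1 / √2]]

/-- `X ∧ Y` is a positive bivector: `sp` is negative definite on `span {X, Y}` and
`det (X, Y, P₂, P₃, P₄) > 0`. -/
def IsPositiveBivector (X Y : R23) : Prop :=
  (∀ a b : ℝ, (a ≠ 0 ∨ b ≠ 0) → sp (a • X + b • Y) (a • X + b • Y) < 0) ∧
    0 < (colMatrix ![X, Y, stdP 2, stdP 3, stdP 4]).det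

/-- `V ∧ W` is a future-directed isotropic bivector. -/
def IsFutureDirected (V W : R23) : Prop :=
  LinearIndependent ℝ ![V, W] ∧ sp V V = 0 ∧ sp W W = 0 ∧ sp V W = 0 ∧
    ∀ X Y : R23, IsPositiveBivector X Y → 0 < sp X V * sp Y W - sp Y V * sp X W

/-- Lightcone bases, i.e. (as columns) the elements of the restricted conformal group. -/
def IsLightconeBasis (F : Fin 5 → R23) : Prop :=
  0 < (colMatrix F).det ∧ (∀ i j, sp (F i) (F j) = gram i j) ∧
    IsFutureDirected (F 0) (F 1 + F 2)

/-- `⟨V₊, V₊⟩` for the projection `V₊` of `V` to `span {P₂, P₃, P₄}`. -/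
def posNormSq (V : R23) : ℝ := sp V (stdP 2) ^ 2 + sp V (stdP 3) ^ 2 + sp V (stdP 4) ^ 2

/-- `-⟨V₋, V₋⟩` for the projection `V₋` of `V` to `span {P₀, P₁}`. -/
def negNormSq (V : R23) : ℝ := sp V (stdP 0) ^ 2 + sp V (stdP 1) ^ 2

/-- The Einstein universe `S¹₋ × S²₊ ⊂ ℝ^{2,3}`. Its Lorentz metric is the restriction of `sp`. -/
def einsteinUniverse : Set R23 := {V | negNormSq V = 1 ∧ posNormSq V = 1}

/-- The point `[V]` of the Einstein universe that lies on the ray of the nonzero null vector `V`. -/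
def ray (V : R23) : R23 := (√(posNormSq V))⁻¹ • V

/-- The neutral space form `S^{2,2}`. -/
def neutralSphere : Set R23 := {V | sp V V = 1}

/-! ### Timelike surfaces -/

section Surfaces

variable {E : Type*} [NormedAddCommGroup E] [NormedSpace ℝ E] {H : Type*} [TopologicalSpace H]
  (I : ModelWithCorners ℝ E H) {X : Type*} [TopologicalSpace X] [ChartedSpace H X]

/-- `(v, w)` is a positive basis of `T_x X` for the orientation `o` of that tangent plane. -/
def IsPositivePair {x : X} (o : Orientation ℝ (TangentSpace I x) (Fin 2))
    (v w : TangentSpace I x) : Prop :=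
  ∃ b : Module.Basis (Fin 2) ℝ (TangentSpace I x), b 0 = v ∧ b 1 = w ∧ b.orientation = o

/-- A choice of orientations of the tangent planes is an orientation of the surface: near each point
it is induced by a smooth local frame. -/
def IsSurfaceOrientation [IsManifold I ∞ X]
    (o : ∀ x : X, Orientation ℝ (TangentSpace I x) (Fin 2)) : Prop :=
  ∀ x : X, ∃ U : Set X, IsOpen U ∧ x ∈ U ∧ ∃ v w : ∀ y : X, TangentSpace I y,
    ContMDiffOn I I.tangent ∞ (fun y => (⟨y, v y⟩ : TangentBundle I X)) U ∧
    ContMDiffOn I I.tangent ∞ (fun y => (⟨y, w y⟩ : TangentBundle I X)) U ∧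
    ∀ y ∈ U, IsPositivePair I (o y) (v y) (w y)

/-- The orientation `o` if `δ = 1`, and the opposite one otherwise. -/
def signedOrientation (δ : ℝ) (o : ∀ x : X, Orientation ℝ (TangentSpace I x) (Fin 2)) :
    ∀ x : X, Orientation ℝ (TangentSpace I x) (Fin 2) :=
  open Classical in fun x => if δ = 1 then o x else -o x

/-- The induced metric `f^* g`. -/
def inducedMetric (f : X → R23) (x : X) (v w : TangentSpace I x) : ℝ :=
  sp (mvfderiv I f x v) (mvfderiv I f x w)

/-- On the open set `W` of the surface, `f` is a smooth immersion into the Einstein universe whose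
induced metric is Lorentzian, i.e. of signature `(1,1)`. -/
def IsTimelikeImmersionOn (f : X → R23) (W : Set X) : Prop :=
  ContMDiffOn I 𝓘(ℝ, R23) ∞ f W ∧
    ∀ x ∈ W, f x ∈ einsteinUniverse ∧ Function.Injective (mvfderiv I f x) ∧
      ∃ v w : TangentSpace I x, inducedMetric I f x v v = -1 ∧ inducedMetric I f x w w = 1 ∧
        inducedMetric I f x v w = 0

/-- The Maurer-Cartan matrix `φ = F⁻¹ dF` of a frame field, evaluated on a tangent vector;
`mc I F x v i j` is `φ^i_j(v)`. -/
def mc (F : X → Fin 5 → R23) (x : X) (v : TangentSpace I x) : Matrix (Fin 5) (Fin 5) ℝ :=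
  (colMatrix (F x))⁻¹ * colMatrix (mvfderiv I F x v)

/-- The wedge product of two covectors, evaluated on a pair of vectors. -/
def wedge {x : X} (α β : TangentSpace I x → ℝ) (v w : TangentSpace I x) : ℝ :=
  α v * β w - α w * β v

/-- `F` is a conformal frame field along `f` on the open set `U`. -/
def IsFrameField (f : X → R23) (U : Set X) (F : X → Fin 5 → R23) : Prop :=
  ContMDiffOn I 𝓘(ℝ, Fin 5 → R23) ∞ F U ∧
    ∀ x ∈ U, IsLightconeBasis (F x) ∧ f x = ray (F x 0)

/-- First order frame fields: `φ^3_0 = 0` and `φ^1_0 ∧ φ^2_0 > 0`. -/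
def IsFirstOrderFrame (f : X → R23) (o : ∀ x : X, Orientation ℝ (TangentSpace I x) (Fin 2))
    (U : Set X) (F : X → Fin 5 → R23) : Prop :=
  IsFrameField I f U F ∧
    ∀ x ∈ U, (∀ v, mc I F x v 3 0 = 0) ∧
      ∀ v w, IsPositivePair I (o x) v w →
        0 < wedge I (fun v => mc I F x v 1 0) (fun v => mc I F x v 2 0) v w

/-- Second order frame fields: `φ^3_1 ∧ φ^2_0 + φ^3_2 ∧ φ^1_0 = 0`. -/
def IsSecondOrderFrame (f : X → R23) (o : ∀ x : X, Orientation ℝ (TangentSpace I x) (Fin 2))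
    (U : Set X) (F : X → Fin 5 → R23) : Prop :=
  IsFirstOrderFrame I f o U F ∧
    ∀ x ∈ U, ∀ v w,
      wedge I (fun v => mc I F x v 3 1) (fun v => mc I F x v 2 0) v w +
        wedge I (fun v => mc I F x v 3 2) (fun v => mc I F x v 1 0) v w = 0

/-- The conformal Gauss map of `f`: its value at `x` is `F₃(x)` for a second order frame field `F`
near `x`. -/
def gaussMap (f : X → R23) (o : ∀ x : X, Orientation ℝ (TangentSpace I x) (Fin 2)) (x : X) : R23 :=
  Classical.epsilon fun n => ∃ (U : Set X) (F : X → Fin 5 → R23),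
    IsOpen U ∧ x ∈ U ∧ IsSecondOrderFrame I f o U F ∧ F x 3 = n

/-- Umbilical points: `f(x) ∧ dN = 0`. -/
def IsUmbilicPoint (f : X → R23) (o : ∀ x : X, Orientation ℝ (TangentSpace I x) (Fin 2))
    (x : X) : Prop :=
  ∀ v : TangentSpace I x, ¬ LinearIndependent ℝ ![f x, mvfderiv I (gaussMap I f o) x v]

/-- Quasi-umbilical points: `⟨dN, dN⟩ = ϱ f^* g` with `ϱ(x) = 0`, and `f(x) ∧ dN ≠ 0`. -/
def IsQuasiUmbilicPoint (f : X → R23) (o : ∀ x : X, Orientation ℝ (TangentSpace I x) (Fin 2))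
    (x : X) : Prop :=
  (∀ v w : TangentSpace I x,
    sp (mvfderiv I (gaussMap I f o) x v) (mvfderiv I (gaussMap I f o) x w) = 0) ∧
  ¬ IsUmbilicPoint I f o x

/-- The restriction of `f` to the open set `W` is a quasi-umbilical timelike immersion. -/
def IsQuasiUmbilicalOn (f : X → R23) (o : ∀ x : X, Orientation ℝ (TangentSpace I x) (Fin 2))
    (W : Set X) : Prop :=
  IsTimelikeImmersionOn I f W ∧ ∀ x ∈ W, IsQuasiUmbilicPoint I f o x

/-- `V ∈ Im dN` at `x`, where `dN` is regarded as an endomorphism of `T_x X` through the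
identification of `T_x X` with `span {f, df(T_x X)} / span {f}`. -/
def MemImDGauss (f : X → R23) (o : ∀ x : X, Orientation ℝ (TangentSpace I x) (Fin 2))
    (x : X) (V : TangentSpace I x) : Prop :=
  ∃ (u : TangentSpace I x) (c : ℝ),
    mvfderiv I (gaussMap I f o) x u = mvfderiv I f x V + c • f x

/-- `(V, V')` consists of a nonzero vector of `Im dN` and a null vector `V'` with
`g(V, V') = -1`. -/
def IsNullPair (f : X → R23) (o : ∀ x : X, Orientation ℝ (TangentSpace I x) (Fin 2))
    (x : X) (V V' : TangentSpace I x) : Prop :=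
  V ≠ 0 ∧ MemImDGauss I f o x V ∧ inducedMetric I f x V' V' = 0 ∧ inducedMetric I f x V V' = -1

/-- `o` is the canonical orientation of the quasi-umbilical immersion `f` on `W`. -/
def IsCanonicalOrientationOn (f : X → R23)
    (o : ∀ x : X, Orientation ℝ (TangentSpace I x) (Fin 2)) (W : Set X) : Prop :=
  ∀ x ∈ W, ∀ V V' : TangentSpace I x, IsNullPair I f o x V V' → IsPositivePair I (o x) V V'

/-- The helicity on `W` is `ε`: the sign of `-g(dN(V'), V')` is `ε`, for all pairs `(V, V')` as in
the previous definition (here `g(dN(V'), V') = ⟨dN(V'), df(V')⟩`, as `⟨f, df⟩ = 0`). -/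
def HasHelicityOn (f : X → R23) (o : ∀ x : X, Orientation ℝ (TangentSpace I x) (Fin 2))
    (W : Set X) (ε : ℝ) : Prop :=
  ∀ x ∈ W, ∀ V V' : TangentSpace I x, IsNullPair I f o x V V' →
    Real.sign (-sp (mvfderiv I (gaussMap I f o) x V') (mvfderiv I f x V')) = ε

/-- Adapted frame fields of a quasi-umbilical immersion of helicity `ε`: second order frame fields
with `φ^3_1 = φ^3_2 = ε (φ^1_0 + φ^2_0)`, i.e. `h = ε`, and
`φ^3_4 = φ^0_0 - 2 φ^2_1 = 0`, `(φ^1_4 + φ^2_4) ∧ (φ^1_0 + φ^2_0) = 0`. -/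
def IsAdaptedFrame (f : X → R23) (o : ∀ x : X, Orientation ℝ (TangentSpace I x) (Fin 2))
    (ε : ℝ) (U : Set X) (F : X → Fin 5 → R23) : Prop :=
  IsSecondOrderFrame I f o U F ∧
    ∀ x ∈ U,
      (∀ v, mc I F x v 3 1 = ε * (mc I F x v 1 0 + mc I F x v 2 0)) ∧
      (∀ v, mc I F x v 3 2 = ε * (mc I F x v 1 0 + mc I F x v 2 0)) ∧
      (∀ v, mc I F x v 3 4 = 0) ∧
      (∀ v, mc I F x v 0 0 - 2 * mc I F x v 2 1 = 0) ∧
      ∀ v w, wedge I (fun v => mc I F x v 1 4 + mc I F x v 2 4)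
        (fun v => mc I F x v 1 0 + mc I F x v 2 0) v w = 0

/-- The dual map of a quasi-umbilical immersion of helicity `ε`: its value at `x` is `[F₄(x)]` for an
adapted frame field `F` near `x`. -/
def dualMap (f : X → R23) (o : ∀ x : X, Orientation ℝ (TangentSpace I x) (Fin 2)) (ε : ℝ)
    (x : X) : R23 :=
  Classical.epsilon fun p => ∃ (U : Set X) (F : X → Fin 5 → R23),
    IsOpen U ∧ x ∈ U ∧ IsAdaptedFrame I f o ε U F ∧ ray (F x 4) = p

/-- The quasi-umbilical immersion `f` of helicity `ε` is exceptional on `W`: the quadratic form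
`⟨dN, df♯⟩` vanishes identically. -/
def IsExceptionalOn (f : X → R23) (o : ∀ x : X, Orientation ℝ (TangentSpace I x) (Fin 2))
    (ε : ℝ) (W : Set X) : Prop :=
  ∀ x ∈ W, ∀ v : TangentSpace I x,
    sp (mvfderiv I (gaussMap I f o) x v) (mvfderiv I (dualMap I f o ε) x v) = 0

/-- Two points lie on the same leaf of the distribution `Ker dN`: they are joined by finitely many
smooth curves tangent to `Ker dN`. -/
def leafSetoid (N : X → R23) : Setoid X :=
  Relation.EqvGen.setoid fun x y => ∃ γ : ℝ → X, ContMDiff 𝓘(ℝ, ℝ) I ∞ γ ∧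
    (∀ t : ℝ, mvfderiv I N (γ t) (mfderiv 𝓘(ℝ, ℝ) I γ t (1 : ℝ)) = 0) ∧ γ 0 = x ∧ γ 1 = y

/-- The leaf space of `Ker dN`, with the quotient topology. -/
abbrev LeafSpace (N : X → R23) : Type _ := Quotient (leafSetoid I N)

end Surfaces

/-! ### Biisotropic curves and their normal tubes -/

section Curves

variable {L : Type*} [TopologicalSpace L] [ChartedSpace ℝ L] {V : Type*} [NormedAddCommGroup V]
  [NormedSpace ℝ V]

/-- A nowhere zero 1-form `ζ` on a 1-manifold, given by its dual vector field `ξ`, `ζ(ξ) = 1`. -/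
def IsLineElement [IsManifold 𝓘(ℝ, ℝ) ∞ L] (ξ : ∀ t : L, TangentSpace 𝓘(ℝ, ℝ) t) : Prop :=
  ContMDiff 𝓘(ℝ, ℝ) 𝓘(ℝ, ℝ).tangent ∞ (fun t => (⟨t, ξ t⟩ : TangentBundle 𝓘(ℝ, ℝ) L)) ∧
    ∀ t, ξ t ≠ 0

/-- The derivative `G'` with respect to `ζ`: `dG = G' ζ`. -/
def der (ξ : ∀ t : L, TangentSpace 𝓘(ℝ, ℝ) t) (G : L → V) (t : L) : V :=
  mvfderiv 𝓘(ℝ, ℝ) G t (ξ t)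

/-- Biisotropic curves in `S^{2,2}`. -/
def IsBiisotropic [IsManifold 𝓘(ℝ, ℝ) ∞ L] (Γ : L → R23) : Prop :=
  ContMDiff 𝓘(ℝ, ℝ) 𝓘(ℝ, R23) ∞ Γ ∧ (∀ t, Γ t ∈ neutralSphere) ∧
    ∃ ξ : ∀ t : L, TangentSpace 𝓘(ℝ, ℝ) t, IsLineElement ξ ∧
      ∀ t, sp (der ξ Γ t) (der ξ Γ t) = 0 ∧ sp (der ξ (der ξ Γ) t) (der ξ (der ξ Γ) t) = 0 ∧
        LinearIndependent ℝ ![der ξ Γ t, der ξ (der ξ Γ) t]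

/-- The first coordinate of the affine reduction of `Γ`, see `IsCalibrated`. -/
def affX (Γ : L → R23) (C : Fin 5 → R23) (t : L) : ℝ := -(1 / 2) * sp (Γ t) (C 1 + C 2)

/-- The second coordinate of the affine reduction of `Γ`, see `IsCalibrated`. -/
def affY (Γ : L → R23) (C : Fin 5 → R23) (t : L) : ℝ := -sp (Γ t) (C 0)

/-- The lightcone basis `C` is calibrated to `Γ` and to the affine line element dual to `ξ`, with
sign `δ = ±1`: `Γ = δ C₃ + x (C₁ - C₂) + y C₄` for an affine plane curve `(x, y)` with
`x' y'' - x'' y' = 1`. -/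
def IsCalibrated [IsManifold 𝓘(ℝ, ℝ) ∞ L] (Γ : L → R23) (δ : ℝ)
    (ξ : ∀ t : L, TangentSpace 𝓘(ℝ, ℝ) t) (C : Fin 5 → R23) : Prop :=
  (δ = 1 ∨ δ = -1) ∧ IsLineElement ξ ∧ IsLightconeBasis C ∧
    ∀ t, Γ t = δ • C 3 + affX Γ C t • (C 1 - C 2) + affY Γ C t • C 4 ∧
      der ξ (affX Γ C) t * der ξ (der ξ (affY Γ C)) t -
        der ξ (der ξ (affX Γ C)) t * der ξ (affY Γ C) t = 1

/-- The isotropic normal vector field `R` along `Γ` relative to a calibrated basis. -/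
def isotropicNormal (Γ : L → R23) (δ : ℝ) (ξ : ∀ t : L, TangentSpace 𝓘(ℝ, ℝ) t)
    (C : Fin 5 → R23) (t : L) : R23 :=
  let x' := der ξ (affX Γ C) t
  let y' := der ξ (affY Γ C) t
  let υsq := x' ^ 2 + y' ^ 2
  let μ := affX Γ C t * y' - x' * affY Γ C t
  (-x') • C 0 + (y' / 2) • (C 1 + C 2) + (μ ^ 2 / (2 * υsq) * y') • (C 1 - C 2) +
    (μ * δ) • C 3 - (μ ^ 2 / (2 * υsq) * x') • C 4

/-- The normal tube: the pairs `(t, [V])` with `V` in the null plane spanned by `R(t)` and `Γ'(t)`. -/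
def normalTube (Γ : L → R23) (δ : ℝ) (ξ : ∀ t : L, TangentSpace 𝓘(ℝ, ℝ) t)
    (C : Fin 5 → R23) : Set (L × R23) :=
  {q | ∃ V ∈ Submodule.span ℝ {isotropicNormal Γ δ ξ C q.1, der ξ Γ q.1}, V ≠ 0 ∧ q.2 = ray V}

/-- The tautological map, with the normal tube identified with `L × S¹`: it sends
`(t, e^{iθ})` to `[cos θ R(t) + (1/2) sin θ Γ'(t)]`. -/
def tautologicalMap (Γ : L → R23) (δ : ℝ) (ξ : ∀ t : L, TangentSpace 𝓘(ℝ, ℝ) t)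
    (C : Fin 5 → R23) (q : L × Circle) : R23 :=
  ray ((q.2 : ℂ).re • isotropicNormal Γ δ ξ C q.1 + (1 / 2 * (q.2 : ℂ).im) • der ξ Γ q.1)

variable (L) in
/-- The umbilical curves `θ = ± π/2`, for `ε = ±1`. -/
def umbilicalCurve (ε : ℝ) : Set (L × Circle) := {q | (q.2 : ℂ) = ε * Complex.I}

variable (L) in
/-- The parabolic components `sgn (cos θ) = ±1`, for `ε = ±1`. -/
def parabolicComponent (ε : ℝ) : Set (L × Circle) := {q | Real.sign (q.2 : ℂ).re = ε}

end Curves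

/-- The smooth structure of `Λ × S¹`. -/
abbrev tubeModel : ModelWithCorners ℝ (ℝ × EuclideanSpace ℝ (Fin 1))
    (ModelProd ℝ (EuclideanSpace ℝ (Fin 1))) := 𝓘(ℝ, ℝ).prod (𝓡 1)

end Einstein

end

/-!
A lightcone basis `F` is replaced throughout by the null frame
`(P, A, B, N, Q) = (F₀, F₁ - F₂, F₁ + F₂, F₃, F₄)`, all of whose vectors except `N` are isotropic
(`IsNullFrame`, `IsOrientedNullFrame`). A conformal frame field is then a `NullField`, and the
conditions on its Maurer-Cartan forms become conditions on the covectors `⟨dP, A⟩`, `⟨dN, B⟩`, …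
(`dform`): the metric `f^* g` is a positive multiple of `-⟨dP, A⟩ ⟨dP, B⟩`, and second order means
that `⟨dP, N⟩ = 0` and that `⟨dN, ·⟩` is trace free. Comparing two such fields at a point shows that
`N`, respectively the ray of `Q` for adapted fields, does not depend on the choice
(`NullField.IsSecondOrder.gaussMap_eq`, `NullField.IsAdapted.dualMap_eq`); hence one explicit frame
field is enough to compute the conformal Gauss map and the dual map, and in an adapted field
`dN = -ε ⟨dP, A⟩ A` displays umbilicity, canonical orientation and helicity.

**From curves to surfaces.** For a biisotropic curve, `Γ'` and `Γ''` span an isotropic plane that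
contains `Γ'''`. The element `ζ` can be chosen, uniquely and therefore globally, so that the minor
of `Γ' ∧ Γ''` in the two negative directions is `-1` (`exists_global_normalized`). Then `Γ'''` is
proportional to `Γ'`, the bivector `Γ' ∧ Γ''` is constant, and `Γ` is a plane affine curve, which
gives calibrated data. Along a calibrated curve, `(R, -Γ', -2 S, δ Γ, -Γ'')` is an oriented null
frame, where `S` is the isotropic normalization of `R'` (`IsCalibrated.isOrientedNullFrame`).
Rotating this frame by `θ` gives a second order frame field on the whole normal tube, with
`N = δ Γ`; shearing it by `(1/2) tan θ` gives adapted frame fields on the two parabolic components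
(`IsCalibrated.exists_orientation`, `IsCalibrated.isAdapted_parabolicField`). All assertions about
the tube are read off from these two fields (`IsCalibrated.normalTube_geometry`).

**From surfaces to curves.** A quasi-umbilical immersion has adapted frame fields near every point
(`exists_isAdapted`), so `dN` has rank one and `N` is locally a submersion onto a curve. The key
point for the leaf space is that each leaf meets a small flow box in at most one plaque,
    since `N` is
constant on leaves and injective on the transversal of the box. Hence a coordinate of `N` is a chart
of the leaf space, which becomes a 1-manifold on which `N` induces the directrix `Γ`
(`exists_leafSpace_manifold`). In an adapted frame field, `Γ'`
is a multiple of `A`, and for an exceptional immersion `dA` has no component outside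
`span {A, Q}`, so `Γ''` lies in the isotropic plane `span {A, Q}` and `Γ` is biisotropic
(`NullField.IsAdapted.der_directrix`). Comparing the orientation of the adapted frame with that of
the frame along `Γ` forces `δ = 1`. Finally `P` is isotropic, orthogonal to `Γ` and `Γ'` but
not to `Γ''`, hence lies in `span {R, Γ'}`, and the sign of its `R`-component is the helicity
(`NullField.IsAdapted.mem_image_tautologicalMap`, `exists_directrix`).
-/

noncomputable section

namespace Einstein

/-! ### The scalar product of signature (2,3) -/

lemma sp_comm (X Y : R23) : sp X Y = sp Y X := by unfold sp; ring

lemma sp_add_left (X Y Z : R23) : sp (X + Y) Z = sp X Z + sp Y Z := by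
  simp only [sp, Pi.add_apply]; ring

lemma sp_add_right (X Y Z : R23) : sp X (Y + Z) = sp X Y + sp X Z := by
  simp only [sp, Pi.add_apply]; ring

lemma sp_sub_left (X Y Z : R23) : sp (X - Y) Z = sp X Z - sp Y Z := by
  simp only [sp, Pi.sub_apply]; ring

lemma sp_sub_right (X Y Z : R23) : sp X (Y - Z) = sp X Y - sp X Z := by
  simp only [sp, Pi.sub_apply]; ring

lemma sp_neg_left (X Y : R23) : sp (-X) Y = -sp X Y := by
  simp only [sp, Pi.neg_apply]; ring

lemma sp_neg_right (X Y : R23) : sp X (-Y) = -sp X Y := by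
  simp only [sp, Pi.neg_apply]; ring

lemma sp_smul_left (c : ℝ) (X Y : R23) : sp (c • X) Y = c * sp X Y := by
  simp only [sp, Pi.smul_apply, smul_eq_mul]; ring

lemma sp_smul_right (c : ℝ) (X Y : R23) : sp X (c • Y) = c * sp X Y := by
  simp only [sp, Pi.smul_apply, smul_eq_mul]; ring

lemma sp_zero_left (X : R23) : sp 0 X = 0 := by simp [sp]

lemma sp_zero_right (X : R23) : sp X 0 = 0 := by simp [sp]

lemma eq_zero_of_forall_sp {X : R23} (h : ∀ Y, sp X Y = 0) : X = 0 := by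
  ext i
  have h0 := h (Pi.single 4 1)
  have h1 := h (Pi.single 1 1)
  have h2 := h (Pi.single 2 1)
  have h3 := h (Pi.single 3 1)
  have h4 := h (Pi.single 0 1)
  fin_cases i <;> simp_all [sp]

lemma sp_eq_dotProduct (X Y : R23) : sp X Y = X ⬝ᵥ gram.mulVec Y := by
  simp [sp, gram, dotProduct, Matrix.mulVec, Fin.sum_univ_succ]; ring

lemma gram_mul_gram : gram * gram = 1 := by
  ext i j
  fin_cases i <;> fin_cases j <;> simp [gram, Matrix.mul_apply, Fin.sum_univ_succ]

/-- A basis with the Gram matrix of the standard basis. -/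
def IsGramBasis (F : Fin 5 → R23) : Prop := ∀ i j, sp (F i) (F j) = gram i j

lemma gram_mul_transpose_mul_apply (F : Fin 5 → R23) (i : Fin 5) (X : R23) :
    ((gram * (colMatrix F).transpose * gram).mulVec X) i =
      ![-sp X (F 4), -sp X (F 1), sp X (F 2), sp X (F 3), -sp X (F 0)] i := by
  rw [← Matrix.mulVec_mulVec, ← Matrix.mulVec_mulVec]
  fin_cases i <;>
    simp [gram, colMatrix, Matrix.mulVec, dotProduct, Fin.sum_univ_succ, sp] <;>
    ring

lemma IsGramBasis.left_inv {F : Fin 5 → R23} (h : IsGramBasis F) :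
    (gram * (colMatrix F).transpose * gram) * colMatrix F = 1 := by
  have h1 : (colMatrix F).transpose * gram * colMatrix F = gram := by
    ext i j
    rw [← h i j, sp_eq_dotProduct, Matrix.mul_assoc]
    simp only [Matrix.mul_apply, colMatrix, Matrix.transpose_apply, Matrix.of_apply, dotProduct,
      Matrix.mulVec]
  rw [Matrix.mul_assoc, Matrix.mul_assoc, ← Matrix.mul_assoc _ gram, h1, gram_mul_gram]

lemma IsGramBasis.inv_eq {F : Fin 5 → R23} (h : IsGramBasis F) :
    (colMatrix F)⁻¹ = gram * (colMatrix F).transpose * gram :=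
  Matrix.inv_eq_left_inv h.left_inv

lemma IsGramBasis.inv_mul_apply {F : Fin 5 → R23} (h : IsGramBasis F) (D : Fin 5 → R23)
    (i j : Fin 5) : ((colMatrix F)⁻¹ * colMatrix D) i j =
      ![-sp (D j) (F 4), -sp (D j) (F 1), sp (D j) (F 2), sp (D j) (F 3), -sp (D j) (F 0)] i := by
  rw [h.inv_eq, ← gram_mul_transpose_mul_apply]
  rfl

/-- The expansion of a vector in a basis with Gram matrix `gram`. -/
lemma IsGramBasis.expand {F : Fin 5 → R23} (h : IsGramBasis F) (X : R23) :
    X = -sp X (F 4) • F 0 - sp X (F 1) • F 1 + sp X (F 2) • F 2 + sp X (F 3) • F 3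
      - sp X (F 0) • F 4 := by
  have h1 : (colMatrix F).mulVec ((gram * (colMatrix F).transpose * gram).mulVec X) = X := by
    rw [Matrix.mulVec_mulVec, mul_eq_one_comm.mp h.left_inv, Matrix.one_mulVec]
  conv_lhs => rw [← h1]
  have h2 : (gram * (colMatrix F).transpose * gram).mulVec X =
      ![-sp X (F 4), -sp X (F 1), sp X (F 2), sp X (F 3), -sp X (F 0)] :=
    funext fun i => gram_mul_transpose_mul_apply F i X
  rw [h2]
  ext i
  simp [Matrix.mulVec, dotProduct, colMatrix, Fin.sum_univ_succ]
  ring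

lemma IsGramBasis.det_sq {F : Fin 5 → R23} (h : IsGramBasis F) : (colMatrix F).det ^ 2 = 1 := by
  have h1 := congrArg Matrix.det h.left_inv
  have h2 := congrArg Matrix.det gram_mul_gram
  simp only [Matrix.det_mul, Matrix.det_transpose, Matrix.det_one] at h1 h2
  linear_combination h1 + (-(colMatrix F).det ^ 2) * h2

/-! ### Time orientation of isotropic planes -/

lemma inv_sqrt_two_mul_self : (√2)⁻¹ * (√2)⁻¹ = (1 / 2 : ℝ) := by
  rw [← mul_inv, Real.mul_self_sqrt (by norm_num)]; norm_num

lemma sp_eq_stdP (X Y : R23) : sp X Y = -(sp X (stdP 0) * sp Y (stdP 0)) -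
    sp X (stdP 1) * sp Y (stdP 1) + sp X (stdP 2) * sp Y (stdP 2) +
    sp X (stdP 3) * sp Y (stdP 3) + sp X (stdP 4) * sp Y (stdP 4) := by
  have h := inv_sqrt_two_mul_self
  simp [sp, stdP]
  linear_combination (2 * (X 0 * Y 4 + X 4 * Y 0)) * h

/-- The minor of the projections of `X` and `Y` to the negative definite plane `span {P₀, P₁}`. -/
def minor (X Y : R23) : ℝ := sp X (stdP 0) * sp Y (stdP 1) - sp X (stdP 1) * sp Y (stdP 0)

/-- The scalar product of the bivectors `X ∧ Y` and `V ∧ W`. -/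
def bisp (X Y V W : R23) : ℝ := sp X V * sp Y W - sp Y V * sp X W

lemma det_stdP (X Y : R23) : (colMatrix ![X, Y, stdP 2, stdP 3, stdP 4]).det = minor X Y := by
  have h := inv_sqrt_two_mul_self
  simp [colMatrix, minor, Matrix.det_succ_row_zero, Fin.sum_univ_succ, stdP, sp, Fin.succAbove]
  ring

lemma posNormSq_nonneg (V : R23) : 0 ≤ posNormSq V := by unfold posNormSq; positivity

lemma sp_self_eq (V : R23) : sp V V = posNormSq V - negNormSq V := by
  rw [sp_eq_stdP, posNormSq, negNormSq]; ring

lemma eq_zero_of_posNormSq {V : R23} (h : posNormSq V = 0) (h' : negNormSq V = 0) : V = 0 := by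
  apply eq_zero_of_forall_sp
  intro Y
  unfold posNormSq at h
  unfold negNormSq at h'
  have h2 : sp V (stdP 2) = 0 := by nlinarith [sq_nonneg (sp V (stdP 3)), sq_nonneg (sp V (stdP 4))]
  have h3 : sp V (stdP 3) = 0 := by nlinarith [sq_nonneg (sp V (stdP 2)), sq_nonneg (sp V (stdP 4))]
  have h4 : sp V (stdP 4) = 0 := by nlinarith [sq_nonneg (sp V (stdP 3)), sq_nonneg (sp V (stdP 2))]
  have h0 : sp V (stdP 0) = 0 := by nlinarith [sq_nonneg (sp V (stdP 1))]
  have h1 : sp V (stdP 1) = 0 := by nlinarith [sq_nonneg (sp V (stdP 0))]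
  rw [sp_eq_stdP, h0, h1, h2, h3, h4]; ring

lemma posNormSq_pos {V : R23} (h : V ≠ 0) (h' : sp V V = 0) :
    0 < posNormSq V := by
  rcases (posNormSq_nonneg V).lt_or_eq with h1 | h1
  · exact h1
  · exact absurd (eq_zero_of_posNormSq h1.symm (by have := sp_self_eq V; linarith)) h

lemma bisp_pos_of_normalized {X Y V W : R23}
    (hX0 : sp X (stdP 0) = 1) (hX1 : sp X (stdP 1) = 0)
    (hY0 : sp Y (stdP 0) = 0) (hY1 : sp Y (stdP 1) = 1)
    (hV0 : sp V (stdP 0) = 1) (hV1 : sp V (stdP 1) = 0)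
    (hW0 : sp W (stdP 0) = 0) (hW1 : sp W (stdP 1) = 1)
    (hneg : ∀ a b : ℝ, (a ≠ 0 ∨ b ≠ 0) → sp (a • X + b • Y) (a • X + b • Y) < 0)
    (hle : ∀ a b : ℝ, sp (a • V + b • W) (a • V + b • W) ≤ 0) :
    0 < bisp X Y V W := by
  -- the bilinear form `⟨a X + b Y, a V + b W⟩` is negative definite, since the difference of the
  -- two vectors lies in the positive definite space `span {P₂, P₃, P₄}`
  have key : ∀ a b : ℝ, (a ≠ 0 ∨ b ≠ 0) → sp (a • X + b • Y) (a • V + b • W) < 0 := by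
    intro a b hab
    have h1 := hneg a b hab
    have h2 := hle a b
    have h3 : 0 ≤ sp ((a • X + b • Y) - (a • V + b • W)) ((a • X + b • Y) - (a • V + b • W)) := by
      rw [sp_self_eq]
      have : negNormSq ((a • X + b • Y) - (a • V + b • W)) = 0 := by
        simp [negNormSq, sp_sub_left, sp_add_left, sp_smul_left, *]
      rw [this, sub_zero]
      exact posNormSq_nonneg _
    rw [sp_sub_left, sp_sub_right, sp_sub_right, sp_comm (a • V + b • W) (a • X + b • Y)] at h3
    linarith
  have hexp : ∀ a b : ℝ, sp (a • X + b • Y) (a • V + b • W) =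
      a ^ 2 * sp X V + a * b * (sp X W + sp Y V) + b ^ 2 * sp Y W := by
    intro a b
    simp only [sp_add_left, sp_add_right, sp_smul_left, sp_smul_right]; ring
  have h1 := key 1 0 (by simp)
  rw [hexp] at h1
  have h2 := key (-(sp X W + sp Y V)) (2 * sp X V) (Or.inr (by nlinarith))
  rw [hexp] at h2
  have h3 : 0 < 4 * (sp X V * sp Y W) - (sp X W + sp Y V) ^ 2 := by
    by_contra hcon
    nlinarith [mul_nonneg_of_nonpos_of_nonpos (by linarith : sp X V ≤ 0) (not_lt.mp hcon)]
  unfold bisp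
  nlinarith [sq_nonneg (sp X W - sp Y V)]

lemma minor_smul_add (a b c d : ℝ) (V W : R23) :
    minor (a • V + b • W) (c • V + d • W) = (a * d - b * c) * minor V W := by
  simp only [minor, sp_add_left, sp_smul_left]; ring

lemma bisp_smul_add_left (a b c d : ℝ) (X Y V W : R23) :
    bisp (a • X + b • Y) (c • X + d • Y) V W = (a * d - b * c) * bisp X Y V W := by
  simp only [bisp, sp_add_left, sp_smul_left]; ring

lemma bisp_smul_add_right (a b c d : ℝ) (X Y V W : R23) :
    bisp X Y (a • V + b • W) (c • V + d • W) = (a * d - b * c) * bisp X Y V W := by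
  simp only [bisp, sp_add_right, sp_smul_right]; ring

/-- A negative semidefinite plane projects isomorphically to `span {P₀, P₁}`. -/
lemma minor_ne_zero {V W : R23} (hli : LinearIndependent ℝ ![V, W])
    (hle : ∀ a b : ℝ, sp (a • V + b • W) (a • V + b • W) ≤ 0) : minor V W ≠ 0 := by
  intro h0
  rw [LinearIndependent.pair_iff] at hli
  have key : ∀ a b : ℝ, sp (a • V + b • W) (stdP 0) = 0 → sp (a • V + b • W) (stdP 1) = 0 →
      a = 0 ∧ b = 0 := by
    intro a b h h'
    apply hli
    have hneg : negNormSq (a • V + b • W) = 0 := by simp [negNormSq, h, h']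
    apply eq_zero_of_posNormSq _ hneg
    have h1 := hle a b
    rw [sp_self_eq, hneg] at h1
    linarith [posNormSq_nonneg (a • V + b • W)]
  unfold minor at h0
  have e0 := key (sp W (stdP 0)) (-sp V (stdP 0))
    (by simp only [sp_add_left, sp_smul_left]; ring)
    (by simp only [sp_add_left, sp_smul_left]; linear_combination -h0)
  have e1 := key (sp W (stdP 1)) (-sp V (stdP 1))
    (by simp only [sp_add_left, sp_smul_left]; linear_combination h0)
    (by simp only [sp_add_left, sp_smul_left]; ring)
  have e2 := key 1 0 (by simp [neg_eq_zero.mp e0.2])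
    (by simp [neg_eq_zero.mp e1.2])
  exact one_ne_zero e2.1

/-- The sign of `⟨X ∧ Y, V ∧ W⟩`, for a negative definite plane `span {X, Y}` and a negative
semidefinite one `span {V, W}`, is read off from their projections to `span {P₀, P₁}`. -/
lemma bisp_mul_minor_pos {X Y V W : R23}
    (hneg : ∀ a b : ℝ, (a ≠ 0 ∨ b ≠ 0) → sp (a • X + b • Y) (a • X + b • Y) < 0)
    (hli : LinearIndependent ℝ ![V, W])
    (hle : ∀ a b : ℝ, sp (a • V + b • W) (a • V + b • W) ≤ 0) :
    0 < bisp X Y V W * (minor X Y * minor V W) := by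
  have hd := minor_ne_zero hli hle
  have hli' : LinearIndependent ℝ ![X, Y] := by
    rw [LinearIndependent.pair_iff]
    intro a b hab
    by_contra hcon
    have := hneg a b (by tauto)
    rw [hab, sp_zero_left] at this
    exact lt_irrefl _ this
  have hd' : minor X Y ≠ 0 := minor_ne_zero hli' fun a b => by
    by_cases hab : a ≠ 0 ∨ b ≠ 0
    · exact (hneg a b hab).le
    · push Not at hab
      simp [hab, sp_zero_left]
  set m := minor X Y with hm
  set n := minor V W with hn
  have hm1 : sp X (stdP 0) * sp Y (stdP 1) - sp X (stdP 1) * sp Y (stdP 0) = m := rfl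
  have hn1 : sp V (stdP 0) * sp W (stdP 1) - sp V (stdP 1) * sp W (stdP 0) = n := rfl
  have h := bisp_pos_of_normalized
    (X := (sp Y (stdP 1) / m) • X + (-sp X (stdP 1) / m) • Y)
    (Y := (-sp Y (stdP 0) / m) • X + (sp X (stdP 0) / m) • Y)
    (V := (sp W (stdP 1) / n) • V + (-sp V (stdP 1) / n) • W)
    (W := (-sp W (stdP 0) / n) • V + (sp V (stdP 0) / n) • W)
    (by simp only [sp_add_left, sp_smul_left]; field_simp; linear_combination hm1)
    (by simp only [sp_add_left, sp_smul_left]; field_simp; ring)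
    (by simp only [sp_add_left, sp_smul_left]; field_simp; ring)
    (by simp only [sp_add_left, sp_smul_left]; field_simp; linear_combination hm1)
    (by simp only [sp_add_left, sp_smul_left]; field_simp; linear_combination hn1)
    (by simp only [sp_add_left, sp_smul_left]; field_simp; ring)
    (by simp only [sp_add_left, sp_smul_left]; field_simp; ring)
    (by simp only [sp_add_left, sp_smul_left]; field_simp; linear_combination hn1)
    (by
      intro a b hab
      have e : a • ((sp Y (stdP 1) / m) • X + (-sp X (stdP 1) / m) • Y) +
          b • ((-sp Y (stdP 0) / m) • X + (sp X (stdP 0) / m) • Y) =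
          ((a * sp Y (stdP 1) - b * sp Y (stdP 0)) / m) • X +
          ((b * sp X (stdP 0) - a * sp X (stdP 1)) / m) • Y := by
        module
      rw [e]
      apply hneg
      by_contra hcon
      push Not at hcon
      have h1 : a * sp Y (stdP 1) - b * sp Y (stdP 0) = 0 := by
        have := hcon.1; field_simp at this; linarith
      have h2 : b * sp X (stdP 0) - a * sp X (stdP 1) = 0 := by
        have := hcon.2; field_simp at this; linarith
      have ha : a * m = 0 := by
        rw [← hm1]; linear_combination sp X (stdP 0) * h1 + sp Y (stdP 0) * h2
      have hb : b * m = 0 := by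
        rw [← hm1]; linear_combination sp X (stdP 1) * h1 + sp Y (stdP 1) * h2
      rcases hab with hab | hab
      · exact hab ((mul_eq_zero.mp ha).resolve_right hd')
      · exact hab ((mul_eq_zero.mp hb).resolve_right hd'))
    (by
      intro a b
      have e : a • ((sp W (stdP 1) / n) • V + (-sp V (stdP 1) / n) • W) +
          b • ((-sp W (stdP 0) / n) • V + (sp V (stdP 0) / n) • W) =
          ((a * sp W (stdP 1) - b * sp W (stdP 0)) / n) • V +
          ((b * sp V (stdP 0) - a * sp V (stdP 1)) / n) • W := by
        module
      rw [e]
      exact hle _ _)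
  rw [bisp_smul_add_left, bisp_smul_add_right] at h
  have e : (sp Y (stdP 1) / m * (sp X (stdP 0) / m) - -sp X (stdP 1) / m * (-sp Y (stdP 0) / m)) =
      m⁻¹ := by field_simp; linear_combination hm1
  have e' : (sp W (stdP 1) / n * (sp V (stdP 0) / n) - -sp V (stdP 1) / n * (-sp W (stdP 0) / n)) =
      n⁻¹ := by field_simp; linear_combination hn1
  rw [e, e'] at h
  have h2 : bisp X Y V W * (m * n) = (m⁻¹ * (n⁻¹ * bisp X Y V W)) * (m * n) ^ 2 := by
    field_simp
  rw [h2]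
  positivity

lemma isFutureDirected_iff {V W : R23} : IsFutureDirected V W ↔
    LinearIndependent ℝ ![V, W] ∧ sp V V = 0 ∧ sp W W = 0 ∧ sp V W = 0 ∧ 0 < minor V W := by
  have hP : ∀ a b : ℝ, (a ≠ 0 ∨ b ≠ 0) →
      sp (a • stdP 0 + b • stdP 1) (a • stdP 0 + b • stdP 1) < 0 := by
    intro a b hab
    have h := inv_sqrt_two_mul_self
    have h2 : sp (a • stdP 0 + b • stdP 1) (a • stdP 0 + b • stdP 1) = -(a ^ 2 + b ^ 2) := by
      simp [sp, stdP]; linear_combination (-2 * a ^ 2) * h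
    rw [h2]
    rcases hab with hab | hab
    · nlinarith [sq_pos_of_ne_zero hab, sq_nonneg b]
    · nlinarith [sq_pos_of_ne_zero hab, sq_nonneg a]
  have hP1 : minor (stdP 0) (stdP 1) = 1 := by
    have h := inv_sqrt_two_mul_self
    simp [minor, sp, stdP]; linear_combination 2 * h
  unfold IsFutureDirected
  refine and_congr_right fun hli => and_congr_right fun hV => and_congr_right fun hW =>
    and_congr_right fun hVW => ?_
  have hle : ∀ a b : ℝ, sp (a • V + b • W) (a • V + b • W) ≤ 0 := by
    intro a b
    simp only [sp_add_left, sp_add_right, sp_smul_left, sp_smul_right, hV, hW, hVW, sp_comm W V]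
    simp
  constructor
  · intro h
    have h1 := h (stdP 0) (stdP 1) ⟨hP, by rw [det_stdP, hP1]; norm_num⟩
    simpa [minor, sp_comm] using! h1
  · intro h X Y hXY
    have h1 := bisp_mul_minor_pos hXY.1 hli hle
    have h2 := hXY.2
    rw [det_stdP] at h2
    exact (pos_iff_pos_of_mul_pos h1).mpr (mul_pos h2 h)

/-! ### Null frames -/

/-- The Gram matrix of the null frame `(F₀, F₁ - F₂, F₁ + F₂, F₃, F₄)` of a lightcone basis `F`. -/
structure IsNullFrame (P A B N Q : R23) : Prop where
  PP : sp P P = 0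
  PA : sp P A = 0
  PB : sp P B = 0
  PN : sp P N = 0
  PQ : sp P Q = -1
  AA : sp A A = 0
  AB : sp A B = -2
  AN : sp A N = 0
  AQ : sp A Q = 0
  BB : sp B B = 0
  BN : sp B N = 0
  BQ : sp B Q = 0
  NN : sp N N = 1
  NQ : sp N Q = 0
  QQ : sp Q Q = 0

/-- The basis `F` with null frame `(P, A, B, N, Q) = (F₀, F₁ - F₂, F₁ + F₂, F₃, F₄)`. -/
def ofNull (P A B N Q : R23) : Fin 5 → R23 :=
  ![P, (1 / 2 : ℝ) • (A + B), (1 / 2 : ℝ) • (B - A), N, Q]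

/-- The determinant of five vectors. -/
def det5 (P A B N Q : R23) : ℝ := (colMatrix ![P, A, B, N, Q]).det

lemma IsNullFrame.isGramBasis {P A B N Q : R23} (h : IsNullFrame P A B N Q) :
    IsGramBasis (ofNull P A B N Q) := by
  have hs : ∀ X Y, sp X Y = sp Y X := sp_comm
  obtain ⟨PP, PA, PB, PN, PQ, AA, AB, AN, AQ, BB, BN, BQ, NN, NQ, QQ⟩ := h
  intro i j
  fin_cases i <;> fin_cases j <;>
    simp [ofNull, gram, sp_add_right, sp_sub_right,
      sp_smul_right, hs B A, hs N P, hs Q P, hs N A, hs Q A, hs N B, hs Q B,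
      hs Q N, *] <;> norm_num

lemma IsGramBasis.isNullFrame {F : Fin 5 → R23} (h : IsGramBasis F) :
    IsNullFrame (F 0) (F 1 - F 2) (F 1 + F 2) (F 3) (F 4) := by
  constructor <;>
    simp only [sp_add_left, sp_add_right, sp_sub_left, sp_sub_right, h _ _] <;>
    simp [gram] <;> norm_num

lemma ofNull_eq (F : Fin 5 → R23) :
    ofNull (F 0) (F 1 - F 2) (F 1 + F 2) (F 3) (F 4) = F := by
  ext i j
  fin_cases i <;> simp [ofNull] <;> ring

lemma IsNullFrame.expand {P A B N Q : R23} (h : IsNullFrame P A B N Q) (X : R23) :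
    X = -sp X Q • P - (1 / 2 * sp X B) • A - (1 / 2 * sp X A) • B + sp X N • N - sp X P • Q := by
  have := h.isGramBasis.expand X
  simp only [ofNull, Matrix.cons_val, sp_smul_right, sp_add_right, sp_sub_right] at this
  conv_lhs => rw [this]
  module

lemma IsNullFrame.eq_of_sp {P A B N Q : R23} (h : IsNullFrame P A B N Q) {X Y : R23}
    (hP : sp X P = sp Y P) (hA : sp X A = sp Y A) (hB : sp X B = sp Y B) (hN : sp X N = sp Y N)
    (hQ : sp X Q = sp Y Q) : X = Y := by
  rw [h.expand X, h.expand Y, hP, hA, hB, hN, hQ]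

lemma colMatrix_mul (F : Fin 5 → R23) (T : Matrix (Fin 5) (Fin 5) ℝ) :
    colMatrix F * T = colMatrix fun j => ∑ k, T k j • F k := by
  ext i j
  simp [colMatrix, Matrix.mul_apply, mul_comm]

lemma det_ofNull (P A B N Q : R23) :
    (colMatrix (ofNull P A B N Q)).det = 1 / 2 * det5 P A B N Q := by
  have h : colMatrix (ofNull P A B N Q) = colMatrix ![P, A, B, N, Q] *
      !![1, 0, 0, 0, 0; 0, 1/2, -1/2, 0, 0; 0, 1/2, 1/2, 0, 0; 0, 0, 0, 1, 0; 0, 0, 0, 0, 1] := by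
    rw [colMatrix_mul]
    congr 1
    ext j i
    fin_cases j <;> simp [ofNull, Fin.sum_univ_succ] <;> ring
  rw [h, Matrix.det_mul, det5, mul_comm]
  congr 1
  simp [Matrix.det_succ_row_zero, Fin.sum_univ_succ, Fin.succAbove]
  norm_num

lemma IsNullFrame.linearIndependent_PA {P A B N Q : R23} (h : IsNullFrame P A B N Q) {s t : ℝ}
    (hst : s ≠ 0 ∨ t ≠ 0) : LinearIndependent ℝ ![P, s • A + t • B] := by
  rw [LinearIndependent.pair_iff]
  intro a b hab
  have h1 := congrArg (sp · Q) hab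
  have h2 := congrArg (sp · A) hab
  have h3 := congrArg (sp · B) hab
  simp only [sp_add_left, sp_smul_left, sp_comm B A, h.PQ, h.AQ, h.BQ, h.PA, h.PB, h.AA, h.AB,
    h.BB, sp_zero_left] at h1 h2 h3
  refine ⟨by linarith, ?_⟩
  rcases hst with hst | hst
  · exact (mul_eq_zero.mp (by linarith : b * s = 0)).resolve_right hst
  · exact (mul_eq_zero.mp (by linarith : b * t = 0)).resolve_right hst

lemma minor_comb (s t : ℝ) (P A B : R23) :
    minor P (s • A + t • B) = s * minor P A + t * minor P B := by
  simp only [minor, sp_add_left, sp_smul_left]; ring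

/-- The null planes `P ∧ A` and `P ∧ B` of a null frame have the same time orientation. -/
lemma IsNullFrame.minor_pos_iff {P A B N Q : R23} (h : IsNullFrame P A B N Q) :
    0 < minor P B ↔ 0 < minor P A := by
  have key : ∀ s t : ℝ, 0 ≤ s → 0 ≤ t → (s ≠ 0 ∨ t ≠ 0) →
      s * minor P A + t * minor P B ≠ 0 := by
    intro s t hs ht hst
    rw [← minor_comb]
    refine minor_ne_zero (h.linearIndependent_PA hst) fun a b => ?_
    simp only [sp_add_left, sp_add_right, sp_smul_left, sp_smul_right, sp_comm B A,
      sp_comm A P, sp_comm B P, h.PP, h.PA, h.PB, h.AA, h.AB, h.BB]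
    nlinarith [mul_nonneg (mul_nonneg hs ht) (sq_nonneg b)]
  have h1 : minor P A ≠ 0 := by simpa using key 1 0 (by simp) (by simp) (by simp)
  have h2 : minor P B ≠ 0 := by simpa using key 0 1 (by simp) (by simp) (by simp)
  constructor
  · intro h3
    by_contra h4
    have h4 : 0 < -minor P A := by
      rw [neg_pos]; exact lt_of_le_of_ne (not_lt.mp h4) h1
    exact key _ _ h3.le h4.le (Or.inl h2) (by ring)
  · intro h3
    by_contra h4
    have h4 : 0 < -minor P B := by
      rw [neg_pos]; exact lt_of_le_of_ne (not_lt.mp h4) h2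
    exact key _ _ h4.le h3.le (Or.inr h1) (by ring)

/-- Lightcone bases in terms of their null frames. -/
lemma isLightconeBasis_ofNull_iff {P A B N Q : R23} : IsLightconeBasis (ofNull P A B N Q) ↔
    IsNullFrame P A B N Q ∧ 0 < det5 P A B N Q ∧ 0 < minor P A := by
  have hA : ofNull P A B N Q 1 - ofNull P A B N Q 2 = A := by
    simp only [ofNull, Matrix.cons_val]; module
  have hB : ofNull P A B N Q 1 + ofNull P A B N Q 2 = B := by
    simp only [ofNull, Matrix.cons_val]; module
  unfold IsLightconeBasis
  rw [det_ofNull, hB, isFutureDirected_iff]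
  constructor
  · rintro ⟨h1, h2, -, -, -, -, h3⟩
    have h4 : IsNullFrame P A B N Q := by
      have := IsGramBasis.isNullFrame h2
      rw [hA, hB] at this
      exact this
    exact ⟨h4, by linarith, h4.minor_pos_iff.mp h3⟩
  · rintro ⟨h1, h2, h3⟩
    refine ⟨by linarith, h1.isGramBasis, ?_, h1.PP, h1.BB, h1.PB, h1.minor_pos_iff.mpr h3⟩
    simpa [ofNull] using h1.linearIndependent_PA (s := 0) (t := 1) (by simp)

lemma IsLightconeBasis.isNullFrame {F : Fin 5 → R23} (h : IsLightconeBasis F) :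
    IsNullFrame (F 0) (F 1 - F 2) (F 1 + F 2) (F 3) (F 4) :=
  IsGramBasis.isNullFrame h.2.1

lemma IsLightconeBasis.det5_pos {F : Fin 5 → R23} (h : IsLightconeBasis F) :
    0 < det5 (F 0) (F 1 - F 2) (F 1 + F 2) (F 3) (F 4) := by
  rw [← ofNull_eq F, isLightconeBasis_ofNull_iff] at h
  exact h.2.1

lemma IsLightconeBasis.minor_pos {F : Fin 5 → R23} (h : IsLightconeBasis F) :
    0 < minor (F 0) (F 1 - F 2) := by
  rw [← ofNull_eq F, isLightconeBasis_ofNull_iff] at h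
  exact h.2.2

lemma det5_mul (P A B N Q : R23) (T : Matrix (Fin 5) (Fin 5) ℝ) :
    det5 (∑ k, T k 0 • ![P, A, B, N, Q] k) (∑ k, T k 1 • ![P, A, B, N, Q] k)
      (∑ k, T k 2 • ![P, A, B, N, Q] k) (∑ k, T k 3 • ![P, A, B, N, Q] k)
      (∑ k, T k 4 • ![P, A, B, N, Q] k) = det5 P A B N Q * T.det := by
  unfold det5
  rw [← Matrix.det_mul, colMatrix_mul]
  congr 2
  ext j i
  fin_cases j <;> rfl

/-- The orientation of a null frame is determined by the null plane `span {A, Q}` and by the class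
of `N` modulo that plane. -/
lemma IsNullFrame.det5_eq {P A B N Q P' A' B' N' Q' : R23} (h : IsNullFrame P A B N Q)
    (h' : IsNullFrame P' A' B' N' Q') {a b c e κ k l : ℝ} (hA : A' = a • A + b • Q)
    (hQ : Q' = c • A + e • Q) (hN : N' = κ • N + k • A + l • Q) :
    det5 P' A' B' N' Q' = κ * det5 P A B N Q := by
  have hP' := h.expand P'
  have hB' := h.expand B'
  have h1 := h'.PA
  have h2 := h'.PQ
  have h3 : sp B' A' = -2 := by rw [sp_comm, h'.AB]
  rw [hA, sp_add_right, sp_smul_right, sp_smul_right] at h1 h3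
  rw [hQ, sp_add_right, sp_smul_right, sp_smul_right] at h2
  have key := det5_mul P A B N Q
    !![-sp P' Q, 0, -sp B' Q, 0, 0;
       -(1/2 * sp P' B), a, -(1/2 * sp B' B), k, c;
       -(1/2 * sp P' A), 0, -(1/2 * sp B' A), 0, 0;
       sp P' N, 0, sp B' N, κ, 0;
       -sp P' P, b, -sp B' P, l, e]
  have hdet : (!![-sp P' Q, 0, -sp B' Q, 0, 0;
       -(1/2 * sp P' B), a, -(1/2 * sp B' B), k, c;
       -(1/2 * sp P' A), 0, -(1/2 * sp B' A), 0, 0;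
       sp P' N, 0, sp B' N, κ, 0;
       -sp P' P, b, -sp B' P, l, e] : Matrix (Fin 5) (Fin 5) ℝ).det = κ := by
    simp [Matrix.det_succ_row_zero, Fin.sum_univ_succ, Fin.succAbove]
    have e5 : (a * e - b * c) * (sp P' A * sp B' Q - sp B' A * sp P' Q) = -2 := by
      linear_combination (c * sp B' A + e * sp B' Q) * h1 -
        (a * sp B' A + b * sp B' Q) * h2 + h3
    linear_combination (-κ / 2) * e5
  rw [hdet] at key
  rw [mul_comm κ, ← key]
  congr 1
  · conv_lhs => rw [hP']
    simp [Fin.sum_univ_succ]; module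
  · rw [hA]; simp [Fin.sum_univ_succ]
  · conv_lhs => rw [hB']
    simp [Fin.sum_univ_succ]; module
  · rw [hN]; simp [Fin.sum_univ_succ]; module
  · rw [hQ]; simp [Fin.sum_univ_succ]

/-- The null frames of lightcone bases. -/
def IsOrientedNullFrame (P A B N Q : R23) : Prop :=
  IsNullFrame P A B N Q ∧ 0 < det5 P A B N Q ∧ 0 < minor P A

lemma det5_smul (P A B N Q : R23) (p a b n q : ℝ) :
    det5 (p • P) (a • A) (b • B) (n • N) (q • Q) = p * a * b * n * q * det5 P A B N Q := by
  have h := det5_mul P A B N Q (Matrix.diagonal ![p, a, b, n, q])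
  rw [Matrix.det_diagonal] at h
  simp [Fin.prod_univ_succ, Matrix.diagonal_apply] at h
  rw [h]; ring

lemma IsOrientedNullFrame.scale {P A B N Q : R23} (h : IsOrientedNullFrame P A B N Q) {r : ℝ}
    (hr : 0 < r) : IsOrientedNullFrame (r • P) A B N (r⁻¹ • Q) := by
  obtain ⟨h, h1, h2⟩ := h
  refine ⟨?_, ?_, ?_⟩
  · constructor <;>
      simp [sp_smul_left, sp_smul_right, h.PP, h.PA, h.PB, h.PN, h.PQ, h.AA, h.AB, h.AN, h.AQ, h.BB,
        h.BN, h.BQ, h.NN, h.NQ, h.QQ, hr.ne']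
  · have := det5_smul P A B N Q r 1 1 1 r⁻¹
    simp only [one_smul, mul_one, mul_inv_cancel₀ hr.ne', one_mul] at this
    rwa [this]
  · have : minor (r • P) A = r * minor P A := by
      simp only [minor, sp_smul_left]; ring
    rw [this]; positivity

lemma IsOrientedNullFrame.sign {P A B N Q : R23} (h : IsOrientedNullFrame P A B N Q) {ε : ℝ}
    (hε : ε * ε = 1) : IsOrientedNullFrame (ε • P) (ε • A) (ε • B) N (ε • Q) := by
  obtain ⟨h, h1, h2⟩ := h
  refine ⟨?_, ?_, ?_⟩
  · constructor <;>
      simp [sp_smul_left, sp_smul_right, h.PP, h.PA, h.PB, h.PN, h.PQ, h.AA, h.AB, h.AN, h.AQ, h.BB,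
        h.BN, h.BQ, h.NN, h.NQ, h.QQ, hε, ← mul_assoc]
  · have := det5_smul P A B N Q ε ε ε 1 ε
    rw [one_smul] at this
    rw [this, show ε * ε * ε * 1 * ε = (ε * ε) * (ε * ε) by ring, hε]; linarith
  · have : minor (ε • P) (ε • A) = (ε * ε) * minor P A := by
      simp only [minor, sp_smul_left]; ring
    rw [this, hε]; linarith

lemma IsOrientedNullFrame.translate {P A B N Q : R23} (h : IsOrientedNullFrame P A B N Q)
    (a b n : ℝ) : IsOrientedNullFrame P (A + a • P) (B + b • P) (N + n • P)
      (Q - (b / 2) • A - (a / 2) • B + n • N + ((n ^ 2 - a * b) / 2) • P) := by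
  obtain ⟨h, h1, h2⟩ := h
  have hs : ∀ X Y, sp X Y = sp Y X := sp_comm
  refine ⟨?_, ?_, ?_⟩
  · constructor <;>
      simp only [sp_add_left, sp_add_right, sp_sub_left, sp_sub_right, sp_smul_left, sp_smul_right,
        hs A P, hs B P, hs N P, hs Q P, hs B A, hs N A, hs Q A, hs N B, hs Q B, hs Q N,
        h.PP, h.PA, h.PB, h.PN, h.PQ, h.AA, h.AB, h.AN, h.AQ, h.BB,
        h.BN, h.BQ, h.NN, h.NQ, h.QQ] <;> ring
  · have key := det5_mul P A B N Q
      !![1, a, b, n, (n ^ 2 - a * b) / 2;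
         0, 1, 0, 0, -(b / 2);
         0, 0, 1, 0, -(a / 2);
         0, 0, 0, 1, n;
         0, 0, 0, 0, 1]
    simp [Fin.sum_univ_succ, Matrix.det_succ_row_zero, Fin.succAbove] at key
    convert h1 using 1
    rw [← key]
    congr 1 <;> module
  · have : minor P (A + a • P) = minor P A := by
      simp only [minor, sp_smul_left, sp_add_left]; ring
    rwa [this]

lemma IsOrientedNullFrame.rotate {P A B N Q : R23} (h : IsOrientedNullFrame P A B N Q)
    {c s : ℝ} (hcs : c ^ 2 + s ^ 2 = 1) :
    IsOrientedNullFrame (c • P - (s / 2) • A) ((2 * s) • P + c • A) (c • B + s • Q) N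
      (c • Q - s • B) := by
  obtain ⟨h, h1, h2⟩ := h
  have hs : ∀ X Y, sp X Y = sp Y X := sp_comm
  refine ⟨?_, ?_, ?_⟩
  · constructor <;>
      simp only [sp_add_left, sp_add_right, sp_sub_left, sp_sub_right, sp_smul_left, sp_smul_right,
        hs A P, hs N B, hs Q B, hs Q N,
        h.PP, h.PA, h.PB, h.PN, h.PQ, h.AA, h.AB, h.AN, h.AQ, h.BB,
        h.BN, h.BQ, h.NN, h.NQ, h.QQ] <;>
      first | (linear_combination -hcs) | (linear_combination (-2) * hcs) | ring
  · have key := det5_mul P A B N Q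
      !![c, 2 * s, 0, 0, 0;
         -(s / 2), c, 0, 0, 0;
         0, 0, c, 0, -s;
         0, 0, 0, 1, 0;
         0, 0, s, 0, c]
    simp [Fin.sum_univ_succ, Matrix.det_succ_row_zero, Fin.succAbove] at key
    convert h1 using 1
    have e : det5 P A B N Q = det5 P A B N Q *
        (c * (c * (c * c) + c * (s * s)) + 2 * s * (s / 2 * (c * c + s * s))) := by
      linear_combination (-(det5 P A B N Q) * (c ^ 2 + s ^ 2 + 1)) * hcs
    rw [e]
    convert! key using 2 <;> first | module | ring
  · have : minor (c • P - (s / 2) • A) ((2 * s) • P + c • A) = (c ^ 2 + s ^ 2) * minor P A := by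
      simp only [minor, sp_smul_left, sp_add_left, sp_sub_left]; ring
    rw [this, hcs]; linarith

lemma IsOrientedNullFrame.shear {P A B N Q : R23} (h : IsOrientedNullFrame P A B N Q)
    (τ : ℝ) : IsOrientedNullFrame (P - τ • A) A (B + (2 * τ) • Q) N Q := by
  obtain ⟨h, h1, h2⟩ := h
  have hs : ∀ X Y, sp X Y = sp Y X := sp_comm
  refine ⟨?_, ?_, ?_⟩
  · constructor <;>
      simp only [sp_add_left, sp_add_right, sp_sub_left, sp_sub_right, sp_smul_left, sp_smul_right,
        hs A P, hs Q B, hs Q N,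
        h.PP, h.PA, h.PB, h.PN, h.PQ, h.AA, h.AB, h.AN, h.AQ, h.BB,
        h.BN, h.BQ, h.NN, h.NQ, h.QQ] <;> ring
  · have key := det5_mul P A B N Q
      !![1, 0, 0, 0, 0;
         -τ, 1, 0, 0, 0;
         0, 0, 1, 0, 0;
         0, 0, 0, 1, 0;
         0, 0, 2 * τ, 0, 1]
    simp [Fin.sum_univ_succ, Matrix.det_succ_row_zero, Fin.succAbove] at key
    convert h1 using 1
    rw [← key]
    congr 1
  · have : minor (P - τ • A) A = minor P A := by
      simp only [minor, sp_smul_left, sp_sub_left]; ring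
    rwa [this]

lemma IsOrientedNullFrame.flip {P A B N Q : R23} (h : IsOrientedNullFrame P A B N Q) :
    IsOrientedNullFrame P B A (-N) Q := by
  obtain ⟨h, h1, h2⟩ := h
  have hs : ∀ X Y, sp X Y = sp Y X := sp_comm
  refine ⟨?_, ?_, h.minor_pos_iff.mpr h2⟩
  · constructor <;>
      simp only [sp_neg_left, sp_neg_right,
        hs B A, h.PP, h.PA, h.PB, h.PN, h.PQ, h.AA, h.AB, h.AN, h.AQ, h.BB,
        h.BN, h.BQ, h.NN, h.NQ, h.QQ] <;> ring
  · have key := det5_mul P A B N Q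
      !![1, 0, 0, 0, 0;
         0, 0, 1, 0, 0;
         0, 1, 0, 0, 0;
         0, 0, 0, -1, 0;
         0, 0, 0, 0, 1]
    simp [Fin.sum_univ_succ, Matrix.det_succ_row_zero, Fin.succAbove] at key
    rwa [key]

/-! ### Completion to null frames -/

lemma det_colMatrix_sq (F : Fin 5 → R23) :
    (colMatrix F).det ^ 2 = (Matrix.of fun i j => sp (F i) (F j)).det := by
  have h1 : (colMatrix F).transpose * gram * colMatrix F = Matrix.of fun i j => sp (F i) (F j) := by
    ext i j
    rw [Matrix.of_apply, sp_eq_dotProduct, Matrix.mul_assoc]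
    simp only [Matrix.mul_apply, colMatrix, Matrix.transpose_apply, Matrix.of_apply, dotProduct,
      Matrix.mulVec]
  have h2 : gram.det = 1 := by
    simp [gram, Matrix.det_succ_row_zero, Fin.sum_univ_succ, Fin.succAbove]
    norm_num
  rw [← h1, Matrix.det_mul, Matrix.det_mul, Matrix.det_transpose, h2]; ring

/-- Half the cross product of four vectors of `ℝ^{2,3}`. It completes `(P, A, B, Q)` to a positively
oriented null frame. -/
def normalVec (P A B Q : R23) : R23 :=
  (1 / 2 : ℝ) • ![-det5 P A B (Pi.single 4 1) Q, -det5 P A B (Pi.single 1 1) Q,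
    det5 P A B (Pi.single 2 1) Q, det5 P A B (Pi.single 3 1) Q, -det5 P A B (Pi.single 0 1) Q]

lemma sp_normalVec (P A B Q X : R23) : sp (normalVec P A B Q) X = 1 / 2 * det5 P A B X Q := by
  have hlin : ∀ Y : R23, det5 P A B Y Q =
      ((colMatrix ![P, A, B, 0, Q]).cramer Y) 3 := by
    intro Y
    rw [Matrix.cramer_apply, det5]
    congr 1
    ext i j
    fin_cases j <;> simp [colMatrix]
  have hX : X = ∑ i, X i • (Pi.single i 1 : R23) := by
    ext j; simp [Finset.sum_apply, Pi.single_apply]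
  conv_rhs => rw [hlin, hX, map_sum]
  simp only [map_smul, Finset.sum_apply, Pi.smul_apply, smul_eq_mul]
  simp only [← hlin]
  simp [sp, normalVec, Fin.sum_univ_succ]
  ring

lemma det5_eq_zero_of_eq {F : Fin 5 → R23} {i j : Fin 5} (hij : i ≠ j) (h : F i = F j) :
    (colMatrix F).det = 0 :=
  Matrix.det_zero_of_column_eq hij fun k => by simp [colMatrix, h]

lemma isNullFrame_normalVec {P A B Q : R23} (PP : sp P P = 0) (PA : sp P A = 0) (PB : sp P B = 0)
    (PQ : sp P Q = -1) (AA : sp A A = 0) (AB : sp A B = -2) (AQ : sp A Q = 0) (BB : sp B B = 0)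
    (BQ : sp B Q = 0) (QQ : sp Q Q = 0) :
    IsNullFrame P A B (normalVec P A B Q) Q ∧ 0 < det5 P A B (normalVec P A B Q) Q := by
  -- a nonzero vector orthogonal to `P, A, B, Q` completes them to a basis
  have hbasis : ∀ n : R23, n ≠ 0 → sp n P = 0 → sp n A = 0 → sp n B = 0 → sp n Q = 0 →
      det5 P A B n Q ≠ 0 := by
    intro n hn nP nA nB nQ hdet
    obtain ⟨c, hc, hc'⟩ := Matrix.exists_mulVec_eq_zero_iff.mpr hdet
    have hsum : c 0 • P + c 1 • A + c 2 • B + c 3 • n + c 4 • Q = 0 := by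
      rw [← hc']
      ext i
      simp [Matrix.mulVec, dotProduct, colMatrix, Fin.sum_univ_succ]; ring
    have e0 := congrArg (sp · P) hsum
    have e1 := congrArg (sp · A) hsum
    have e2 := congrArg (sp · B) hsum
    have e4 := congrArg (sp · Q) hsum
    simp only [sp_add_left, sp_smul_left, sp_zero_left, PP, PA, PB, PQ, AA, AB, AQ, BB, BQ, QQ,
      nP, nA, nB, nQ, sp_comm A P, sp_comm B P, sp_comm Q P, sp_comm B A, sp_comm Q A,
      sp_comm Q B] at e0 e1 e2 e4
    have c0 : c 0 = 0 := by linarith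
    have c1 : c 1 = 0 := by linarith
    have c2 : c 2 = 0 := by linarith
    have c4 : c 4 = 0 := by linarith
    rw [c0, c1, c2, c4] at hsum
    have c3 : c 3 = 0 := by simpa [hn] using hsum
    apply hc
    ext i
    fin_cases i <;> simp [*]
  set n := normalVec P A B Q with hndef
  have nX : ∀ X, sp n X = 1 / 2 * det5 P A B X Q := sp_normalVec P A B Q
  have nP : sp n P = 0 := by
    rw [nX, det5, det5_eq_zero_of_eq (i := 0) (j := 3) (by decide) rfl, mul_zero]
  have nA : sp n A = 0 := by
    rw [nX, det5, det5_eq_zero_of_eq (i := 1) (j := 3) (by decide) rfl, mul_zero]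
  have nB : sp n B = 0 := by
    rw [nX, det5, det5_eq_zero_of_eq (i := 2) (j := 3) (by decide) rfl, mul_zero]
  have nQ : sp n Q = 0 := by
    rw [nX, det5, det5_eq_zero_of_eq (i := 4) (j := 3) (by decide) rfl, mul_zero]
  have hn0 : n ≠ 0 := by
    obtain ⟨m, hm, hm'⟩ : ∃ m : R23, m ≠ 0 ∧
        (Matrix.of ![P, A, B, Q] * gram).mulVec m = 0 := by
      have hker : LinearMap.ker (Matrix.toLin' (Matrix.of ![P, A, B, Q] * gram)) ≠ ⊥ :=
        LinearMap.ker_ne_bot_of_finrank_lt (by simp)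
      obtain ⟨m, hm, hm0⟩ := Submodule.exists_mem_ne_zero_of_ne_bot hker
      exact ⟨m, hm0, by simpa using hm⟩
    have hm2 : ∀ i, sp m (![P, A, B, Q] i) = 0 := by
      intro i
      have h := congrFun hm' i
      rw [← Matrix.mulVec_mulVec] at h
      rw [sp_comm, sp_eq_dotProduct]
      exact h
    have hne := hbasis m hm (hm2 0) (hm2 1) (hm2 2) (hm2 3)
    intro hn
    have := nX m
    rw [hn, sp_zero_left] at this
    exact hne (by linarith)
  have hdet := hbasis n hn0 nP nA nB nQ
  have hnn : sp n n = 1 / 2 * det5 P A B n Q := nX n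
  have hsq := det_colMatrix_sq ![P, A, B, n, Q]
  have hgram : (Matrix.of fun i j => sp (![P, A, B, n, Q] i) (![P, A, B, n, Q] j)) =
      !![0, 0, 0, 0, -1; 0, 0, -2, 0, 0; 0, -2, 0, 0, 0; 0, 0, 0, sp n n, 0; -1, 0, 0, 0, 0] := by
    ext i j
    fin_cases i <;> fin_cases j <;>
      simp [PP, PA, PB, PQ, AA, AB, AQ, BB, BQ, QQ,
      nP, nA, nB, nQ, sp_comm A P, sp_comm B P, sp_comm Q P, sp_comm B A, sp_comm Q A,
      sp_comm Q B, sp_comm P n, sp_comm A n, sp_comm B n, sp_comm Q n]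
  have hgd : (!![0, 0, 0, 0, -1; 0, 0, -2, 0, 0; 0, -2, 0, 0, 0; 0, 0, 0, sp n n, 0;
      -1, 0, 0, 0, 0] : Matrix (Fin 5) (Fin 5) ℝ).det = 4 * sp n n := by
    simp [Matrix.det_succ_row_zero, Fin.sum_univ_succ, Fin.succAbove]
    ring
  rw [hgram, hgd] at hsq
  have hd2 : det5 P A B n Q = 2 := by
    have h1 : det5 P A B n Q ^ 2 = 4 * sp n n := hsq
    rw [hnn] at h1
    have : det5 P A B n Q * (det5 P A B n Q - 2) = 0 := by linarith
    exact sub_eq_zero.mp ((mul_eq_zero.mp this).resolve_left hdet)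
  refine ⟨⟨PP, PA, PB, by rw [sp_comm, nP], PQ, AA, AB, by rw [sp_comm, nA], AQ, BB,
    by rw [sp_comm, nB], BQ, by rw [hnn, hd2]; norm_num, nQ, QQ⟩, by rw [hd2]; norm_num⟩

/-! ### Calculus on manifolds -/

/-- The scalar product `sp` as a continuous bilinear map. -/
def spL : R23 →L[ℝ] R23 →L[ℝ] ℝ :=
  (LinearMap.mk₂ ℝ sp sp_add_left sp_smul_left sp_add_right sp_smul_right).toContinuousBilinearMap

@[simp] lemma spL_apply (X Y : R23) : spL X Y = sp X Y := rfl

section Calculus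

variable {E : Type*} [NormedAddCommGroup E] [NormedSpace ℝ E] {H : Type*} [TopologicalSpace H]
  {I : ModelWithCorners ℝ E H} {X : Type*} [TopologicalSpace X] [ChartedSpace H X]
  {V : Type*} [NormedAddCommGroup V] [NormedSpace ℝ V]
  {W : Type*} [NormedAddCommGroup W] [NormedSpace ℝ W]

lemma mvfderiv_congr {f g : X → V} {x : X} (h : f =ᶠ[𝓝 x] g) :
    mvfderiv I f x = mvfderiv I g x := by
  ext v
  exact DFunLike.congr_fun (h.mfderiv_eq (I := I) (I' := 𝓘(ℝ, V))) v

lemma mvfderiv_comp_fderiv {f : X → V} {g : V → W} {x : X} (hg : DifferentiableAt ℝ g (f x))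
    (hf : MDifferentiableAt I 𝓘(ℝ, V) f x) (v : TangentSpace I x) :
    mvfderiv I (fun y => g (f y)) x v = fderiv ℝ g (f x) (mvfderiv I f x v) := by
  have h := mfderiv_comp_apply (I := I) (I' := 𝓘(ℝ, V)) (I'' := 𝓘(ℝ, W)) x
    hg.mdifferentiableAt hf v
  rw [mfderiv_eq_fderiv] at h
  exact h

lemma mvfderiv_clm_comp (L : V →L[ℝ] W) {f : X → V} {x : X}
    (hf : MDifferentiableAt I 𝓘(ℝ, V) f x) (v : TangentSpace I x) :
    mvfderiv I (fun y => L (f y)) x v = L (mvfderiv I f x v) := by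
  rw [mvfderiv_comp_fderiv L.differentiableAt hf, L.fderiv]

lemma mvfderiv_pi_apply {ι : Type*} [Fintype ι] {f : X → ι → V} {x : X}
    (hf : MDifferentiableAt I 𝓘(ℝ, ι → V) f x) (v : TangentSpace I x) (i : ι) :
    mvfderiv I f x v i = mvfderiv I (fun y => f y i) x v :=
  (mvfderiv_clm_comp (ContinuousLinearMap.proj (R := ℝ) (φ := fun _ : ι => V) i) hf v).symm

lemma mvfderiv_smul_apply {a : X → ℝ} {f : X → V} {x : X} (ha : MDifferentiableAt I 𝓘(ℝ, ℝ) a x)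
    (hf : MDifferentiableAt I 𝓘(ℝ, V) f x) (v : TangentSpace I x) :
    mvfderiv I (fun y => a y • f y) x v = a x • mvfderiv I f x v + mvfderiv I a x v • f x := by
  rw [mvfderiv_fun_smul ha hf]; rfl

lemma mvfderiv_add_apply {f g : X → V} {x : X} (hf : MDifferentiableAt I 𝓘(ℝ, V) f x)
    (hg : MDifferentiableAt I 𝓘(ℝ, V) g x) (v : TangentSpace I x) :
    mvfderiv I (fun y => f y + g y) x v = mvfderiv I f x v + mvfderiv I g x v := by
  rw [mvfderiv_fun_add hf hg]; rfl

lemma mvfderiv_sub_apply {f g : X → V} {x : X} (hf : MDifferentiableAt I 𝓘(ℝ, V) f x)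
    (hg : MDifferentiableAt I 𝓘(ℝ, V) g x) (v : TangentSpace I x) :
    mvfderiv I (fun y => f y - g y) x v = mvfderiv I f x v - mvfderiv I g x v := by
  rw [mvfderiv_fun_sub hf hg]; rfl

lemma mvfderiv_neg_apply {f : X → V} {x : X} (v : TangentSpace I x) :
    mvfderiv I (fun y => -f y) x v = -mvfderiv I f x v := by
  rw [mvfderiv_fun_neg]; rfl

lemma mvfderiv_const_smul_apply {f : X → V} {x : X} (hf : MDifferentiableAt I 𝓘(ℝ, V) f x) (c : ℝ)
    (v : TangentSpace I x) :
    mvfderiv I (fun y => c • f y) x v = c • mvfderiv I f x v :=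
  mvfderiv_clm_comp (c • ContinuousLinearMap.id ℝ V) hf v

lemma mdifferentiableAt_sp {f g : X → R23} {x : X} (hf : MDifferentiableAt I 𝓘(ℝ, R23) f x)
    (hg : MDifferentiableAt I 𝓘(ℝ, R23) g x) :
    MDifferentiableAt I 𝓘(ℝ, ℝ) (fun y => sp (f y) (g y)) x := by
  have h1 : MDifferentiableAt I 𝓘(ℝ, R23 × R23) (fun y => (f y, g y)) x := hf.prodMk_space hg
  have h2 : DifferentiableAt ℝ (fun p : R23 × R23 => spL p.1 p.2) (f x, g x) :=
    spL.isBoundedBilinearMap.differentiableAt _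
  exact h2.mdifferentiableAt.comp x h1

lemma contMDiffOn_sp {f g : X → R23} {U : Set X} (hf : ContMDiffOn I 𝓘(ℝ, R23) ∞ f U)
    (hg : ContMDiffOn I 𝓘(ℝ, R23) ∞ g U) :
    ContMDiffOn I 𝓘(ℝ, ℝ) ∞ (fun y => sp (f y) (g y)) U := by
  have h1 : ContMDiffOn I 𝓘(ℝ, R23 × R23) ∞ (fun y => (f y, g y)) U := hf.prodMk_space hg
  have h2 : ContDiff ℝ ∞ (fun p : R23 × R23 => spL p.1 p.2) := spL.isBoundedBilinearMap.contDiff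
  exact h2.contMDiff.comp_contMDiffOn h1

lemma mvfderiv_sp {f g : X → R23} {x : X} (hf : MDifferentiableAt I 𝓘(ℝ, R23) f x)
    (hg : MDifferentiableAt I 𝓘(ℝ, R23) g x) (v : TangentSpace I x) :
    mvfderiv I (fun y => sp (f y) (g y)) x v =
      sp (mvfderiv I f x v) (g x) + sp (f x) (mvfderiv I g x v) := by
  have h1 : MDifferentiableAt I 𝓘(ℝ, R23 × R23) (fun y => (f y, g y)) x := hf.prodMk_space hg
  have h2 : DifferentiableAt ℝ (fun p : R23 × R23 => spL p.1 p.2) (f x, g x) :=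
    spL.isBoundedBilinearMap.differentiableAt _
  have h3 := mvfderiv_comp_fderiv (I := I) (f := fun y => (f y, g y)) (x := x)
    (g := fun p : R23 × R23 => spL p.1 p.2) h2 h1 v
  rw [spL.isBoundedBilinearMap.fderiv] at h3
  have h4 := mvfderiv_clm_comp (ContinuousLinearMap.fst ℝ R23 R23) h1 v
  have h5 := mvfderiv_clm_comp (ContinuousLinearMap.snd ℝ R23 R23) h1 v
  simp only [ContinuousLinearMap.coe_fst', ContinuousLinearMap.coe_snd'] at h4 h5
  simp only [spL_apply] at h3
  rw [h3]
  simp [IsBoundedBilinearMap.deriv, h4, h5, add_comm]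

lemma sp_mvfderiv_eq_neg {f g : X → R23} {x : X} {c : ℝ} (hf : MDifferentiableAt I 𝓘(ℝ, R23) f x)
    (hg : MDifferentiableAt I 𝓘(ℝ, R23) g x) (h : ∀ᶠ y in 𝓝 x, sp (f y) (g y) = c)
    (v : TangentSpace I x) : sp (mvfderiv I f x v) (g x) = -sp (mvfderiv I g x v) (f x) := by
  have h1 := mvfderiv_sp hf hg v
  rw [mvfderiv_congr (I := I) (g := fun _ => c) h, mvfderiv_const] at h1
  rw [sp_comm (mvfderiv I g x v)]
  simp at h1
  linarith

/-- The derivative of `f` along a smooth local vector field is smooth. -/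
lemma contMDiffOn_mvfderiv_apply [IsManifold I ∞ X] {f : X → V} {U : Set X} (hU : IsOpen U)
    (hf : ContMDiffOn I 𝓘(ℝ, V) ∞ f U) {v : ∀ y : X, TangentSpace I y}
    (hv : ContMDiffOn I I.tangent ∞ (fun y => (⟨y, v y⟩ : TangentBundle I X)) U) :
    ContMDiffOn I 𝓘(ℝ, V) ∞ (fun y => mvfderiv I f y (v y)) U := by
  have : IsManifold I 1 X := IsManifold.of_le (m := 1) (n := ∞) (by simp)
  have h1 := hf.contMDiffOn_tangentMapWithin (m := ∞) (by simp) hU.uniqueMDiffOn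
  have h2 := h1.comp hv (fun y hy => hy)
  have h3 := (contMDiff_snd_tangentBundle_modelSpace V 𝓘(ℝ, V) (n := ∞)).comp_contMDiffOn h2
  refine h3.congr fun y hy => ?_
  simp only [Function.comp, tangentMapWithin]
  rw [mfderivWithin_of_isOpen hU hy]
  rfl

section Boundaryless

variable [I.Boundaryless] [IsManifold I ∞ X]

omit [IsManifold I ∞ X] in
/-- In a chart centered at `x`, the derivative at `x` is the Fréchet derivative. -/
lemma mvfderiv_eq_fderiv_chart {f : X → V} {x : X} (hf : MDifferentiableAt I 𝓘(ℝ, V) f x) :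
    mvfderiv I f x = fderiv ℝ (fun e => f ((extChartAt I x).symm e)) (extChartAt I x x) := by
  have h := hf.mvfderiv
  rw [I.range_eq_univ, fderivWithin_univ] at h
  exact h

lemma mdifferentiableAt_chart_symm (x : X) {e : E} (he : e ∈ (extChartAt I x).target) :
    MDifferentiableAt 𝓘(ℝ, E) I (extChartAt I x).symm e := by
  have : IsManifold I 1 X := IsManifold.of_le (m := 1) (n := ∞) (by simp)
  exact ((contMDiffOn_extChartAt_symm (n := 1) x).contMDiffAt
    ((isOpen_extChartAt_target x).mem_nhds he)).mdifferentiableAt one_ne_zero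

lemma fderiv_chart_apply {f : X → V} (x : X) {e : E} (he : e ∈ (extChartAt I x).target)
    (hf : MDifferentiableAt I 𝓘(ℝ, V) f ((extChartAt I x).symm e)) (u : E) :
    fderiv ℝ (fun e => f ((extChartAt I x).symm e)) e u =
      mvfderiv I f ((extChartAt I x).symm e) (mfderiv 𝓘(ℝ, E) I (extChartAt I x).symm e u) := by
  have h := mfderiv_comp_apply (I := 𝓘(ℝ, E)) (I' := I) (I'' := 𝓘(ℝ, V)) e hf
    (mdifferentiableAt_chart_symm x he) u
  rw [mfderiv_eq_fderiv] at h
  exact h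

lemma differentiableAt_chart {f : X → V} (x : X) {e : E} (he : e ∈ (extChartAt I x).target)
    (hf : MDifferentiableAt I 𝓘(ℝ, V) f ((extChartAt I x).symm e)) :
    DifferentiableAt ℝ (fun e => f ((extChartAt I x).symm e)) e :=
  (hf.comp e (mdifferentiableAt_chart_symm x he)).differentiableAt

/-- A function with vanishing derivative is locally constant. -/
lemma eventually_eq_of_mvfderiv_eq_zero {f : X → V} {x : X}
    (hf : ∀ᶠ y in 𝓝 x, MDifferentiableAt I 𝓘(ℝ, V) f y)
    (h : ∀ᶠ y in 𝓝 x, mvfderiv I f y = 0) : ∀ᶠ y in 𝓝 x, f y = f x := by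
  set φ := extChartAt I x with hφ
  have hcont : ContinuousAt φ.symm (φ x) := continuousAt_extChartAt_symm x
  have hx : φ.symm (φ x) = x := extChartAt_to_inv x
  have h1 : ∀ᶠ e in 𝓝 (φ x), MDifferentiableAt I 𝓘(ℝ, V) f (φ.symm e) ∧
      mvfderiv I f (φ.symm e) = 0 ∧ e ∈ φ.target := by
    have := hcont.tendsto
    rw [hx] at this
    filter_upwards [this.eventually hf, this.eventually h,
      extChartAt_target_mem_nhds x] with e a b c
    exact ⟨a, b, c⟩
  obtain ⟨r, hr, hball⟩ := Metric.eventually_nhds_iff_ball.mp h1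
  have h2 : ∀ e ∈ Metric.ball (φ x) r, f (φ.symm e) = f (φ.symm (φ x)) := by
    intro e he
    refine (convex_ball (φ x) r).is_const_of_fderivWithin_eq_zero (𝕜 := ℝ)
      (f := fun e => f (φ.symm e)) ?_ ?_ he (Metric.mem_ball_self hr)
    · intro e he
      obtain ⟨a, b, c⟩ := hball e he
      exact (differentiableAt_chart x c a).differentiableWithinAt
    · intro e he
      obtain ⟨a, b, c⟩ := hball e he
      rw [fderivWithin_of_isOpen Metric.isOpen_ball he]
      ext u
      rw [fderiv_chart_apply x c a, b]
      rfl
  have h3 : ∀ᶠ y in 𝓝 x, φ y ∈ Metric.ball (φ x) r :=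
    (continuousAt_extChartAt x).eventually (Metric.ball_mem_nhds _ hr)
  filter_upwards [h3, extChartAt_source_mem_nhds (I := I) x] with y hy hy'
  have := h2 _ hy
  rwa [φ.left_inv hy', hx] at this

lemma eq_of_mvfderiv_eq_zero [PreconnectedSpace X] {f : X → V}
    (hf : ∀ y, MDifferentiableAt I 𝓘(ℝ, V) f y) (h : ∀ y, mvfderiv I f y = 0) (x y : X) :
    f x = f y := by
  have : IsLocallyConstant f := (IsLocallyConstant.iff_eventually_eq f).mpr fun z =>
    eventually_eq_of_mvfderiv_eq_zero (I := I) (.of_forall hf) (.of_forall h)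
  exact this.apply_eq_of_preconnectedSpace x y

/-- The symmetry of second derivatives, `d² = 0`: if `⟨N, dG⟩ + ⟨N', dG'⟩ = 0` then
`⟨dN ∧ dG⟩ + ⟨dN' ∧ dG'⟩ = 0`. -/
lemma symm_of_sp_mvfderiv_eq_zero {N G N' G' : X → R23} {U : Set X} (hU : IsOpen U)
    (hN : ContMDiffOn I 𝓘(ℝ, R23) ∞ N U) (hG : ContMDiffOn I 𝓘(ℝ, R23) ∞ G U)
    (hN' : ContMDiffOn I 𝓘(ℝ, R23) ∞ N' U) (hG' : ContMDiffOn I 𝓘(ℝ, R23) ∞ G' U)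
    (h : ∀ y ∈ U, ∀ v, sp (N y) (mvfderiv I G y v) + sp (N' y) (mvfderiv I G' y v) = 0)
    {x : X} (hx : x ∈ U) (v w : TangentSpace I x) :
    sp (mvfderiv I N x v) (mvfderiv I G x w) + sp (mvfderiv I N' x v) (mvfderiv I G' x w) =
    sp (mvfderiv I N x w) (mvfderiv I G x v) + sp (mvfderiv I N' x w) (mvfderiv I G' x v) := by
  set φ := extChartAt I x with hφ
  have hφx : φ.symm (φ x) = x := extChartAt_to_inv x
  have hxt : φ x ∈ φ.target := mem_extChartAt_target x
  have hmd : ∀ {F : X → R23}, ContMDiffOn I 𝓘(ℝ, R23) ∞ F U → ∀ y ∈ U,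
      MDifferentiableAt I 𝓘(ℝ, R23) F y := fun hF y hy =>
    (hF.contMDiffAt (hU.mem_nhds hy)).mdifferentiableAt (by simp)
  have hnhds : ∀ᶠ e in 𝓝 (φ x), e ∈ φ.target ∧ φ.symm e ∈ U := by
    have hcont : ContinuousAt φ.symm (φ x) := continuousAt_extChartAt_symm x
    filter_upwards [extChartAt_target_mem_nhds x,
      hcont.eventually (by rw [hφx]; exact hU.mem_nhds hx)] with e a b using ⟨a, b⟩
  have hcd : ∀ {F : X → R23}, ContMDiffOn I 𝓘(ℝ, R23) ∞ F U →
      ContDiffAt ℝ 2 (fun e => F (φ.symm e)) (φ x) := by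
    intro F hF
    have h1 : ContMDiffAt I 𝓘(ℝ, R23) 2 F (φ.symm (φ x)) := by
      rw [hφx]
      exact (hF.contMDiffAt (hU.mem_nhds hx)).of_le ENat.LEInfty.out
    have : IsManifold I 2 X := IsManifold.of_le (m := 2) (n := ∞) ENat.LEInfty.out
    have h2 : ContMDiffAt 𝓘(ℝ, E) I 2 φ.symm (φ x) :=
      (contMDiffOn_extChartAt_symm (n := 2) x).contMDiffAt
        ((isOpen_extChartAt_target x).mem_nhds hxt)
    exact (h1.comp _ h2).contDiffAt
  have hdd : ∀ {F : X → R23}, ContMDiffOn I 𝓘(ℝ, R23) ∞ F U →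
      DifferentiableAt ℝ (fderiv ℝ fun e => F (φ.symm e)) (φ x) := fun hF =>
    ((hcd hF).fderiv_right (m := 1) (by norm_num)).differentiableAt one_ne_zero
  have hsymm : ∀ {F : X → R23}, ContMDiffOn I 𝓘(ℝ, R23) ∞ F U →
      IsSymmSndFDerivAt ℝ (fun e => F (φ.symm e)) (φ x) := fun hF =>
    (hcd hF).isSymmSndFDerivAt (by simp)
  have hder : ∀ {N G : X → R23}, ContMDiffOn I 𝓘(ℝ, R23) ∞ N U → ContMDiffOn I 𝓘(ℝ, R23) ∞ G U →
      ∀ u w : E, DifferentiableAt ℝ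
        (fun e => sp (N (φ.symm e)) (fderiv ℝ (fun e => G (φ.symm e)) e u)) (φ x) ∧
      fderiv ℝ (fun e => sp (N (φ.symm e)) (fderiv ℝ (fun e => G (φ.symm e)) e u)) (φ x) w =
        sp (N (φ.symm (φ x))) (fderiv ℝ (fderiv ℝ (fun e => G (φ.symm e))) (φ x) w u) +
        sp (fderiv ℝ (fun e => N (φ.symm e)) (φ x) w)
          (fderiv ℝ (fun e => G (φ.symm e)) (φ x) u) := by
    intro N G hN hG u w
    have a1 := ((hcd hN).differentiableAt two_ne_zero).hasFDerivAt
    have a2 := (hdd hG).hasFDerivAt.clm_apply (hasFDerivAt_const u (φ x))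
    have a3 := spL.hasFDerivAt_of_bilinear a1 a2
    simp only [spL_apply] at a3
    refine ⟨a3.differentiableAt, ?_⟩
    rw [a3.fderiv]
    simp
  have hzero : ∀ u w : E, fderiv ℝ (fun e =>
      sp (N (φ.symm e)) (fderiv ℝ (fun e => G (φ.symm e)) e u) +
      sp (N' (φ.symm e)) (fderiv ℝ (fun e => G' (φ.symm e)) e u)) (φ x) w = 0 := by
    intro u w
    have : (fun e => sp (N (φ.symm e)) (fderiv ℝ (fun e => G (φ.symm e)) e u) +
      sp (N' (φ.symm e)) (fderiv ℝ (fun e => G' (φ.symm e)) e u)) =ᶠ[𝓝 (φ x)] fun _ => 0 := by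
      filter_upwards [hnhds] with e he
      rw [fderiv_chart_apply x he.1 (hmd hG _ he.2), fderiv_chart_apply x he.1 (hmd hG' _ he.2)]
      exact h _ he.2 _
    rw [this.fderiv_eq]
    simp
  have hexp : ∀ u w : E,
      sp (N (φ.symm (φ x))) (fderiv ℝ (fderiv ℝ (fun e => G (φ.symm e))) (φ x) w u) +
        sp (fderiv ℝ (fun e => N (φ.symm e)) (φ x) w)
          (fderiv ℝ (fun e => G (φ.symm e)) (φ x) u) +
      (sp (N' (φ.symm (φ x))) (fderiv ℝ (fderiv ℝ (fun e => G' (φ.symm e))) (φ x) w u) +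
        sp (fderiv ℝ (fun e => N' (φ.symm e)) (φ x) w)
          (fderiv ℝ (fun e => G' (φ.symm e)) (φ x) u)) = 0 := by
    intro u w
    rw [← (hder hN hG u w).2, ← (hder hN' hG' u w).2, ← hzero u w,
      fderiv_fun_add (hder hN hG u w).1 (hder hN' hG' u w).1]
    rfl
  have hfin : ∀ v w : E, sp (fderiv ℝ (fun e => N (φ.symm e)) (φ x) v)
        (fderiv ℝ (fun e => G (φ.symm e)) (φ x) w) +
      sp (fderiv ℝ (fun e => N' (φ.symm e)) (φ x) v)
        (fderiv ℝ (fun e => G' (φ.symm e)) (φ x) w) =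
      sp (fderiv ℝ (fun e => N (φ.symm e)) (φ x) w)
        (fderiv ℝ (fun e => G (φ.symm e)) (φ x) v) +
      sp (fderiv ℝ (fun e => N' (φ.symm e)) (φ x) w)
        (fderiv ℝ (fun e => G' (φ.symm e)) (φ x) v) := by
    intro v w
    have e1 := hexp v w
    have e2 := hexp w v
    rw [(hsymm hG).eq, (hsymm hG').eq] at e1
    linear_combination e2 - e1
  rw [mvfderiv_eq_fderiv_chart (hmd hN _ hx), mvfderiv_eq_fderiv_chart (hmd hG _ hx),
    mvfderiv_eq_fderiv_chart (hmd hN' _ hx), mvfderiv_eq_fderiv_chart (hmd hG' _ hx)]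
  exact hfin v w

end Boundaryless

end Calculus

section Frames

variable {E : Type*} [NormedAddCommGroup E] [NormedSpace ℝ E] {H : Type*} [TopologicalSpace H]
  {I : ModelWithCorners ℝ E H} {X : Type*} [TopologicalSpace X] [ChartedSpace H X]

lemma contMDiffOn_smul {V : Type*} [NormedAddCommGroup V] [NormedSpace ℝ V] {a : X → ℝ} {f : X → V}
    {U : Set X} (ha : ContMDiffOn I 𝓘(ℝ, ℝ) ∞ a U) (hf : ContMDiffOn I 𝓘(ℝ, V) ∞ f U) :
    ContMDiffOn I 𝓘(ℝ, V) ∞ (fun y => a y • f y) U := ha.smul hf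

/-! ### Orientations of tangent planes -/

lemma wedge_smul_add {x : X} (α β : TangentSpace I x →ₗ[ℝ] ℝ) (a b c d : ℝ)
    (v w : TangentSpace I x) :
    wedge I α β (a • v + b • w) (c • v + d • w) = (a * d - b * c) * wedge I α β v w := by
  simp only [wedge, map_add, map_smul, smul_eq_mul]; ring

lemma IsPositivePair.exists_coeff {x : X} {o : Orientation ℝ (TangentSpace I x) (Fin 2)}
    {v w : TangentSpace I x} (h : IsPositivePair I o v w) (u : TangentSpace I x) :
    ∃ a b : ℝ, u = a • v + b • w := by
  obtain ⟨b, rfl, rfl, -⟩ := h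
  refine ⟨b.repr u 0, b.repr u 1, ?_⟩
  conv_lhs => rw [← b.sum_repr u, Fin.sum_univ_two]

lemma IsPositivePair.exists_wedge_eq {x : X} {o : Orientation ℝ (TangentSpace I x) (Fin 2)}
    {v w : TangentSpace I x} (h : IsPositivePair I o v w) (v' w' : TangentSpace I x) :
    ∃ d : ℝ, ∀ α β : TangentSpace I x →ₗ[ℝ] ℝ, wedge I α β v' w' = d * wedge I α β v w := by
  obtain ⟨a, b, rfl⟩ := h.exists_coeff v'
  obtain ⟨c, d, rfl⟩ := h.exists_coeff w'
  exact ⟨a * d - b * c, fun α β => wedge_smul_add α β a b c d v w⟩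

lemma IsPositivePair.exists_pos_wedge_eq {x : X} {o : Orientation ℝ (TangentSpace I x) (Fin 2)}
    {v w v' w' : TangentSpace I x} (h : IsPositivePair I o v w) (h' : IsPositivePair I o v' w') :
    ∃ d : ℝ, 0 < d ∧
      ∀ α β : TangentSpace I x →ₗ[ℝ] ℝ, wedge I α β v' w' = d * wedge I α β v w := by
  obtain ⟨b, rfl, rfl, hb⟩ := h
  obtain ⟨b', rfl, rfl, hb'⟩ := h'
  have hdet := (b.orientation_eq_iff_det_pos b').mp (hb.trans hb'.symm)
  rw [Module.Basis.det_apply, Matrix.det_fin_two] at hdet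
  simp only [Module.Basis.toMatrix_apply] at hdet
  refine ⟨_, hdet, fun α β => ?_⟩
  have h0 : b' 0 = b.repr (b' 0) 0 • b 0 + b.repr (b' 0) 1 • b 1 := by
    conv_lhs => rw [← b.sum_repr (b' 0), Fin.sum_univ_two]
  have h1 : b' 1 = b.repr (b' 1) 0 • b 0 + b.repr (b' 1) 1 • b 1 := by
    conv_lhs => rw [← b.sum_repr (b' 1), Fin.sum_univ_two]
  conv_lhs => rw [h0, h1, wedge_smul_add]
  ring

lemma IsPositivePair.swap {x : X} {o : Orientation ℝ (TangentSpace I x) (Fin 2)}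
    {v w : TangentSpace I x} (h : IsPositivePair I (-o) v w) : IsPositivePair I o w v := by
  obtain ⟨b, rfl, rfl, hb⟩ := h
  refine ⟨b.reindex (Equiv.swap 0 1), by simp, by simp, ?_⟩
  rcases (b.reindex (Equiv.swap 0 1)).orientation_eq_or_eq_neg o with ho | ho
  · exact ho.symm
  · exfalso
    have h3 : b.orientation = (b.reindex (Equiv.swap 0 1)).orientation := by
      rw [hb, ho]; exact neg_neg (b.reindex (Equiv.swap 0 1)).orientation
    have h4 := (b.orientation_eq_iff_det_pos _).mp h3
    rw [Module.Basis.det_apply, Matrix.det_fin_two] at h4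
    simp [Module.Basis.toMatrix_apply] at h4
    linarith

variable [hE : Fact (Module.finrank ℝ E = 2)]

lemma exists_basis_of_wedge_ne {x : X} {α β : TangentSpace I x →ₗ[ℝ] ℝ} {v w : TangentSpace I x}
    (h : wedge I α β v w ≠ 0) :
    ∃ b : Module.Basis (Fin 2) ℝ (TangentSpace I x), b 0 = v ∧ b 1 = w := by
  have hli : LinearIndependent ℝ ![v, w] := by
    rw [LinearIndependent.pair_iff]
    intro a b hab
    have h1 := congrArg α hab
    have h2 := congrArg β hab
    simp only [map_add, map_smul, smul_eq_mul, map_zero] at h1 h2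
    unfold wedge at h
    constructor
    · refine (mul_eq_zero.mp (?_ : a * (α v * β w - α w * β v) = 0)).resolve_right h
      linear_combination β w * h1 - α w * h2
    · refine (mul_eq_zero.mp (?_ : b * (α v * β w - α w * β v) = 0)).resolve_right h
      linear_combination -β v * h1 + α v * h2
  refine ⟨basisOfLinearIndependentOfCardEqFinrank hli ?_, ?_, ?_⟩
  · rw [Fintype.card_fin]; exact hE.out.symm
  · simp
  · simp

lemma isPositivePair_of_wedge_pos {x : X} {o : Orientation ℝ (TangentSpace I x) (Fin 2)}
    {α β : TangentSpace I x →ₗ[ℝ] ℝ} {v w : TangentSpace I x}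
    (hpos : ∀ v w, IsPositivePair I o v w → 0 < wedge I α β v w) (h : 0 < wedge I α β v w) :
    IsPositivePair I o v w := by
  obtain ⟨b, hv, hw⟩ := exists_basis_of_wedge_ne h.ne'
  rcases b.orientation_eq_or_eq_neg o with ho | ho
  · exact ⟨b, hv, hw, ho.symm⟩
  · exfalso
    have h1 : wedge I α β v (-w) < 0 := by
      simp only [wedge, map_neg] at h ⊢; linarith
    obtain ⟨b', hv', hw'⟩ := exists_basis_of_wedge_ne h1.ne
    have h2 : b'.orientation = o := by
      rcases b'.orientation_eq_or_eq_neg o with ho' | ho'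
      · exact ho'.symm
      · exfalso
        have h3 : b.orientation = b'.orientation := by
          have h4 : -b.orientation = -b'.orientation := ho.symm.trans ho'
          exact neg_injective h4
        have h4 := (b.orientation_eq_iff_det_pos b').mp h3
        have h5 : (b' : Fin 2 → TangentSpace I x) = ![b 0, -b 1] := by
          ext i; fin_cases i <;> simp [hv', hw', hv, hw]
        rw [h5, Module.Basis.det_apply, Matrix.det_fin_two] at h4
        simp [Module.Basis.toMatrix_apply] at h4
        linarith
    exact absurd (hpos v (-w) ⟨b', hv', hw', h2⟩) (not_lt.mpr h1.le)

lemma exists_isPositivePair {x : X} (o : Orientation ℝ (TangentSpace I x) (Fin 2)) :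
    ∃ v w, IsPositivePair I o v w := by
  have h : Module.finrank ℝ (TangentSpace I x) = 2 := hE.out
  have : FiniteDimensional ℝ (TangentSpace I x) := .of_finrank_pos (by rw [h]; norm_num)
  let b := (Module.finBasisOfFinrankEq ℝ (TangentSpace I x) h).adjustToOrientation o
  exact ⟨b 0, b 1, b, rfl, rfl, Module.Basis.orientation_adjustToOrientation _ o⟩

/-! ### Frame fields -/

/-- Five vector-valued functions, to be thought of as the null frame
`(F₀, F₁ - F₂, F₁ + F₂, F₃, F₄)` of a frame field `F`. -/
structure NullField (X : Type*) where
  P : X → R23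
  A : X → R23
  B : X → R23
  N : X → R23
  Q : X → R23

/-- The frame field with a given null frame. -/
def NullField.toFrame {X : Type*} (Φ : NullField X) (y : X) : Fin 5 → R23 :=
  ofNull (Φ.P y) (Φ.A y) (Φ.B y) (Φ.N y) (Φ.Q y)

/-- The null frame of a frame field. -/
def nullField {X : Type*} (F : X → Fin 5 → R23) : NullField X :=
  ⟨fun y => F y 0, fun y => F y 1 - F y 2, fun y => F y 1 + F y 2, fun y => F y 3, fun y => F y 4⟩

lemma toFrame_nullField {X : Type*} (F : X → Fin 5 → R23) : (nullField F).toFrame = F :=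
  funext fun y => ofNull_eq (F y)

/-- The covector `v ↦ ⟨dG(v), Y⟩`. -/
def dform (I : ModelWithCorners ℝ E H) (G : X → R23) (Y : R23) (x : X) :
    TangentSpace I x →ₗ[ℝ] ℝ :=
  ((spL.flip Y).comp (mvfderiv I G x)).toLinearMap

omit hE in
lemma dform_apply (G : X → R23) (Y : R23) (x : X) (v : TangentSpace I x) :
    dform I G Y x v = sp (mvfderiv I G x v) Y := rfl

/-- Frame fields along `f` on the open set `U`, see `IsFrameField`. -/
structure NullField.IsAlong (Φ : NullField X) (I : ModelWithCorners ℝ E H) (f : X → R23)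
    (U : Set X) : Prop where
  isOpen : IsOpen U
  sP : ContMDiffOn I 𝓘(ℝ, R23) ∞ Φ.P U
  sA : ContMDiffOn I 𝓘(ℝ, R23) ∞ Φ.A U
  sB : ContMDiffOn I 𝓘(ℝ, R23) ∞ Φ.B U
  sN : ContMDiffOn I 𝓘(ℝ, R23) ∞ Φ.N U
  sQ : ContMDiffOn I 𝓘(ℝ, R23) ∞ Φ.Q U
  oriented : ∀ x ∈ U, IsOrientedNullFrame (Φ.P x) (Φ.A x) (Φ.B x) (Φ.N x) (Φ.Q x)
  ray_eq : ∀ x ∈ U, f x = ray (Φ.P x)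

/-- First order frame fields, see `IsFirstOrderFrame`. -/
structure NullField.IsFirstOrder (Φ : NullField X) (I : ModelWithCorners ℝ E H) (f : X → R23)
    (o : ∀ x : X, Orientation ℝ (TangentSpace I x) (Fin 2)) (U : Set X) : Prop
    extends Φ.IsAlong I f U where
  dP_N : ∀ x ∈ U, ∀ v, dform I Φ.P (Φ.N x) x v = 0
  wedge_pos : ∀ x ∈ U, ∀ v w, IsPositivePair I (o x) v w →
    0 < wedge I (dform I Φ.P (Φ.B x) x) (dform I Φ.P (Φ.A x) x) v w

/-- Second order frame fields, see `IsSecondOrderFrame`. -/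
structure NullField.IsSecondOrder (Φ : NullField X) (I : ModelWithCorners ℝ E H) (f : X → R23)
    (o : ∀ x : X, Orientation ℝ (TangentSpace I x) (Fin 2)) (U : Set X) : Prop
    extends Φ.IsFirstOrder I f o U where
  trace : ∀ x ∈ U, ∀ v w, wedge I (dform I Φ.N (Φ.A x) x) (dform I Φ.P (Φ.B x) x) v w =
    wedge I (dform I Φ.N (Φ.B x) x) (dform I Φ.P (Φ.A x) x) v w

/-- Adapted frame fields, see `IsAdaptedFrame`. -/
structure NullField.IsAdapted (Φ : NullField X) (I : ModelWithCorners ℝ E H) (f : X → R23)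
    (o : ∀ x : X, Orientation ℝ (TangentSpace I x) (Fin 2)) (ε : ℝ) (U : Set X) : Prop
    extends Φ.IsSecondOrder I f o U where
  dN_A : ∀ x ∈ U, ∀ v, dform I Φ.N (Φ.A x) x v = 0
  dN_B : ∀ x ∈ U, ∀ v, dform I Φ.N (Φ.B x) x v = 2 * ε * dform I Φ.P (Φ.A x) x v
  dN_Q : ∀ x ∈ U, ∀ v, dform I Φ.N (Φ.Q x) x v = 0
  dP_Q : ∀ x ∈ U, ∀ v, dform I Φ.P (Φ.Q x) x v + dform I Φ.A (Φ.B x) x v = 0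
  dQ_A : ∀ x ∈ U, ∀ v w,
    wedge I (dform I Φ.Q (Φ.A x) x) (dform I Φ.P (Φ.A x) x) v w = 0

section

omit hE

lemma NullField.IsAlong.mdiff {Φ : NullField X} {f : X → R23} {U : Set X}
    (h : Φ.IsAlong I f U) {x : X} (hx : x ∈ U) :
    MDifferentiableAt I 𝓘(ℝ, R23) Φ.P x ∧ MDifferentiableAt I 𝓘(ℝ, R23) Φ.A x ∧
    MDifferentiableAt I 𝓘(ℝ, R23) Φ.B x ∧ MDifferentiableAt I 𝓘(ℝ, R23) Φ.N x ∧
    MDifferentiableAt I 𝓘(ℝ, R23) Φ.Q x := by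
  have key : ∀ {G : X → R23}, ContMDiffOn I 𝓘(ℝ, R23) ∞ G U →
      MDifferentiableAt I 𝓘(ℝ, R23) G x := fun hG =>
    (hG.contMDiffAt (h.isOpen.mem_nhds hx)).mdifferentiableAt (by simp)
  exact ⟨key h.sP, key h.sA, key h.sB, key h.sN, key h.sQ⟩

lemma NullField.isFrameField_toFrame_iff {Φ : NullField X} {f : X → R23} {U : Set X}
    (hU : IsOpen U) : IsFrameField I f U Φ.toFrame ↔ Φ.IsAlong I f U := by
  constructor
  · rintro ⟨h1, h2⟩
    have h3 : ∀ i, ContMDiffOn I 𝓘(ℝ, R23) ∞ (fun y => Φ.toFrame y i) U :=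
      contMDiffOn_pi_space.mp h1
    have hA : Φ.A = fun y => Φ.toFrame y 1 - Φ.toFrame y 2 := by
      ext y i; simp [toFrame, ofNull]; ring
    have hB : Φ.B = fun y => Φ.toFrame y 1 + Φ.toFrame y 2 := by
      ext y i; simp [toFrame, ofNull]; ring
    refine ⟨hU, h3 0, ?_, ?_, h3 3, h3 4, fun x hx => ?_, fun x hx => (h2 x hx).2⟩
    · rw [hA]; exact (h3 1).sub (h3 2)
    · rw [hB]; exact (h3 1).add (h3 2)
    · exact isLightconeBasis_ofNull_iff.mp (h2 x hx).1
  · intro h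
    refine ⟨contMDiffOn_pi_space.mpr fun i => ?_, fun x hx =>
      ⟨isLightconeBasis_ofNull_iff.mpr (h.oriented x hx), h.ray_eq x hx⟩⟩
    fin_cases i
    · exact h.sP
    · exact contMDiffOn_smul contMDiffOn_const (h.sA.add h.sB)
    · exact contMDiffOn_smul contMDiffOn_const (h.sB.sub h.sA)
    · exact h.sN
    · exact h.sQ

/-- The Maurer-Cartan forms in terms of scalar products: the inverse of a matrix with Gram matrix
`gram` is its adjoint. -/
lemma mc_apply {F : X → Fin 5 → R23} {x : X} (h : IsGramBasis (F x))
    (hF : MDifferentiableAt I 𝓘(ℝ, Fin 5 → R23) F x) (v : TangentSpace I x) (i j : Fin 5) :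
    mc I F x v i j =
      ![-dform I (fun y => F y j) (F x 4) x v, -dform I (fun y => F y j) (F x 1) x v,
        dform I (fun y => F y j) (F x 2) x v, dform I (fun y => F y j) (F x 3) x v,
        -dform I (fun y => F y j) (F x 0) x v] i := by
  simp only [dform_apply, ← mvfderiv_pi_apply hF]
  exact h.inv_mul_apply _ i j

/-- The derivatives of the relations that define null frames. -/
lemma NullField.IsAlong.dform_relations {Φ : NullField X} {f : X → R23} {U : Set X}
    (h : Φ.IsAlong I f U) {x : X} (hx : x ∈ U) (v : TangentSpace I x) :
    dform I Φ.P (Φ.P x) x v = 0 ∧ dform I Φ.A (Φ.A x) x v = 0 ∧ dform I Φ.B (Φ.B x) x v = 0 ∧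
    dform I Φ.N (Φ.N x) x v = 0 ∧ dform I Φ.Q (Φ.Q x) x v = 0 ∧
    dform I Φ.A (Φ.P x) x v = -dform I Φ.P (Φ.A x) x v ∧
    dform I Φ.B (Φ.P x) x v = -dform I Φ.P (Φ.B x) x v ∧
    dform I Φ.N (Φ.P x) x v = -dform I Φ.P (Φ.N x) x v ∧
    dform I Φ.Q (Φ.P x) x v = -dform I Φ.P (Φ.Q x) x v ∧
    dform I Φ.B (Φ.A x) x v = -dform I Φ.A (Φ.B x) x v ∧
    dform I Φ.A (Φ.N x) x v = -dform I Φ.N (Φ.A x) x v ∧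
    dform I Φ.A (Φ.Q x) x v = -dform I Φ.Q (Φ.A x) x v ∧
    dform I Φ.B (Φ.N x) x v = -dform I Φ.N (Φ.B x) x v ∧
    dform I Φ.B (Φ.Q x) x v = -dform I Φ.Q (Φ.B x) x v ∧
    dform I Φ.Q (Φ.N x) x v = -dform I Φ.N (Φ.Q x) x v := by
  obtain ⟨dP, dA, dB, dN, dQ⟩ := h.mdiff hx
  have hn : ∀ᶠ y in 𝓝 x, IsNullFrame (Φ.P y) (Φ.A y) (Φ.B y) (Φ.N y) (Φ.Q y) := by
    filter_upwards [h.isOpen.mem_nhds hx] with y hy using (h.oriented y hy).1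
  have hs : ∀ X Y, sp X Y = sp Y X := sp_comm
  have self : ∀ {a : ℝ}, a = -a → a = 0 := fun h => by linarith
  simp only [dform_apply]
  exact ⟨self (sp_mvfderiv_eq_neg dP dP (hn.mono fun y hy => hy.PP) v),
    self (sp_mvfderiv_eq_neg dA dA (hn.mono fun y hy => hy.AA) v),
    self (sp_mvfderiv_eq_neg dB dB (hn.mono fun y hy => hy.BB) v),
    self (sp_mvfderiv_eq_neg dN dN (hn.mono fun y hy => hy.NN) v),
    self (sp_mvfderiv_eq_neg dQ dQ (hn.mono fun y hy => hy.QQ) v),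
    sp_mvfderiv_eq_neg dA dP (hn.mono fun y hy => by rw [hs, hy.PA]) v,
    sp_mvfderiv_eq_neg dB dP (hn.mono fun y hy => by rw [hs, hy.PB]) v,
    sp_mvfderiv_eq_neg dN dP (hn.mono fun y hy => by rw [hs, hy.PN]) v,
    sp_mvfderiv_eq_neg dQ dP (hn.mono fun y hy => by rw [hs, hy.PQ]) v,
    sp_mvfderiv_eq_neg dB dA (hn.mono fun y hy => by rw [hs, hy.AB]) v,
    sp_mvfderiv_eq_neg dA dN (hn.mono fun y hy => hy.AN) v,
    sp_mvfderiv_eq_neg dA dQ (hn.mono fun y hy => hy.AQ) v,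
    sp_mvfderiv_eq_neg dB dN (hn.mono fun y hy => hy.BN) v,
    sp_mvfderiv_eq_neg dB dQ (hn.mono fun y hy => hy.BQ) v,
    sp_mvfderiv_eq_neg dQ dN (hn.mono fun y hy => by rw [hs, hy.NQ]) v⟩

/-- The Maurer-Cartan forms that occur in the reduction of frame fields. -/
lemma NullField.IsAlong.mc_toFrame {Φ : NullField X} {f : X → R23} {U : Set X}
    (h : Φ.IsAlong I f U) {x : X} (hx : x ∈ U) (v : TangentSpace I x) :
    mc I Φ.toFrame x v 3 0 = dform I Φ.P (Φ.N x) x v ∧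
    mc I Φ.toFrame x v 1 0 = -(dform I Φ.P (Φ.A x) x v + dform I Φ.P (Φ.B x) x v) / 2 ∧
    mc I Φ.toFrame x v 2 0 = (dform I Φ.P (Φ.B x) x v - dform I Φ.P (Φ.A x) x v) / 2 ∧
    mc I Φ.toFrame x v 3 1 = -(dform I Φ.N (Φ.A x) x v + dform I Φ.N (Φ.B x) x v) / 2 ∧
    mc I Φ.toFrame x v 3 2 = (dform I Φ.N (Φ.A x) x v - dform I Φ.N (Φ.B x) x v) / 2 ∧
    mc I Φ.toFrame x v 3 4 = -dform I Φ.N (Φ.Q x) x v ∧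
    mc I Φ.toFrame x v 0 0 = -dform I Φ.P (Φ.Q x) x v ∧
    mc I Φ.toFrame x v 2 1 = dform I Φ.A (Φ.B x) x v / 2 ∧
    mc I Φ.toFrame x v 1 4 + mc I Φ.toFrame x v 2 4 = -dform I Φ.Q (Φ.A x) x v := by
  obtain ⟨PP, AA, BB, NN, QQ, AP, BP, NP, QP, BA, AN, AQ, BN, BQ, QN⟩ := h.dform_relations hx v
  obtain ⟨dP, dA, dB, dN, dQ⟩ := h.mdiff hx
  have hF := (((isFrameField_toFrame_iff h.isOpen).mpr h).1.contMDiffAt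
    (h.isOpen.mem_nhds hx)).mdifferentiableAt (by simp)
  have key := mc_apply (F := Φ.toFrame) (h.oriented x hx).1.isGramBasis hF v
  have h1 : ∀ Y, dform I (fun y => Φ.toFrame y 1) Y x v =
      (dform I Φ.A Y x v + dform I Φ.B Y x v) / 2 := by
    intro Y
    have : mvfderiv I (fun y => Φ.toFrame y 1) x v =
        (1 / 2 : ℝ) • (mvfderiv I Φ.A x v + mvfderiv I Φ.B x v) := by
      have hd : MDifferentiableAt I 𝓘(ℝ, R23) (fun y => Φ.A y + Φ.B y) x := dA.add dB
      rw [← mvfderiv_add_apply dA dB, ← mvfderiv_const_smul_apply hd]; rfl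
    simp only [dform_apply, this, sp_smul_left, sp_add_left]; ring
  have h2 : ∀ Y, dform I (fun y => Φ.toFrame y 2) Y x v =
      (dform I Φ.B Y x v - dform I Φ.A Y x v) / 2 := by
    intro Y
    have : mvfderiv I (fun y => Φ.toFrame y 2) x v =
        (1 / 2 : ℝ) • (mvfderiv I Φ.B x v - mvfderiv I Φ.A x v) := by
      have hd : MDifferentiableAt I 𝓘(ℝ, R23) (fun y => Φ.B y - Φ.A y) x := dB.sub dA
      rw [← mvfderiv_sub_apply dB dA, ← mvfderiv_const_smul_apply hd]; rfl
    simp only [dform_apply, this, sp_smul_left, sp_sub_left]; ring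
  have e : ∀ (G : X → R23) (Y Z : R23), dform I G ((1 / 2 : ℝ) • (Y + Z)) x v =
      (dform I G Y x v + dform I G Z x v) / 2 ∧ dform I G ((1 / 2 : ℝ) • (Y - Z)) x v =
      (dform I G Y x v - dform I G Z x v) / 2 := by
    intro G Y Z
    simp only [dform_apply, sp_smul_right, sp_add_right, sp_sub_right]
    constructor <;> ring
  have f0 : (fun y => Φ.toFrame y 0) = Φ.P := rfl
  have f4 : (fun y => Φ.toFrame y 4) = Φ.Q := rfl
  have g1 : Φ.toFrame x 1 = (1 / 2 : ℝ) • (Φ.A x + Φ.B x) := rfl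
  have g2 : Φ.toFrame x 2 = (1 / 2 : ℝ) • (Φ.B x - Φ.A x) := rfl
  have g3 : Φ.toFrame x 3 = Φ.N x := rfl
  have g4 : Φ.toFrame x 4 = Φ.Q x := rfl
  simp only [key, h1, h2, f0, f4, Matrix.cons_val, g1, g2, g3, g4, (e _ _ _).1, (e _ _ _).2]
  refine ⟨trivial, by ring, trivial, ?_, ?_, ?_, trivial, ?_, by ring⟩
  · rw [AN, BN]; ring
  · rw [AN, BN]; ring
  · rw [QN]
  · rw [AA, BB, BA]; ring

lemma NullField.isFirstOrderFrame_iff {Φ : NullField X} {f : X → R23}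
    {o : ∀ x : X, Orientation ℝ (TangentSpace I x) (Fin 2)} {U : Set X} (hU : IsOpen U) :
    IsFirstOrderFrame I f o U Φ.toFrame ↔ Φ.IsFirstOrder I f o U := by
  have key : ∀ h : Φ.IsAlong I f U, ∀ x ∈ U, ∀ v w,
      wedge I (fun v => mc I Φ.toFrame x v 1 0) (fun v => mc I Φ.toFrame x v 2 0) v w =
        1 / 2 * wedge I (dform I Φ.P (Φ.B x) x) (dform I Φ.P (Φ.A x) x) v w := by
    intro h x hx v w
    obtain ⟨-, v1, v2, -⟩ := h.mc_toFrame hx v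
    obtain ⟨-, w1, w2, -⟩ := h.mc_toFrame hx w
    simp only [wedge, v1, v2, w1, w2]; ring
  unfold IsFirstOrderFrame
  rw [isFrameField_toFrame_iff hU]
  constructor
  · rintro ⟨h, h'⟩
    refine ⟨h, fun x hx v => ?_, fun x hx v w hvw => ?_⟩
    · rw [← (h.mc_toFrame hx v).1]; exact (h' x hx).1 v
    · have := (h' x hx).2 v w hvw
      rw [key h x hx] at this
      linarith
  · intro h
    refine ⟨h.toIsAlong, fun x hx => ⟨fun v => ?_, fun v w hvw => ?_⟩⟩
    · rw [(h.mc_toFrame hx v).1]; exact h.dP_N x hx v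
    · rw [key h.toIsAlong x hx]
      linarith [h.wedge_pos x hx v w hvw]

lemma NullField.isSecondOrderFrame_iff {Φ : NullField X} {f : X → R23}
    {o : ∀ x : X, Orientation ℝ (TangentSpace I x) (Fin 2)} {U : Set X} (hU : IsOpen U) :
    IsSecondOrderFrame I f o U Φ.toFrame ↔ Φ.IsSecondOrder I f o U := by
  have key : ∀ h : Φ.IsAlong I f U, ∀ x ∈ U, ∀ v w,
      wedge I (fun v => mc I Φ.toFrame x v 3 1) (fun v => mc I Φ.toFrame x v 2 0) v w +
      wedge I (fun v => mc I Φ.toFrame x v 3 2) (fun v => mc I Φ.toFrame x v 1 0) v w =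
        -(1 / 2) * (wedge I (dform I Φ.N (Φ.A x) x) (dform I Φ.P (Φ.B x) x) v w -
          wedge I (dform I Φ.N (Φ.B x) x) (dform I Φ.P (Φ.A x) x) v w) := by
    intro h x hx v w
    obtain ⟨-, v1, v2, v3, v4, -⟩ := h.mc_toFrame hx v
    obtain ⟨-, w1, w2, w3, w4, -⟩ := h.mc_toFrame hx w
    simp only [wedge, v1, v2, v3, v4, w1, w2, w3, w4]; ring
  unfold IsSecondOrderFrame
  rw [isFirstOrderFrame_iff hU]
  constructor
  · rintro ⟨h, h'⟩
    refine ⟨h, fun x hx v w => ?_⟩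
    have := h' x hx v w
    rw [key h.toIsAlong x hx] at this
    linarith
  · intro h
    refine ⟨h.toIsFirstOrder, fun x hx v w => ?_⟩
    rw [key h.toIsAlong x hx, h.trace x hx v w]
    ring

lemma NullField.isAdaptedFrame_iff {Φ : NullField X} {f : X → R23}
    {o : ∀ x : X, Orientation ℝ (TangentSpace I x) (Fin 2)} {ε : ℝ} {U : Set X} (hU : IsOpen U) :
    IsAdaptedFrame I f o ε U Φ.toFrame ↔ Φ.IsAdapted I f o ε U := by
  unfold IsAdaptedFrame
  rw [isSecondOrderFrame_iff hU]
  constructor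
  · rintro ⟨h, h'⟩
    refine ⟨h, fun x hx v => ?_, fun x hx v => ?_, fun x hx v => ?_, fun x hx v => ?_,
      fun x hx v w => ?_⟩
    all_goals
      obtain ⟨h1, h2, h3, h4, h5⟩ := h' x hx
      obtain ⟨-, v1, v2, v3, v4, v5, v6, v7, v8⟩ := h.mc_toFrame hx v
      have h1 := h1 v
      have h2 := h2 v
      have h3 := h3 v
      have h4 := h4 v
      rw [v1, v2] at h1 h2
      rw [v3] at h1
      rw [v4] at h2
      rw [v5] at h3
      rw [v6, v7] at h4
    · linarith
    · linarith
    · linarith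
    · linarith
    · have := h5 v w
      obtain ⟨-, w1, w2, w3, w4, w5, w6, w7, w8⟩ := h.mc_toFrame hx w
      simp only [wedge, v8, w8, v1, v2, w1, w2] at this ⊢
      linarith
  · intro h
    refine ⟨h.toIsSecondOrder, fun x hx => ⟨fun v => ?_, fun v => ?_, fun v => ?_, fun v => ?_,
      fun v w => ?_⟩⟩
    all_goals
      obtain ⟨-, v1, v2, v3, v4, v5, v6, v7, v8⟩ := h.mc_toFrame hx v
      have h1 := h.dN_A x hx v
      have h2 := h.dN_B x hx v
      have h3 := h.dN_Q x hx v
      have h4 := h.dP_Q x hx v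
    · rw [v3, v1, v2]; linarith
    · rw [v4, v1, v2]; linarith
    · rw [v5]; linarith
    · rw [v6, v7]; linarith
    · have := h.dQ_A x hx v w
      obtain ⟨-, w1, w2, w3, w4, w5, w6, w7, w8⟩ := h.mc_toFrame hx w
      simp only [wedge, v8, w8, v1, v2, w1, w2] at this ⊢
      linarith

end

end Frames

/-! ### Uniqueness of the conformal Gauss map and of the dual map -/

lemma IsNullFrame.swap {P A B N Q : R23} (h : IsNullFrame P A B N Q) : IsNullFrame Q A B N P := by
  have hs : ∀ X Y, sp X Y = sp Y X := sp_comm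
  obtain ⟨PP, PA, PB, PN, PQ, AA, AB, AN, AQ, BB, BN, BQ, NN, NQ, QQ⟩ := h
  constructor <;> first | assumption | (rw [hs]; assumption)

lemma det5_swap (P A B N Q : R23) : det5 Q A B N P = -det5 P A B N Q := by
  have h := Matrix.det_permute' (Equiv.swap (0 : Fin 5) 4) (colMatrix ![P, A, B, N, Q])
  rw [Equiv.Perm.sign_swap (by decide)] at h
  have h2 : (colMatrix ![P, A, B, N, Q]).submatrix id (Equiv.swap (0 : Fin 5) 4) =
      colMatrix ![Q, A, B, N, P] := by
    ext i j
    fin_cases j <;> rfl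
  rw [h2] at h
  simpa [det5] using h

lemma posNormSq_smul (r : ℝ) (V : R23) : posNormSq (r • V) = r ^ 2 * posNormSq V := by
  simp only [posNormSq, sp_smul_left]; ring

lemma ray_smul {r : ℝ} (hr : 0 < r) (V : R23) : ray (r • V) = ray V := by
  unfold ray
  rw [posNormSq_smul, Real.sqrt_mul (by positivity), Real.sqrt_sq hr.le, smul_smul, mul_inv,
    mul_assoc, mul_comm (√_)⁻¹, ← mul_assoc, inv_mul_cancel₀ hr.ne', one_mul]

lemma exists_pos_smul_of_ray_eq {V W : R23} (hV : V ≠ 0) (hVV : sp V V = 0) (hW : W ≠ 0)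
    (hWW : sp W W = 0) (h : ray V = ray W) : ∃ r : ℝ, 0 < r ∧ W = r • V := by
  have h1 := Real.sqrt_pos.mpr (posNormSq_pos hV hVV)
  have h2 := Real.sqrt_pos.mpr (posNormSq_pos hW hWW)
  refine ⟨√(posNormSq W) * (√(posNormSq V))⁻¹, by positivity, ?_⟩
  rw [mul_smul]
  change _ = _ • ray V
  rw [h, ray, smul_smul, mul_inv_cancel₀ h2.ne', one_smul]

lemma IsNullFrame.P_ne {P A B N Q : R23} (h : IsNullFrame P A B N Q) : P ≠ 0 := by
  rintro rfl
  have := h.PQ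
  simp [sp_zero_left] at this

section Uniqueness

variable {E : Type*} [NormedAddCommGroup E] [NormedSpace ℝ E] {H : Type*} [TopologicalSpace H]
  {I : ModelWithCorners ℝ E H} {X : Type*} [TopologicalSpace X] [ChartedSpace H X]
  {f : X → R23} {o : ∀ x : X, Orientation ℝ (TangentSpace I x) (Fin 2)} {U U' : Set X}

lemma dform_smul_of_eventuallyEq {G G' : X → R23} {r : X → ℝ} {x : X}
    (hr : MDifferentiableAt I 𝓘(ℝ, ℝ) r x) (hG : MDifferentiableAt I 𝓘(ℝ, R23) G x)
    (h : ∀ᶠ y in 𝓝 x, G' y = r y • G y) (Y : R23) (v : TangentSpace I x) :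
    dform I G' Y x v = r x * dform I G Y x v + mvfderiv I r x v * sp (G x) Y := by
  rw [dform_apply, mvfderiv_congr (I := I) (g := fun y => r y • G y) h, mvfderiv_smul_apply hr hG,
    sp_add_left, sp_smul_left, sp_smul_left]
  rfl

lemma dform_add_smul_of_eventuallyEq {G K G' : X → R23} {r : X → ℝ} {x : X}
    (hK : MDifferentiableAt I 𝓘(ℝ, R23) K x)
    (hr : MDifferentiableAt I 𝓘(ℝ, ℝ) r x) (hG : MDifferentiableAt I 𝓘(ℝ, R23) G x)
    (h : ∀ᶠ y in 𝓝 x, G' y = K y + r y • G y) (Y : R23) (v : TangentSpace I x) :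
    dform I G' Y x v =
      dform I K Y x v + (r x * dform I G Y x v + mvfderiv I r x v * sp (G x) Y) := by
  have hd : MDifferentiableAt I 𝓘(ℝ, R23) (fun y => r y • G y) x := hr.smul hG
  rw [dform_apply, mvfderiv_congr (I := I) (g := fun y => K y + r y • G y) h,
    mvfderiv_add_apply hK hd, mvfderiv_smul_apply hr hG, sp_add_left, sp_add_left, sp_smul_left,
    sp_smul_left]
  rfl

lemma dform_smul_right (G : X → R23) (c : ℝ) (Y : R23) (x : X) (v : TangentSpace I x) :
    dform I G (c • Y) x v = c * dform I G Y x v := sp_smul_right _ _ _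

lemma dform_add_right (G : X → R23) (Y Z : R23) (x : X) (v : TangentSpace I x) :
    dform I G (Y + Z) x v = dform I G Y x v + dform I G Z x v := sp_add_right _ _ _

variable [hE : Fact (Module.finrank ℝ E = 2)]

omit hE in
/-- If `α ∧ β ≠ 0` then `α` and `β` are linearly independent. -/
lemma eq_zero_of_wedge_ne {x : X} {α β : TangentSpace I x →ₗ[ℝ] ℝ} {v w : TangentSpace I x}
    (h : wedge I α β v w ≠ 0) {a b : ℝ} (hab : ∀ v, a * α v + b * β v = 0) : a = 0 ∧ b = 0 := by
  have h1 := hab v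
  have h2 := hab w
  unfold wedge at h
  constructor
  · refine (mul_eq_zero.mp (?_ : a * (α v * β w - α w * β v) = 0)).resolve_right h
    linear_combination β w * h1 - β v * h2
  · refine (mul_eq_zero.mp (?_ : b * (α v * β w - α w * β v) = 0)).resolve_right h
    linear_combination -α w * h1 + α v * h2

/-- Two first order frame fields have proportional `P`, and up to this scaling differ by a boost of
`A, B` and translations. -/
lemma NullField.IsFirstOrder.compare {Φ Ψ : NullField X} (h : Φ.IsFirstOrder I f o U)
    (h' : Ψ.IsFirstOrder I f o U') {x : X} (hx : x ∈ U) (hx' : x ∈ U') :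
    ∃ r k a b c : ℝ, 0 < r ∧ 0 < k ∧ Ψ.P x = r • Φ.P x ∧ Ψ.A x = k • Φ.A x + a • Φ.P x ∧
      Ψ.B x = k⁻¹ • Φ.B x + b • Φ.P x ∧ Ψ.N x = Φ.N x + c • Φ.P x := by
  have hs : ∀ X Y, sp X Y = sp Y X := sp_comm
  have hn := (h.oriented x hx).1
  have hn' := (h'.oriented x hx').1
  have hP : ∀ y ∈ U ∩ U', ∃ r : ℝ, 0 < r ∧ Ψ.P y = r • Φ.P y := fun y hy =>
    exists_pos_smul_of_ray_eq (h.oriented y hy.1).1.P_ne (h.oriented y hy.1).1.PP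
      (h'.oriented y hy.2).1.P_ne (h'.oriented y hy.2).1.PP
      ((h.ray_eq y hy.1).symm.trans (h'.ray_eq y hy.2))
  obtain ⟨r, hr, hPr⟩ := hP x ⟨hx, hx'⟩
  obtain ⟨dP, dA, dB, dN, dQ⟩ := h.mdiff hx
  obtain ⟨dP', dA', dB', dN', dQ'⟩ := h'.mdiff hx'
  -- both fields lie on the ray of `f`, so `Ψ.P = ρ Φ.P` near `x`, and the term `dρ Φ.P` is
  -- invisible to vectors `Y` orthogonal to `Φ.P`
  have hdP : ∀ Y v, sp (Φ.P x) Y = 0 → dform I Ψ.P Y x v = r * dform I Φ.P Y x v := by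
    intro Y v hY
    have hρ : MDifferentiableAt I 𝓘(ℝ, ℝ) (fun y => sp (Ψ.P y) (-Φ.Q y)) x :=
      mdifferentiableAt_sp dP' dQ.neg
    have hval : ∀ y ∈ U ∩ U', Ψ.P y = sp (Ψ.P y) (-Φ.Q y) • Φ.P y := by
      intro y hy
      obtain ⟨s, -, hs⟩ := hP y hy
      rw [hs, sp_smul_left, sp_neg_right, (h.oriented y hy.1).1.PQ]
      simp
    have := dform_smul_of_eventuallyEq hρ dP
      (Filter.eventually_of_mem ((h.isOpen.inter h'.isOpen).mem_nhds ⟨hx, hx'⟩) hval) Y v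
    rw [this, hY, hPr, sp_smul_left, sp_neg_right, hn.PQ]
    ring
  have orth : ∀ {Y}, sp (Ψ.P x) Y = 0 → sp (Φ.P x) Y = 0 := by
    intro Y hY
    rw [hPr, sp_smul_left] at hY
    exact (mul_eq_zero.mp hY).resolve_left hr.ne'
  obtain ⟨v₀, w₀, hvw⟩ := exists_isPositivePair (o x)
  have hpos := h.wedge_pos x hx v₀ w₀ hvw
  have hpos' := h'.wedge_pos x hx' v₀ w₀ hvw
  -- `Ψ.N` is orthogonal to `dP`, hence a combination of `N` and `P`
  have hN0 := orth hn'.PN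
  have hN1 : ∀ v, (1 / 2 * sp (Ψ.N x) (Φ.A x)) * dform I Φ.P (Φ.B x) x v +
      (1 / 2 * sp (Ψ.N x) (Φ.B x)) * dform I Φ.P (Φ.A x) x v = 0 := by
    intro v
    have h1 := hdP (Ψ.N x) v hN0
    rw [h'.dP_N x hx' v, hn.expand (Ψ.N x), hs _ (Φ.P x), hN0] at h1
    have h2 := h.dP_N x hx v
    have h3 := (h.dform_relations hx v).1
    simp only [dform_apply] at h1 h2 h3 ⊢
    simp only [sp_add_right, sp_sub_right, sp_smul_right, h2, h3] at h1
    have := (mul_eq_zero.mp h1.symm).resolve_left hr.ne'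
    linarith
  obtain ⟨hNA, hNB⟩ := eq_zero_of_wedge_ne hpos.ne' hN1
  replace hNA : sp (Ψ.N x) (Φ.A x) = 0 := by linarith
  replace hNB : sp (Ψ.N x) (Φ.B x) = 0 := by linarith
  have hN : Ψ.N x = sp (Ψ.N x) (Φ.N x) • Φ.N x + (-sp (Ψ.N x) (Φ.Q x)) • Φ.P x := by
    conv_lhs => rw [hn.expand (Ψ.N x), hs _ (Φ.P x), hN0, hNA, hNB]
    module
  set e := sp (Ψ.N x) (Φ.N x) with he
  set c := -sp (Ψ.N x) (Φ.Q x) with hc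
  have he2 : e * e = 1 := by
    have := hn'.NN
    rw [hN] at this
    simp only [sp_add_left, sp_add_right, sp_smul_left, sp_smul_right, hn.NN, hn.PP, hn.PN,
      hs (Φ.N x) (Φ.P x)] at this
    linarith
  have orthN : ∀ {Y}, sp (Φ.P x) Y = 0 → sp (Ψ.N x) Y = 0 → sp Y (Φ.N x) = 0 := by
    intro Y h1 h2
    rw [hN, sp_add_left, sp_smul_left, sp_smul_left, h1] at h2
    rw [hs]
    have : e * e * sp (Φ.N x) Y = 0 := by linear_combination e * h2
    rwa [he2, one_mul] at this
  -- `Â` and `B̂` are combinations of `P`, `A`, `B`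
  have comb : ∀ {Y}, sp (Φ.P x) Y = 0 → sp (Ψ.N x) Y = 0 → ∃ a₀ a₁ a₂ : ℝ,
      Y = a₀ • Φ.P x + a₁ • Φ.A x + a₂ • Φ.B x := by
    intro Y h1 h2
    refine ⟨-sp Y (Φ.Q x), -(1 / 2 * sp Y (Φ.B x)), -(1 / 2 * sp Y (Φ.A x)), ?_⟩
    conv_lhs => rw [hn.expand Y, hs _ (Φ.P x), h1, orthN h1 h2]
    module
  have hPA := orth hn'.PA
  have hPB := orth hn'.PB
  obtain ⟨a₀, a₁, a₂, hA⟩ := comb hPA (by rw [hs]; exact hn'.AN)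
  obtain ⟨b₀, b₁, b₂, hB⟩ := comb hPB (by rw [hs]; exact hn'.BN)
  have g1 := hn'.AA
  have g2 := hn'.AB
  have g3 := hn'.BB
  rw [hA] at g1 g2
  rw [hB] at g2 g3
  simp only [sp_add_left, sp_add_right, sp_smul_left, sp_smul_right, hn.PP, hn.PA, hn.PB, hn.AA,
    hn.AB, hn.BB, hs (Φ.A x) (Φ.P x), hs (Φ.B x) (Φ.P x), hs (Φ.B x) (Φ.A x)] at g1 g2 g3
  have hdet : 0 < a₁ * b₂ - a₂ * b₁ := by
    have e1 : ∀ v, dform I Ψ.P (Ψ.A x) x v =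
        r * (a₁ * dform I Φ.P (Φ.A x) x v + a₂ * dform I Φ.P (Φ.B x) x v) := by
      intro v
      rw [hdP _ _ hPA, hA, dform_add_right, dform_add_right, dform_smul_right, dform_smul_right,
        dform_smul_right, (h.dform_relations hx v).1]
      ring
    have e2 : ∀ v, dform I Ψ.P (Ψ.B x) x v =
        r * (b₁ * dform I Φ.P (Φ.A x) x v + b₂ * dform I Φ.P (Φ.B x) x v) := by
      intro v
      rw [hdP _ _ hPB, hB, dform_add_right, dform_add_right, dform_smul_right, dform_smul_right,
        dform_smul_right, (h.dform_relations hx v).1]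
      ring
    have e3 : wedge I (dform I Ψ.P (Ψ.B x) x) (dform I Ψ.P (Ψ.A x) x) v₀ w₀ =
        r ^ 2 * (a₁ * b₂ - a₂ * b₁) *
          wedge I (dform I Φ.P (Φ.B x) x) (dform I Φ.P (Φ.A x) x) v₀ w₀ := by
      simp only [wedge, e1, e2]; ring
    rw [e3] at hpos'
    exact pos_of_mul_pos_right (pos_of_mul_pos_left hpos' hpos.le) (by positivity)
  have ha₂ : a₂ = 0 := by
    have h1 : a₁ * a₂ = 0 := by linarith
    rcases mul_eq_zero.mp h1 with h2 | h2
    · subst h2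
      linarith
    · exact h2
  subst ha₂
  have hab : a₁ * b₂ = 1 := by linarith
  have ha₁ : a₁ ≠ 0 := left_ne_zero_of_mul_eq_one hab
  have hb₁ : b₁ = 0 := by
    have h1 : b₁ * b₂ = 0 := by linarith
    exact (mul_eq_zero.mp h1).resolve_right (right_ne_zero_of_mul_eq_one hab)
  subst hb₁
  have hdete : e = 1 := by
    have h1 := hn.swap.det5_eq hn'.swap (a := a₁) (b := a₀) (c := 0) (e := r) (κ := e) (k := 0)
      (l := c) (by rw [hA]; module) (by rw [hPr]; module) (by conv_lhs => rw [hN]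
                                                              module)
    rw [det5_swap, det5_swap (Φ.P x)] at h1
    have h2 := (h.oriented x hx).2.1
    have h3 := (h'.oriented x hx').2.1
    have h4 : 0 < e * det5 (Φ.P x) (Φ.A x) (Φ.B x) (Φ.N x) (Φ.Q x) := by linarith
    have h5 := pos_of_mul_pos_left h4 h2.le
    nlinarith
  have hk : 0 < a₁ := by
    have h1 := (h.oriented x hx).2.2
    have h2 := (h'.oriented x hx').2.2
    rw [hPr, hA] at h2
    have h3 := minor_smul_add r 0 a₀ a₁ (Φ.P x) (Φ.A x)
    simp only [zero_smul, add_zero] at h3 h2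
    rw [h3] at h2
    have := pos_of_mul_pos_left h2 h1.le
    rw [zero_mul, sub_zero] at this
    exact pos_of_mul_pos_right this hr.le
  refine ⟨r, a₁, a₀, b₀, c, hr, hk, hPr, by rw [hA]; module, ?_, ?_⟩
  · rw [hB, eq_inv_of_mul_eq_one_right hab]; module
  · conv_lhs => rw [hN, hdete]
    module

/-- Second order frame fields have the same `N`. -/
lemma NullField.IsSecondOrder.N_eq {Φ Ψ : NullField X} (h : Φ.IsSecondOrder I f o U)
    (h' : Ψ.IsSecondOrder I f o U') {x : X} (hx : x ∈ U) (hx' : x ∈ U') : Ψ.N x = Φ.N x := by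
  have hn := (h.oriented x hx).1
  obtain ⟨r, k, a, b, c, hr, hk, hP, hA, hB, hN⟩ := h.compare h'.toIsFirstOrder hx hx'
  obtain ⟨dP, dA, dB, dN, dQ⟩ := h.mdiff hx
  obtain ⟨dP', dA', dB', dN', dQ'⟩ := h'.mdiff hx'
  have hnh := (h.isOpen.inter h'.isOpen).mem_nhds ⟨hx, hx'⟩
  have hNc : ∀ᶠ y in 𝓝 x, Ψ.N y = Φ.N y + (sp (Ψ.N y) (-Φ.Q y)) • Φ.P y := by
    filter_upwards [hnh] with y hy
    obtain ⟨r, k, a, b, c, hr, hk, hP, hA, hB, hN⟩ := h.compare h'.toIsFirstOrder hy.1 hy.2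
    rw [hN, sp_neg_right, sp_add_left, sp_smul_left, (h.oriented y hy.1).1.PQ,
      (h.oriented y hy.1).1.NQ]
    simp
  have hPr : ∀ᶠ y in 𝓝 x, Ψ.P y = (sp (Ψ.P y) (-Φ.Q y)) • Φ.P y := by
    filter_upwards [hnh] with y hy
    obtain ⟨r, k, a, b, c, hr, hk, hP, hA, hB, hN⟩ := h.compare h'.toIsFirstOrder hy.1 hy.2
    rw [hP, sp_neg_right, sp_smul_left, (h.oriented y hy.1).1.PQ]
    simp
  have hc : sp (Ψ.N x) (-Φ.Q x) = c := by
    rw [hN, sp_neg_right, sp_add_left, sp_smul_left, hn.PQ, hn.NQ]; ring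
  have hrr : sp (Ψ.P x) (-Φ.Q x) = r := by
    rw [hP, sp_neg_right, sp_smul_left, hn.PQ]; ring
  have kN := fun Y v => dform_add_smul_of_eventuallyEq dN
    (mdifferentiableAt_sp dN' dQ.neg) dP hNc Y v
  have kP := fun Y v => dform_smul_of_eventuallyEq (mdifferentiableAt_sp dP' dQ.neg) dP hPr Y v
  simp only [Pi.neg_apply, hc, hrr] at kN kP
  obtain ⟨v₀, w₀, hvw⟩ := exists_isPositivePair (o x)
  have hpos := h.wedge_pos x hx v₀ w₀ hvw
  have t := h.trace x hx v₀ w₀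
  have t' := h'.trace x hx' v₀ w₀
  have zP := fun v => (h.dform_relations hx v).1
  have zN := fun v => (h.dform_relations hx v).2.2.2.2.2.2.2.1
  have zPN := fun v => h.dP_N x hx v
  simp only [wedge] at t t' hpos
  rw [hA, hB] at t'
  simp only [dform_add_right, dform_smul_right, kN, kP, sp_add_right, sp_smul_right, hn.PA, hn.PB,
    hn.PP, zP, zN, zPN, mul_zero, add_zero, neg_zero] at t'
  have hkk : k * k⁻¹ = 1 := mul_inv_cancel₀ hk.ne'
  have hc0 : c * (dform I Φ.P (Φ.B x) x v₀ * dform I Φ.P (Φ.A x) x w₀ -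
      dform I Φ.P (Φ.B x) x w₀ * dform I Φ.P (Φ.A x) x v₀) = 0 := by
    refine (mul_eq_zero.mp (?_ : r * _ = 0)).resolve_left hr.ne'
    linear_combination (r * (k * k⁻¹) / 2) * t - (1 / 2) * t' - (r * (c * (dform I Φ.P
      (Φ.B x) x v₀ *
      dform I Φ.P (Φ.A x) x w₀ - dform I Φ.P (Φ.B x) x w₀ * dform I Φ.P (Φ.A x) x v₀))) * hkk
  rw [hN, (mul_eq_zero.mp hc0).resolve_right hpos.ne']
  simp

/-- The conformal Gauss map is the vector `N` of any second order frame field. -/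
theorem NullField.IsSecondOrder.gaussMap_eq {Φ : NullField X} (h : Φ.IsSecondOrder I f o U)
    {x : X} (hx : x ∈ U) : gaussMap I f o x = Φ.N x := by
  have h1 : ∃ (n : R23) (U : Set X) (F : X → Fin 5 → R23),
      IsOpen U ∧ x ∈ U ∧ IsSecondOrderFrame I f o U F ∧ F x 3 = n :=
    ⟨Φ.N x, U, Φ.toFrame, h.isOpen, hx, (isSecondOrderFrame_iff h.isOpen).mpr h, rfl⟩
  obtain ⟨U', F, hU', hx', hF, hn⟩ := Classical.epsilon_spec h1
  rw [← toFrame_nullField F, isSecondOrderFrame_iff hU'] at hF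
  have h2 := h.N_eq hF hx hx'
  exact hn.symm.trans h2

omit hE in
/-- Exchanging `A` and `B` and reversing `N` gives a second order frame field for the opposite
orientation. -/
lemma NullField.IsSecondOrder.flip {Φ : NullField X} (h : Φ.IsSecondOrder I f o U) :
    NullField.IsSecondOrder ⟨Φ.P, Φ.B, Φ.A, fun y => -Φ.N y, Φ.Q⟩ I f (fun x => -o x) U := by
  have hN : ∀ x ∈ U, ∀ Y v, dform I (fun y => -Φ.N y) Y x v = -dform I Φ.N Y x v := by
    intro x hx Y v
    rw [dform_apply, mvfderiv_neg_apply, sp_neg_left]; rfl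
  refine ⟨⟨⟨h.isOpen, h.sP, h.sB, h.sA, h.sN.neg, h.sQ, fun x hx => (h.oriented x hx).flip,
    h.ray_eq⟩, fun x hx v => ?_, fun x hx v w hvw => ?_⟩, fun x hx v w => ?_⟩
  · have := h.dP_N x hx v
    rw [dform_apply] at this ⊢
    change sp _ (-Φ.N x) = 0
    rw [sp_neg_right, this, neg_zero]
  · have := h.wedge_pos x hx w v hvw.swap
    simp only [wedge] at this ⊢
    linarith
  · have := h.trace x hx v w
    simp only [wedge] at this ⊢
    simp only [hN x hx]
    linarith

/-- Adapted frame fields have proportional `Q`. -/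
lemma NullField.IsAdapted.Q_eq {Φ Ψ : NullField X} {ε : ℝ} (hε : ε ≠ 0)
    (h : Φ.IsAdapted I f o ε U)
    (h' : Ψ.IsAdapted I f o ε U') {x : X} (hx : x ∈ U) (hx' : x ∈ U') :
    ∃ r : ℝ, 0 < r ∧ Ψ.Q x = r • Φ.Q x := by
  have hs : ∀ X Y, sp X Y = sp Y X := sp_comm
  have hnh := (h.isOpen.inter h'.isOpen).mem_nhds ⟨hx, hx'⟩
  have key : ∀ y ∈ U ∩ U', ∃ r k b : ℝ, 0 < r ∧ 0 < k ∧ r * k ^ 2 = 1 ∧ Ψ.P y = r • Φ.P y ∧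
      Ψ.A y = k • Φ.A y ∧ Ψ.B y = k⁻¹ • Φ.B y + b • Φ.P y ∧
      Ψ.Q y = (-(k * b * r⁻¹ / 2)) • Φ.A y + r⁻¹ • Φ.Q y := by
    intro y hy
    have hn := (h.oriented y hy.1).1
    have hn' := (h'.oriented y hy.2).1
    obtain ⟨dP, dA, dB, dN, dQ⟩ := h.mdiff hy.1
    obtain ⟨dP', dA', dB', dN', dQ'⟩ := h'.mdiff hy.2
    obtain ⟨r, k, a, b, c, hr, hk, hP, hA, hB, -⟩ :=
      h.compare h'.toIsSecondOrder.toIsFirstOrder hy.1 hy.2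
    have hN := h.N_eq h'.toIsSecondOrder hy.1 hy.2
    have hN' : ∀ᶠ z in 𝓝 y, Ψ.N z = Φ.N z := by
      filter_upwards [(h.isOpen.inter h'.isOpen).mem_nhds hy] with z hz using
        h.N_eq h'.toIsSecondOrder hz.1 hz.2
    have hdN : ∀ Y v, dform I Ψ.N Y y v = dform I Φ.N Y y v := by
      intro Y v; rw [dform_apply, mvfderiv_congr hN']; rfl
    have hdN2 : ∀ Y v, dform I Φ.N Y y v = -(ε * dform I Φ.P (Φ.A y) y v) * sp (Φ.A y) Y := by
      intro Y v
      have h1 := h.dN_A y hy.1 v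
      have h2 := h.dN_B y hy.1 v
      have h3 := h.dN_Q y hy.1 v
      have h4 := (h.dform_relations hy.1 v).2.2.2.2.2.2.2.1
      have h5 := (h.dform_relations hy.1 v).2.2.2.1
      have h6 := h.dP_N y hy.1 v
      rw [h6] at h4
      rw [dform_apply] at h1 h2 h3 h4 h5 ⊢
      rw [hn.expand (mvfderiv I Φ.N y v), h1, h2, h3, h4, h5]
      simp only [sp_add_left, sp_sub_left, sp_smul_left]
      ring
    obtain ⟨v₀, w₀, hvw⟩ := exists_isPositivePair (o y)
    have hpos := h.wedge_pos y hy.1 v₀ w₀ hvw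
    obtain ⟨v, hv⟩ : ∃ v, dform I Φ.P (Φ.A y) y v ≠ 0 := by
      by_contra! hcon
      simp [wedge, hcon] at hpos
    have hAQ : sp (Φ.A y) (Ψ.Q y) = 0 := by
      have h1 := h'.dN_Q y hy.2 v
      rw [hdN, hdN2] at h1
      exact (mul_eq_zero.mp h1).resolve_left (neg_ne_zero.mpr (mul_ne_zero hε hv))
    have hPQ : sp (Φ.P y) (Ψ.Q y) = -r⁻¹ := by
      have h1 := hn'.PQ
      rw [hP, sp_smul_left] at h1
      field_simp
      linarith
    have hNQ : sp (Φ.N y) (Ψ.Q y) = 0 := by rw [← hN]; exact hn'.NQ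
    have ha : a = 0 := by
      have h1 := hn'.AQ
      rw [hA, sp_add_left, sp_smul_left, sp_smul_left, hAQ, hPQ] at h1
      simpa [hr.ne'] using h1
    subst ha
    have hq := hn.expand (Ψ.Q y)
    rw [hs _ (Φ.A y), hAQ, hs _ (Φ.P y), hPQ, hs _ (Φ.N y), hNQ] at hq
    set q := sp (Ψ.Q y) (Φ.Q y) with hqdef
    set β := sp (Ψ.Q y) (Φ.B y) with hβ
    have hq0 : q = 0 := by
      have h1 := hn'.QQ
      rw [hq] at h1
      simp only [sp_add_left, sp_add_right, sp_sub_left, sp_sub_right, sp_smul_left, sp_smul_right,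
        hn.PP, hn.PA, hn.PB, hn.PN, hn.PQ, hn.AA, hn.AB, hn.AN, hn.AQ, hn.QQ, hs (Φ.A y) (Φ.P y),
        hs (Φ.Q y) _] at h1
      have : q * r⁻¹ = 0 := by linarith
      exact (mul_eq_zero.mp this).resolve_right (inv_ne_zero hr.ne')
    have hβ' : β = k * b * r⁻¹ := by
      have h1 := hn'.BQ
      rw [hB, sp_add_left, sp_smul_left, sp_smul_left, hPQ, hs, ← hβ] at h1
      field_simp at h1 ⊢
      linarith
    refine ⟨r, k, b, hr, hk, ?_, hP, by rw [hA]; simp, hB, ?_⟩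
    · have hdP : dform I Ψ.P (Ψ.A y) y v = r * k * dform I Φ.P (Φ.A y) y v := by
        have hPr : ∀ᶠ z in 𝓝 y, Ψ.P z = (sp (Ψ.P z) (-Φ.Q z)) • Φ.P z := by
          filter_upwards [(h.isOpen.inter h'.isOpen).mem_nhds hy] with z hz
          obtain ⟨r, k, a, b, c, hr, hk, hP, hA, hB, hN⟩ :=
            h.compare h'.toIsSecondOrder.toIsFirstOrder hz.1 hz.2
          rw [hP, sp_neg_right, sp_smul_left, (h.oriented z hz.1).1.PQ]
          simp
        have := dform_smul_of_eventuallyEq (mdifferentiableAt_sp dP' dQ.neg) dP hPr (Ψ.A y) v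
        rw [this, hA, zero_smul, add_zero, sp_smul_right, hn.PA, hP, dform_smul_right]
        simp only [Pi.neg_apply, sp_neg_right, sp_smul_left, hn.PQ]
        ring
      have h1 := h'.dN_B y hy.2 v
      rw [hdN, hdN2, hB, sp_add_right, sp_smul_right, sp_smul_right, hn.AB, hs _ (Φ.P y), hn.PA,
        hdP] at h1
      field_simp at h1
      linear_combination (-1 / 2) * h1
    · rw [hq, hq0, hβ']; module
  obtain ⟨r, k, b, hr, hk, hrk, hP, hA, hB, hQ⟩ := key x ⟨hx, hx'⟩
  have hn := (h.oriented x hx).1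
  obtain ⟨dP, dA, dB, dN, dQ⟩ := h.mdiff hx
  obtain ⟨dP', dA', dB', dN', dQ'⟩ := h'.mdiff hx'
  set ρ : X → ℝ := fun y => sp (Ψ.P y) (-Φ.Q y) with hρ
  set κ : X → ℝ := fun y => sp (Ψ.A y) (-((1 / 2 : ℝ) • Φ.B y)) with hκ
  have dρ : MDifferentiableAt I 𝓘(ℝ, ℝ) ρ x := mdifferentiableAt_sp dP' dQ.neg
  have dκ : MDifferentiableAt I 𝓘(ℝ, ℝ) κ x :=
    mdifferentiableAt_sp dA' ((dB.const_smul (1 / 2 : ℝ)).neg)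
  have hval : ∀ y ∈ U ∩ U', Ψ.P y = ρ y • Φ.P y ∧ Ψ.A y = κ y • Φ.A y ∧ ρ y * κ y * κ y = 1 := by
    intro y hy
    obtain ⟨r, k, b, hr, hk, hrk, hP, hA, hB, hQ⟩ := key y hy
    have hn := (h.oriented y hy.1).1
    have h1 : ρ y = r := by
      simp only [hρ, hP, sp_neg_right, sp_smul_left, hn.PQ]; ring
    have h2 : κ y = k := by
      simp only [hκ, hA, sp_neg_right, sp_smul_left, sp_smul_right, hn.AB]; ring
    rw [h1, h2]
    exact ⟨hP, hA, by linarith⟩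
  have hρx : ρ x = r := by
    simp only [hρ, hP, sp_neg_right, sp_smul_left, hn.PQ]; ring
  have hκx : κ x = k := by
    simp only [hκ, hA, sp_neg_right, sp_smul_left, sp_smul_right, hn.AB]; ring
  obtain ⟨v₀, w₀, hvw⟩ := exists_isPositivePair (o x)
  have hpos := h.wedge_pos x hx v₀ w₀ hvw
  obtain ⟨v, hv⟩ : ∃ v, dform I Φ.P (Φ.A x) x v ≠ 0 := by
    by_contra! hcon
    simp [wedge, hcon] at hpos
  have eP := dform_smul_of_eventuallyEq dρ dP
    (Filter.eventually_of_mem hnh fun y hy => (hval y hy).1) (Ψ.Q x) v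
  have eA := dform_smul_of_eventuallyEq dκ dA
    (Filter.eventually_of_mem hnh fun y hy => (hval y hy).2.1) (Ψ.B x) v
  -- differentiate `ρ κ² = 1`
  have hlog : mvfderiv I ρ x v * k ^ 2 + 2 * r * k * mvfderiv I κ x v = 0 := by
    have h1 : mvfderiv I (fun y => (ρ y * κ y) * κ y) x v = 0 := by
      rw [mvfderiv_congr (I := I) (g := fun _ => (1 : ℝ))
        (Filter.eventually_of_mem hnh fun y hy => (hval y hy).2.2), mvfderiv_const]
      rfl
    have dρκ : MDifferentiableAt I 𝓘(ℝ, ℝ) (fun y => ρ y • κ y) x := dρ.smul dκ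
    have h2 := mvfderiv_smul_apply dρκ dκ v
    rw [mvfderiv_smul_apply dρ dκ] at h2
    simp only [smul_eq_mul, h1, hρx, hκx] at h2
    linarith
  have h1 := h'.dP_Q x hx' v
  have h2 := h.dP_Q x hx v
  have h3 := (h.dform_relations hx v).1
  have h4 := (h.dform_relations hx v).2.2.2.2.2.1
  rw [eP, eA, hQ, hB] at h1
  simp only [dform_add_right, dform_smul_right, sp_add_right, sp_smul_right, hn.PA, hn.PQ, hn.AB,
    hs (Φ.A x) (Φ.P x), hρx, hκx, h4] at h1
  have hb : b = 0 := by
    have h5 : k * b * dform I Φ.P (Φ.A x) x v = 0 := by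
      have hr2 : r = (k ^ 2)⁻¹ := eq_inv_of_mul_eq_one_left hrk
      rw [hr2] at h1 hlog
      field_simp at h1 hlog
      refine (mul_eq_zero.mp (?_ : (3 * k) * _ = 0)).resolve_left (by positivity)
      linear_combination 2 * k * h2 - h1 - 2 * hlog
    have h7 := (mul_eq_zero.mp h5).resolve_right hv
    exact (mul_eq_zero.mp h7).resolve_left hk.ne'
  refine ⟨r⁻¹, inv_pos.mpr hr, ?_⟩
  rw [hQ, hb]
  simp

/-- The dual map is given by the vector `Q` of any adapted frame field. -/
theorem NullField.IsAdapted.dualMap_eq {Φ : NullField X} {ε : ℝ} (hε : ε ≠ 0)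
    (h : Φ.IsAdapted I f o ε U) {x : X} (hx : x ∈ U) : dualMap I f o ε x = ray (Φ.Q x) := by
  have h1 : ∃ (n : R23) (U : Set X) (F : X → Fin 5 → R23),
      IsOpen U ∧ x ∈ U ∧ IsAdaptedFrame I f o ε U F ∧ ray (F x 4) = n :=
    ⟨_, U, Φ.toFrame, h.isOpen, hx, (isAdaptedFrame_iff h.isOpen).mpr h, rfl⟩
  obtain ⟨U', F, hU', hx', hF, hn⟩ := Classical.epsilon_spec h1
  rw [← toFrame_nullField F, isAdaptedFrame_iff hU'] at hF
  obtain ⟨r, hr, hQ⟩ := h.Q_eq hε hF hx hx'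
  refine hn.symm.trans ?_
  change ray ((nullField F).Q x) = _
  rw [hQ, ray_smul hr]

end Uniqueness

/-! ### Existence of second order frame fields -/

lemma sp_eq_zero_of_norms {V : R23} (h : V ∈ einsteinUniverse) : sp V V = 0 := by
  rw [sp_self_eq, h.1, h.2, sub_self]

lemma ray_eq_self {V : R23} (h : V ∈ einsteinUniverse) : ray V = V := by
  rw [ray, h.2]; simp

lemma ne_zero_of_mem_einsteinUniverse {V : R23} (h : V ∈ einsteinUniverse) : V ≠ 0 := by
  rintro rfl
  have := h.2
  simp [posNormSq, sp_zero_left] at this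

/-- The Gram-Schmidt process for `P` null and `G₁`, `G₂` timelike and spacelike modulo `P`. -/
lemma isNullFrame_gramSchmidt {P G₁ G₂ Q₀ : R23} (PP : sp P P = 0) (P1 : sp P G₁ = 0)
    (P2 : sp P G₂ = 0) {F₁ K F₂ A B q Q : R23} (h1 : sp G₁ G₁ < 0)
    (hF₁ : F₁ = (√(-sp G₁ G₁))⁻¹ • G₁) (hK : K = G₂ + sp G₂ F₁ • F₁) (h2 : 0 < sp K K)
    (hF₂ : F₂ = (√(sp K K))⁻¹ • K) (hA : A = F₁ - F₂) (hB : B = F₁ + F₂) (hQ₀ : sp Q₀ P ≠ 0)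
    (hq : q = (-sp Q₀ P)⁻¹ • (Q₀ + (1 / 2 * sp Q₀ B) • A + (1 / 2 * sp Q₀ A) • B))
    (hQ : Q = q + (1 / 2 * sp q q) • P) :
    IsNullFrame P A B (normalVec P A B Q) Q ∧ 0 < det5 P A B (normalVec P A B Q) Q := by
  have hs : ∀ X Y, sp X Y = sp Y X := sp_comm
  have PF1 : sp P F₁ = 0 := by rw [hF₁, sp_smul_right, P1, mul_zero]
  have F11 : sp F₁ F₁ = -1 := by
    rw [hF₁, sp_smul_left, sp_smul_right, ← mul_assoc, ← mul_inv,
      Real.mul_self_sqrt (by linarith)]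
    have : sp G₁ G₁ ≠ 0 := h1.ne
    field_simp
  have PK : sp P K = 0 := by rw [hK, sp_add_right, sp_smul_right, P2, PF1]; ring
  have FK : sp F₁ K = 0 := by rw [hK, sp_add_right, sp_smul_right, F11, hs G₂]; ring
  have PF2 : sp P F₂ = 0 := by rw [hF₂, sp_smul_right, PK, mul_zero]
  have F12 : sp F₁ F₂ = 0 := by rw [hF₂, sp_smul_right, FK, mul_zero]
  have F22 : sp F₂ F₂ = 1 := by
    rw [hF₂, sp_smul_left, sp_smul_right, ← mul_assoc, ← mul_inv, Real.mul_self_sqrt h2.le]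
    exact inv_mul_cancel₀ h2.ne'
  have PA : sp P A = 0 := by rw [hA, sp_sub_right, PF1, PF2, sub_zero]
  have PB : sp P B = 0 := by rw [hB, sp_add_right, PF1, PF2, add_zero]
  have AA : sp A A = 0 := by
    rw [hA]; simp only [sp_sub_left, sp_sub_right, F11, F12, F22, hs F₂ F₁]; ring
  have AB : sp A B = -2 := by
    rw [hA, hB]; simp only [sp_sub_left, sp_add_right, F11, F12, F22, hs F₂ F₁]; ring
  have BB : sp B B = 0 := by
    rw [hB]; simp only [sp_add_left, sp_add_right, F11, F12, F22, hs F₂ F₁]; ring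
  have Aq : sp A q = 0 := by
    rw [hq]; simp only [sp_smul_right, sp_add_right, AA, AB, hs A Q₀]; ring
  have Bq : sp B q = 0 := by
    rw [hq]; simp only [sp_smul_right, sp_add_right, BB, AB, hs B A, hs B Q₀]; ring
  have Pq : sp P q = -1 := by
    rw [hq]; simp only [sp_smul_right, sp_add_right, PA, PB, hs P Q₀]
    field_simp
    ring
  refine isNullFrame_normalVec PP PA PB ?_ AA AB ?_ BB ?_ ?_
  · rw [hQ, sp_add_right, sp_smul_right, PP, Pq]; ring
  · rw [hQ, sp_add_right, sp_smul_right, Aq, hs A, PA]; ring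
  · rw [hQ, sp_add_right, sp_smul_right, Bq, hs B, PB]; ring
  · rw [hQ]; simp only [sp_add_left, sp_add_right, sp_smul_left, sp_smul_right, PP, Pq, hs q P]
    ring

lemma contDiff_det {n : Type*} [Fintype n] [DecidableEq n] :
    ContDiff ℝ ∞ (fun F : n → n → ℝ => (Matrix.of fun i j => F j i).det) := by
  simp only [Matrix.det_apply', Matrix.of_apply]
  refine ContDiff.sum fun σ _ => contDiff_const.mul (contDiff_prod fun i _ => ?_)
  exact contDiff_apply_apply (𝕜 := ℝ) (E := ℝ) i (σ i)

section Existence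

variable {E : Type*} [NormedAddCommGroup E] [NormedSpace ℝ E] {H : Type*} [TopologicalSpace H]
  {I : ModelWithCorners ℝ E H} {X : Type*} [TopologicalSpace X] [ChartedSpace H X]
  {f : X → R23} {o : ∀ x : X, Orientation ℝ (TangentSpace I x) (Fin 2)} {U U' : Set X}

lemma contMDiffOn_mul {a b : X → ℝ} (ha : ContMDiffOn I 𝓘(ℝ, ℝ) ∞ a U)
    (hb : ContMDiffOn I 𝓘(ℝ, ℝ) ∞ b U) : ContMDiffOn I 𝓘(ℝ, ℝ) ∞ (fun y => a y * b y) U :=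
  ha.smul hb

lemma contMDiffOn_div {a b : X → ℝ} (ha : ContMDiffOn I 𝓘(ℝ, ℝ) ∞ a U)
    (hb : ContMDiffOn I 𝓘(ℝ, ℝ) ∞ b U) (h : ∀ y ∈ U, b y ≠ 0) :
    ContMDiffOn I 𝓘(ℝ, ℝ) ∞ (fun y => a y / b y) U :=
  ha.div₀ hb h

lemma contMDiffOn_inv_sqrt {a : X → ℝ} (ha : ContMDiffOn I 𝓘(ℝ, ℝ) ∞ a U)
    (h : ∀ y ∈ U, 0 < a y) : ContMDiffOn I 𝓘(ℝ, ℝ) ∞ (fun y => (√(a y))⁻¹) U := by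
  refine ContMDiffOn.inv₀ (fun y hy => ?_) fun y hy => (Real.sqrt_pos.mpr (h y hy)).ne'
  exact (Real.contDiffAt_sqrt (h y hy).ne').contMDiffAt.comp_contMDiffWithinAt y (ha y hy)

lemma contMDiffOn_det5 {P A B N Q : X → R23} (hP : ContMDiffOn I 𝓘(ℝ, R23) ∞ P U)
    (hA : ContMDiffOn I 𝓘(ℝ, R23) ∞ A U) (hB : ContMDiffOn I 𝓘(ℝ, R23) ∞ B U)
    (hN : ContMDiffOn I 𝓘(ℝ, R23) ∞ N U) (hQ : ContMDiffOn I 𝓘(ℝ, R23) ∞ Q U) :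
    ContMDiffOn I 𝓘(ℝ, ℝ) ∞ (fun y => det5 (P y) (A y) (B y) (N y) (Q y)) U := by
  have h1 : ContMDiffOn I 𝓘(ℝ, Fin 5 → R23) ∞ (fun y => ![P y, A y, B y, N y, Q y]) U := by
    refine contMDiffOn_pi_space.mpr fun i => ?_
    fin_cases i <;> assumption
  obtain ⟨g, hg, hgF⟩ : ∃ g : (Fin 5 → R23) → ℝ, ContDiff ℝ ∞ g ∧ ∀ F, g F = (colMatrix F).det :=
    ⟨fun F => (colMatrix F).det, contDiff_det, fun _ => rfl⟩
  simp only [det5, ← hgF]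
  exact hg.contMDiff.comp_contMDiffOn h1

lemma contMDiffOn_normalVec {P A B Q : X → R23} (hP : ContMDiffOn I 𝓘(ℝ, R23) ∞ P U)
    (hA : ContMDiffOn I 𝓘(ℝ, R23) ∞ A U) (hB : ContMDiffOn I 𝓘(ℝ, R23) ∞ B U)
    (hQ : ContMDiffOn I 𝓘(ℝ, R23) ∞ Q U) :
    ContMDiffOn I 𝓘(ℝ, R23) ∞ (fun y => normalVec (P y) (A y) (B y) (Q y)) U := by
  refine contMDiffOn_smul contMDiffOn_const (contMDiffOn_pi_space.mpr fun i => ?_)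
  have h := fun c : R23 => contMDiffOn_det5 hP hA hB (contMDiffOn_const (c := c)) hQ
  fin_cases i
  · exact (h _).neg
  · exact (h _).neg
  · exact h _
  · exact h _
  · exact (h _).neg

/-- A smooth positive local frame of the tangent bundle of an oriented surface. -/
structure IsPositiveFields (I : ModelWithCorners ℝ E H) [IsManifold I ∞ X]
    (o : ∀ x : X, Orientation ℝ (TangentSpace I x) (Fin 2))
    (E₁ E₂ : ∀ y : X, TangentSpace I y) (U : Set X) : Prop where
  isOpen : IsOpen U
  s1 : ContMDiffOn I I.tangent ∞ (fun y => (⟨y, E₁ y⟩ : TangentBundle I X)) U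
  s2 : ContMDiffOn I I.tangent ∞ (fun y => (⟨y, E₂ y⟩ : TangentBundle I X)) U
  pos : ∀ y ∈ U, IsPositivePair I (o y) (E₁ y) (E₂ y)

variable [IsManifold I ∞ X]

lemma IsPositiveFields.mono {E₁ E₂ : ∀ y : X, TangentSpace I y}
    (h : IsPositiveFields I o E₁ E₂ U) (hU' : IsOpen U') (hs : U' ⊆ U) :
    IsPositiveFields I o E₁ E₂ U' :=
  ⟨hU', h.s1.mono hs, h.s2.mono hs, fun y hy => h.pos y (hs hy)⟩

lemma contMDiffOn_dform (hU : IsOpen U) {G Y : X → R23} (hG : ContMDiffOn I 𝓘(ℝ, R23) ∞ G U)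
    (hY : ContMDiffOn I 𝓘(ℝ, R23) ∞ Y U) {v : ∀ y : X, TangentSpace I y}
    (hv : ContMDiffOn I I.tangent ∞ (fun y => (⟨y, v y⟩ : TangentBundle I X)) U) :
    ContMDiffOn I 𝓘(ℝ, ℝ) ∞ (fun y => dform I G (Y y) y (v y)) U :=
  contMDiffOn_sp (contMDiffOn_mvfderiv_apply hU hG hv) hY

omit [IsManifold I ∞ X] in
lemma contMDiffOn_wedge {α β : ∀ x : X, TangentSpace I x → ℝ} {E₁ E₂ : ∀ y : X, TangentSpace I y}
    (h1 : ContMDiffOn I 𝓘(ℝ, ℝ) ∞ (fun y => α y (E₁ y)) U)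
    (h2 : ContMDiffOn I 𝓘(ℝ, ℝ) ∞ (fun y => α y (E₂ y)) U)
    (h3 : ContMDiffOn I 𝓘(ℝ, ℝ) ∞ (fun y => β y (E₁ y)) U)
    (h4 : ContMDiffOn I 𝓘(ℝ, ℝ) ∞ (fun y => β y (E₂ y)) U) :
    ContMDiffOn I 𝓘(ℝ, ℝ) ∞ (fun y => wedge I (α y) (β y) (E₁ y) (E₂ y)) U :=
  (contMDiffOn_mul h1 h4).sub (contMDiffOn_mul h2 h3)

variable [hE : Fact (Module.finrank ℝ E = 2)]

/-- Constant linear combinations of a positive local frame. -/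
lemma IsPositiveFields.comb {E₁ E₂ : ∀ y : X, TangentSpace I y} (h : IsPositiveFields I o E₁ E₂ U)
    {a b c d : ℝ} (hd : 0 < a * d - b * c) :
    IsPositiveFields I o (fun y => a • E₁ y + b • E₂ y) (fun y => c • E₁ y + d • E₂ y) U := by
  have hs : ∀ a b : ℝ, ContMDiffOn I I.tangent ∞
      (fun y => (⟨y, a • E₁ y + b • E₂ y⟩ : TangentBundle I X)) U := by
    intro a b
    have h1 := ContMDiffOn.const_smul_section (a := a) h.s1
    have h2 := ContMDiffOn.const_smul_section (a := b) h.s2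
    exact ContMDiffOn.add_section h1 h2
  refine ⟨h.isOpen, hs a b, hs c d, fun y hy => ?_⟩
  have hp := h.pos y hy
  obtain ⟨e, he1, he2, he⟩ := hp
  have hw : wedge I (e.coord 0) (e.coord 1) (E₁ y) (E₂ y) = 1 := by
    rw [← he1, ← he2]; simp [wedge]
  refine isPositivePair_of_wedge_pos (α := e.coord 0) (β := e.coord 1) (fun v w hvw => ?_) ?_
  · obtain ⟨t, ht, hw'⟩ := (h.pos y hy).exists_pos_wedge_eq hvw
    rw [hw', hw]; linarith
  · rw [wedge_smul_add, hw]; linarith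

/-- A positive local frame that is orthonormal at a given point. -/
lemma exists_positiveFields (ho : IsSurfaceOrientation I o) (hf : IsTimelikeImmersionOn I f univ)
    (x : X) : ∃ U E₁ E₂, IsPositiveFields I o E₁ E₂ U ∧ x ∈ U ∧
      inducedMetric I f x (E₁ x) (E₁ x) = -1 ∧ inducedMetric I f x (E₂ x) (E₂ x) = 1 ∧
      inducedMetric I f x (E₁ x) (E₂ x) = 0 ∧ 0 < minor (f x) (mvfderiv I f x (E₁ x)) := by
  obtain ⟨U, hU, hx, v, w, hv, hw, hvw⟩ := ho x
  have hF : IsPositiveFields I o v w U := ⟨hU, hv, hw, hvw⟩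
  obtain ⟨hfx, -, e₁, e₂, h1, h2, h3⟩ := hf.2 x (mem_univ x)
  have hd : ∀ y, MDifferentiableAt I 𝓘(ℝ, R23) f y := fun y =>
    (hf.1.contMDiffAt Filter.univ_mem).mdifferentiableAt (by simp)
  have hs : ∀ X Y, sp X Y = sp Y X := sp_comm
  have hff : sp (f x) (f x) = 0 := sp_eq_zero_of_norms hfx
  have hdf : ∀ u, sp (mvfderiv I f x u) (f x) = 0 := by
    intro u
    have := sp_mvfderiv_eq_neg (hd x) (hd x)
      (Filter.Eventually.of_forall fun y => sp_eq_zero_of_norms (hf.2 y (mem_univ y)).1) u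
    linarith
  unfold inducedMetric at h1 h2 h3
  -- the sign of `e₁` is determined by the time orientation
  have hm : minor (f x) (mvfderiv I f x e₁) ≠ 0 := by
    refine minor_ne_zero ?_ fun a b => ?_
    · rw [LinearIndependent.pair_iff]
      intro a b hab
      have hb := congrArg (sp · (mvfderiv I f x e₁)) hab
      simp only [sp_add_left, sp_smul_left, h1, hs (f x), hdf, sp_zero_left] at hb
      have hb0 : b = 0 := by linarith
      rw [hb0, zero_smul, add_zero] at hab
      exact ⟨(smul_eq_zero.mp hab).resolve_right (ne_zero_of_mem_einsteinUniverse hfx), hb0⟩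
    · simp only [sp_add_left, sp_smul_left, sp_add_right, sp_smul_right, h1, hdf,
        hs (f x) (mvfderiv I f x e₁), hff]
      nlinarith [mul_self_nonneg b]
  obtain ⟨s, hs1, hs2⟩ : ∃ s : ℝ, s * s = 1 ∧ 0 < s * minor (f x) (mvfderiv I f x e₁) := by
    rcases lt_or_gt_of_ne hm with h | h
    · exact ⟨-1, by norm_num, by linarith⟩
    · exact ⟨1, by norm_num, by linarith⟩
  obtain ⟨a, b, hab⟩ := (hvw x hx).exists_coeff e₁
  obtain ⟨c, d, hcd⟩ := (hvw x hx).exists_coeff e₂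
  have hD : a * d - b * c ≠ 0 := by
    intro h0
    have hk := wedge_smul_add (dform I f (mvfderiv I f x e₁) x) (dform I f (mvfderiv I f x e₂) x)
      a b c d (v x) (w x)
    rw [← hab, ← hcd, h0, zero_mul] at hk
    simp only [wedge, dform_apply, h1, h2, h3, hs (mvfderiv I f x e₂) (mvfderiv I f x e₁)] at hk
    norm_num at hk
  obtain ⟨t, ht1, ht2⟩ : ∃ t : ℝ, t * t = 1 ∧ 0 < t * (s * (a * d - b * c)) := by
    have hD' : s * (a * d - b * c) ≠ 0 := mul_ne_zero (left_ne_zero_of_mul_eq_one hs1) hD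
    rcases lt_or_gt_of_ne hD' with h | h
    · exact ⟨-1, by norm_num, by linarith⟩
    · exact ⟨1, by norm_num, by linarith⟩
  have e1 : (s * a) • v x + (s * b) • w x = s • e₁ := by rw [hab]; module
  have e2 : (t * c) • v x + (t * d) • w x = t • e₂ := by rw [hcd]; module
  refine ⟨U, fun y => (s * a) • v y + (s * b) • w y, fun y => (t * c) • v y + (t * d) • w y,
    hF.comb (by linarith), hx, ?_, ?_, ?_, ?_⟩
  · simp only [inducedMetric, e1, map_smul, sp_smul_left, sp_smul_right, h1]; linarith
  · simp only [inducedMetric, e2, map_smul, sp_smul_left, sp_smul_right, h2]; linarith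
  · simp only [inducedMetric, e1, e2, map_smul, sp_smul_left, sp_smul_right, h3]; ring
  · simp only [e1, map_smul]
    have := minor_smul_add 1 0 0 s (f x) (mvfderiv I f x e₁)
    simp only [one_smul, zero_smul, add_zero, zero_add] at this
    rw [this]; linarith

/-- Timelike immersions have first order frame fields with `P = f`. -/
lemma exists_isFirstOrder (ho : IsSurfaceOrientation I o) (hf : IsTimelikeImmersionOn I f univ)
    (x : X) : ∃ U E₁ E₂, IsPositiveFields I o E₁ E₂ U ∧ x ∈ U ∧
      ∃ Φ : NullField X, Φ.IsFirstOrder I f o U := by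
  obtain ⟨U, E₁, E₂, hF, hx, g11, g22, g12, hmin⟩ := exists_positiveFields ho hf x
  have hs : ∀ X Y, sp X Y = sp Y X := sp_comm
  have hfx := fun y => (hf.2 y (mem_univ y)).1
  have hd : ∀ y, MDifferentiableAt I 𝓘(ℝ, R23) f y := fun y =>
    (hf.1.contMDiffAt Filter.univ_mem).mdifferentiableAt (by simp)
  have hdf : ∀ y u, sp (f y) (mvfderiv I f y u) = 0 := by
    intro y u
    have := sp_mvfderiv_eq_neg (hd y) (hd y)
      (Filter.Eventually.of_forall fun y => sp_eq_zero_of_norms (hfx y)) u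
    rw [hs]
    linarith
  obtain ⟨Q₀, hQ₀⟩ : ∃ Q₀, sp Q₀ (f x) ≠ 0 := by
    by_contra! hcon
    exact ne_zero_of_mem_einsteinUniverse (hfx x)
      (eq_zero_of_forall_sp fun Y => by rw [hs]; exact hcon Y)
  set G₁ : X → R23 := fun y => mvfderiv I f y (E₁ y) with hG₁
  set G₂ : X → R23 := fun y => mvfderiv I f y (E₂ y) with hG₂
  have sf : ContMDiffOn I 𝓘(ℝ, R23) ∞ f U := hf.1.mono (subset_univ _)
  have sG₁ : ContMDiffOn I 𝓘(ℝ, R23) ∞ G₁ U := contMDiffOn_mvfderiv_apply hF.isOpen sf hF.s1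
  have sG₂ : ContMDiffOn I 𝓘(ℝ, R23) ∞ G₂ U := contMDiffOn_mvfderiv_apply hF.isOpen sf hF.s2
  -- the conditions that the Gram-Schmidt process needs are open: each one holds at `x`, hence on
  -- a smaller neighbourhood
  have shrink : ∀ {V : Set X} {a : X → ℝ}, IsOpen V → x ∈ V → ContMDiffOn I 𝓘(ℝ, ℝ) ∞ a V →
      0 < a x → ∃ V' ⊆ V, IsOpen V' ∧ x ∈ V' ∧ ∀ y ∈ V', 0 < a y := by
    intro V a hV hxV ha h0
    refine ⟨V ∩ a ⁻¹' Ioi 0, inter_subset_left, ha.continuousOn.isOpen_inter_preimage hV isOpen_Ioi,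
      ⟨hxV, h0⟩, fun y hy => hy.2⟩
  have sneg : ∀ {V : Set X} {a : X → ℝ}, ContMDiffOn I 𝓘(ℝ, ℝ) ∞ a V →
      ContMDiffOn I 𝓘(ℝ, ℝ) ∞ (fun y => -a y) V := fun h => h.neg
  -- `G₁` remains timelike near `x`, and can be normalized
  obtain ⟨U₁, hU₁, oU₁, hx₁, pos₁⟩ := shrink hF.isOpen hx (sneg (contMDiffOn_sp sG₁ sG₁))
    (by rw [show sp (G₁ x) (G₁ x) = -1 from g11]; norm_num)
  set F₁ : X → R23 := fun y => (√(-sp (G₁ y) (G₁ y)))⁻¹ • G₁ y with hF₁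
  have sF₁ : ContMDiffOn I 𝓘(ℝ, R23) ∞ F₁ U₁ :=
    contMDiffOn_smul (contMDiffOn_inv_sqrt ((sneg (contMDiffOn_sp sG₁ sG₁)).mono hU₁) pos₁)
      (sG₁.mono hU₁)
  set K : X → R23 := fun y => G₂ y + sp (G₂ y) (F₁ y) • F₁ y with hK
  have sK : ContMDiffOn I 𝓘(ℝ, R23) ∞ K U₁ :=
    (sG₂.mono hU₁).add (contMDiffOn_smul (contMDiffOn_sp (sG₂.mono hU₁) sF₁) sF₁)
  have hF₁x : F₁ x = G₁ x := by
    simp only [hF₁]; rw [show sp (G₁ x) (G₁ x) = -1 from g11]; simp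
  have hKx : K x = G₂ x := by
    simp only [hK]; rw [hF₁x, hs, show sp (G₁ x) (G₂ x) = 0 from g12]; simp
  -- the component `K` of `G₂` orthogonal to `F₁` remains spacelike near `x`
  obtain ⟨U₂, hU₂, oU₂, hx₂, pos₂⟩ := shrink oU₁ hx₁ (contMDiffOn_sp sK sK)
    (by rw [hKx, show sp (G₂ x) (G₂ x) = 1 from g22]; norm_num)
  set F₂ : X → R23 := fun y => (√(sp (K y) (K y)))⁻¹ • K y with hF₂
  have sF₂ : ContMDiffOn I 𝓘(ℝ, R23) ∞ F₂ U₂ :=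
    contMDiffOn_smul (contMDiffOn_inv_sqrt ((contMDiffOn_sp sK sK).mono hU₂) pos₂) (sK.mono hU₂)
  have hF₂x : F₂ x = G₂ x := by
    simp only [hF₂]; rw [hKx, show sp (G₂ x) (G₂ x) = 1 from g22]; simp
  set A : X → R23 := fun y => F₁ y - F₂ y with hA
  set B : X → R23 := fun y => F₁ y + F₂ y with hB
  have sA : ContMDiffOn I 𝓘(ℝ, R23) ∞ A U₂ := (sF₁.mono hU₂).sub sF₂
  have sB : ContMDiffOn I 𝓘(ℝ, R23) ∞ B U₂ := (sF₁.mono hU₂).add sF₂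
  -- the constant vector `Q₀` remains transversal to the orthogonal complement of `f`, and yields `Q`
  have sQ₀ : ContMDiffOn I 𝓘(ℝ, ℝ) ∞ (fun y => sp Q₀ (f y)) U :=
    contMDiffOn_sp contMDiffOn_const sf
  obtain ⟨U₃, hU₃, oU₃, hx₃, pos₃⟩ := shrink oU₂ hx₂
    (((contMDiffOn_mul sQ₀ sQ₀).mono (hU₂.trans hU₁))) (mul_self_pos.mpr hQ₀)
  have pos₃' : ∀ y ∈ U₃, sp Q₀ (f y) ≠ 0 := fun y hy => mul_self_pos.mp (pos₃ y hy)
  have i31 : U₃ ⊆ U₁ := hU₃.trans hU₂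
  have i3 : U₃ ⊆ U := i31.trans hU₁
  set q : X → R23 := fun y => (-sp Q₀ (f y))⁻¹ •
    (Q₀ + (1 / 2 * sp Q₀ (B y)) • A y + (1 / 2 * sp Q₀ (A y)) • B y) with hq
  have sq : ContMDiffOn I 𝓘(ℝ, R23) ∞ q U₃ := by
    have h1 : ContMDiffOn I 𝓘(ℝ, ℝ) ∞ (fun y => (-sp Q₀ (f y))⁻¹) U₃ :=
      ContMDiffOn.inv₀ (sneg (sQ₀.mono i3)) fun y hy => neg_ne_zero.mpr (pos₃' y hy)
    have c1 := contMDiffOn_sp (contMDiffOn_const (c := Q₀)) (sA.mono hU₃)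
    have c2 := contMDiffOn_sp (contMDiffOn_const (c := Q₀)) (sB.mono hU₃)
    exact contMDiffOn_smul h1 ((contMDiffOn_const.add
      (contMDiffOn_smul (contMDiffOn_mul contMDiffOn_const c2) (sA.mono hU₃))).add
      (contMDiffOn_smul (contMDiffOn_mul contMDiffOn_const c1) (sB.mono hU₃)))
  set Q : X → R23 := fun y => q y + (1 / 2 * sp (q y) (q y)) • f y with hQ
  have sQ : ContMDiffOn I 𝓘(ℝ, R23) ∞ Q U₃ :=
    sq.add (contMDiffOn_smul (contMDiffOn_mul contMDiffOn_const (contMDiffOn_sp sq sq))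
      (sf.mono i3))
  set N : X → R23 := fun y => normalVec (f y) (A y) (B y) (Q y) with hN
  have sN : ContMDiffOn I 𝓘(ℝ, R23) ∞ N U₃ :=
    contMDiffOn_normalVec (sf.mono i3) (sA.mono hU₃) (sB.mono hU₃) sQ
  have frame : ∀ y ∈ U₃, IsNullFrame (f y) (A y) (B y) (N y) (Q y) ∧
      0 < det5 (f y) (A y) (B y) (N y) (Q y) := fun y hy =>
    isNullFrame_gramSchmidt (sp_eq_zero_of_norms (hfx y)) (hdf y (E₁ y)) (hdf y (E₂ y))
      (by linarith [pos₁ y (i31 hy)]) rfl rfl (pos₂ y (hU₃ hy)) rfl rfl rfl (pos₃' y hy) rfl rfl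
  -- the frame keeps the time orientation that it has at `x`
  have smin : ContMDiffOn I 𝓘(ℝ, ℝ) ∞ (fun y => minor (f y) (G₁ y)) U :=
    (contMDiffOn_mul (contMDiffOn_sp sf contMDiffOn_const)
      (contMDiffOn_sp sG₁ contMDiffOn_const)).sub
      (contMDiffOn_mul (contMDiffOn_sp sf contMDiffOn_const) (contMDiffOn_sp sG₁ contMDiffOn_const))
  obtain ⟨U₄, hU₄, oU₄, hx₄, pos₄⟩ := shrink oU₃ hx₃ (smin.mono i3) hmin
  have i41 : U₄ ⊆ U₁ := hU₄.trans i31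
  -- and `⟨dP, B⟩ ∧ ⟨dP, A⟩` keeps its sign
  have swedge : ContMDiffOn I 𝓘(ℝ, ℝ) ∞
      (fun y => wedge I (dform I f (B y) y) (dform I f (A y) y) (E₁ y) (E₂ y)) U₂ := by
    have j : U₂ ⊆ U := hU₂.trans hU₁
    exact contMDiffOn_wedge (contMDiffOn_dform oU₂ (sf.mono j) sB (hF.s1.mono j))
      (contMDiffOn_dform oU₂ (sf.mono j) sB (hF.s2.mono j))
      (contMDiffOn_dform oU₂ (sf.mono j) sA (hF.s1.mono j))
      (contMDiffOn_dform oU₂ (sf.mono j) sA (hF.s2.mono j))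
  obtain ⟨U₅, hU₅, oU₅, hx₅, pos₅⟩ := shrink oU₄ hx₄ (swedge.mono (hU₄.trans hU₃)) (by
    change 0 < sp (G₁ x) (F₁ x + F₂ x) * sp (G₂ x) (F₁ x - F₂ x) -
      sp (G₂ x) (F₁ x + F₂ x) * sp (G₁ x) (F₁ x - F₂ x)
    rw [hF₁x, hF₂x]
    simp only [sp_add_right, sp_sub_right, show sp (G₁ x) (G₁ x) = -1 from g11,
      show sp (G₂ x) (G₂ x) = 1 from g22, show sp (G₁ x) (G₂ x) = 0 from g12, hs (G₂ x) (G₁ x)]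
    norm_num)
  have i53 : U₅ ⊆ U₃ := hU₅.trans hU₄
  refine ⟨U₅, E₁, E₂, hF.mono oU₅ (i53.trans i3), hx₅, ⟨f, A, B, N, Q⟩,
    ⟨⟨oU₅, sf.mono (i53.trans i3), sA.mono (i53.trans hU₃), sB.mono (i53.trans hU₃), sN.mono i53,
      sQ.mono i53, fun y hy => ?_, fun y _ => (ray_eq_self (hfx y)).symm⟩, ?_, ?_⟩⟩
  · obtain ⟨h1, h2⟩ := frame y (i53 hy)
    refine ⟨h1, h2, ?_⟩
    have h3 := pos₄ y (hU₅ hy)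
    by_contra h4
    have h5 := mt h1.minor_pos_iff.mp h4
    have h6 : G₁ y = √(-sp (G₁ y) (G₁ y)) • F₁ y := by
      rw [hF₁, smul_smul, mul_inv_cancel₀ (Real.sqrt_pos.mpr (pos₁ y (i31 (i53 hy)))).ne', one_smul]
    have h7 : F₁ y = (1 / 2 : ℝ) • A y + (1 / 2 : ℝ) • B y := by
      simp only [hA, hB]; module
    have h8 := minor_smul_add 1 0 0 (√(-sp (G₁ y) (G₁ y))) (f y) (F₁ y)
    simp only [one_smul, zero_smul, add_zero, zero_add] at h8
    rw [h6, h8, h7, minor_comb] at h3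
    simp only [not_lt] at h4 h5
    nlinarith [Real.sqrt_nonneg (-sp (G₁ y) (G₁ y))]
  · intro y hy u
    have hy1 := i31 (i53 hy)
    obtain ⟨h1, h2⟩ := frame y (i53 hy)
    obtain ⟨a, b, rfl⟩ := (hF.pos y (i3 (i53 hy))).exists_coeff u
    have hF₁N : sp (F₁ y) (N y) = 0 := by
      have h7 : F₁ y = (1 / 2 : ℝ) • A y + (1 / 2 : ℝ) • B y := by
        simp only [hA, hB]; module
      rw [h7, sp_add_left, sp_smul_left, sp_smul_left, h1.AN, h1.BN]; ring
    have hF₂N : sp (F₂ y) (N y) = 0 := by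
      have h7 : F₂ y = (1 / 2 : ℝ) • B y - (1 / 2 : ℝ) • A y := by
        simp only [hA, hB]; module
      rw [h7, sp_sub_left, sp_smul_left, sp_smul_left, h1.AN, h1.BN]; ring
    have hG₁N : sp (G₁ y) (N y) = 0 := by
      have h6 : G₁ y = √(-sp (G₁ y) (G₁ y)) • F₁ y := by
        rw [hF₁, smul_smul, mul_inv_cancel₀ (Real.sqrt_pos.mpr (pos₁ y hy1)).ne', one_smul]
      rw [h6, sp_smul_left, hF₁N, mul_zero]
    have hG₂N : sp (G₂ y) (N y) = 0 := by
      have h6 : K y = √(sp (K y) (K y)) • F₂ y := by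
        rw [hF₂, smul_smul, mul_inv_cancel₀ (Real.sqrt_pos.mpr (pos₂ y (hU₃ (i53 hy)))).ne',
          one_smul]
      have h8 : G₂ y = K y - sp (G₂ y) (F₁ y) • F₁ y := by simp only [hK]; module
      rw [h8, sp_sub_left, sp_smul_left, hF₁N, h6, sp_smul_left, hF₂N]; ring
    rw [map_add, map_smul, map_smul]
    change a * sp (G₁ y) (N y) + b * sp (G₂ y) (N y) = 0
    rw [hG₁N, hG₂N]; ring
  · intro y hy v w hvw
    obtain ⟨t, ht, hw⟩ := (hF.pos y (i3 (i53 hy))).exists_pos_wedge_eq hvw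
    rw [hw]
    exact mul_pos ht (pos₅ y hy)

end Existence

section Reduction

variable {E : Type*} [NormedAddCommGroup E] [NormedSpace ℝ E] {H : Type*} [TopologicalSpace H]
  {I : ModelWithCorners ℝ E H} {X : Type*} [TopologicalSpace X] [ChartedSpace H X]
  {f : X → R23} {o : ∀ x : X, Orientation ℝ (TangentSpace I x) (Fin 2)} {U U' : Set X}

/-! ### Changes of frame fields -/

/-- The frame field obtained by translating `A`, `B` and `N` along `P`. -/
def NullField.translate (Φ : NullField X) (a b n : X → ℝ) : NullField X where
  P := Φ.P
  A y := Φ.A y + a y • Φ.P y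
  B y := Φ.B y + b y • Φ.P y
  N y := Φ.N y + n y • Φ.P y
  Q y := Φ.Q y - (b y / 2) • Φ.A y - (a y / 2) • Φ.B y + n y • Φ.N y +
    ((n y ^ 2 - a y * b y) / 2) • Φ.P y

/-- The frame field obtained by rescaling `P`. -/
def NullField.scale (Φ : NullField X) (r : X → ℝ) : NullField X where
  P y := r y • Φ.P y
  A := Φ.A
  B := Φ.B
  N := Φ.N
  Q y := (r y)⁻¹ • Φ.Q y

lemma NullField.IsAlong.translate {Φ : NullField X} (h : Φ.IsAlong I f U) {a b n : X → ℝ}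
    (ha : ContMDiffOn I 𝓘(ℝ, ℝ) ∞ a U) (hb : ContMDiffOn I 𝓘(ℝ, ℝ) ∞ b U)
    (hn : ContMDiffOn I 𝓘(ℝ, ℝ) ∞ n U) : (Φ.translate a b n).IsAlong I f U := by
  have two : ContMDiffOn I 𝓘(ℝ, ℝ) ∞ (fun _ : X => (2 : ℝ)) U := contMDiffOn_const
  have hdiv : ∀ {c : X → ℝ}, ContMDiffOn I 𝓘(ℝ, ℝ) ∞ c U →
      ContMDiffOn I 𝓘(ℝ, ℝ) ∞ (fun y => c y / 2) U := fun hc =>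
    contMDiffOn_div hc two fun _ _ => two_ne_zero
  refine ⟨h.isOpen, h.sP, h.sA.add (contMDiffOn_smul ha h.sP), h.sB.add (contMDiffOn_smul hb h.sP),
    h.sN.add (contMDiffOn_smul hn h.sP), ?_, fun x hx => (h.oriented x hx).translate _ _ _,
    h.ray_eq⟩
  refine (((h.sQ.sub (contMDiffOn_smul (hdiv hb) h.sA)).sub
    (contMDiffOn_smul (hdiv ha) h.sB)).add (contMDiffOn_smul hn h.sN)).add
    (contMDiffOn_smul (hdiv ?_) h.sP)
  simp only [pow_two]
  exact (contMDiffOn_mul hn hn).sub (contMDiffOn_mul ha hb)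

lemma NullField.IsAlong.scale {Φ : NullField X} (h : Φ.IsAlong I f U) {r : X → ℝ}
    (hr : ContMDiffOn I 𝓘(ℝ, ℝ) ∞ r U) (hpos : ∀ x ∈ U, 0 < r x) :
    (Φ.scale r).IsAlong I f U := by
  refine ⟨h.isOpen, contMDiffOn_smul hr h.sP, h.sA, h.sB, h.sN,
    contMDiffOn_smul (hr.inv₀ fun x hx => (hpos x hx).ne') h.sQ,
    fun x hx => (h.oriented x hx).scale (hpos x hx), fun x hx => ?_⟩
  rw [h.ray_eq x hx]
  exact (ray_smul (hpos x hx) _).symm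

lemma mdifferentiableAt_of_contMDiffOn {V : Type*} [NormedAddCommGroup V] [NormedSpace ℝ V]
    {g : X → V} (hU : IsOpen U) (hg : ContMDiffOn I 𝓘(ℝ, V) ∞ g U) {x : X} (hx : x ∈ U) :
    MDifferentiableAt I 𝓘(ℝ, V) g x :=
  (hg.contMDiffAt (hU.mem_nhds hx)).mdifferentiableAt (by simp)

lemma NullField.dform_scale {Φ : NullField X} (h : Φ.IsAlong I f U) {r : X → ℝ}
    (hr : ContMDiffOn I 𝓘(ℝ, ℝ) ∞ r U) {x : X} (hx : x ∈ U) {Y : R23}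
    (hY : sp (Φ.P x) Y = 0) (v : TangentSpace I x) :
    dform I (Φ.scale r).P Y x v = r x * dform I Φ.P Y x v := by
  rw [dform_smul_of_eventuallyEq (G' := (Φ.scale r).P)
    (mdifferentiableAt_of_contMDiffOn h.isOpen hr hx)
    (h.mdiff hx).1 (.of_forall fun y => rfl), hY, mul_zero, add_zero]

/-- The derivative of `f` in terms of a frame field along `f`. -/
lemma NullField.IsAlong.exists_mvfderiv {Φ : NullField X} (h : Φ.IsAlong I f U) {x : X}
    (hx : x ∈ U) : ∃ ρ : ℝ, 0 < ρ ∧ f x = ρ • Φ.P x ∧ ∀ v : TangentSpace I x, ∃ s : ℝ,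
      mvfderiv I f x v = ρ • mvfderiv I Φ.P x v + s • Φ.P x := by
  have hpos : ∀ y ∈ U, 0 < posNormSq (Φ.P y) := fun y hy =>
    posNormSq_pos (h.oriented y hy).1.P_ne (h.oriented y hy).1.PP
  have hsm : ContMDiffOn I 𝓘(ℝ, ℝ) ∞ (fun y => (√(posNormSq (Φ.P y)))⁻¹) U := by
    refine contMDiffOn_inv_sqrt ?_ hpos
    simp only [posNormSq, pow_two]
    have hc := fun c : R23 => contMDiffOn_sp h.sP (contMDiffOn_const (c := c))
    exact ((contMDiffOn_mul (hc _) (hc _)).add (contMDiffOn_mul (hc _) (hc _))).add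
      (contMDiffOn_mul (hc _) (hc _))
  refine ⟨_, inv_pos.mpr (Real.sqrt_pos.mpr (hpos x hx)), h.ray_eq x hx, fun v =>
    ⟨mvfderiv I (fun y => (√(posNormSq (Φ.P y)))⁻¹) x v, ?_⟩⟩
  rw [← mvfderiv_smul_apply (mdifferentiableAt_of_contMDiffOn h.isOpen hsm hx) (h.mdiff hx).1]
  rw [mvfderiv_congr (I := I) (Filter.eventually_of_mem (h.isOpen.mem_nhds hx) h.ray_eq)]
  rfl

lemma NullField.IsFirstOrder.mvfderiv_P {Φ : NullField X} (h : Φ.IsFirstOrder I f o U) {x : X}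
    (hx : x ∈ U) (v : TangentSpace I x) :
    mvfderiv I Φ.P x v = (-dform I Φ.P (Φ.Q x) x v) • Φ.P x -
      (1 / 2 * dform I Φ.P (Φ.B x) x v) • Φ.A x - (1 / 2 * dform I Φ.P (Φ.A x) x v) • Φ.B x := by
  have h1 := h.dP_N x hx v
  have h2 := (h.dform_relations hx v).1
  have h3 := (h.oriented x hx).1.expand (mvfderiv I Φ.P x v)
  rw [dform_apply] at h1 h2
  rw [h1, h2, zero_smul, zero_smul, sub_zero, add_zero] at h3
  exact h3

lemma NullField.IsFirstOrder.mvfderiv_N {Φ : NullField X} (h : Φ.IsFirstOrder I f o U) {x : X}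
    (hx : x ∈ U) (v : TangentSpace I x) :
    mvfderiv I Φ.N x v = (-dform I Φ.N (Φ.Q x) x v) • Φ.P x -
      (1 / 2 * dform I Φ.N (Φ.B x) x v) • Φ.A x - (1 / 2 * dform I Φ.N (Φ.A x) x v) • Φ.B x := by
  have h1 := (h.dform_relations hx v).2.2.2.2.2.2.2.1
  have h2 := (h.dform_relations hx v).2.2.2.1
  have h3 := (h.oriented x hx).1.expand (mvfderiv I Φ.N x v)
  rw [h.dP_N x hx v, neg_zero] at h1
  rw [dform_apply] at h1 h2
  rw [h1, h2, zero_smul, zero_smul, sub_zero, add_zero] at h3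
  exact h3

/-! ### Null pairs and helicity -/

/-- The null pairs of a quasi-umbilical point, in terms of a frame with `dN` proportional to `A`
modulo `P`. -/
lemma isNullPair_iff {x : X} {P A B : R23} {a b : TangentSpace I x →ₗ[ℝ] ℝ} {ρ β : ℝ}
    (PP : sp P P = 0) (PA : sp P A = 0) (PB : sp P B = 0) (AA : sp A A = 0) (AB : sp A B = -2)
    (BB : sp B B = 0) (hρ : ρ ≠ 0) (hβ : β ≠ 0) (hfx : f x = ρ • P)
    (hdf : ∀ v, ∃ s : ℝ, mvfderiv I f x v = s • P - (ρ / 2 * b v) • A - (ρ / 2 * a v) • B)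
    (hdN : ∀ v, ∃ s : ℝ, mvfderiv I (gaussMap I f o) x v = s • P - (β / 2 * a v) • A)
    (V V' : TangentSpace I x) :
    (IsNullPair I f o x V V' ↔ a V = 0 ∧ b V' = 0 ∧ ρ ^ 2 * (b V * a V') = 2) ∧
      sp (mvfderiv I (gaussMap I f o) x V') (mvfderiv I f x V') = -(β * ρ / 2) * a V' ^ 2 := by
  have hs : ∀ X Y, sp X Y = sp Y X := sp_comm
  have hg : ∀ v w, inducedMetric I f x v w = -(ρ ^ 2 / 2) * (a v * b w + b v * a w) := by
    intro v w
    obtain ⟨s, hs1⟩ := hdf v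
    obtain ⟨t, ht⟩ := hdf w
    rw [inducedMetric, hs1, ht]
    simp only [sp_sub_left, sp_sub_right, sp_smul_left, sp_smul_right, PP, PA, PB, AA, AB, BB,
      hs A P, hs B P, hs B A]
    ring
  refine ⟨⟨?_, ?_⟩, ?_⟩
  · rintro ⟨-, ⟨u, c, hu⟩, h1, h2⟩
    have haV : a V = 0 := by
      obtain ⟨s, hs1⟩ := hdf V
      obtain ⟨t, ht⟩ := hdN u
      rw [hs1, ht, hfx] at hu
      have := congrArg (sp A) hu
      simp only [sp_sub_right, sp_add_right, sp_smul_right, AA, AB, hs A P, PA] at this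
      have h3 : ρ * a V = 0 := by linarith
      exact (mul_eq_zero.mp h3).resolve_left hρ
    rw [hg] at h1 h2
    rw [haV] at h2
    have h4 : ρ ^ 2 * (b V * a V') = 2 := by linarith
    have haV' : a V' ≠ 0 := by
      intro h0
      rw [h0] at h4
      norm_num at h4
    refine ⟨haV, ?_, h4⟩
    have h5 : (ρ ^ 2 * a V') * b V' = 0 := by linarith
    exact (mul_eq_zero.mp h5).resolve_left (by positivity)
  · rintro ⟨h1, h2, h3⟩
    have haV' : a V' ≠ 0 := by
      intro h0
      rw [h0] at h3
      norm_num at h3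
    refine ⟨?_, ?_, ?_, ?_⟩
    · rintro rfl
      simp at h3
    · obtain ⟨s, hs1⟩ := hdf V
      obtain ⟨t, ht⟩ := hdN ((ρ * b V / (β * a V')) • V')
      refine ⟨(ρ * b V / (β * a V')) • V', (t - s) / ρ, ?_⟩
      · rw [ht, hs1, hfx, h1, map_smul, smul_eq_mul, smul_smul, div_mul_cancel₀ _ hρ]
        have : β / 2 * (ρ * b V / (β * a V') * a V') = ρ / 2 * b V := by
          field_simp
        rw [this]
        module
    · rw [hg, h2]; ring
    · rw [hg, h1]; linarith
  · obtain ⟨s, hs1⟩ := hdf V'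
    obtain ⟨t, ht⟩ := hdN V'
    rw [hs1, ht]
    simp only [sp_sub_left, sp_sub_right, sp_smul_left, sp_smul_right, PP, PA, PB, AA, AB,
      hs A P]
    ring

variable [hE : Fact (Module.finrank ℝ E = 2)]

omit hE in
/-- Two independent covectors on a plane take arbitrary values. -/
lemma exists_covector_values {x : X} {α β : TangentSpace I x →ₗ[ℝ] ℝ} {v w : TangentSpace I x}
    (h : wedge I α β v w ≠ 0) (s t : ℝ) : ∃ u, α u = s ∧ β u = t := by
  unfold wedge at h
  refine ⟨((s * β w - t * α w) / (α v * β w - α w * β v)) • v +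
    ((t * α v - s * β v) / (α v * β w - α w * β v)) • w, ?_, ?_⟩ <;>
  · simp only [map_add, map_smul, smul_eq_mul]
    rw [div_mul_eq_mul_div, div_mul_eq_mul_div, ← add_div, div_eq_iff h]
    ring

variable [IsManifold I ∞ X]

omit hE in
/-- A smooth covector field that is proportional to `⟨dP, A⟩` is a smooth multiple of it. -/
lemma NullField.IsFirstOrder.exists_coeff {Φ : NullField X} (h : Φ.IsFirstOrder I f o U)
    {E₁ E₂ : ∀ y : X, TangentSpace I y} (hF : IsPositiveFields I o E₁ E₂ U)
    {α : ∀ x : X, TangentSpace I x →ₗ[ℝ] ℝ}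
    (h1 : ContMDiffOn I 𝓘(ℝ, ℝ) ∞ (fun y => α y (E₁ y)) U)
    (h2 : ContMDiffOn I 𝓘(ℝ, ℝ) ∞ (fun y => α y (E₂ y)) U)
    (hα : ∀ x ∈ U, ∀ v w, wedge I (α x) (dform I Φ.P (Φ.A x) x) v w = 0) :
    ∃ c : X → ℝ, ContMDiffOn I 𝓘(ℝ, ℝ) ∞ c U ∧
      ∀ x ∈ U, ∀ v, α x v = c x * dform I Φ.P (Φ.A x) x v := by
  have hne : ∀ y ∈ U, wedge I (dform I Φ.P (Φ.B y) y) (dform I Φ.P (Φ.A y) y) (E₁ y) (E₂ y) ≠ 0 :=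
    fun y hy => (h.wedge_pos y hy _ _ (hF.pos y hy)).ne'
  have hB1 := contMDiffOn_dform h.isOpen h.sP h.sB hF.s1
  have hB2 := contMDiffOn_dform h.isOpen h.sP h.sB hF.s2
  have hA1 := contMDiffOn_dform h.isOpen h.sP h.sA hF.s1
  have hA2 := contMDiffOn_dform h.isOpen h.sP h.sA hF.s2
  refine ⟨fun y => wedge I (dform I Φ.P (Φ.B y) y) (α y) (E₁ y) (E₂ y) /
    wedge I (dform I Φ.P (Φ.B y) y) (dform I Φ.P (Φ.A y) y) (E₁ y) (E₂ y),
    contMDiffOn_div (contMDiffOn_wedge hB1 hB2 h1 h2) (contMDiffOn_wedge hB1 hB2 hA1 hA2) hne,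
    fun x hx v => ?_⟩
  have h3 := hne x hx
  obtain ⟨s, t, rfl⟩ := (hF.pos x hx).exists_coeff v
  have h4 := hα x hx (E₁ x) (E₂ x)
  simp only [wedge] at h3 h4 ⊢
  rw [div_mul_eq_mul_div, eq_div_iff h3]
  simp only [map_add, map_smul, smul_eq_mul]
  linear_combination (s * dform I Φ.P (Φ.B x) x (E₁ x) + t * dform I Φ.P (Φ.B x) x (E₂ x)) * h4

/-- Timelike immersions have second order frame fields. -/
theorem exists_isSecondOrder (ho : IsSurfaceOrientation I o) (hf : IsTimelikeImmersionOn I f univ)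
    (x : X) : ∃ U E₁ E₂, IsPositiveFields I o E₁ E₂ U ∧ x ∈ U ∧
      ∃ Φ : NullField X, Φ.IsSecondOrder I f o U := by
  obtain ⟨U, E₁, E₂, hF, hx, Φ, h⟩ := exists_isFirstOrder ho hf x
  refine ⟨U, E₁, E₂, hF, hx, ?_⟩
  have hU := h.isOpen
  have hB1 := contMDiffOn_dform hU h.sP h.sB hF.s1
  have hB2 := contMDiffOn_dform hU h.sP h.sB hF.s2
  have hA1 := contMDiffOn_dform hU h.sP h.sA hF.s1
  have hA2 := contMDiffOn_dform hU h.sP h.sA hF.s2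
  have nB1 := contMDiffOn_dform hU h.sN h.sB hF.s1
  have nB2 := contMDiffOn_dform hU h.sN h.sB hF.s2
  have nA1 := contMDiffOn_dform hU h.sN h.sA hF.s1
  have nA2 := contMDiffOn_dform hU h.sN h.sA hF.s2
  have hpos := fun y hy => h.wedge_pos y hy _ _ (hF.pos y hy)
  -- the translation of `N` that makes the second fundamental form traceless
  set c : X → ℝ := fun y =>
    (wedge I (dform I Φ.N (Φ.A y) y) (dform I Φ.P (Φ.B y) y) (E₁ y) (E₂ y) -
      wedge I (dform I Φ.N (Φ.B y) y) (dform I Φ.P (Φ.A y) y) (E₁ y) (E₂ y)) /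
    (2 * wedge I (dform I Φ.P (Φ.B y) y) (dform I Φ.P (Φ.A y) y) (E₁ y) (E₂ y)) with hc
  have sc : ContMDiffOn I 𝓘(ℝ, ℝ) ∞ c U :=
    contMDiffOn_div ((contMDiffOn_wedge nA1 nA2 hB1 hB2).sub (contMDiffOn_wedge nB1 nB2 hA1 hA2))
      (contMDiffOn_mul contMDiffOn_const (contMDiffOn_wedge hB1 hB2 hA1 hA2)) fun y hy =>
      (mul_pos two_pos (hpos y hy)).ne'
  have s0 : ContMDiffOn I 𝓘(ℝ, ℝ) ∞ (fun _ : X => (0 : ℝ)) U := contMDiffOn_const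
  refine ⟨Φ.translate (fun _ => 0) (fun _ => 0) c, ⟨⟨h.toIsAlong.translate s0 s0 sc, ?_, ?_⟩, ?_⟩⟩
  · intro y hy v
    change dform I Φ.P (Φ.N y + c y • Φ.P y) y v = 0
    rw [dform_add_right, dform_smul_right, h.dP_N y hy, (h.dform_relations hy v).1]; ring
  · intro y hy v w hvw
    change 0 < wedge I (dform I Φ.P (Φ.B y + (0 : ℝ) • Φ.P y) y)
      (dform I Φ.P (Φ.A y + (0 : ℝ) • Φ.P y) y) v w
    simp only [zero_smul, add_zero]
    exact h.wedge_pos y hy v w hvw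
  · intro y hy v w
    change wedge I (dform I (Φ.translate (fun _ => 0) (fun _ => 0) c).N (Φ.A y + (0 : ℝ) • Φ.P y) y)
      (dform I Φ.P (Φ.B y + (0 : ℝ) • Φ.P y) y) v w =
      wedge I (dform I (Φ.translate (fun _ => 0) (fun _ => 0) c).N (Φ.B y + (0 : ℝ) • Φ.P y) y)
      (dform I Φ.P (Φ.A y + (0 : ℝ) • Φ.P y) y) v w
    simp only [zero_smul, add_zero]
    have hn := (h.oriented y hy).1
    have hN : ∀ Y, sp (Φ.P y) Y = 0 → ∀ v, dform I (Φ.translate (fun _ => 0)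
      (fun _ => 0) c).N Y y v =
        dform I Φ.N Y y v + c y * dform I Φ.P Y y v := by
      intro Y hY v
      rw [dform_add_smul_of_eventuallyEq (G' := (Φ.translate (fun _ => 0) (fun _ => 0) c).N)
        (h.mdiff hy).2.2.2.1
        (mdifferentiableAt_of_contMDiffOn hU sc hy) (h.mdiff hy).1 (.of_forall fun y => rfl), hY]
      ring
    obtain ⟨d, hd⟩ := (hF.pos y hy).exists_wedge_eq v w
    have e1 : wedge I (dform I (Φ.translate (fun _ => 0) (fun _ => 0) c).N (Φ.A y) y)
        (dform I Φ.P (Φ.B y) y) v w = wedge I (dform I Φ.N (Φ.A y) y) (dform I Φ.P (Φ.B y) y) v w -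
          c y * wedge I (dform I Φ.P (Φ.B y) y) (dform I Φ.P (Φ.A y) y) v w := by
      simp only [wedge, hN _ hn.PA]; ring
    have e2 : wedge I (dform I (Φ.translate (fun _ => 0) (fun _ => 0) c).N (Φ.B y) y)
        (dform I Φ.P (Φ.A y) y) v w = wedge I (dform I Φ.N (Φ.B y) y) (dform I Φ.P (Φ.A y) y) v w +
          c y * wedge I (dform I Φ.P (Φ.B y) y) (dform I Φ.P (Φ.A y) y) v w := by
      simp only [wedge, hN _ hn.PB]; ring
    rw [e1, e2, hd, hd, hd]
    have hp := (hpos y hy).ne'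
    have hcy : c y * (2 * wedge I (dform I Φ.P (Φ.B y) y) (dform I Φ.P (Φ.A y) y) (E₁ y) (E₂ y)) =
      wedge I (dform I Φ.N (Φ.A y) y) (dform I Φ.P (Φ.B y) y) (E₁ y) (E₂ y) -
      wedge I (dform I Φ.N (Φ.B y) y) (dform I Φ.P (Φ.A y) y) (E₁ y) (E₂ y) :=
      div_mul_cancel₀ _ (by positivity)
    linear_combination -d * hcy

omit [IsManifold I ∞ X] in
/-- The null pairs of an adapted frame field. -/
lemma NullField.IsAdapted.isNullPair_iff {Φ : NullField X} {ε : ℝ} (hε : ε ≠ 0)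
    (h : Φ.IsAdapted I f o ε U) {x : X} (hx : x ∈ U) : ∃ ρ : ℝ, 0 < ρ ∧
      ∀ V V' : TangentSpace I x, (IsNullPair I f o x V V' ↔ dform I Φ.P (Φ.A x) x V = 0 ∧
        dform I Φ.P (Φ.B x) x V' = 0 ∧
        ρ ^ 2 * (dform I Φ.P (Φ.B x) x V * dform I Φ.P (Φ.A x) x V') = 2) ∧
      sp (mvfderiv I (gaussMap I f o) x V') (mvfderiv I f x V') =
        -(2 * ε * ρ / 2) * dform I Φ.P (Φ.A x) x V' ^ 2 := by
  have hn := (h.oriented x hx).1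
  obtain ⟨ρ, hρ, hfx, hdf⟩ := h.exists_mvfderiv hx
  refine ⟨ρ, hρ, fun V V' => Einstein.isNullPair_iff hn.PP hn.PA hn.PB hn.AA hn.AB hn.BB hρ.ne'
    (mul_ne_zero two_ne_zero hε) hfx (fun v => ?_) (fun v => ?_) V V'⟩
  · obtain ⟨s, hs⟩ := hdf v
    refine ⟨s - ρ * dform I Φ.P (Φ.Q x) x v, ?_⟩
    rw [hs, h.mvfderiv_P hx]
    module
  · refine ⟨0, ?_⟩
    rw [mvfderiv_congr (I := I) (Filter.eventually_of_mem (h.isOpen.mem_nhds hx)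
      fun y hy => h.gaussMap_eq hy), h.mvfderiv_N hx, h.dN_A x hx, h.dN_B x hx, h.dN_Q x hx]
    module

omit [IsManifold I ∞ X] in
lemma NullField.IsAdapted.isPositivePair {Φ : NullField X} {ε : ℝ} (hε : ε ≠ 0)
    (h : Φ.IsAdapted I f o ε U) {x : X} (hx : x ∈ U) {V V' : TangentSpace I x}
    (hV : IsNullPair I f o x V V') : IsPositivePair I (o x) V V' := by
  obtain ⟨ρ, hρ, hiff⟩ := h.isNullPair_iff hε hx
  obtain ⟨h1, h2, h3⟩ := (hiff V V').1.mp hV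
  refine isPositivePair_of_wedge_pos (h.wedge_pos x hx) ?_
  rw [wedge, h1, h2]
  have : 0 < ρ ^ 2 * (dform I Φ.P (Φ.B x) x V * dform I Φ.P (Φ.A x) x V') := by linarith
  have := pos_of_mul_pos_right this (by positivity)
  linarith

omit [IsManifold I ∞ X] in
lemma NullField.IsAdapted.sign_eq {Φ : NullField X} {ε : ℝ} (hε : ε = 1 ∨ ε = -1)
    (h : Φ.IsAdapted I f o ε U) {x : X} (hx : x ∈ U) {V V' : TangentSpace I x}
    (hV : IsNullPair I f o x V V') :
    Real.sign (-sp (mvfderiv I (gaussMap I f o) x V') (mvfderiv I f x V')) = ε := by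
  have hε0 : ε ≠ 0 := by rcases hε with rfl | rfl <;> norm_num
  obtain ⟨ρ, hρ, hiff⟩ := h.isNullPair_iff hε0 hx
  obtain ⟨h1, h2, h3⟩ := (hiff V V').1.mp hV
  have ha : dform I Φ.P (Φ.A x) x V' ≠ 0 := by
    intro h0
    rw [h0] at h3
    norm_num at h3
  rw [(hiff V V').2]
  have hpos : 0 < ρ * dform I Φ.P (Φ.A x) x V' ^ 2 := by positivity
  rcases hε with rfl | rfl
  · exact Real.sign_of_pos (by linarith)
  · exact Real.sign_of_neg (by linarith)

omit [IsManifold I ∞ X] in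
lemma NullField.IsAdapted.isQuasiUmbilicPoint {Φ : NullField X} {ε : ℝ} (hε : ε ≠ 0)
    (h : Φ.IsAdapted I f o ε U) {x : X} (hx : x ∈ U) : IsQuasiUmbilicPoint I f o x := by
  have hn := (h.oriented x hx).1
  have hdN : ∀ v, mvfderiv I (gaussMap I f o) x v = (-(ε * dform I Φ.P (Φ.A x) x v)) • Φ.A x := by
    intro v
    rw [mvfderiv_congr (I := I) (Filter.eventually_of_mem (h.isOpen.mem_nhds hx)
      fun y hy => h.gaussMap_eq hy), h.mvfderiv_N hx, h.dN_A x hx, h.dN_B x hx, h.dN_Q x hx]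
    module
  refine ⟨fun v w => ?_, fun hcon => ?_⟩
  · rw [hdN, hdN, sp_smul_left, sp_smul_right, hn.AA]; ring
  · obtain ⟨v₀, w₀, hvw⟩ := exists_isPositivePair (o x)
    have hpos := h.wedge_pos x hx v₀ w₀ hvw
    obtain ⟨v, hv⟩ : ∃ v, dform I Φ.P (Φ.A x) x v ≠ 0 := by
      by_contra! hcon
      simp [wedge, hcon] at hpos
    refine hcon v ?_
    obtain ⟨ρ, hρ, hfx, -⟩ := h.exists_mvfderiv hx
    rw [hdN, hfx, LinearIndependent.pair_iff]
    intro s t hst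
    have h1 := congrArg (sp · (Φ.Q x)) hst
    have h2 := congrArg (sp · (Φ.B x)) hst
    simp only [sp_add_left, sp_smul_left, hn.PQ, hn.AQ, hn.PB, hn.AB, sp_zero_left] at h1 h2
    have h3 : s * ρ = 0 := by linarith
    have h4 : t * (ε * dform I Φ.P (Φ.A x) x v) = 0 := by linarith
    exact ⟨(mul_eq_zero.mp h3).resolve_right hρ.ne',
      (mul_eq_zero.mp h4).resolve_right (mul_ne_zero hε hv)⟩

end Reduction

section Adapted

variable {E : Type*} [NormedAddCommGroup E] [NormedSpace ℝ E] {H : Type*} [TopologicalSpace H]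
  {I : ModelWithCorners ℝ E H} {X : Type*} [TopologicalSpace X] [ChartedSpace H X]
  {f : X → R23} {o : ∀ x : X, Orientation ℝ (TangentSpace I x) (Fin 2)} {U U' : Set X}

/-! ### Existence of adapted frame fields -/

section Moves

variable [hE : Fact (Module.finrank ℝ E = 2)]

omit hE in
lemma exists_coeff_of_wedge_eq_zero {x : X} {α β γ : TangentSpace I x →ₗ[ℝ] ℝ}
    {v₀ w₀ : TangentSpace I x} (h : wedge I γ β v₀ w₀ ≠ 0)
    (hα : ∀ v w, wedge I α β v w = 0) : ∃ c : ℝ, ∀ v, α v = c * β v := by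
  obtain ⟨u, -, hu⟩ := exists_covector_values h 0 1
  refine ⟨α u, fun v => ?_⟩
  have := hα v u
  rw [wedge, hu] at this
  linarith

omit [TopologicalSpace X] in
omit hE in
lemma NullField.translate_N (Φ : NullField X) (a b : X → ℝ) :
    (Φ.translate a b fun _ => 0).N = Φ.N := by
  funext y
  simp [translate]

omit hE in
lemma NullField.IsSecondOrder.translate {Φ : NullField X} (h : Φ.IsSecondOrder I f o U)
    {a b : X → ℝ} (ha : ContMDiffOn I 𝓘(ℝ, ℝ) ∞ a U) (hb : ContMDiffOn I 𝓘(ℝ, ℝ) ∞ b U) :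
    (Φ.translate a b fun _ => 0).IsSecondOrder I f o U := by
  have hA : ∀ y ∈ U, ∀ (c : ℝ) Y v, dform I Φ.P (Y + c • Φ.P y) y v = dform I Φ.P Y y v := by
    intro y hy c Y v
    rw [dform_add_right, dform_smul_right, (h.dform_relations hy v).1]; ring
  have hN : ∀ y ∈ U, ∀ (c : ℝ) Y v, dform I Φ.N (Y + c • Φ.P y) y v = dform I Φ.N Y y v := by
    intro y hy c Y v
    rw [dform_add_right, dform_smul_right, (h.dform_relations hy v).2.2.2.2.2.2.2.1, h.dP_N y hy]
    ring
  refine ⟨⟨h.toIsAlong.translate ha hb contMDiffOn_const, ?_, ?_⟩, ?_⟩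
  · intro y hy v
    rw [translate_N]
    exact h.dP_N y hy v
  · intro y hy v w hvw
    change 0 < wedge I (dform I Φ.P (Φ.B y + _ • Φ.P y) y) (dform I Φ.P (Φ.A y + _ • Φ.P y) y) v w
    simp only [wedge, hA y hy]
    exact h.wedge_pos y hy v w hvw
  · intro y hy v w
    rw [translate_N]
    change wedge I (dform I Φ.N (Φ.A y + _ • Φ.P y) y) (dform I Φ.P (Φ.B y + _ • Φ.P y) y) v w =
      wedge I (dform I Φ.N (Φ.B y + _ • Φ.P y) y) (dform I Φ.P (Φ.A y + _ • Φ.P y) y) v w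
    simp only [wedge, hA y hy, hN y hy]
    exact h.trace y hy v w

omit hE in
lemma NullField.IsSecondOrder.scale {Φ : NullField X} (h : Φ.IsSecondOrder I f o U)
    {r : X → ℝ} (hr : ContMDiffOn I 𝓘(ℝ, ℝ) ∞ r U) (hpos : ∀ x ∈ U, 0 < r x) :
    (Φ.scale r).IsSecondOrder I f o U := by
  have hP : ∀ y ∈ U, ∀ Y, sp (Φ.P y) Y = 0 → ∀ v,
      dform I (Φ.scale r).P Y y v = r y * dform I Φ.P Y y v := fun y hy Y hY v =>
    NullField.dform_scale h.toIsAlong hr hy hY v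
  refine ⟨⟨h.toIsAlong.scale hr hpos, ?_, ?_⟩, ?_⟩
  · intro y hy v
    rw [hP y hy]
    · exact mul_eq_zero_of_right _ (h.dP_N y hy v)
    · exact (h.oriented y hy).1.PN
  · intro y hy v w hvw
    have h1 := hP y hy _ (h.oriented y hy).1.PA
    have h2 := hP y hy _ (h.oriented y hy).1.PB
    change 0 < wedge I (dform I (Φ.scale r).P (Φ.B y) y) (dform I (Φ.scale r).P (Φ.A y) y) v w
    have h3 := h.wedge_pos y hy v w hvw
    have h4 : wedge I (dform I (Φ.scale r).P (Φ.B y) y) (dform I (Φ.scale r).P (Φ.A y) y) v w =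
        r y ^ 2 * wedge I (dform I Φ.P (Φ.B y) y) (dform I Φ.P (Φ.A y) y) v w := by
      simp only [wedge, h1, h2]; ring
    rw [h4]
    have := hpos y hy
    positivity
  · intro y hy v w
    have h1 := hP y hy _ (h.oriented y hy).1.PA
    have h2 := hP y hy _ (h.oriented y hy).1.PB
    change wedge I (dform I Φ.N (Φ.A y) y) (dform I (Φ.scale r).P (Φ.B y) y) v w =
      wedge I (dform I Φ.N (Φ.B y) y) (dform I (Φ.scale r).P (Φ.A y) y) v w
    have h3 := h.trace y hy v w
    simp only [wedge, h1, h2] at h3 ⊢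
    linear_combination r y * h3

end Moves

variable [hE : Fact (Module.finrank ℝ E = 2)] [I.Boundaryless] [IsManifold I ∞ X]

omit hE in
/-- `d² = 0` for a single vanishing form `⟨N, dG⟩`. -/
lemma symm_of_dform_eq_zero {N G : X → R23} (hU : IsOpen U)
    (hN : ContMDiffOn I 𝓘(ℝ, R23) ∞ N U) (hG : ContMDiffOn I 𝓘(ℝ, R23) ∞ G U)
    (h : ∀ y ∈ U, ∀ v, dform I G (N y) y v = 0) {x : X} (hx : x ∈ U) (v w : TangentSpace I x) :
    sp (mvfderiv I N x v) (mvfderiv I G x w) = sp (mvfderiv I N x w) (mvfderiv I G x v) := by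
  have h0 : ContMDiffOn I 𝓘(ℝ, R23) ∞ (fun _ : X => (0 : R23)) U := contMDiffOn_const
  have := symm_of_sp_mvfderiv_eq_zero hU hN hG h0 hG (fun y hy v => by
    have := h y hy v
    rw [dform_apply, sp_comm] at this
    rw [this, sp_zero_left, add_zero]) hx v w
  rw [mvfderiv_const] at this
  simpa [sp_zero_left] using this

/-- At a quasi-umbilical point, `dN` is proportional to `A` modulo `P` for the canonical
orientation, and the helicity is the sign of the factor. -/
lemma NullField.IsSecondOrder.exists_quasiUmbilic_coeff {Φ : NullField X} {ε : ℝ}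
    (h : Φ.IsSecondOrder I f o U) {x : X} (hx : x ∈ U) (hq : IsQuasiUmbilicPoint I f o x)
    (hcan : ∀ V V' : TangentSpace I x, IsNullPair I f o x V V' → IsPositivePair I (o x) V V')
    (hhel : ∀ V V' : TangentSpace I x, IsNullPair I f o x V V' →
      Real.sign (-sp (mvfderiv I (gaussMap I f o) x V') (mvfderiv I f x V')) = ε) :
    ∃ β : ℝ, 0 < ε * β ∧ (∀ v, dform I Φ.N (Φ.A x) x v = 0) ∧
      ∀ v, dform I Φ.N (Φ.B x) x v = β * dform I Φ.P (Φ.A x) x v := by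
  have hs : ∀ X Y, sp X Y = sp Y X := sp_comm
  have hn := (h.oriented x hx).1
  have hg : mvfderiv I (gaussMap I f o) x = mvfderiv I Φ.N x :=
    mvfderiv_congr (Filter.eventually_of_mem (h.isOpen.mem_nhds hx) fun y hy => h.gaussMap_eq hy)
  obtain ⟨v₀, w₀, hvw⟩ := exists_isPositivePair (o x)
  have hpos := h.wedge_pos x hx v₀ w₀ hvw
  have hpos' : wedge I (dform I Φ.P (Φ.A x) x) (dform I Φ.P (Φ.B x) x) v₀ w₀ ≠ 0 := by
    simp only [wedge] at hpos ⊢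
    intro h0
    linarith
  have hsym : ∀ v w, wedge I (dform I Φ.N (Φ.A x) x) (dform I Φ.P (Φ.B x) x) v w +
      wedge I (dform I Φ.N (Φ.B x) x) (dform I Φ.P (Φ.A x) x) v w = 0 := by
    intro v w
    have h1 := symm_of_dform_eq_zero h.isOpen h.sN h.sP h.dP_N hx v w
    rw [h.mvfderiv_N hx v, h.mvfderiv_N hx w, h.mvfderiv_P hx v, h.mvfderiv_P hx w] at h1
    simp only [sp_sub_left, sp_sub_right, sp_smul_left, sp_smul_right, hn.PP, hn.PA, hn.PB, hn.AA,
      hn.AB, hn.BB, hs (Φ.A x) (Φ.P x), hs (Φ.B x) (Φ.P x), hs (Φ.B x) (Φ.A x)] at h1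
    simp only [wedge]
    linear_combination -2 * h1
  have htr := h.trace x hx
  obtain ⟨α, hα⟩ := exists_coeff_of_wedge_eq_zero (α := dform I Φ.N (Φ.A x) x) hpos'
    fun v w => by linarith [hsym v w, htr v w]
  obtain ⟨β, hβ⟩ := exists_coeff_of_wedge_eq_zero (α := dform I Φ.N (Φ.B x) x) hpos.ne'
    fun v w => by linarith [hsym v w, htr v w]
  have hαβ : α * β = 0 := by
    obtain ⟨u, hu1, hu2⟩ := exists_covector_values hpos.ne' 1 1
    have h1 := hq.1 u u
    rw [hg, h.mvfderiv_N hx u, hα, hβ, hu1, hu2] at h1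
    simp only [sp_sub_left, sp_sub_right, sp_smul_left, sp_smul_right, hn.PP, hn.PA, hn.PB, hn.AA,
      hn.AB, hn.BB, hs (Φ.A x) (Φ.P x), hs (Φ.B x) (Φ.P x), hs (Φ.B x) (Φ.A x)] at h1
    linarith
  obtain ⟨ρ, hρ, hfx, hdf⟩ := h.exists_mvfderiv hx
  have hne : ¬ (α = 0 ∧ β = 0) := by
    rintro ⟨rfl, rfl⟩
    refine hq.2 fun v hli => ?_
    rw [LinearIndependent.pair_iff, hg, h.mvfderiv_N hx v, hα, hβ, hfx] at hli
    have := hli (dform I Φ.N (Φ.Q x) x v) ρ (by module)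
    exact hρ.ne' this.2
  rcases mul_eq_zero.mp hαβ with h0 | h0
  · have hβ0 : β ≠ 0 := fun h1 => hne ⟨h0, h1⟩
    have hα' : ∀ v, dform I Φ.N (Φ.A x) x v = 0 := fun v => by rw [hα, h0, zero_mul]
    refine ⟨β, ?_, hα', hβ⟩
    have key := fun V V' => isNullPair_iff (I := I) (f := f) (o := o) (x := x)
      (a := dform I Φ.P (Φ.A x) x) (b := dform I Φ.P (Φ.B x) x)
      hn.PP hn.PA hn.PB hn.AA hn.AB hn.BB hρ.ne' hβ0 hfx
      (fun v => by
        obtain ⟨s, hs⟩ := hdf v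
        refine ⟨s - ρ * dform I Φ.P (Φ.Q x) x v, ?_⟩
        rw [hs, h.mvfderiv_P hx]
        module)
      (fun v => by
        refine ⟨-dform I Φ.N (Φ.Q x) x v, ?_⟩
        rw [hg, h.mvfderiv_N hx, hα', hβ]
        module) V V'
    obtain ⟨V, hV1, hV2⟩ := exists_covector_values hpos.ne' 1 0
    obtain ⟨V', hV1', hV2'⟩ := exists_covector_values hpos.ne' 0 (2 / ρ ^ 2)
    have hnull : IsNullPair I f o x V V' := by
      refine (key V V').1.mpr ⟨hV2, hV1', ?_⟩
      rw [hV1, hV2']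
      field_simp
    have h2 := hhel V V' hnull
    rw [(key V V').2, hV2'] at h2
    have h3 : 0 < ρ * (2 / ρ ^ 2) ^ 2 := by positivity
    rcases lt_or_gt_of_ne hβ0 with h4 | h4
    · rw [Real.sign_of_neg (by nlinarith)] at h2
      rw [← h2]; linarith
    · rw [Real.sign_of_pos (by nlinarith)] at h2
      rw [← h2]; linarith
  · exfalso
    have hα0 : α ≠ 0 := fun h1 => hne ⟨h1, h0⟩
    have hβ' : ∀ v, dform I Φ.N (Φ.B x) x v = 0 := fun v => by rw [hβ, h0, zero_mul]
    have key := fun V V' => isNullPair_iff (I := I) (f := f) (o := o) (x := x)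
      (a := dform I Φ.P (Φ.B x) x) (b := dform I Φ.P (Φ.A x) x)
      hn.PP hn.PB hn.PA hn.BB ((hs _ _).trans hn.AB) hn.AA hρ.ne' hα0 hfx
      (fun v => by
        obtain ⟨s, hs⟩ := hdf v
        refine ⟨s - ρ * dform I Φ.P (Φ.Q x) x v, ?_⟩
        rw [hs, h.mvfderiv_P hx]
        module)
      (fun v => by
        refine ⟨-dform I Φ.N (Φ.Q x) x v, ?_⟩
        rw [hg, h.mvfderiv_N hx, hβ', hα]
        module) V V'
    obtain ⟨V, hV1, hV2⟩ := exists_covector_values hpos.ne' 0 1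
    obtain ⟨V', hV1', hV2'⟩ := exists_covector_values hpos.ne' (2 / ρ ^ 2) 0
    have hnull : IsNullPair I f o x V V' := by
      refine (key V V').1.mpr ⟨hV1, hV2', ?_⟩
      rw [hV2, hV1']
      field_simp
    have h2 := h.wedge_pos x hx V V' (hcan V V' hnull)
    rw [wedge, hV1, hV2, hV1', hV2'] at h2
    have h3 : 0 < 2 / ρ ^ 2 := by positivity
    linarith

omit hE in
/-- If `dN` is a multiple of `A`, then so is `dQ` modulo `⟨dP, A⟩`. -/
lemma NullField.IsSecondOrder.wedge_dQ_A {Φ : NullField X} {ε : ℝ} (hε : ε ≠ 0)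
    (h : Φ.IsSecondOrder I f o U)
    (hA : ∀ y ∈ U, ∀ v, dform I Φ.N (Φ.A y) y v = 0)
    (hB : ∀ y ∈ U, ∀ v, dform I Φ.N (Φ.B y) y v = 2 * ε * dform I Φ.P (Φ.A y) y v)
    (hQ : ∀ y ∈ U, ∀ v, dform I Φ.N (Φ.Q y) y v = 0) {x : X} (hx : x ∈ U)
    (v w : TangentSpace I x) :
    wedge I (dform I Φ.Q (Φ.A x) x) (dform I Φ.P (Φ.A x) x) v w = 0 := by
  have hdN : ∀ u, mvfderiv I Φ.N x u = (-(ε * dform I Φ.P (Φ.A x) x u)) • Φ.A x := by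
    intro u
    rw [h.mvfderiv_N hx u, hA x hx, hB x hx, hQ x hx]; module
  have h1 := symm_of_dform_eq_zero h.isOpen h.sQ h.sN hQ hx v w
  rw [hdN, hdN, sp_smul_right, sp_smul_right, ← dform_apply, ← dform_apply] at h1
  have h2 : ε * wedge I (dform I Φ.Q (Φ.A x) x) (dform I Φ.P (Φ.A x) x) v w = 0 := by
    simp only [wedge]; linear_combination -h1
  exact (mul_eq_zero.mp h2).resolve_left hε

/-- Quasi-umbilical immersions have adapted frame fields. -/
theorem exists_isAdapted {ε : ℝ} (hε : ε = 1 ∨ ε = -1) (ho : IsSurfaceOrientation I o)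
    (hf : IsQuasiUmbilicalOn I f o univ) (hcan : IsCanonicalOrientationOn I f o univ)
    (hhel : HasHelicityOn I f o univ ε) (x : X) :
    ∃ U, x ∈ U ∧ ∃ Φ : NullField X, Φ.IsAdapted I f o ε U := by
  have hs : ∀ X Y, sp X Y = sp Y X := sp_comm
  have hε0 : ε ≠ 0 := by rcases hε with rfl | rfl <;> norm_num
  have hε2 : ε * ε = 1 := by rcases hε with rfl | rfl <;> norm_num
  obtain ⟨U, E₁, E₂, hF, hx, Φ, h⟩ := exists_isSecondOrder ho hf.1 x
  have hU := h.isOpen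
  refine ⟨U, hx, ?_⟩
  -- rescale `P` so that the factor of `⟨dN, B⟩` becomes `2 ε`
  obtain ⟨Φ₁, h₁, A₁, B₁⟩ : ∃ Φ₁ : NullField X, Φ₁.IsSecondOrder I f o U ∧
      (∀ y ∈ U, ∀ v, dform I Φ₁.N (Φ₁.A y) y v = 0) ∧
      (∀ y ∈ U, ∀ v, dform I Φ₁.N (Φ₁.B y) y v = 2 * ε * dform I Φ₁.P (Φ₁.A y) y v) := by
    have hc := fun y (hy : y ∈ U) => h.exists_quasiUmbilic_coeff hy (hf.2 y (mem_univ y))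
      (hcan y (mem_univ y)) (hhel y (mem_univ y))
    obtain ⟨β, sβ, hβ⟩ := h.exists_coeff hF (α := fun y => dform I Φ.N (Φ.B y) y)
      (contMDiffOn_dform hU h.sN h.sB hF.s1) (contMDiffOn_dform hU h.sN h.sB hF.s2)
      (fun y hy v w => by
        obtain ⟨β, -, -, hβ⟩ := hc y hy
        simp only [wedge, hβ]; ring)
    have hpos : ∀ y ∈ U, 0 < (ε / 2) * β y := by
      intro y hy
      obtain ⟨b, hb1, -, hb2⟩ := hc y hy
      have hw := h.wedge_pos y hy _ _ (hF.pos y hy)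
      obtain ⟨u, -, hu⟩ := exists_covector_values hw.ne' 0 1
      have h1 := hβ y hy u
      rw [hb2, hu] at h1
      have : b = β y := by linarith
      rw [← this]; linarith
    refine ⟨Φ.scale fun y => (ε / 2) * β y, h.scale (contMDiffOn_mul contMDiffOn_const sβ) hpos,
      fun y hy v => ?_, fun y hy v => ?_⟩
    · obtain ⟨b, -, hb, -⟩ := hc y hy
      exact hb v
    · have h1 := NullField.dform_scale h.toIsAlong
        (contMDiffOn_mul (contMDiffOn_const (c := ε / 2)) sβ) hy (h.oriented y hy).1.PA v
      change dform I Φ.N (Φ.B y) y v = 2 * ε * dform I (Φ.scale _).P (Φ.A y) y v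
      rw [h1, hβ y hy]
      linear_combination -(β y * dform I Φ.P (Φ.A y) y v) * hε2
  -- translate `A` along `P` to remove the component of `dN` along `P`
  obtain ⟨Φ₂, h₂, A₂, B₂, Q₂⟩ : ∃ Φ₂ : NullField X, Φ₂.IsSecondOrder I f o U ∧
      (∀ y ∈ U, ∀ v, dform I Φ₂.N (Φ₂.A y) y v = 0) ∧
      (∀ y ∈ U, ∀ v, dform I Φ₂.N (Φ₂.B y) y v = 2 * ε * dform I Φ₂.P (Φ₂.A y) y v) ∧
      (∀ y ∈ U, ∀ v, dform I Φ₂.N (Φ₂.Q y) y v = 0) := by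
    have hdN : ∀ y ∈ U, ∀ v, mvfderiv I Φ₁.N y v =
        (-dform I Φ₁.N (Φ₁.Q y) y v) • Φ₁.P y - (ε * dform I Φ₁.P (Φ₁.A y) y v) • Φ₁.A y := by
      intro y hy v
      rw [h₁.mvfderiv_N hy, A₁ y hy, B₁ y hy]; module
    obtain ⟨a, sa, ha⟩ := h₁.exists_coeff hF (α := fun y => dform I Φ₁.N (Φ₁.Q y) y)
      (contMDiffOn_dform hU h₁.sN h₁.sQ hF.s1) (contMDiffOn_dform hU h₁.sN h₁.sQ hF.s2)
      (fun y hy v w => by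
        have h3 := symm_of_dform_eq_zero hU h₁.sA h₁.sN A₁ hy v w
        rw [hdN y hy, hdN y hy] at h3
        obtain ⟨-, AAv, -, -, -, APv, -⟩ := h₁.dform_relations hy v
        obtain ⟨-, AAw, -, -, -, APw, -⟩ := h₁.dform_relations hy w
        simp only [sp_sub_right, sp_smul_right, ← dform_apply, AAv, APv, AAw, APw] at h3
        simp only [wedge]
        linear_combination -h3)
    have sεa : ContMDiffOn I 𝓘(ℝ, ℝ) ∞ (fun y => ε * a y) U := contMDiffOn_mul contMDiffOn_const sa
    have s0 : ContMDiffOn I 𝓘(ℝ, ℝ) ∞ (fun _ : X => (0 : ℝ)) U := contMDiffOn_const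
    have hNP : ∀ y ∈ U, ∀ v, dform I Φ₁.N (Φ₁.P y) y v = 0 := fun y hy v => by
      rw [(h₁.dform_relations hy v).2.2.2.2.2.2.2.1, h₁.dP_N y hy, neg_zero]
    refine ⟨Φ₁.translate (fun y => ε * a y) (fun _ => 0) fun _ => 0, h₁.translate sεa s0,
      fun y hy v => ?_, fun y hy v => ?_, fun y hy v => ?_⟩
    · rw [NullField.translate_N]
      change dform I Φ₁.N (Φ₁.A y + _ • Φ₁.P y) y v = 0
      rw [dform_add_right, dform_smul_right, hNP y hy, A₁ y hy]; ring
    · rw [NullField.translate_N]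
      change dform I Φ₁.N (Φ₁.B y + _ • Φ₁.P y) y v =
        2 * ε * dform I Φ₁.P (Φ₁.A y + _ • Φ₁.P y) y v
      rw [dform_add_right, dform_smul_right, dform_add_right, dform_smul_right, hNP y hy, B₁ y hy,
        (h₁.dform_relations hy v).1]
      ring
    · rw [NullField.translate_N]
      change sp (mvfderiv I Φ₁.N y v) (Φ₁.Q y - ((0 : ℝ) / 2) • Φ₁.A y - (ε * a y / 2) • Φ₁.B y +
        (0 : ℝ) • Φ₁.N y + (((0 : ℝ) ^ 2 - ε * a y * 0) / 2) • Φ₁.P y) = 0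
      simp only [sp_add_right, sp_sub_right, sp_smul_right, ← dform_apply, hNP y hy, B₁ y hy,
        ha y hy]
      linear_combination -(a y * dform I Φ₁.P (Φ₁.A y) y v) * hε2
  -- `⟨dP, Q⟩ + ⟨dA, B⟩` is a multiple of `⟨dP, A⟩`, which a translation of `B` removes
  have hdN : ∀ y ∈ U, ∀ v, mvfderiv I Φ₂.N y v =
      (-(ε * dform I Φ₂.P (Φ₂.A y) y v)) • Φ₂.A y := by
    intro y hy v
    rw [h₂.mvfderiv_N hy, A₂ y hy, B₂ y hy, Q₂ y hy]; module
  obtain ⟨b, sb, hb⟩ := h₂.exists_coeff hF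
    (α := fun y => dform I Φ₂.P (Φ₂.Q y) y + dform I Φ₂.A (Φ₂.B y) y)
    ((contMDiffOn_dform hU h₂.sP h₂.sQ hF.s1).add (contMDiffOn_dform hU h₂.sA h₂.sB hF.s1))
    ((contMDiffOn_dform hU h₂.sP h₂.sQ hF.s2).add (contMDiffOn_dform hU h₂.sA h₂.sB hF.s2))
    (fun y hy v w => by
      have s2 : ContMDiffOn I 𝓘(ℝ, R23) ∞ (fun y => (-(2 * ε)) • Φ₂.A y) U :=
        contMDiffOn_smul contMDiffOn_const h₂.sA
      have h3 := symm_of_sp_mvfderiv_eq_zero hU h₂.sB h₂.sN s2 h₂.sP (fun y hy v => by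
        have := B₂ y hy v
        rw [dform_apply, dform_apply] at this
        rw [sp_smul_left, hs (Φ₂.B y), hs (Φ₂.A y), this]
        ring) hy v w
      rw [hdN y hy, hdN y hy, mvfderiv_const_smul_apply (h₂.mdiff hy).2.1,
        mvfderiv_const_smul_apply (h₂.mdiff hy).2.1, h₂.mvfderiv_P hy, h₂.mvfderiv_P hy] at h3
      obtain ⟨-, AAv, -, -, -, APv, -, -, -, BAv, -⟩ := h₂.dform_relations hy v
      obtain ⟨-, AAw, -, -, -, APw, -, -, -, BAw, -⟩ := h₂.dform_relations hy w
      simp only [sp_sub_right, sp_smul_right, sp_smul_left, ← dform_apply, AAv, APv, AAw, APw, BAv,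
        BAw] at h3
      have h4 : ε * wedge I (dform I Φ₂.P (Φ₂.Q y) y + dform I Φ₂.A (Φ₂.B y) y)
          (dform I Φ₂.P (Φ₂.A y) y) v w = 0 := by
        simp only [wedge, LinearMap.add_apply]
        linear_combination (1 / 2) * h3
      exact (mul_eq_zero.mp h4).resolve_left hε0)
  -- `B + c P` lowers `⟨dA, B⟩` by `c ⟨dP, A⟩`, and `Q - (c / 2) A` lowers `⟨dP, Q⟩` by half of that
  set c : X → ℝ := fun y => 2 / 3 * b y with hc
  have sc : ContMDiffOn I 𝓘(ℝ, ℝ) ∞ c U := contMDiffOn_mul contMDiffOn_const sb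
  have s0 : ContMDiffOn I 𝓘(ℝ, ℝ) ∞ (fun _ : X => (0 : ℝ)) U := contMDiffOn_const
  have hNP : ∀ y ∈ U, ∀ v, dform I Φ₂.N (Φ₂.P y) y v = 0 := fun y hy v => by
    rw [(h₂.dform_relations hy v).2.2.2.2.2.2.2.1, h₂.dP_N y hy, neg_zero]
  set Φ₃ := Φ₂.translate (fun _ => 0) c fun _ => 0 with hΦ₃
  have h₃ : Φ₃.IsSecondOrder I f o U := h₂.translate s0 sc
  have N₃ : Φ₃.N = Φ₂.N := Φ₂.translate_N _ _
  have A₃ : Φ₃.A = Φ₂.A := by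
    funext y
    change Φ₂.A y + (0 : ℝ) • Φ₂.P y = _
    rw [zero_smul, add_zero]
  have B₃ : ∀ y, Φ₃.B y = Φ₂.B y + c y • Φ₂.P y := fun y => rfl
  have Q₃ : ∀ y, Φ₃.Q y = Φ₂.Q y - (c y / 2) • Φ₂.A y := by
    intro y
    change Φ₂.Q y - (c y / 2) • Φ₂.A y - ((0 : ℝ) / 2) • Φ₂.B y +
        (0 : ℝ) • Φ₂.N y + (((0 : ℝ) ^ 2 - 0 * c y) / 2) • Φ₂.P y = _
    module
  have P₃ : Φ₃.P = Φ₂.P := rfl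
  have k1 : ∀ y ∈ U, ∀ v, dform I Φ₃.N (Φ₃.A y) y v = 0 := by
    rw [N₃, A₃]; exact A₂
  have k2 : ∀ y ∈ U, ∀ v, dform I Φ₃.N (Φ₃.B y) y v = 2 * ε * dform I Φ₃.P (Φ₃.A y) y v := by
    intro y hy v
    rw [N₃, A₃, B₃, dform_add_right, dform_smul_right, hNP y hy, B₂ y hy, P₃]; ring
  have k3 : ∀ y ∈ U, ∀ v, dform I Φ₃.N (Φ₃.Q y) y v = 0 := by
    intro y hy v
    rw [N₃, Q₃, sub_eq_add_neg, ← neg_smul, dform_add_right, dform_smul_right, Q₂ y hy, A₂ y hy]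
    ring
  refine ⟨Φ₃, ⟨h₃, k1, k2, k3, fun y hy v => ?_, fun y hy v w => h₃.wedge_dQ_A hε0 k1 k2 k3 hy v w⟩⟩
  have h4 := hb y hy v
  rw [LinearMap.add_apply] at h4
  rw [P₃, A₃, Q₃, B₃, sub_eq_add_neg, ← neg_smul, dform_add_right, dform_smul_right,
    dform_add_right, dform_smul_right, (h₂.dform_relations hy v).2.2.2.2.2.1]
  simp only [hc]
  linear_combination h4

end Adapted

/-! ### Leaf spaces of maps of rank one -/

section Leaves

variable {E : Type*} [NormedAddCommGroup E] [NormedSpace ℝ E]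
  {X : Type*} [TopologicalSpace X] [ChartedSpace E X]

lemma mvfderiv_comp_mfderiv {E' : Type*} [NormedAddCommGroup E'] [NormedSpace ℝ E'] {H' : Type*}
    [TopologicalSpace H'] {J : ModelWithCorners ℝ E' H'} {Y : Type*} [TopologicalSpace Y]
    [ChartedSpace H' Y] {E₂ : Type*} [NormedAddCommGroup E₂] [NormedSpace ℝ E₂] {H₂ : Type*}
    [TopologicalSpace H₂] {I : ModelWithCorners ℝ E₂ H₂} {Z : Type*} [TopologicalSpace Z]
    [ChartedSpace H₂ Z] {V : Type*} [NormedAddCommGroup V] [NormedSpace ℝ V] {g : Z → V} {γ : Y → Z}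
    {t : Y} (hg : MDifferentiableAt I 𝓘(ℝ, V) g (γ t)) (hγ : MDifferentiableAt J I γ t)
    (u : TangentSpace J t) :
    mvfderiv J (fun t => g (γ t)) t u = mvfderiv I g (γ t) (mfderiv J I γ t u) :=
  mfderiv_comp_apply (I := J) (I' := I) (I'' := 𝓘(ℝ, V)) t hg hγ u

/-- The derivative of `N` has rank one everywhere. -/
def HasRankOne (N : X → R23) : Prop :=
  ∀ x : X, ∃ (α : TangentSpace 𝓘(ℝ, E) x →ₗ[ℝ] ℝ) (u : R23), α ≠ 0 ∧ u ≠ 0 ∧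
    ∀ v, mvfderiv 𝓘(ℝ, E) N x v = α v • u

/-- A flow box of `Ker dN`: a chart onto a square whose first coordinate is a linear function of
`N`. -/
structure IsFlowBox (N : X → R23) (ℓ : R23 →L[ℝ] ℝ) (φ : OpenPartialHomeomorph X (ℝ × ℝ))
    (p : ℝ × ℝ) (r : ℝ) : Prop where
  target_eq : φ.target = Metric.ball p r
  smooth : ContMDiffOn 𝓘(ℝ, E) 𝓘(ℝ, ℝ × ℝ) ∞ φ φ.source
  smooth_symm : ContMDiffOn 𝓘(ℝ, ℝ × ℝ) 𝓘(ℝ, E) ∞ φ.symm φ.target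
  fst_eq : ∀ x ∈ φ.source, (φ x).1 = ℓ (N x)

lemma exists_flowBox [FiniteDimensional ℝ E] (hE : Module.finrank ℝ E = 2) [IsManifold 𝓘(ℝ, E) ∞ X]
    {N : X → R23}
    (hN : ContMDiff 𝓘(ℝ, E) 𝓘(ℝ, R23) ∞ N) (hr : HasRankOne (E := E) N) (x₀ : X) :
    ∃ (ℓ : R23 →L[ℝ] ℝ) (φ : OpenPartialHomeomorph X (ℝ × ℝ)) (p : ℝ × ℝ) (r : ℝ),
      IsFlowBox (E := E) N ℓ φ p r ∧ x₀ ∈ φ.source := by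
  have : CompleteSpace E := FiniteDimensional.complete ℝ E
  obtain ⟨α, u, hα, hu, hdN⟩ := hr x₀
  obtain ⟨i, hi⟩ := Function.ne_iff.mp hu
  set ℓ : R23 →L[ℝ] ℝ := ContinuousLinearMap.proj i with hℓ
  set c := chartAt E x₀ with hc
  set e₀ := c x₀ with he₀
  have hx₀ : x₀ ∈ c.source := mem_chart_source E x₀
  have he₀t : e₀ ∈ c.target := c.map_source hx₀
  set h : E → ℝ := fun e => ℓ (N (c.symm e)) with hh
  have sh : ContDiffOn ℝ ∞ h c.target := by
    have h1 : ContMDiffOn 𝓘(ℝ, E) 𝓘(ℝ, R23) ∞ (fun e => N (c.symm e)) c.target :=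
      hN.comp_contMDiffOn (contMDiffOn_chart_symm (I := 𝓘(ℝ, E)))
    exact ℓ.contDiff.comp_contDiffOn (contMDiffOn_iff_contDiffOn.mp h1)
  have dh : ∀ e ∈ c.target, DifferentiableAt ℝ h e := fun e he =>
    (sh.contDiffAt (c.open_target.mem_nhds he)).differentiableAt (by simp)
  -- the derivative of `h` at `e₀` does not vanish
  have hA : fderiv ℝ h e₀ ≠ 0 := by
    intro h0
    obtain ⟨v, hv⟩ : ∃ v, α v ≠ 0 := by
      by_contra! hcon
      exact hα (LinearMap.ext hcon)
    have hNd : MDifferentiableAt 𝓘(ℝ, E) 𝓘(ℝ, R23) N x₀ := hN.mdifferentiableAt (by simp)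
    have h1 : mvfderiv 𝓘(ℝ, E) (fun y => ℓ (N y)) x₀ = fderiv ℝ h e₀ := by
      have h2 : MDifferentiableAt 𝓘(ℝ, E) 𝓘(ℝ, ℝ) (fun y => ℓ (N y)) x₀ :=
        ℓ.differentiableAt.mdifferentiableAt.comp x₀ hNd
      have := mvfderiv_eq_fderiv_chart (I := 𝓘(ℝ, E)) h2
      simpa [extChartAt] using this
    have h2 := mvfderiv_clm_comp (I := 𝓘(ℝ, E)) ℓ hNd v
    rw [h1, h0, hdN, map_smul] at h2
    have h3 : (0 : ℝ) = α v * u i := h2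
    exact mul_ne_zero hv hi h3.symm
  -- a linear coordinate `κ` that completes `dh` at `e₀` to an isomorphism
  obtain ⟨κ, hκ⟩ : ∃ κ : E →L[ℝ] ℝ, ∀ v, fderiv ℝ h e₀ v = 0 → κ v = 0 → v = 0 := by
    let b := Module.finBasisOfFinrankEq ℝ E hE
    have hb : ∀ v, v = b.coord 0 v • b 0 + b.coord 1 v • b 1 := fun v => by
      conv_lhs => rw [← b.sum_repr v, Fin.sum_univ_two]
      rfl
    by_cases h0 : fderiv ℝ h e₀ (b 0) = 0
    · have h1 : fderiv ℝ h e₀ (b 1) ≠ 0 := by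
        intro h1
        refine hA (ContinuousLinearMap.ext fun v => ?_)
        rw [hb v, map_add, map_smul, map_smul, h0, h1]; simp
      refine ⟨(b.coord 0).toContinuousLinearMap, fun v hv1 hv2 => ?_⟩
      have hv2' : b.coord 0 v = 0 := hv2
      rw [hb v, hv2', zero_smul, zero_add, map_smul] at hv1
      have := (smul_eq_zero.mp hv1).resolve_right h1
      rw [hb v, hv2', this]; simp
    · refine ⟨(b.coord 1).toContinuousLinearMap, fun v hv1 hv2 => ?_⟩
      have hv2' : b.coord 1 v = 0 := hv2
      rw [hb v, hv2', zero_smul, add_zero, map_smul] at hv1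
      have := (smul_eq_zero.mp hv1).resolve_right h0
      rw [hb v, hv2', this]; simp
  set G : E → ℝ × ℝ := fun e => (h e, κ e) with hG
  have sG : ContDiffOn ℝ ∞ G c.target := sh.prodMk κ.contDiff.contDiffOn
  have dG : ∀ e ∈ c.target, HasFDerivAt G ((fderiv ℝ h e).prod κ) e := fun e he =>
    (dh e he).hasFDerivAt.prodMk κ.hasFDerivAt
  obtain ⟨D, hD⟩ : ∃ D : E ≃L[ℝ] ℝ × ℝ, (D : E →L[ℝ] ℝ × ℝ) = (fderiv ℝ h e₀).prod κ := by
    have hinj : Function.Injective ((fderiv ℝ h e₀).prod κ : E →L[ℝ] ℝ × ℝ).toLinearMap := by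
      refine (injective_iff_map_eq_zero _).mpr fun v hv => ?_
      have hv' : (fderiv ℝ h e₀ v, κ v) = (0, 0) := hv
      exact hκ v (congrArg Prod.fst hv') (congrArg Prod.snd hv')
    have hfr : Module.finrank ℝ E = Module.finrank ℝ (ℝ × ℝ) := by simp [hE]
    refine ⟨(LinearEquiv.ofInjectiveOfFinrankEq _ hinj hfr).toContinuousLinearEquiv, ?_⟩
    ext v <;> rfl
  have hG₀ : ContDiffAt ℝ ∞ G e₀ := sG.contDiffAt (c.open_target.mem_nhds he₀t)
  have hG₀' : HasFDerivAt G (D : E →L[ℝ] ℝ × ℝ) e₀ := by rw [hD]; exact dG e₀ he₀t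
  set K := hG₀.toOpenPartialHomeomorph G hG₀' (by simp) with hK
  -- the set where the derivative of `G` is invertible
  obtain ⟨O, hO, hOo, he₀O⟩ : ∃ O ⊆ {e | e ∈ c.target ∧ ∃ D : E ≃L[ℝ] ℝ × ℝ,
      (D : E →L[ℝ] ℝ × ℝ) = (fderiv ℝ h e).prod κ}, IsOpen O ∧ e₀ ∈ O := by
    refine mem_nhds_iff.mp ?_
    have h1 : ContinuousAt (fun e => (fderiv ℝ h e).prod κ) e₀ := by
      have h2 : ContinuousAt (fderiv ℝ h) e₀ :=
        ((sh.contDiffAt (c.open_target.mem_nhds he₀t)).fderiv_right (m := 0) (by simp)).continuousAt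
      have h3 : Continuous fun L : E →L[ℝ] ℝ => L.prod κ := by
        have h4 : (fun L : E →L[ℝ] ℝ => L.prod κ) = fun L =>
            ContinuousLinearMap.compL ℝ E ℝ (ℝ × ℝ) (ContinuousLinearMap.inl ℝ ℝ ℝ) L +
              (ContinuousLinearMap.inr ℝ ℝ ℝ).comp κ := by
          ext L v <;> simp
        rw [h4]
        fun_prop
      exact h3.continuousAt.comp h2
    have h2 : range (fun D : E ≃L[ℝ] ℝ × ℝ => (D : E →L[ℝ] ℝ × ℝ)) ∈ 𝓝 ((fderiv ℝ h e₀).prod κ) :=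
      by
      rw [← hD]
      exact ContinuousLinearEquiv.nhds D
    filter_upwards [c.open_target.mem_nhds he₀t, h1 h2] with e he1 he2
    exact ⟨he1, he2⟩
  set φ₁ := c.trans (K.restrOpen O hOo) with hφ₁
  have hx₁ : x₀ ∈ φ₁.source := by
    rw [hφ₁, OpenPartialHomeomorph.trans_source]
    exact ⟨hx₀, ContDiffAt.mem_toOpenPartialHomeomorph_source hG₀ hG₀' (by simp), he₀O⟩
  have hφ₁c : ∀ x, φ₁ x = G (c x) := fun x => rfl
  obtain ⟨r, hr0, hball⟩ := Metric.isOpen_iff.mp φ₁.open_target (φ₁ x₀) (φ₁.map_source hx₁)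
  set φ := (φ₁.symm.restrOpen (Metric.ball (φ₁ x₀) r) Metric.isOpen_ball).symm with hφ
  have hφs : φ.source = φ₁.source ∩ φ₁ ⁻¹' Metric.ball (φ₁ x₀) r := by
    rw [hφ]
    simp
  have hφt : φ.target = Metric.ball (φ₁ x₀) r := by
    change (φ₁.symm.restrOpen (Metric.ball (φ₁ x₀) r) Metric.isOpen_ball).source = _
    rw [OpenPartialHomeomorph.restrOpen_source]
    exact inter_eq_right.mpr hball
  have hsub : φ.source ⊆ c.source := by
    rw [hφs, hφ₁, OpenPartialHomeomorph.trans_source]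
    exact fun x hx => hx.1.1
  refine ⟨ℓ, φ, φ₁ x₀, r, ⟨hφt, ?_, ?_, ?_⟩, ?_⟩
  · have h1 : ContMDiffOn 𝓘(ℝ, E) 𝓘(ℝ, ℝ × ℝ) ∞ (fun x => G (c x)) c.source :=
      (contMDiffOn_iff_contDiffOn.mpr sG).comp (contMDiffOn_chart (I := 𝓘(ℝ, E)))
        fun x hx => c.map_source hx
    exact h1.mono hsub
  · intro z hz
    have hz1 : z ∈ φ₁.target := by
      rw [hφt] at hz; exact hball hz
    rw [hφ₁, OpenPartialHomeomorph.trans_target] at hz1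
    have hz2 : z ∈ (K.restrOpen O hOo).target := hz1.1
    have hzK : z ∈ K.target := by
      have := (K.restrOpen O hOo).map_target hz2
      rw [OpenPartialHomeomorph.restrOpen_source] at this
      have h2 := K.map_source this.1
      rwa [show K ((K.restrOpen O hOo).symm z) = z from (K.restrOpen O hOo).right_inv hz2] at h2
    have hzO : K.symm z ∈ O := by
      have := (K.restrOpen O hOo).map_target hz2
      rw [OpenPartialHomeomorph.restrOpen_source] at this
      exact this.2
    obtain ⟨hzc, D', hD'⟩ := hO hzO
    have h1 : ContDiffAt ℝ ∞ K.symm z := by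
      refine K.contDiffAt_symm (f₀' := D') hzK ?_ ?_
      · rw [hD']; exact dG _ hzc
      · exact sG.contDiffAt (c.open_target.mem_nhds hzc)
    have h2 : ContMDiffAt 𝓘(ℝ, E) 𝓘(ℝ, E) ∞ c.symm (K.symm z) :=
      (contMDiffOn_chart_symm (I := 𝓘(ℝ, E))).contMDiffAt (c.open_target.mem_nhds hzc)
    exact (h2.comp z h1.contMDiffAt).contMDiffWithinAt
  · intro x hx
    change ℓ (N (c.symm (c x))) = _
    rw [c.left_inv (hsub hx)]
  · rw [hφs]
    exact ⟨hx₁, Metric.mem_ball_self hr0⟩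

section FlowBox

variable {N : X → R23} {ℓ : R23 →L[ℝ] ℝ} {φ : OpenPartialHomeomorph X (ℝ × ℝ)} {p : ℝ × ℝ} {r : ℝ}

lemma IsFlowBox.symm_fst (h : IsFlowBox (E := E) N ℓ φ p r) {z : ℝ × ℝ} (hz : z ∈ φ.target) :
    ℓ (N (φ.symm z)) = z.1 := by
  rw [← h.fst_eq _ (φ.map_target hz), φ.right_inv hz]

lemma IsFlowBox.exists_ne (h : IsFlowBox (E := E) N ℓ φ p r)
    (hN : ContMDiff 𝓘(ℝ, E) 𝓘(ℝ, R23) ∞ N) {x : X} (hx : x ∈ φ.source) :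
    ∃ v, ℓ (mvfderiv 𝓘(ℝ, E) N x v) = 1 := by
  have hz := φ.map_source hx
  have h1 : MDifferentiableAt 𝓘(ℝ, ℝ × ℝ) 𝓘(ℝ, E) φ.symm (φ x) :=
    (h.smooth_symm.contMDiffAt (φ.open_target.mem_nhds hz)).mdifferentiableAt (by simp)
  have hNd : MDifferentiableAt 𝓘(ℝ, E) 𝓘(ℝ, R23) N (φ.symm (φ x)) :=
    hN.mdifferentiableAt (by simp)
  have h3 := mvfderiv_comp_mfderiv hNd h1 ((1, 0) : ℝ × ℝ)
  have h4 : MDifferentiableAt 𝓘(ℝ, ℝ × ℝ) 𝓘(ℝ, R23) (fun z => N (φ.symm z)) (φ x) := hNd.comp _ h1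
  have h5 := mvfderiv_clm_comp ℓ h4 ((1, 0) : ℝ × ℝ)
  have h6 : (fun z => ℓ (N (φ.symm z))) =ᶠ[𝓝 (φ x)] Prod.fst := by
    filter_upwards [φ.open_target.mem_nhds hz] with z hz using h.symm_fst hz
  rw [mvfderiv_congr h6, h3] at h5
  have h7 : mvfderiv 𝓘(ℝ, ℝ × ℝ) (Prod.fst : ℝ × ℝ → ℝ) (φ x) ((1, 0) : ℝ × ℝ) = 1 := by
    change mfderiv 𝓘(ℝ, ℝ × ℝ) 𝓘(ℝ, ℝ) (Prod.fst : ℝ × ℝ → ℝ) (φ x) ((1, 0) : ℝ × ℝ) = (1 : ℝ)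
    rw [mfderiv_eq_fderiv, fderiv_fst]
    rfl
  rw [h7] at h5
  rw [← φ.left_inv hx]
  rw [← φ.left_inv hx] at h5 ⊢
  exact ⟨_, by simpa [φ.left_inv hx] using h5.symm⟩

/-- In a flow box, the kernel of `dN` is the kernel of the derivative of the first coordinate. -/
lemma IsFlowBox.mvfderiv_eq_zero (h : IsFlowBox (E := E) N ℓ φ p r)
    (hN : ContMDiff 𝓘(ℝ, E) 𝓘(ℝ, R23) ∞ N) (hr : HasRankOne (E := E) N) {x : X} (hx : x ∈ φ.source)
    {v : TangentSpace 𝓘(ℝ, E) x} (hv : ℓ (mvfderiv 𝓘(ℝ, E) N x v) = 0) :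
    mvfderiv 𝓘(ℝ, E) N x v = 0 := by
  obtain ⟨w, hw⟩ := h.exists_ne hN hx
  obtain ⟨α, u, -, -, hdN⟩ := hr x
  rw [hdN, map_smul, smul_eq_mul] at hw hv
  have hu : ℓ u ≠ 0 := right_ne_zero_of_mul_eq_one hw
  rw [hdN, (mul_eq_zero.mp hv).resolve_right hu, zero_smul]

/-- Points of a flow box with the same first coordinate lie on the same leaf. -/
lemma IsFlowBox.rel (h : IsFlowBox (E := E) N ℓ φ p r)
    (hN : ContMDiff 𝓘(ℝ, E) 𝓘(ℝ, R23) ∞ N) (hr : HasRankOne (E := E) N) {x y : X}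
    (hx : x ∈ φ.source) (hy : y ∈ φ.source) (hxy : ℓ (N x) = ℓ (N y)) :
    leafSetoid 𝓘(ℝ, E) N x y := by
  refine Relation.EqvGen.rel _ _ ?_
  -- the plaque through `x` and `y` is traversed by `s(t) = sin² (π t / 2)`, which stays in `[0, 1]`
  set c : ℝ → ℝ × ℝ := fun t => φ x + (Real.sin (Real.pi * t / 2)) ^ 2 • (φ y - φ x) with hc
  have hct : ∀ t, c t ∈ φ.target := by
    intro t
    rw [h.target_eq]
    have h1 := (convex_ball p r).add_smul_sub_mem (x := φ x) (y := φ y)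
      (by rw [← h.target_eq]; exact φ.map_source hx) (by rw [← h.target_eq]; exact φ.map_source hy)
      (t := (Real.sin (Real.pi * t / 2)) ^ 2) ⟨by positivity, Real.sin_sq_le_one _⟩
    exact h1
  have hc1 : ∀ t, (c t).1 = ℓ (N x) := by
    intro t
    simp [hc, h.fst_eq x hx, h.fst_eq y hy, hxy]
  have sc : ContMDiff 𝓘(ℝ, ℝ) 𝓘(ℝ, ℝ × ℝ) ∞ c := by
    refine ContDiff.contMDiff ?_
    have : ContDiff ℝ ∞ fun t : ℝ => Real.sin (Real.pi * t / 2) :=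
      Real.contDiff_sin.comp (by fun_prop)
    exact contDiff_const.add ((this.pow 2).smul contDiff_const)
  have sγ : ContMDiff 𝓘(ℝ, ℝ) 𝓘(ℝ, E) ∞ fun t => φ.symm (c t) := fun t =>
    (h.smooth_symm.contMDiffAt (φ.open_target.mem_nhds (hct t))).comp t (sc t)
  refine ⟨_, sγ, fun t => ?_, ?_, ?_⟩
  · refine h.mvfderiv_eq_zero hN hr (φ.map_target (hct t)) ?_
    have hNd : MDifferentiableAt 𝓘(ℝ, E) 𝓘(ℝ, R23) N (φ.symm (c t)) :=
      hN.mdifferentiableAt (by simp)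
    have hγd : MDifferentiableAt 𝓘(ℝ, ℝ) 𝓘(ℝ, E) (fun t => φ.symm (c t)) t :=
      (sγ t).mdifferentiableAt (by simp)
    have h1 := mvfderiv_comp_mfderiv (J := 𝓘(ℝ, ℝ)) (I := 𝓘(ℝ, E)) (g := N)
      (γ := fun t => φ.symm (c t)) (t := t) hNd hγd (1 : ℝ)
    have hd : MDifferentiableAt 𝓘(ℝ, ℝ) 𝓘(ℝ, R23) (fun t => N (φ.symm (c t))) t := hNd.comp t hγd
    have h2 := mvfderiv_clm_comp (I := 𝓘(ℝ, ℝ)) ℓ hd (1 : ℝ)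
    rw [h1] at h2
    refine h2.symm.trans ?_
    have h3 : (fun t => ℓ (N (φ.symm (c t)))) = fun _ => ℓ (N x) := by
      funext t
      rw [← hc1 t]
      exact h.symm_fst (hct t)
    rw [h3, mvfderiv_const]
    rfl
  · simp only [hc]
    simp [φ.left_inv hx]
  · simp only [hc]
    simp [φ.left_inv hy]

/-- `N` is constant along curves tangent to `Ker dN`. -/
lemma eq_of_tangent_curve (hN : ContMDiff 𝓘(ℝ, E) 𝓘(ℝ, R23) ∞ N) {γ : ℝ → X}
    (sγ : ContMDiff 𝓘(ℝ, ℝ) 𝓘(ℝ, E) ∞ γ)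
    (hγ : ∀ t, mvfderiv 𝓘(ℝ, E) N (γ t) (mfderiv 𝓘(ℝ, ℝ) 𝓘(ℝ, E) γ t (1 : ℝ)) = 0) (s t : ℝ) :
    N (γ s) = N (γ t) := by
  have hNd : ∀ t, MDifferentiableAt 𝓘(ℝ, E) 𝓘(ℝ, R23) N (γ t) := fun t =>
    hN.mdifferentiableAt (by simp)
  have hγd : ∀ t, MDifferentiableAt 𝓘(ℝ, ℝ) 𝓘(ℝ, E) γ t := fun t =>
    (sγ t).mdifferentiableAt (by simp)
  refine eq_of_mvfderiv_eq_zero (I := 𝓘(ℝ, ℝ)) (f := fun t => N (γ t))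
    (fun t => (hNd t).comp t (hγd t)) (fun t => ?_) s t
  ext1
  have h1 := mvfderiv_comp_mfderiv (J := 𝓘(ℝ, ℝ)) (I := 𝓘(ℝ, E)) (hNd t) (hγd t) (1 : ℝ)
  rw [hγ t] at h1
  exact h1

lemma eq_of_leafSetoid (hN : ContMDiff 𝓘(ℝ, E) 𝓘(ℝ, R23) ∞ N) {x y : X}
    (h : leafSetoid 𝓘(ℝ, E) N x y) : N x = N y := by
  induction h with
  | rel x y h =>
    obtain ⟨γ, sγ, hγ, rfl, rfl⟩ := h
    exact eq_of_tangent_curve hN sγ hγ 0 1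
  | refl x => rfl
  | symm x y _ ih => exact ih.symm
  | trans x y z _ _ ih1 ih2 => exact ih1.trans ih2

end FlowBox

/-- The projection to the leaf space is open. -/
lemma isOpenMap_leafSpace [FiniteDimensional ℝ E] (hE : Module.finrank ℝ E = 2)
    [IsManifold 𝓘(ℝ, E) ∞ X] {N : X → R23} (hN : ContMDiff 𝓘(ℝ, E) 𝓘(ℝ, R23) ∞ N)
    (hr : HasRankOne (E := E) N) :
    IsOpenMap (Quotient.mk (leafSetoid 𝓘(ℝ, E) N)) := by
  intro V hV
  set mk := Quotient.mk (leafSetoid 𝓘(ℝ, E) N) with hmk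
  set S := mk ⁻¹' (mk '' V) with hS
  have hSat : ∀ {x y}, leafSetoid 𝓘(ℝ, E) N x y → x ∈ S → y ∈ S := by
    rintro x y hxy ⟨z, hz, hzx⟩
    exact ⟨z, hz, hzx.trans (Quotient.sound hxy)⟩
  -- the interior of the saturation is saturated: along a curve in a leaf, belonging to it is an
  -- open condition, and a closed one since in a flow box the leaf through a point is determined
  -- by the first coordinate
  have key : ∀ {x y}, leafSetoid 𝓘(ℝ, E) N x y → (x ∈ interior S ↔ y ∈ interior S) := by
    intro x y hxy
    induction hxy with
    | rel x y h =>
      obtain ⟨γ, sγ, hγ, rfl, rfl⟩ := h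
      have hconst := eq_of_tangent_curve hN sγ hγ
      have hclopen : IsClopen (γ ⁻¹' interior S) := by
        refine ⟨isClosed_of_closure_subset fun t ht => ?_,
          isOpen_interior.preimage sγ.continuous⟩
        obtain ⟨ℓ, φ, p, r, hbox, hx⟩ := exists_flowBox hE hN hr (γ t)
        have hO : IsOpen (γ ⁻¹' φ.source) := φ.open_source.preimage sγ.continuous
        obtain ⟨s, hs1, hs2⟩ := mem_closure_iff.mp ht _ hO hx
        -- the first coordinates of `interior S ∩ φ.source` form an open set
        have h1 : IsOpen (Prod.fst '' (φ '' (φ.source ∩ interior S))) :=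
          isOpenMap_fst _ (φ.isOpen_image_source_inter isOpen_interior)
        have h2 : IsOpen (φ.source ∩ (fun y => ℓ (N y)) ⁻¹'
            (Prod.fst '' (φ '' (φ.source ∩ interior S)))) :=
          φ.open_source.inter (h1.preimage (ℓ.continuous.comp hN.continuous))
        refine mem_interior.mpr ⟨_, ?_, h2, hx, ?_⟩
        · rintro y ⟨hy, ⟨_, ⟨z, ⟨hz, hzS⟩, rfl⟩, hyz⟩⟩
          have h3 : ℓ (N z) = ℓ (N y) := by rw [← hbox.fst_eq z hz]; exact hyz
          exact hSat (hbox.rel hN hr hz hy h3) (interior_subset hzS)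
        · refine ⟨_, ⟨γ s, ⟨hs1, hs2⟩, rfl⟩, ?_⟩
          rw [hbox.fst_eq _ hs1]
          exact congrArg ℓ (hconst s t)
      rcases isClopen_iff.mp hclopen with h0 | h0
      · exact ⟨fun h => absurd (show (0 : ℝ) ∈ γ ⁻¹' interior S from h) (by rw [h0]; simp),
          fun h => absurd (show (1 : ℝ) ∈ γ ⁻¹' interior S from h) (by rw [h0]; simp)⟩
      · exact ⟨fun _ => show (1 : ℝ) ∈ γ ⁻¹' interior S by rw [h0]; trivial,
          fun _ => show (0 : ℝ) ∈ γ ⁻¹' interior S by rw [h0]; trivial⟩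
    | refl x => rfl
    | symm x y _ ih => exact ih.symm
    | trans x y z _ _ ih1 ih2 => exact ih1.trans ih2
  have hSo : IsOpen S := by
    have : S ⊆ interior S := by
      rintro y ⟨x, hx, hxy⟩
      have hVS : V ⊆ S := fun z hz => ⟨z, hz, rfl⟩
      exact (key (Quotient.exact hxy)).mp (interior_maximal hVS hV hx)
    rw [subset_interior_iff_isOpen] at this
    exact this
  exact isQuotientMap_quotient_mk'.isOpen_preimage.mp hSo

/-- The directrix: the map induced by `N` on the leaf space. -/
def directrix {N : X → R23} (hN : ContMDiff 𝓘(ℝ, E) 𝓘(ℝ, R23) ∞ N) :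
    LeafSpace 𝓘(ℝ, E) N → R23 :=
  Quotient.lift N fun _ _ h => eq_of_leafSetoid hN h

lemma continuous_directrix {N : X → R23} (hN : ContMDiff 𝓘(ℝ, E) 𝓘(ℝ, R23) ∞ N) :
    Continuous (directrix hN) :=
  hN.continuous.quotient_lift _

/-- The chart of the leaf space given by a flow box. -/
def leafChart [FiniteDimensional ℝ E] (hE : Module.finrank ℝ E = 2)
    [IsManifold 𝓘(ℝ, E) ∞ X] {N : X → R23} (hN : ContMDiff 𝓘(ℝ, E) 𝓘(ℝ, R23) ∞ N)
    (hr : HasRankOne (E := E) N) {ℓ : R23 →L[ℝ] ℝ} {φ : OpenPartialHomeomorph X (ℝ × ℝ)}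
    {p : ℝ × ℝ} {r : ℝ} (h : IsFlowBox (E := E) N ℓ φ p r) :
    OpenPartialHomeomorph (LeafSpace 𝓘(ℝ, E) N) ℝ where
  toFun q := ℓ (directrix hN q)
  invFun τ := Quotient.mk _ (φ.symm (τ, p.2))
  source := Quotient.mk _ '' φ.source
  target := Metric.ball p.1 r
  map_source' := by
    rintro _ ⟨x, hx, rfl⟩
    change ℓ (N x) ∈ _
    have h1 := φ.map_source hx
    rw [h.target_eq, ← ball_prod_same, mem_prod, h.fst_eq x hx] at h1
    exact h1.1
  map_target' := by
    intro τ hτ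
    refine ⟨_, φ.map_target ?_, rfl⟩
    rw [h.target_eq, ← ball_prod_same]
    exact ⟨hτ, Metric.mem_ball_self (Metric.pos_of_mem_ball hτ)⟩
  left_inv' := by
    rintro _ ⟨x, hx, rfl⟩
    change Quotient.mk _ (φ.symm (ℓ (N x), p.2)) = _
    have h1 := φ.map_source hx
    rw [h.target_eq, ← ball_prod_same, mem_prod, h.fst_eq x hx] at h1
    have h2 : (ℓ (N x), p.2) ∈ φ.target := by
      rw [h.target_eq, ← ball_prod_same]
      exact ⟨h1.1, Metric.mem_ball_self (Metric.pos_of_mem_ball h1.1)⟩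
    exact Quotient.sound (h.rel hN hr (φ.map_target h2) hx (h.symm_fst h2))
  right_inv' := by
    intro τ hτ
    refine h.symm_fst (z := (τ, p.2)) ?_
    rw [h.target_eq, ← ball_prod_same]
    exact ⟨hτ, Metric.mem_ball_self (Metric.pos_of_mem_ball hτ)⟩
  open_source := isOpenMap_leafSpace hE hN hr _ φ.open_source
  open_target := Metric.isOpen_ball
  continuousOn_toFun := (ℓ.continuous.comp (continuous_directrix hN)).continuousOn
  continuousOn_invFun := by
    refine continuous_quot_mk.comp_continuousOn (φ.symm.continuousOn.comp (by fun_prop) ?_)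
    intro τ hτ
    change (τ, p.2) ∈ φ.target
    rw [h.target_eq, ← ball_prod_same]
    exact ⟨hτ, Metric.mem_ball_self (Metric.pos_of_mem_ball hτ)⟩

/-- The leaf space of a map of rank one is a 1-manifold onto which the surface submerses. -/
theorem exists_leafSpace_manifold [FiniteDimensional ℝ E] (hE : Module.finrank ℝ E = 2)
    [IsManifold 𝓘(ℝ, E) ∞ X] {N : X → R23} (hN : ContMDiff 𝓘(ℝ, E) 𝓘(ℝ, R23) ∞ N)
    (hr : HasRankOne (E := E) N) :
    ∃ (_ : ChartedSpace ℝ (LeafSpace 𝓘(ℝ, E) N)) (_ : IsManifold 𝓘(ℝ, ℝ) ∞ (LeafSpace 𝓘(ℝ, E) N)),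
      ContMDiff 𝓘(ℝ, E) 𝓘(ℝ, ℝ) ∞ (Quotient.mk (leafSetoid 𝓘(ℝ, E) N)) ∧
      (∀ x : X, Function.Surjective
        (mfderiv 𝓘(ℝ, E) 𝓘(ℝ, ℝ) (Quotient.mk (leafSetoid 𝓘(ℝ, E) N)) x)) ∧
      ContMDiff 𝓘(ℝ, ℝ) 𝓘(ℝ, R23) ∞ (directrix hN) := by
  choose ℓ φ p r hbox hx using exists_flowBox hE hN hr
  set mk := Quotient.mk (leafSetoid 𝓘(ℝ, E) N) with hmk
  let chart : X → OpenPartialHomeomorph (LeafSpace 𝓘(ℝ, E) N) ℝ := fun x =>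
    leafChart hE hN hr (hbox x)
  have hsec : ∀ x, ContMDiffOn 𝓘(ℝ, ℝ) 𝓘(ℝ, E) ∞ (fun τ : ℝ => (φ x).symm (τ, (p x).2))
      (Metric.ball (p x).1 (r x)) := by
    intro x
    refine (hbox x).smooth_symm.comp (t := (φ x).target)
      (f := fun τ : ℝ => ((τ, (p x).2) : ℝ × ℝ)) ?_ ?_
    · exact (contDiff_id.prodMk contDiff_const).contMDiff.contMDiffOn
    · intro τ hτ
      change (τ, (p x).2) ∈ (φ x).target
      rw [(hbox x).target_eq, ← ball_prod_same]
      exact ⟨hτ, Metric.mem_ball_self (Metric.pos_of_mem_ball hτ)⟩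
  let cs : ChartedSpace ℝ (LeafSpace 𝓘(ℝ, E) N) :=
    { atlas := range chart
      chartAt := fun q => chart q.out
      mem_chart_source := fun q => ⟨q.out, hx _, Quotient.out_eq q⟩
      chart_mem_atlas := fun q => ⟨_, rfl⟩ }
  have mf : IsManifold 𝓘(ℝ, ℝ) ∞ (LeafSpace 𝓘(ℝ, E) N) := by
    refine isManifold_of_contDiffOn _ _ _ ?_
    rintro _ _ ⟨x, rfl⟩ ⟨y, rfl⟩
    have h1 : ContDiffOn ℝ ∞ (fun τ : ℝ => ℓ y (N ((φ x).symm (τ, (p x).2))))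
        (Metric.ball (p x).1 (r x)) :=
      (ℓ y).contDiff.comp_contDiffOn (contMDiffOn_iff_contDiffOn.mp (hN.comp_contMDiffOn (hsec x)))
    refine h1.mono ?_
    rintro τ ⟨hτ, -⟩
    simp only [OpenPartialHomeomorph.trans_source] at hτ
    exact hτ.1
  refine ⟨cs, mf, ?_⟩
  -- charts are smooth, with smooth inverses
  have hchart : ∀ q, ContMDiffAt 𝓘(ℝ, ℝ) 𝓘(ℝ, ℝ) ∞ (fun q' => ℓ q.out (directrix hN q')) q := by
    intro q
    exact (contMDiffOn_chart (I := 𝓘(ℝ, ℝ)) (x := q)).contMDiffAt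
      ((chartAt ℝ q).open_source.mem_nhds (mem_chart_source ℝ q))
  have hΓ : ContMDiff 𝓘(ℝ, ℝ) 𝓘(ℝ, R23) ∞ (directrix hN) := by
    intro q
    have h1 : ContMDiffAt 𝓘(ℝ, ℝ) 𝓘(ℝ, R23) ∞
        (fun q' => N ((φ q.out).symm (ℓ q.out (directrix hN q'), (p q.out).2))) q := by
      have h2 : ContMDiffAt 𝓘(ℝ, ℝ) 𝓘(ℝ, E) ∞ (fun τ : ℝ => (φ q.out).symm (τ, (p q.out).2))
          (ℓ q.out (directrix hN q)) :=
        (hsec q.out).contMDiffAt (Metric.isOpen_ball.mem_nhds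
          ((chartAt ℝ q).map_source (mem_chart_source ℝ q)))
      have h3 : ContMDiffAt 𝓘(ℝ, ℝ) 𝓘(ℝ, R23) ∞ (fun τ : ℝ => N ((φ q.out).symm (τ, (p q.out).2)))
          (ℓ q.out (directrix hN q)) := hN.contMDiffAt.comp _ h2
      exact ContMDiffAt.comp (g := fun τ : ℝ => N ((φ q.out).symm (τ, (p q.out).2)))
        (f := fun q' => ℓ q.out (directrix hN q')) q h3 (hchart q)
    refine h1.congr_of_eventuallyEq ?_
    filter_upwards [(chartAt ℝ q).open_source.mem_nhds (mem_chart_source ℝ q)] with q' hq'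
    have h3 := (chartAt ℝ q).left_inv hq'
    change mk ((φ q.out).symm (ℓ q.out (directrix hN q'), (p q.out).2)) = q' at h3
    conv_lhs => rw [← h3]
    rfl
  have hmk_smooth : ContMDiff 𝓘(ℝ, E) 𝓘(ℝ, ℝ) ∞ mk := by
    intro x
    have hcont : Continuous mk := continuous_quot_mk
    refine (contMDiffAt_iff_target (I' := 𝓘(ℝ, ℝ))).mpr ⟨hcont.continuousAt, ?_⟩
    have h1 : ContMDiffAt 𝓘(ℝ, E) 𝓘(ℝ, ℝ) ∞ (fun y => ℓ (mk x).out (N y)) x :=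
      (ℓ (mk x).out).contDiff.contMDiff.comp hN x
    exact h1
  refine ⟨hmk_smooth, fun x => ?_, hΓ⟩
  -- the composition with `N = Γ ∘ mk` shows that the derivative does not vanish
  obtain ⟨α, u, hα, hu, hdN⟩ := hr x
  obtain ⟨v, hv⟩ : ∃ v, α v ≠ 0 := by
    by_contra! hcon
    exact hα (LinearMap.ext hcon)
  have h1 : mfderiv 𝓘(ℝ, E) 𝓘(ℝ, ℝ) mk x v ≠ 0 := by
    intro h0
    have hd1 : MDifferentiableAt 𝓘(ℝ, ℝ) 𝓘(ℝ, R23) (directrix hN) (mk x) :=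
      hΓ.mdifferentiableAt (by simp)
    have hd2 : MDifferentiableAt 𝓘(ℝ, E) 𝓘(ℝ, ℝ) mk x := hmk_smooth.mdifferentiableAt (by simp)
    have h2 := mvfderiv_comp_mfderiv hd1 hd2 v
    rw [h0, map_zero] at h2
    have h3 : (fun t => directrix hN (mk t)) = N := rfl
    rw [h3, hdN] at h2
    exact (smul_ne_zero hv hu) h2
  intro w
  have h4 : ∀ a b : ℝ, b ≠ 0 → ∃ c : ℝ, c • b = a := fun a b hb => ⟨a / b, div_mul_cancel₀ a hb⟩
  obtain ⟨c, hc⟩ := h4 w _ h1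
  refine ⟨c • v, ?_⟩
  rw [map_smul]
  exact hc

end Leaves

/-! ### Null frames adapted to isotropic planes -/

/-- The two null planes `P ∧ A` and `A ∧ Q` of a null frame have opposite time orientations. -/
lemma IsNullFrame.minor_AQ_neg_iff {P A B N Q : R23} (h : IsNullFrame P A B N Q) :
    minor A Q < 0 ↔ 0 < minor P A := by
  have hBA : sp B A = -2 := by rw [sp_comm, h.AB]
  have hQP : sp Q P = -1 := by rw [sp_comm, h.PQ]
  have hAP : sp A P = 0 := by rw [sp_comm, h.PA]
  have hBP : sp B P = 0 := by rw [sp_comm, h.PB]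
  have hQA : sp Q A = 0 := by rw [sp_comm, h.AQ]
  have hQB : sp Q B = 0 := by rw [sp_comm, h.BQ]
  have hneg : ∀ a b : ℝ, (a ≠ 0 ∨ b ≠ 0) →
      sp (a • (P + Q) + b • (A + B)) (a • (P + Q) + b • (A + B)) < 0 := by
    intro a b hab
    simp only [sp_add_left, sp_add_right, sp_smul_left, sp_smul_right, hBA, hQP, hAP, hBP, hQA, hQB,
      h.PP, h.PA, h.PB, h.PQ, h.AA, h.AB, h.AQ, h.BB, h.BQ, h.QQ]
    rcases hab with h0 | h0 <;> have := pow_pos (abs_pos.mpr h0) 2 <;> rw [sq_abs] at this <;>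
      nlinarith [sq_nonneg a, sq_nonneg b]
  have h1 := bisp_mul_minor_pos (V := P) (W := A) hneg
    (by simpa using h.linearIndependent_PA (s := 1) (t := 0) (by simp)) fun a b => by
      simp [sp_add_left, sp_add_right, sp_smul_left, sp_smul_right, h.PP, h.PA, h.AA, hAP]
  have h2 := bisp_mul_minor_pos (V := A) (W := Q) hneg
    (by
      rw [LinearIndependent.pair_iff]
      intro s t hst
      have e1 := congrArg (sp B) hst
      have e2 := congrArg (sp P) hst
      simp only [sp_add_right, sp_smul_right, sp_zero_right, hBA, h.BQ, h.PA, h.PQ] at e1 e2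
      exact ⟨by linarith, by linarith⟩) fun a b => by
      simp [sp_add_left, sp_add_right, sp_smul_left, sp_smul_right, h.AA, h.AQ, h.QQ, hQA]
  have e1 : bisp (P + Q) (A + B) P A = 2 := by
    simp only [bisp, sp_add_left, h.PP, hQP, h.AA, hBA, hAP, hBP, h.PA, hQA]; ring
  have e2 : bisp (P + Q) (A + B) A Q = -2 := by
    simp only [bisp, sp_add_left, h.PA, hQA, h.AQ, h.BQ, h.AA, hBA, h.PQ, h.QQ]; ring
  rw [e1] at h1
  rw [e2] at h2
  have h3 : 0 < minor (P + Q) (A + B) * minor P A := by linarith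
  have h4 : minor (P + Q) (A + B) * minor A Q < 0 := by linarith
  constructor
  · intro h5
    have : 0 < minor (P + Q) (A + B) := by
      by_contra h6
      nlinarith [mul_nonneg_of_nonpos_of_nonpos (not_lt.mp h6) h5.le]
    exact (mul_pos_iff_of_pos_left this).mp h3
  · intro h5
    have : 0 < minor (P + Q) (A + B) := (mul_pos_iff_of_pos_right h5).mp h3
    by_contra h6
    nlinarith [mul_nonneg this.le (not_lt.mp h6)]

lemma minor_ne_zero_of_isotropic {U V : R23} (hli : LinearIndependent ℝ ![U, V]) (UU : sp U U = 0)
    (UV : sp U V = 0) (VV : sp V V = 0) : minor U V ≠ 0 :=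
  minor_ne_zero hli fun a b => by
    simp [sp_add_left, sp_add_right, sp_smul_left, sp_smul_right, UU, UV, VV, sp_comm V U]

/-- An isotropic plane and a unit vector orthogonal to it are part of a null frame. -/
lemma exists_isNullFrame_of_isotropic {U V N : R23} (hli : LinearIndependent ℝ ![U, V])
    (UU : sp U U = 0) (UV : sp U V = 0) (VV : sp V V = 0) (NN : sp N N = 1) (UN : sp U N = 0)
    (VN : sp V N = 0) : ∃ P B, IsNullFrame P U B N V := by
  have hm := minor_ne_zero_of_isotropic hli UU UV VV
  have NU : sp N U = 0 := by rw [sp_comm, UN]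
  have NV : sp N V = 0 := by rw [sp_comm, VN]
  have VU : sp V U = 0 := by rw [sp_comm, UV]
  have hdual : ∀ a b : ℝ, ∃ X, sp X U = a ∧ sp X V = b ∧ sp X N = 0 := by
    intro a b
    -- solve for `X` in `span {P₀, P₁}`, then remove the component along `N`
    set X₀ := ((a * sp V (stdP 1) - b * sp U (stdP 1)) / minor U V) • stdP 0 +
      ((b * sp U (stdP 0) - a * sp V (stdP 0)) / minor U V) • stdP 1 with hX₀
    have h1 : sp X₀ U = a := by
      rw [hX₀, sp_add_left, sp_smul_left, sp_smul_left, sp_comm (stdP 0), sp_comm (stdP 1)]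
      field_simp
      simp only [minor]; ring
    have h2 : sp X₀ V = b := by
      rw [hX₀, sp_add_left, sp_smul_left, sp_smul_left, sp_comm (stdP 0), sp_comm (stdP 1)]
      field_simp
      simp only [minor]; ring
    refine ⟨X₀ - sp X₀ N • N, ?_, ?_, ?_⟩ <;>
      simp [sp_sub_left, sp_smul_left, NU, NV, NN, h1, h2]
  obtain ⟨P₁, PU, PV, PN⟩ := hdual 0 (-1)
  obtain ⟨B₁, BU, BV, BN⟩ := hdual (-2) 0
  have UP : sp U P₁ = 0 := by rw [sp_comm, PU]
  have VP : sp V P₁ = -1 := by rw [sp_comm, PV]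
  have UB : sp U B₁ = -2 := by rw [sp_comm, BU]
  have VB : sp V B₁ = 0 := by rw [sp_comm, BV]
  have hc : sp P₁ B₁ = sp B₁ P₁ := sp_comm _ _
  refine ⟨P₁ + (1 / 2 * sp P₁ P₁) • V, B₁ + (1 / 4 * sp B₁ B₁) • U + sp B₁ P₁ • V, ?_⟩
  constructor <;>
    simp only [sp_add_left, sp_add_right, sp_smul_left, sp_smul_right, UU, UV, VV, VU, UN, VN, NN,
      NV, PU, PV, PN, BU, BV, BN, VP, UB, VB, hc] <;> ring

/-- The orthogonal complement of `A`, `N` and `Q` in a null frame. -/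
lemma IsNullFrame.eq_comb {P A B N Q X : R23} (h : IsNullFrame P A B N Q) (hA : sp X A = 0)
    (hN : sp X N = 0) (hQ : sp X Q = 0) : X = (-(1 / 2) * sp X B) • A + (-sp X P) • Q := by
  refine h.eq_of_sp ?_ ?_ ?_ ?_ ?_ <;>
    simp only [sp_add_left, sp_smul_left, hA, hN, hQ, h.AA, h.AB, h.AN, h.AQ, h.QQ, sp_comm Q A,
      sp_comm Q P, sp_comm Q B, sp_comm Q N, sp_comm A P, h.PA, h.PQ, h.BQ, h.NQ] <;> ring

/-! ### Line elements on curves -/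

section Curves

variable {L : Type*} [TopologicalSpace L] [ChartedSpace ℝ L] [IsManifold 𝓘(ℝ, ℝ) ∞ L]
  {V : Type*} [NormedAddCommGroup V] [NormedSpace ℝ V]
  {ξ ξ' : ∀ t : L, TangentSpace 𝓘(ℝ, ℝ) t} {U : Set L}

/-- A smooth nowhere zero vector field on an open set of a curve. -/
structure IsFieldOn (ξ : ∀ t : L, TangentSpace 𝓘(ℝ, ℝ) t) (U : Set L) : Prop where
  isOpen : IsOpen U
  smooth : ContMDiffOn 𝓘(ℝ, ℝ) 𝓘(ℝ, ℝ).tangent ∞ (fun t => (⟨t, ξ t⟩ : TangentBundle 𝓘(ℝ, ℝ) L)) U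
  ne_zero : ∀ t ∈ U, ξ t ≠ 0

lemma IsLineElement.isFieldOn (h : IsLineElement ξ) : IsFieldOn ξ univ :=
  ⟨isOpen_univ, h.1.contMDiffOn, fun t _ => h.2 t⟩

lemma IsFieldOn.mono (h : IsFieldOn ξ U) {U' : Set L} (hU' : IsOpen U') (hsub : U' ⊆ U) :
    IsFieldOn ξ U' :=
  ⟨hU', h.smooth.mono hsub, fun t ht => h.ne_zero t (hsub ht)⟩

lemma contMDiffOn_der (h : IsFieldOn ξ U) {F : L → V} (hF : ContMDiffOn 𝓘(ℝ, ℝ) 𝓘(ℝ, V) ∞ F U) :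
    ContMDiffOn 𝓘(ℝ, ℝ) 𝓘(ℝ, V) ∞ (der ξ F) U :=
  contMDiffOn_mvfderiv_apply h.isOpen hF h.smooth

omit [IsManifold 𝓘(ℝ, ℝ) ∞ L] in
lemma exists_smul_eq_of_ne_zero {t : L} {u : TangentSpace 𝓘(ℝ, ℝ) t} (hu : u ≠ 0)
    (v : TangentSpace 𝓘(ℝ, ℝ) t) : ∃ c : ℝ, v = c • u := by
  have key : ∀ a b : ℝ, b ≠ 0 → ∃ c : ℝ, a = c • b := fun a b hb =>
    ⟨a / b, (div_mul_cancel₀ a hb).symm⟩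
  exact key v u hu

omit [IsManifold 𝓘(ℝ, ℝ) ∞ L] in
lemma mvfderiv_eq_zero_of_der {F : L → V} {t : L} (hξ : ξ t ≠ 0) (h : der ξ F t = 0) :
    mvfderiv 𝓘(ℝ, ℝ) F t = 0 := by
  refine ContinuousLinearMap.ext fun v => ?_
  obtain ⟨c, rfl⟩ := exists_smul_eq_of_ne_zero hξ v
  rw [map_smul, show mvfderiv 𝓘(ℝ, ℝ) F t (ξ t) = 0 from h, smul_zero]
  rfl

/-- Near every point there is a nowhere zero smooth vector field. -/
lemma exists_isFieldOn (t : L) : ∃ (U : Set L) (ξ : ∀ t : L, TangentSpace 𝓘(ℝ, ℝ) t),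
    t ∈ U ∧ IsFieldOn ξ U := by
  set e := trivializationAt ℝ (TangentSpace 𝓘(ℝ, ℝ) : L → Type _) t with he
  set b := Module.Basis.singleton (Fin 1) ℝ with hb
  refine ⟨e.baseSet, e.localFrame b 0, FiberBundle.mem_baseSet_trivializationAt' t, e.open_baseSet,
    e.contMDiffOn_localFrame_baseSet ∞ b 0, fun s hs => ?_⟩
  rw [e.localFrame_apply_of_mem_baseSet b hs]
  exact (e.basisAt b hs).ne_zero 0

/-- Two vector fields on a curve differ by a smooth factor. -/
lemma IsFieldOn.exists_smul_eq (h : IsFieldOn ξ U) (h' : IsFieldOn ξ' U) :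
    ∃ g : L → ℝ, ContMDiffOn 𝓘(ℝ, ℝ) 𝓘(ℝ, ℝ) ∞ g U ∧ ∀ t ∈ U, ξ' t = g t • ξ t := by
  have hex : ∀ t : L, ∃ c : ℝ, t ∈ U → ξ' t = c • ξ t := fun t => by
    by_cases ht : t ∈ U
    · obtain ⟨c, hc⟩ := exists_smul_eq_of_ne_zero (h.ne_zero t ht) (ξ' t)
      exact ⟨c, fun _ => hc⟩
    · exact ⟨0, fun h => absurd h ht⟩
  choose g hg using hex
  refine ⟨g, fun t ht => ?_, hg⟩
  set e := trivializationAt ℝ (TangentSpace 𝓘(ℝ, ℝ) : L → Type _) t with he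
  set b := Module.Basis.singleton (Fin 1) ℝ with hb
  have hte : t ∈ e.baseSet := FiberBundle.mem_baseSet_trivializationAt' t
  set c := e.localFrameCoeff 𝓘(ℝ, ℝ) b 0 with hc
  have h1 : ContMDiffAt 𝓘(ℝ, ℝ) 𝓘(ℝ, ℝ) ∞ (fun s => c s (ξ s)) t :=
    _root_.contMDiffAt_localFrameCoeff b hte ((h.smooth t ht).contMDiffAt (h.isOpen.mem_nhds ht)) 0
  have h2 : ContMDiffAt 𝓘(ℝ, ℝ) 𝓘(ℝ, ℝ) ∞ (fun s => c s (ξ' s)) t :=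
    _root_.contMDiffAt_localFrameCoeff b hte ((h'.smooth t ht).contMDiffAt (h.isOpen.mem_nhds ht)) 0
  have h3 : ∀ s ∈ e.baseSet ∩ U, c s (ξ s) ≠ 0 := by
    rintro s ⟨hs, hsU⟩ h0
    have h4 := e.eq_sum_localFrameCoeff_smul (I := 𝓘(ℝ, ℝ)) (b := b) (s := ξ) hs
    rw [Fin.sum_univ_one] at h4
    refine h.ne_zero s hsU ?_
    rw [h4]
    change c s (ξ s) • _ = _
    rw [h0, zero_smul]
  refine ContMDiffAt.contMDiffWithinAt ?_
  refine ContMDiffAt.congr_of_eventuallyEq (f := fun s => c s (ξ' s) / c s (ξ s)) ?_ ?_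
  · exact h2.div₀ h1 (h3 t ⟨hte, ht⟩)
  · filter_upwards [(e.open_baseSet.inter h.isOpen).mem_nhds ⟨hte, ht⟩] with s hs
    rw [hg s hs.2, map_smul, smul_eq_mul, mul_div_assoc, div_self (h3 s hs), mul_one]

/-- Change of the line element. -/
lemma IsFieldOn.der_smul (h : IsFieldOn ξ U) {g : L → ℝ}
    (hg : ContMDiffOn 𝓘(ℝ, ℝ) 𝓘(ℝ, ℝ) ∞ g U) (hξ' : ∀ t ∈ U, ξ' t = g t • ξ t) {F : L → V}
    (hF : ContMDiffOn 𝓘(ℝ, ℝ) 𝓘(ℝ, V) ∞ F U) {t : L} (ht : t ∈ U) :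
    der ξ' F t = g t • der ξ F t ∧ der ξ' (der ξ' F) t =
      (g t * der ξ g t) • der ξ F t + (g t) ^ 2 • der ξ (der ξ F) t := by
  have h1 : ∀ s ∈ U, der ξ' F s = g s • der ξ F s := fun s hs => by
    unfold der; rw [hξ' s hs, map_smul]
  refine ⟨h1 t ht, ?_⟩
  have h2 : der ξ' F =ᶠ[𝓝 t] fun s => g s • der ξ F s := by
    filter_upwards [h.isOpen.mem_nhds ht] with s hs using h1 s hs
  change mvfderiv 𝓘(ℝ, ℝ) (der ξ' F) t (ξ' t) = _
  rw [mvfderiv_congr h2, hξ' t ht, map_smul,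
    mvfderiv_smul_apply (mdifferentiableAt_of_contMDiffOn h.isOpen hg ht)
      (mdifferentiableAt_of_contMDiffOn h.isOpen (contMDiffOn_der h hF) ht)]
  change g t • (g t • der ξ (der ξ F) t + der ξ g t • der ξ F t) = _
  module

/-! ### Isotropic line elements -/

/-- With respect to `ξ`, the curve `Γ` is biisotropic on `U`. -/
def IsIsotropicOn (Γ : L → R23) (ξ : ∀ t : L, TangentSpace 𝓘(ℝ, ℝ) t) (U : Set L) : Prop :=
  ∀ t ∈ U, sp (der ξ Γ t) (der ξ Γ t) = 0 ∧ sp (der ξ (der ξ Γ) t) (der ξ (der ξ Γ) t) = 0 ∧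
    LinearIndependent ℝ ![der ξ Γ t, der ξ (der ξ Γ) t]

omit [IsManifold 𝓘(ℝ, ℝ) ∞ L] in
lemma der_sp {F G : L → R23} {t : L} (hF : MDifferentiableAt 𝓘(ℝ, ℝ) 𝓘(ℝ, R23) F t)
    (hG : MDifferentiableAt 𝓘(ℝ, ℝ) 𝓘(ℝ, R23) G t) :
    der ξ (fun s => sp (F s) (G s)) t = sp (der ξ F t) (G t) + sp (F t) (der ξ G t) :=
  mvfderiv_sp hF hG _

omit [IsManifold 𝓘(ℝ, ℝ) ∞ L] in
lemma der_eq_zero_of_eqOn_const {F : L → V} {c : V} (hU : IsOpen U) (h : ∀ t ∈ U, F t = c) {t : L}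
    (ht : t ∈ U) : der ξ F t = 0 := by
  have h1 : F =ᶠ[𝓝 t] fun _ => c := by
    filter_upwards [hU.mem_nhds ht] with s hs using h s hs
  unfold der
  rw [mvfderiv_congr h1, mvfderiv_const]
  rfl

variable {Γ : L → R23}

/-- The derivatives of a biisotropic curve: the third one is a combination of the first two. -/
lemma IsIsotropicOn.relations (hξ : IsFieldOn ξ U) (sΓ : ContMDiffOn 𝓘(ℝ, ℝ) 𝓘(ℝ, R23) ∞ Γ U)
    (hΓ : ∀ t ∈ U, sp (Γ t) (Γ t) = 1) (h : IsIsotropicOn Γ ξ U) {t : L} (ht : t ∈ U) :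
    sp (Γ t) (der ξ Γ t) = 0 ∧ sp (Γ t) (der ξ (der ξ Γ) t) = 0 ∧
      sp (der ξ Γ t) (der ξ (der ξ Γ) t) = 0 ∧
      ∃ a b : ℝ, der ξ (der ξ (der ξ Γ)) t = a • der ξ Γ t + b • der ξ (der ξ Γ) t := by
  have s1 := contMDiffOn_der hξ sΓ
  have s2 := contMDiffOn_der hξ s1
  have d0 : ∀ s ∈ U, MDifferentiableAt 𝓘(ℝ, ℝ) 𝓘(ℝ, R23) Γ s := fun s hs =>
    mdifferentiableAt_of_contMDiffOn hξ.isOpen sΓ hs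
  have d1 : ∀ s ∈ U, MDifferentiableAt 𝓘(ℝ, ℝ) 𝓘(ℝ, R23) (der ξ Γ) s := fun s hs =>
    mdifferentiableAt_of_contMDiffOn hξ.isOpen s1 hs
  have d2 : ∀ s ∈ U, MDifferentiableAt 𝓘(ℝ, ℝ) 𝓘(ℝ, R23) (der ξ (der ξ Γ)) s := fun s hs =>
    mdifferentiableAt_of_contMDiffOn hξ.isOpen s2 hs
  have e1 : ∀ s ∈ U, sp (Γ s) (der ξ Γ s) = 0 := fun s hs => by
    have := der_sp (ξ := ξ) (d0 s hs) (d0 s hs)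
    rw [der_eq_zero_of_eqOn_const hξ.isOpen hΓ hs, sp_comm (der ξ Γ s)] at this
    linarith
  have e2 : ∀ s ∈ U, sp (der ξ Γ s) (der ξ (der ξ Γ) s) = 0 := fun s hs => by
    have := der_sp (ξ := ξ) (d1 s hs) (d1 s hs)
    rw [der_eq_zero_of_eqOn_const hξ.isOpen (fun s hs => (h s hs).1) hs, sp_comm (der ξ
      (der ξ Γ) s)]
      at this
    linarith
  have e3 : ∀ s ∈ U, sp (Γ s) (der ξ (der ξ Γ) s) = 0 := fun s hs => by
    have := der_sp (ξ := ξ) (d0 s hs) (d1 s hs)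
    rw [der_eq_zero_of_eqOn_const hξ.isOpen e1 hs, (h s hs).1] at this
    linarith
  have e4 : sp (Γ t) (der ξ (der ξ (der ξ Γ)) t) = 0 := by
    have := der_sp (ξ := ξ) (d0 t ht) (d2 t ht)
    rw [der_eq_zero_of_eqOn_const hξ.isOpen e3 ht, e2 t ht] at this
    linarith
  have e5 : sp (der ξ Γ t) (der ξ (der ξ (der ξ Γ)) t) = 0 := by
    have := der_sp (ξ := ξ) (d1 t ht) (d2 t ht)
    rw [der_eq_zero_of_eqOn_const hξ.isOpen e2 ht, (h t ht).2.1] at this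
    linarith
  have e6 : sp (der ξ (der ξ Γ) t) (der ξ (der ξ (der ξ Γ)) t) = 0 := by
    have := der_sp (ξ := ξ) (d2 t ht) (d2 t ht)
    rw [der_eq_zero_of_eqOn_const hξ.isOpen (fun s hs => (h s hs).2.1) ht,
      sp_comm (der ξ (der ξ (der ξ Γ)) t)] at this
    linarith
  refine ⟨e1 t ht, e3 t ht, e2 t ht, ?_⟩
  obtain ⟨h1, h2, h3⟩ := h t ht
  obtain ⟨P, B, hF⟩ := exists_isNullFrame_of_isotropic h3 h1 (e2 t ht) h2 (hΓ t ht)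
    (by rw [sp_comm]; exact e1 t ht) (by rw [sp_comm]; exact e3 t ht)
  exact ⟨_, _, hF.eq_comb (by rw [sp_comm, e5]) (by rw [sp_comm, e4]) (by rw [sp_comm, e6])⟩

lemma IsIsotropicOn.minor_ne_zero (hξ : IsFieldOn ξ U) (sΓ : ContMDiffOn 𝓘(ℝ, ℝ) 𝓘(ℝ, R23) ∞ Γ U)
    (hΓ : ∀ t ∈ U, sp (Γ t) (Γ t) = 1) (h : IsIsotropicOn Γ ξ U) {t : L} (ht : t ∈ U) :
    minor (der ξ Γ t) (der ξ (der ξ Γ) t) ≠ 0 :=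
  minor_ne_zero_of_isotropic (h t ht).2.2 (h t ht).1 (h.relations hξ sΓ hΓ ht).2.2.1 (h t ht).2.1

/-- Change of the line element of a biisotropic curve. -/
lemma IsIsotropicOn.smul (hξ : IsFieldOn ξ U) (sΓ : ContMDiffOn 𝓘(ℝ, ℝ) 𝓘(ℝ, R23) ∞ Γ U)
    (hΓ : ∀ t ∈ U, sp (Γ t) (Γ t) = 1) (h : IsIsotropicOn Γ ξ U) {g : L → ℝ}
    (hg : ContMDiffOn 𝓘(ℝ, ℝ) 𝓘(ℝ, ℝ) ∞ g U) (hg0 : ∀ t ∈ U, g t ≠ 0)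
    (hξ' : ∀ t ∈ U, ξ' t = g t • ξ t) :
    IsIsotropicOn Γ ξ' U ∧ ∀ t ∈ U, minor (der ξ' Γ t) (der ξ' (der ξ' Γ) t) =
      g t ^ 3 * minor (der ξ Γ t) (der ξ (der ξ Γ) t) := by
  refine ⟨fun t ht => ?_, fun t ht => ?_⟩ <;> obtain ⟨e1, e2⟩ := hξ.der_smul hg hξ' sΓ ht
  · obtain ⟨h1, h2, h3⟩ := h t ht
    have h4 := (h.relations hξ sΓ hΓ ht).2.2.1
    rw [e1, e2]
    refine ⟨by simp [sp_smul_left, sp_smul_right, h1],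
      by simp [sp_add_left, sp_add_right, sp_smul_left, sp_smul_right, h1, h2, h4,
        sp_comm (der ξ (der ξ Γ) t) (der ξ Γ t)], ?_⟩
    rw [LinearIndependent.pair_iff] at h3 ⊢
    intro a b hab
    obtain ⟨h5, h6⟩ := h3 (a * g t + b * (g t * der ξ g t)) (b * g t ^ 2) (by rw [← hab]; module)
    have hb : b = 0 := (mul_eq_zero.mp h6).resolve_right (pow_ne_zero 2 (hg0 t ht))
    rw [hb, zero_mul, add_zero] at h5
    exact ⟨(mul_eq_zero.mp h5).resolve_right (hg0 t ht), hb⟩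
  · rw [e1, e2]
    have := minor_smul_add (g t) 0 (g t * der ξ g t) (g t ^ 2) (der ξ Γ t) (der ξ (der ξ Γ) t)
    rw [zero_smul, add_zero] at this
    rw [this]; ring

/-- Near every point, the line element can be normalized such that the time orientation minor of
`Γ' ∧ Γ''` is `-1`. -/
lemma exists_normalized (hξ : IsFieldOn ξ U) (sΓ : ContMDiffOn 𝓘(ℝ, ℝ) 𝓘(ℝ, R23) ∞ Γ U)
    (hΓ : ∀ t ∈ U, sp (Γ t) (Γ t) = 1) (h : IsIsotropicOn Γ ξ U) {t : L} (ht : t ∈ U) :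
    ∃ (U' : Set L) (ξ' : ∀ t : L, TangentSpace 𝓘(ℝ, ℝ) t), t ∈ U' ∧ IsFieldOn ξ' U' ∧
      IsIsotropicOn Γ ξ' U' ∧ ∀ s ∈ U', minor (der ξ' Γ s) (der ξ' (der ξ' Γ) s) = -1 := by
  set m : L → ℝ := fun s => minor (der ξ Γ s) (der ξ (der ξ Γ) s) with hm
  have s1 := contMDiffOn_der hξ sΓ
  have s2 := contMDiffOn_der hξ s1
  have sm : ContMDiffOn 𝓘(ℝ, ℝ) 𝓘(ℝ, ℝ) ∞ m U := by
    have hc : ∀ {F : L → R23} (X : R23), ContMDiffOn 𝓘(ℝ, ℝ) 𝓘(ℝ, R23) ∞ F U →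
      ContMDiffOn 𝓘(ℝ, ℝ) 𝓘(ℝ, ℝ) ∞ (fun s => sp (F s) X) U := fun X hF =>
        contMDiffOn_sp hF contMDiffOn_const
    exact (contMDiffOn_mul (hc _ s1) (hc _ s2)).sub (contMDiffOn_mul (hc _ s1) (hc _ s2))
  have hm0 : m t ≠ 0 := h.minor_ne_zero hξ sΓ hΓ ht
  obtain ⟨σ, hσ, hσm⟩ : ∃ σ : ℝ, σ * σ = 1 ∧ 0 < σ * m t := by
    rcases lt_or_gt_of_ne hm0 with h0 | h0
    · exact ⟨-1, by norm_num, by linarith⟩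
    · exact ⟨1, by norm_num, by linarith⟩
  obtain ⟨O, hO, hOU⟩ := (continuousOn_iff'.mp (continuousOn_const.mul sm.continuousOn :
    ContinuousOn (fun s => σ * m s) U)) (Ioi 0) isOpen_Ioi
  set U' := U ∩ (fun s => σ * m s) ⁻¹' Ioi 0 with hU'
  have hU'o : IsOpen U' := by
    rw [hU', inter_comm]; change IsOpen (((fun _ => σ) * m) ⁻¹' Ioi 0 ∩ U); rw
      [hOU]; exact hO.inter hξ.isOpen
  have hsub : U' ⊆ U := inter_subset_left
  set g : L → ℝ := fun s => -σ * (σ * m s) ^ (-(1 / 3) : ℝ) with hg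
  have sg : ContMDiffOn 𝓘(ℝ, ℝ) 𝓘(ℝ, ℝ) ∞ g U' := by
    intro s hs
    have h1 : ContMDiffAt 𝓘(ℝ, ℝ) 𝓘(ℝ, ℝ) ∞ (fun s => σ * m s) s :=
      contMDiffAt_const.mul (sm.contMDiffAt (hξ.isOpen.mem_nhds (hsub hs)))
    have h2 : ContDiffAt ℝ ∞ (fun r : ℝ => -σ * r ^ (-(1 / 3) : ℝ)) (σ * m s) :=
      contDiffAt_const.mul (Real.contDiffAt_rpow_const_of_ne (ne_of_gt hs.2))
    exact (h2.contMDiffAt.comp s h1).contMDiffWithinAt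
  have hg3 : ∀ s ∈ U', g s ^ 3 * m s = -1 := by
    intro s hs
    have h1 : 0 < σ * m s := hs.2
    have h2 : ((σ * m s) ^ (-(1 / 3) : ℝ)) ^ 3 = (σ * m s)⁻¹ := by
      rw [← Real.rpow_natCast, ← Real.rpow_mul h1.le, ← Real.rpow_neg_one]
      norm_num
    have h3 : m s ≠ 0 := right_ne_zero_of_mul h1.ne'
    have h4 : σ ≠ 0 := left_ne_zero_of_mul h1.ne'
    rw [hg]
    simp only [mul_pow, h2]
    field_simp
    linear_combination -hσ
  have hg0 : ∀ s ∈ U', g s ≠ 0 := fun s hs h0 => by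
    have := hg3 s hs
    rw [h0] at this
    norm_num at this
  have key := IsIsotropicOn.smul (ξ' := fun s => g s • ξ s) (hξ.mono hU'o hsub) (sΓ.mono hsub)
    (fun s hs => hΓ s (hsub hs)) (fun s hs => h s (hsub hs)) sg hg0 (fun s _ => rfl)
  refine ⟨U', fun s => g s • ξ s, ⟨ht, hσm⟩, ⟨hU'o, ?_, fun s hs =>
    smul_ne_zero (hg0 s hs) (hξ.ne_zero s (hsub hs))⟩, key.1, fun s hs => ?_⟩
  · exact ContMDiffOn.smul_section sg (hξ.smooth.mono hsub)
  · rw [key.2 s hs]; exact hg3 s hs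

/-- A curve that is biisotropic near every point has a global normalized line element. -/
theorem exists_global_normalized (sΓ : ContMDiff 𝓘(ℝ, ℝ) 𝓘(ℝ, R23) ∞ Γ)
    (hΓ : ∀ t, sp (Γ t) (Γ t) = 1)
    (h : ∀ t : L, ∃ (U : Set L) (ξ : ∀ t : L, TangentSpace 𝓘(ℝ, ℝ) t), t ∈ U ∧ IsFieldOn ξ U ∧
      IsIsotropicOn Γ ξ U) :
    ∃ ξ : ∀ t : L, TangentSpace 𝓘(ℝ, ℝ) t, IsLineElement ξ ∧ IsIsotropicOn Γ ξ univ ∧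
      ∀ t, minor (der ξ Γ t) (der ξ (der ξ Γ) t) = -1 := by
  have h1 : ∀ t : L, ∃ (U' : Set L) (ξ' : ∀ t : L, TangentSpace 𝓘(ℝ, ℝ) t), t ∈ U' ∧
      IsFieldOn ξ' U' ∧ IsIsotropicOn Γ ξ' U' ∧
      ∀ s ∈ U', minor (der ξ' Γ s) (der ξ' (der ξ' Γ) s) = -1 := fun t => by
    obtain ⟨U, ξ, ht, hξ, hiso⟩ := h t
    exact exists_normalized hξ sΓ.contMDiffOn (fun t _ => hΓ t) hiso ht
  choose U ξ hmem hξ hiso hnorm using h1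
  have huniq : ∀ t s, s ∈ U t → ξ s s = (1 : ℝ) • ξ t s := by
    intro t s hs
    have hO := (hξ t).isOpen.inter (hξ s).isOpen
    have f1 := (hξ t).mono hO inter_subset_left
    have f2 := (hξ s).mono hO inter_subset_right
    obtain ⟨g, sg, hg⟩ := f1.exists_smul_eq f2
    have hg0 : ∀ r ∈ U t ∩ U s, g r ≠ 0 := fun r hr h0 => f2.ne_zero r hr (by rw [hg r hr, h0,
      zero_smul])
    have h2 := (IsIsotropicOn.smul f1 sΓ.contMDiffOn (fun t _ => hΓ t)
      (fun r hr => hiso t r hr.1) sg hg0 hg).2 s ⟨hs, hmem s⟩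
    rw [hnorm s s (hmem s), hnorm t s hs] at h2
    have h3 : g s = 1 := by
      have h4 : (g s - 1) * (g s ^ 2 + g s + 1) = 0 := by linear_combination h2
      rcases mul_eq_zero.mp h4 with h5 | h5
      · linarith
      · nlinarith [sq_nonneg (g s + 1 / 2)]
    rw [hg s ⟨hs, hmem s⟩, h3]
  have key := fun t => IsIsotropicOn.smul (ξ' := fun s => ξ s s) (hξ t) sΓ.contMDiffOn
    (fun t _ => hΓ t) (hiso t) (g := fun _ => 1) contMDiffOn_const (by simp) (huniq t)
  refine ⟨fun t => ξ t t, ⟨fun t => ?_, fun t => (hξ t).ne_zero t (hmem t)⟩,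
    fun t _ => (key t).1 t (hmem t), fun t => ?_⟩
  · have h2 := (hξ t).smooth.contMDiffAt ((hξ t).isOpen.mem_nhds (hmem t))
    refine h2.congr_of_eventuallyEq ?_
    filter_upwards [(hξ t).isOpen.mem_nhds (hmem t)] with s hs
    simp only [huniq t s hs, one_smul]
  · rw [(key t).2 t (hmem t), hnorm t t (hmem t)]; norm_num

/-! ### Calibrated data -/

lemma minor_eq_bisp (V W : R23) : minor V W = bisp (stdP 0) (stdP 1) V W := by
  simp only [minor, bisp, sp_comm V, sp_comm W]

omit [IsManifold 𝓘(ℝ, ℝ) ∞ L] in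
/-- The derivative of the bivector `Γ' ∧ Γ''`. -/
lemma der_bisp {t : L} {a b : ℝ} (d1 : MDifferentiableAt 𝓘(ℝ, ℝ) 𝓘(ℝ, R23) (der ξ Γ) t)
    (d2 : MDifferentiableAt 𝓘(ℝ, ℝ) 𝓘(ℝ, R23) (der ξ (der ξ Γ)) t)
    (h : der ξ (der ξ (der ξ Γ)) t = a • der ξ Γ t + b • der ξ (der ξ Γ) t) (X Y : R23) :
    der ξ (fun t => bisp X Y (der ξ Γ t) (der ξ (der ξ Γ) t)) t =
      b * bisp X Y (der ξ Γ t) (der ξ (der ξ Γ) t) := by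
  set l : R23 →L[ℝ] R23 := (spL X).smulRight Y - (spL Y).smulRight X with hl
  have hL : ∀ V W : R23, bisp X Y V W = sp (l V) W := by
    intro V W
    simp [hl, bisp, sp_sub_left, sp_smul_left]
  have h4 : MDifferentiableAt 𝓘(ℝ, ℝ) 𝓘(ℝ, R23) (fun t => l (der ξ Γ t)) t :=
    l.differentiableAt.mdifferentiableAt.comp t d1
  have h5 := der_sp (ξ := ξ) h4 d2
  have h6 : der ξ (fun t => l (der ξ Γ t)) t = l (der ξ (der ξ Γ) t) := mvfderiv_clm_comp l d1 _
  simp only [hL]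
  rw [h5, h6, h, sp_add_right, sp_smul_right, sp_smul_right, ← hL, ← hL, ← hL]
  simp only [bisp]; ring

/-- The plane `Γ' ∧ Γ''` of a biisotropic curve is constant. -/
lemma bisp_eq_of_normalized [PreconnectedSpace L] (sΓ : ContMDiff 𝓘(ℝ, ℝ) 𝓘(ℝ, R23) ∞ Γ)
    (hΓ : ∀ t, sp (Γ t) (Γ t) = 1) (hξ : IsLineElement ξ) (hiso : IsIsotropicOn Γ ξ univ)
    (hnorm : ∀ t, minor (der ξ Γ t) (der ξ (der ξ Γ) t) = -1) (X Y : R23) (s t : L) :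
    bisp X Y (der ξ Γ s) (der ξ (der ξ Γ) s) = bisp X Y (der ξ Γ t) (der ξ (der ξ Γ) t) := by
  have hf := hξ.isFieldOn
  have s1 := contMDiffOn_der hf sΓ.contMDiffOn
  have s2 := contMDiffOn_der hf s1
  have d1 : ∀ t, MDifferentiableAt 𝓘(ℝ, ℝ) 𝓘(ℝ, R23) (der ξ Γ) t := fun t =>
    mdifferentiableAt_of_contMDiffOn hf.isOpen s1 (mem_univ t)
  have d2 : ∀ t, MDifferentiableAt 𝓘(ℝ, ℝ) 𝓘(ℝ, R23) (der ξ (der ξ Γ)) t := fun t =>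
    mdifferentiableAt_of_contMDiffOn hf.isOpen s2 (mem_univ t)
  refine eq_of_mvfderiv_eq_zero (I := 𝓘(ℝ, ℝ))
    (f := fun t => bisp X Y (der ξ Γ t) (der ξ (der ξ Γ) t)) (fun t => ?_) (fun t => ?_) s t
  · have hc : ∀ {F : L → R23} (X : R23), MDifferentiableAt 𝓘(ℝ, ℝ) 𝓘(ℝ, R23) F t →
      MDifferentiableAt 𝓘(ℝ, ℝ) 𝓘(ℝ, ℝ) (fun s => sp X (F s)) t := fun X hF =>
        mdifferentiableAt_sp mdifferentiableAt_const hF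
    exact ((hc _ (d1 t)).mul (hc _ (d2 t))).sub ((hc _ (d1 t)).mul (hc _ (d2 t)))
  · obtain ⟨-, -, -, a, b, h3⟩ := hiso.relations hf sΓ.contMDiffOn (fun t _ => hΓ t) (mem_univ t)
    have h4 := der_bisp (d1 t) (d2 t) h3 (stdP 0) (stdP 1)
    rw [der_eq_zero_of_eqOn_const (c := -1) isOpen_univ
      (fun t _ => by rw [← minor_eq_bisp, hnorm]) (mem_univ t), ← minor_eq_bisp, hnorm] at h4
    refine mvfderiv_eq_zero_of_der (hξ.2 t) ?_
    rw [der_bisp (d1 t) (d2 t) h3 X Y, show b = 0 by linarith, zero_mul]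

/-- The derivatives of a curve in terms of its affine coordinates. -/
lemma affine_derivatives {C : Fin 5 → R23} {N A Q : R23} (sΓ : ContMDiff 𝓘(ℝ, ℝ) 𝓘(ℝ, R23) ∞ Γ)
    (hξ : IsLineElement ξ) (hΓ : ∀ t, Γ t = N + affX Γ C t • A + affY Γ C t • Q) :
    ContMDiff 𝓘(ℝ, ℝ) 𝓘(ℝ, ℝ) ∞ (affX Γ C) ∧ ContMDiff 𝓘(ℝ, ℝ) 𝓘(ℝ, ℝ) ∞ (affY Γ C) ∧
      ∀ t, der ξ Γ t = der ξ (affX Γ C) t • A + der ξ (affY Γ C) t • Q ∧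
        der ξ (der ξ Γ) t = der ξ (der ξ (affX Γ C)) t • A + der ξ (der ξ (affY Γ C)) t • Q := by
  have hf := hξ.isFieldOn
  have sc : ∀ X, ContMDiff 𝓘(ℝ, ℝ) 𝓘(ℝ, ℝ) ∞ fun t => sp (Γ t) X := fun X =>
    contMDiffOn_univ.mp (contMDiffOn_sp sΓ.contMDiffOn contMDiffOn_const)
  have sx : ContMDiff 𝓘(ℝ, ℝ) 𝓘(ℝ, ℝ) ∞ (affX Γ C) := contMDiff_const.mul (sc _)
  have sy : ContMDiff 𝓘(ℝ, ℝ) 𝓘(ℝ, ℝ) ∞ (affY Γ C) := (sc _).neg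
  have hcomb : ∀ (N : R23) (x y : L → ℝ), ContMDiff 𝓘(ℝ, ℝ) 𝓘(ℝ, ℝ) ∞ x →
      ContMDiff 𝓘(ℝ, ℝ) 𝓘(ℝ, ℝ) ∞ y → ∀ t, der ξ (fun t => N + x t • A + y t • Q) t =
        der ξ x t • A + der ξ y t • Q := by
    intro N x y sx sy t
    have dx : MDifferentiableAt 𝓘(ℝ, ℝ) 𝓘(ℝ, ℝ) x t := sx.mdifferentiableAt (by simp)
    have dy : MDifferentiableAt 𝓘(ℝ, ℝ) 𝓘(ℝ, ℝ) y t := sy.mdifferentiableAt (by simp)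
    have hd : DifferentiableAt ℝ (fun p : ℝ × ℝ => N + p.1 • A + p.2 • Q) (x t, y t) := by fun_prop
    have h1 := mvfderiv_comp_fderiv (f := fun t => (x t, y t)) hd (dx.prodMk_space dy) (ξ t)
    have h2 := mvfderiv_clm_comp (ContinuousLinearMap.fst ℝ ℝ ℝ) (dx.prodMk_space dy) (ξ t)
    have h3 := mvfderiv_clm_comp (ContinuousLinearMap.snd ℝ ℝ ℝ) (dx.prodMk_space dy) (ξ t)
    have h4 : HasFDerivAt (fun p : ℝ × ℝ => N + p.1 • A + p.2 • Q)
        ((ContinuousLinearMap.fst ℝ ℝ ℝ).smulRight A + (ContinuousLinearMap.snd ℝ ℝ ℝ).smulRight Q)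
        (x t, y t) := by
      have h5 := ((ContinuousLinearMap.fst ℝ ℝ ℝ).smulRight A +
        (ContinuousLinearMap.snd ℝ ℝ ℝ).smulRight Q).hasFDerivAt (x := (x t, y t))
      have h6 := h5.const_add N
      refine h6.congr_of_eventuallyEq (.of_forall fun p => ?_)
      simp [add_assoc]
    rw [h4.fderiv] at h1
    change mvfderiv 𝓘(ℝ, ℝ) (fun t => N + x t • A + y t • Q) t (ξ t) = _
    rw [h1]
    simp only [_root_.add_apply, ContinuousLinearMap.smulRight_apply]
    rw [← h2, ← h3]
    rfl
  have h1 : ∀ t, der ξ Γ t = der ξ (affX Γ C) t • A + der ξ (affY Γ C) t • Q := by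
    intro t
    rw [← hcomb N _ _ sx sy t, ← funext hΓ]
  refine ⟨sx, sy, fun t => ⟨h1 t, ?_⟩⟩
  have s1 : ContMDiff 𝓘(ℝ, ℝ) 𝓘(ℝ, ℝ) ∞ (der ξ (affX Γ C)) :=
    contMDiffOn_univ.mp (contMDiffOn_der hf sx.contMDiffOn)
  have s2 : ContMDiff 𝓘(ℝ, ℝ) 𝓘(ℝ, ℝ) ∞ (der ξ (affY Γ C)) :=
    contMDiffOn_univ.mp (contMDiffOn_der hf sy.contMDiffOn)
  rw [← hcomb 0 _ _ s1 s2 t]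
  congr 1
  funext t
  rw [zero_add, h1 t]

/-- Calibrated data exist for every normalized line element. -/
theorem exists_isCalibrated_of_normalized [ConnectedSpace L] (sΓ : ContMDiff 𝓘(ℝ, ℝ) 𝓘(ℝ, R23) ∞ Γ)
    (hΓ : ∀ t, sp (Γ t) (Γ t) = 1) (hξ : IsLineElement ξ) (hiso : IsIsotropicOn Γ ξ univ)
    (hnorm : ∀ t, minor (der ξ Γ t) (der ξ (der ξ Γ) t) = -1) :
    ∃ δ C, IsCalibrated Γ δ ξ C := by
  obtain ⟨t₀⟩ : Nonempty L := inferInstance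
  have hf := hξ.isFieldOn
  have hrel := fun t => hiso.relations hf sΓ.contMDiffOn (fun t _ => hΓ t) (mem_univ t)
  have s1 := contMDiffOn_der hf sΓ.contMDiffOn
  have s2 := contMDiffOn_der hf s1
  have d0 : ∀ t, MDifferentiableAt 𝓘(ℝ, ℝ) 𝓘(ℝ, R23) Γ t := fun t => sΓ.mdifferentiableAt (by simp)
  have d1 : ∀ t, MDifferentiableAt 𝓘(ℝ, ℝ) 𝓘(ℝ, R23) (der ξ Γ) t := fun t =>
    mdifferentiableAt_of_contMDiffOn hf.isOpen s1 (mem_univ t)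
  obtain ⟨P, B, hF⟩ := exists_isNullFrame_of_isotropic (hiso t₀ trivial).2.2 (hiso t₀ trivial).1
    (hrel t₀).2.2.1 (hiso t₀ trivial).2.1 (hΓ t₀) (by rw [sp_comm]; exact (hrel t₀).1)
    (by rw [sp_comm]; exact (hrel t₀).2.1)
  set A := der ξ Γ t₀ with hA
  set Q := der ξ (der ξ Γ) t₀ with hQ
  set N := Γ t₀ with hN
  -- vectors orthogonal to the plane at `t₀` are orthogonal to `Γ'` everywhere
  have horth : ∀ X, sp X A = 0 → sp X Q = 0 → ∀ t, sp X (der ξ Γ t) = 0 := by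
    intro X hXA hXQ t
    have h1 : ∀ Y, bisp X Y (der ξ Γ t) (der ξ (der ξ Γ) t) = 0 := fun Y => by
      rw [bisp_eq_of_normalized sΓ hΓ hξ hiso hnorm X Y t t₀]
      simp only [bisp, ← hA, ← hQ, hXA, hXQ]; ring
    have h2 : (-sp X (der ξ (der ξ Γ) t)) • der ξ Γ t + sp X (der ξ Γ t) • der ξ (der ξ Γ) t = 0 :=
      by
      refine eq_zero_of_forall_sp fun Y => ?_
      have := h1 Y
      rw [bisp] at this
      rw [sp_add_left, sp_smul_left, sp_smul_left, sp_comm _ Y, sp_comm _ Y]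
      linarith
    exact ((LinearIndependent.pair_iff.mp (hiso t trivial).2.2) _ _ h2).2
  have hconst : ∀ X, sp X A = 0 → sp X Q = 0 → ∀ t, sp X (Γ t) = sp X N := by
    intro X hXA hXQ t
    refine eq_of_mvfderiv_eq_zero (I := 𝓘(ℝ, ℝ)) (f := fun t => sp X (Γ t))
      (fun t => mdifferentiableAt_sp mdifferentiableAt_const (d0 t)) (fun t => ?_) t t₀
    refine mvfderiv_eq_zero_of_der (hξ.2 t) ?_
    rw [der_sp mdifferentiableAt_const (d0 t), horth X hXA hXQ t,
      der_eq_zero_of_eqOn_const (c := X) isOpen_univ (fun _ _ => rfl) (mem_univ t), sp_zero_left,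
        zero_add]
  obtain ⟨δ, hδ, hδd⟩ : ∃ δ : ℝ, (δ = 1 ∨ δ = -1) ∧ 0 < δ * det5 P A B N Q := by
    have h1 : det5 P A B N Q ≠ 0 := by
      have h2 := hF.isGramBasis.det_sq
      intro h0
      rw [det_ofNull, h0] at h2
      norm_num at h2
    rcases lt_or_gt_of_ne h1 with h0 | h0
    · exact ⟨-1, Or.inr rfl, by linarith⟩
    · exact ⟨1, Or.inl rfl, by linarith⟩
  have hδδ : δ * δ = 1 := by rcases hδ with rfl | rfl <;> norm_num
  have hC : IsLightconeBasis (ofNull P A B (δ • N) Q) := by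
    rw [isLightconeBasis_ofNull_iff]
    refine ⟨?_, ?_, hF.minor_AQ_neg_iff.mp (by rw [hnorm]; norm_num)⟩
    · constructor <;> simp [sp_smul_left, sp_smul_right, hF.PP, hF.PA, hF.PB, hF.PN, hF.PQ, hF.AA,
        hF.AB, hF.AN, hF.AQ, hF.BB, hF.BN, hF.BQ, hF.NN, hF.NQ, hF.QQ, hδδ]
    · have := det5_smul P A B N Q 1 1 1 δ 1
      simp only [one_smul, one_mul, mul_one] at this
      rw [this]; exact hδd
  refine ⟨δ, ofNull P A B (δ • N) Q, hδ, hξ, hC, fun t => ?_⟩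
  set C := ofNull P A B (δ • N) Q with hCdef
  have c12 : C 1 - C 2 = A := by simp only [hCdef, ofNull, Matrix.cons_val]; module
  have c12' : C 1 + C 2 = B := by simp only [hCdef, ofNull, Matrix.cons_val]; module
  have c0 : C 0 = P := rfl
  have c3 : C 3 = δ • N := rfl
  have c4 : C 4 = Q := rfl
  have hexp : ∀ t, Γ t = N + affX Γ C t • A + affY Γ C t • Q := by
    intro t
    have h1 := hF.eq_comb (X := Γ t - N)
      (by rw [sp_sub_left, sp_comm (Γ t), sp_comm N A, hconst A hF.AA hF.AQ]; ring)
      (by rw [sp_sub_left, sp_comm (Γ t), hconst N (by rw [sp_comm, hF.AN]) hF.NQ]; ring)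
      (by rw [sp_sub_left, sp_comm (Γ t), sp_comm N Q, hconst Q (by rw [sp_comm,
        hF.AQ]) hF.QQ]; ring)
    have h2 : sp (Γ t - N) B = sp (Γ t) B := by
      rw [sp_sub_left, sp_comm N B, hF.BN, sub_zero]
    have h3 : sp (Γ t - N) P = sp (Γ t) P := by
      rw [sp_sub_left, sp_comm N P, hF.PN, sub_zero]
    rw [h2, h3] at h1
    simp only [affX, affY, c12', c0]
    rw [add_assoc, ← h1]; abel
  refine ⟨?_, ?_⟩
  · rw [c3, smul_smul, hδδ, one_smul, c12, c4]; exact hexp t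
  obtain ⟨-, -, hd⟩ := affine_derivatives sΓ hξ hexp
  obtain ⟨h1, h2⟩ := hd t
  have h3 := hnorm t
  rw [h1, h2, minor_smul_add, hnorm t₀] at h3
  linarith

end Curves

/-! ### The null frame along a calibrated curve -/

/-- The algebra of the isotropic normal vector: `R` is isotropic, orthogonal to `Γ` and `Γ'`, and
`⟨R, Γ''⟩ = 1`. -/
lemma IsNullFrame.isotropicNormal_relations {P A B N Q : R23} (h : IsNullFrame P A B N Q)
    {δ x y x₁ y₁ x₂ y₂ : ℝ} (hδ : δ * δ = 1) (hD : x₁ * y₂ - x₂ * y₁ = 1) {R : R23}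
    (hR : R = (-x₁) • P + (y₁ / 2) • B +
      ((x * y₁ - x₁ * y) ^ 2 / (2 * (x₁ ^ 2 + y₁ ^ 2)) * y₁) • A + ((x * y₁ - x₁ * y) * δ) • N -
      ((x * y₁ - x₁ * y) ^ 2 / (2 * (x₁ ^ 2 + y₁ ^ 2)) * x₁) • Q) :
    sp R R = 0 ∧ sp R (δ • N + x • A + y • Q) = 0 ∧ sp R (x₁ • A + y₁ • Q) = 0 ∧
      sp R (x₂ • A + y₂ • Q) = 1 := by
  have hv : x₁ ^ 2 + y₁ ^ 2 ≠ 0 := by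
    intro h0
    have h1 : x₁ = 0 := by nlinarith [sq_nonneg x₁, sq_nonneg y₁]
    have h2 : y₁ = 0 := by nlinarith [sq_nonneg x₁, sq_nonneg y₁]
    rw [h1, h2] at hD
    norm_num at hD
  set κ := (x * y₁ - x₁ * y) ^ 2 / (2 * (x₁ ^ 2 + y₁ ^ 2)) with hκ
  have hκ' : κ * (2 * (x₁ ^ 2 + y₁ ^ 2)) = (x * y₁ - x₁ * y) ^ 2 :=
    div_mul_cancel₀ _ (mul_ne_zero two_ne_zero hv)
  have hs : ∀ X Y, sp X Y = sp Y X := sp_comm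
  subst hR
  refine ⟨?_, ?_, ?_, ?_⟩ <;>
    simp only [sp_add_left, sp_add_right, sp_sub_left, sp_sub_right, sp_smul_left, sp_smul_right,
      hs B A, hs A P, hs B P, hs N P, hs Q P, hs N A, hs Q A, hs N B, hs Q B, hs Q N, h.PP, h.PA,
      h.PB, h.PN, h.PQ, h.AA, h.AB, h.AN, h.AQ, h.BB, h.BN, h.BQ, h.NN, h.NQ, h.QQ]
  · linear_combination -hκ' + (x * y₁ - x₁ * y) ^ 2 * hδ
  · linear_combination (x * y₁ - x₁ * y) * hδ
  · ring
  · linear_combination hD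

lemma linearIndependent_of_minor_ne_zero {U V : R23} (h : minor U V ≠ 0) :
    LinearIndependent ℝ ![U, V] := by
  rw [LinearIndependent.pair_iff]
  intro s t hst
  have h1 := minor_smul_add s t 0 1 U V
  have h2 := minor_smul_add 1 0 s t U V
  rw [hst] at h1 h2
  simp only [minor, sp_zero_left, zero_mul, mul_zero, sub_self, mul_one, sub_zero, one_mul] at h1 h2
  exact ⟨(mul_eq_zero.mp h1.symm).resolve_right h, (mul_eq_zero.mp h2.symm).resolve_right h⟩

section Calibrated

variable {L : Type*} [TopologicalSpace L] [ChartedSpace ℝ L] [IsManifold 𝓘(ℝ, ℝ) ∞ L]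
  {Γ : L → R23} {δ : ℝ} {ξ : ∀ t : L, TangentSpace 𝓘(ℝ, ℝ) t} {C : Fin 5 → R23}

lemma contMDiff_der {V : Type*} [NormedAddCommGroup V] [NormedSpace ℝ V] (hξ : IsLineElement ξ)
    {F : L → V} (hF : ContMDiff 𝓘(ℝ, ℝ) 𝓘(ℝ, V) ∞ F) :
    ContMDiff 𝓘(ℝ, ℝ) 𝓘(ℝ, V) ∞ (der ξ F) :=
  contMDiffOn_univ.mp (contMDiffOn_der hξ.isFieldOn hF.contMDiffOn)

lemma IsCalibrated.sq_eq (h : IsCalibrated Γ δ ξ C) : δ * δ = 1 := by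
  rcases h.1 with rfl | rfl <;> norm_num

/-- The affine coordinates of a calibrated curve, and its derivatives. -/
lemma IsCalibrated.derivatives (h : IsCalibrated Γ δ ξ C)
    (sΓ : ContMDiff 𝓘(ℝ, ℝ) 𝓘(ℝ, R23) ∞ Γ) :
    ContMDiff 𝓘(ℝ, ℝ) 𝓘(ℝ, ℝ) ∞ (affX Γ C) ∧ ContMDiff 𝓘(ℝ, ℝ) 𝓘(ℝ, ℝ) ∞ (affY Γ C) ∧
      ∀ t, der ξ Γ t = der ξ (affX Γ C) t • (C 1 - C 2) + der ξ (affY Γ C) t • C 4 ∧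
        der ξ (der ξ Γ) t =
          der ξ (der ξ (affX Γ C)) t • (C 1 - C 2) + der ξ (der ξ (affY Γ C)) t • C 4 :=
  affine_derivatives sΓ h.2.1 fun t => (h.2.2.2 t).1

lemma IsCalibrated.sp_self (h : IsCalibrated Γ δ ξ C) (t : L) : sp (Γ t) (Γ t) = 1 := by
  have hC := h.2.2.1.isNullFrame
  rw [(h.2.2.2 t).1]
  simp only [sp_add_left, sp_add_right, sp_smul_left, sp_smul_right, hC.NN, hC.AA, hC.AN, hC.AQ,
    hC.NQ, hC.QQ, sp_comm (C 3) (C 1 - C 2), sp_comm (C 4)]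
  linear_combination h.sq_eq

lemma IsCalibrated.isIsotropicOn (h : IsCalibrated Γ δ ξ C)
    (sΓ : ContMDiff 𝓘(ℝ, ℝ) 𝓘(ℝ, R23) ∞ Γ) : IsIsotropicOn Γ ξ univ := by
  intro t _
  have hC := h.2.2.1.isNullFrame
  obtain ⟨-, -, hd⟩ := h.derivatives sΓ
  obtain ⟨h1, h2⟩ := hd t
  have hD := (h.2.2.2 t).2
  have hQA : sp (C 4) (C 1 - C 2) = 0 := by rw [sp_comm, hC.AQ]
  rw [h1, h2]
  refine ⟨by simp [sp_add_left, sp_add_right, sp_smul_left, sp_smul_right, hC.AA, hC.AQ, hC.QQ,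
    hQA],
    by simp [sp_add_left, sp_add_right, sp_smul_left, sp_smul_right, hC.AA, hC.AQ, hC.QQ, hQA], ?_⟩
  refine linearIndependent_of_minor_ne_zero ?_
  rw [minor_smul_add, mul_comm (der ξ (affY Γ C) t), hD, one_mul]
  exact (hC.minor_AQ_neg_iff.mpr h.2.2.1.minor_pos).ne

/-- The vectors `R` of the normal tube. -/
lemma IsCalibrated.isotropicNormal_relations (h : IsCalibrated Γ δ ξ C)
    (sΓ : ContMDiff 𝓘(ℝ, ℝ) 𝓘(ℝ, R23) ∞ Γ) (t : L) :
    sp (isotropicNormal Γ δ ξ C t) (isotropicNormal Γ δ ξ C t) = 0 ∧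
      sp (isotropicNormal Γ δ ξ C t) (Γ t) = 0 ∧
      sp (isotropicNormal Γ δ ξ C t) (der ξ Γ t) = 0 ∧
      sp (isotropicNormal Γ δ ξ C t) (der ξ (der ξ Γ) t) = 1 := by
  obtain ⟨-, -, hd⟩ := h.derivatives sΓ
  obtain ⟨h1, h2⟩ := hd t
  have key := h.2.2.1.isNullFrame.isotropicNormal_relations (x := affX Γ C t) (y := affY Γ C t)
    h.sq_eq (h.2.2.2 t).2 (R := isotropicNormal Γ δ ξ C t) rfl
  rw [← h1, ← h2, ← (h.2.2.2 t).1] at key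
  exact key

lemma IsCalibrated.contMDiff_isotropicNormal (h : IsCalibrated Γ δ ξ C)
    (sΓ : ContMDiff 𝓘(ℝ, ℝ) 𝓘(ℝ, R23) ∞ Γ) :
    ContMDiff 𝓘(ℝ, ℝ) 𝓘(ℝ, R23) ∞ (isotropicNormal Γ δ ξ C) := by
  obtain ⟨sx, sy, -⟩ := h.derivatives sΓ
  have s1 := contMDiff_der h.2.1 sx
  have s2 := contMDiff_der h.2.1 sy
  have sμ : ContMDiff 𝓘(ℝ, ℝ) 𝓘(ℝ, ℝ) ∞ (fun t => affX Γ C t * der ξ (affY Γ C) t -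
      der ξ (affX Γ C) t * affY Γ C t) := (sx.mul s2).sub (s1.mul sy)
  have sκ : ContMDiff 𝓘(ℝ, ℝ) 𝓘(ℝ, ℝ) ∞ (fun t => (affX Γ C t * der ξ (affY Γ C) t -
      der ξ (affX Γ C) t * affY Γ C t) ^ 2 /
        (2 * (der ξ (affX Γ C) t ^ 2 + der ξ (affY Γ C) t ^ 2))) := by
    refine (sμ.pow 2).div₀ (contMDiff_const.mul ((s1.pow 2).add (s2.pow 2))) fun t h0 => ?_
    have h0 : 2 * (der ξ (affX Γ C) t ^ 2 + der ξ (affY Γ C) t ^ 2) = 0 := h0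
    have hD := (h.2.2.2 t).2
    have h1 : der ξ (affX Γ C) t = 0 := by
      nlinarith [sq_nonneg (der ξ (affX Γ C) t), sq_nonneg (der ξ (affY Γ C) t)]
    have h2 : der ξ (affY Γ C) t = 0 := by
      nlinarith [sq_nonneg (der ξ (affX Γ C) t), sq_nonneg (der ξ (affY Γ C) t)]
    rw [h1, h2] at hD
    norm_num at hD
  have s3 : ContMDiff 𝓘(ℝ, ℝ) 𝓘(ℝ, ℝ) ∞ (fun t => der ξ (affY Γ C) t / 2) :=
    s2.div₀ contMDiff_const fun _ => two_ne_zero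
  exact ((((s1.neg.smul contMDiff_const).add (s3.smul contMDiff_const)).add
    ((sκ.mul s2).smul contMDiff_const)).add
    ((sμ.mul contMDiff_const).smul contMDiff_const)).sub ((sκ.mul s1).smul contMDiff_const)

/-- The third derivative of a calibrated curve is proportional to the first one. -/
lemma IsCalibrated.exists_third_derivative (h : IsCalibrated Γ δ ξ C)
    (sΓ : ContMDiff 𝓘(ℝ, ℝ) 𝓘(ℝ, R23) ∞ Γ) (t : L) :
    ∃ a : ℝ, der ξ (der ξ (der ξ Γ)) t = a • der ξ Γ t := by
  have hf := h.2.1.isFieldOn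
  have hiso := h.isIsotropicOn sΓ
  obtain ⟨-, -, -, a, b, h3⟩ := hiso.relations hf sΓ.contMDiffOn (fun t _ => h.sp_self t)
    (mem_univ t)
  obtain ⟨-, -, hd⟩ := h.derivatives sΓ
  have s1 := contMDiff_der h.2.1 sΓ
  have s2 := contMDiff_der h.2.1 s1
  have hmin : ∀ s, minor (der ξ Γ s) (der ξ (der ξ Γ) s) = minor (C 1 - C 2) (C 4) := fun s => by
    rw [(hd s).1, (hd s).2, minor_smul_add, mul_comm (der ξ (affY Γ C) s), (h.2.2.2 s).2, one_mul]
  have h4 := der_bisp (s1.mdifferentiableAt (by simp)) (s2.mdifferentiableAt (by simp)) h3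
    (stdP 0) (stdP 1)
  rw [der_eq_zero_of_eqOn_const (c := minor (C 1 - C 2) (C 4)) isOpen_univ
    (fun s _ => by rw [← minor_eq_bisp, hmin]) (mem_univ t), ← minor_eq_bisp, hmin] at h4
  have hb : b = 0 := (mul_eq_zero.mp h4.symm).resolve_right
    (h.2.2.1.isNullFrame.minor_AQ_neg_iff.mpr h.2.2.1.minor_pos).ne
  exact ⟨a, by rw [h3, hb, zero_smul, add_zero]⟩

/-- The derivative `R'`, normalized to be isotropic. -/
def normalDerivative (Γ : L → R23) (δ : ℝ) (ξ : ∀ t : L, TangentSpace 𝓘(ℝ, ℝ) t)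
    (C : Fin 5 → R23) (t : L) : R23 :=
  der ξ (isotropicNormal Γ δ ξ C) t + (1 / 2 * sp (der ξ (isotropicNormal Γ δ ξ C) t)
    (der ξ (isotropicNormal Γ δ ξ C) t)) • der ξ Γ t

/-- The null frame `(R, -Γ', -2 S, δ Γ, -Γ'')` along a calibrated curve. -/
lemma IsCalibrated.isOrientedNullFrame (h : IsCalibrated Γ δ ξ C)
    (sΓ : ContMDiff 𝓘(ℝ, ℝ) 𝓘(ℝ, R23) ∞ Γ) (t : L) :
    IsOrientedNullFrame (isotropicNormal Γ δ ξ C t) (-der ξ Γ t)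
      ((-2 : ℝ) • normalDerivative Γ δ ξ C t) (δ • Γ t) (-der ξ (der ξ Γ) t) := by
  have hf := h.2.1.isFieldOn
  have hiso := h.isIsotropicOn sΓ
  have hδ := h.sq_eq
  have sR := h.contMDiff_isotropicNormal sΓ
  have s1 := contMDiff_der h.2.1 sΓ
  have s2 := contMDiff_der h.2.1 s1
  have md : ∀ {F : L → R23}, ContMDiff 𝓘(ℝ, ℝ) 𝓘(ℝ, R23) ∞ F →
      MDifferentiableAt 𝓘(ℝ, ℝ) 𝓘(ℝ, R23) F t := fun hF => hF.mdifferentiableAt (by simp)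
  obtain ⟨h1, h2, h3⟩ := hiso t trivial
  obtain ⟨r1, r2, r3, -⟩ := hiso.relations hf sΓ.contMDiffOn (fun t _ => h.sp_self t) (mem_univ t)
  obtain ⟨n1, n2, n3, n4⟩ := h.isotropicNormal_relations sΓ t
  obtain ⟨a, h4⟩ := h.exists_third_derivative sΓ t
  have key : ∀ {F : L → R23} {c : ℝ}, ContMDiff 𝓘(ℝ, ℝ) 𝓘(ℝ, R23) ∞ F →
      (∀ s, sp (isotropicNormal Γ δ ξ C s) (F s) = c) →
      sp (der ξ (isotropicNormal Γ δ ξ C) t) (F t) = -sp (isotropicNormal Γ δ ξ C t) (der ξ F t) :=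
        by
    intro F c hF hc
    have := der_sp (ξ := ξ) (md sR) (md hF)
    rw [der_eq_zero_of_eqOn_const isOpen_univ (fun s _ => hc s) (mem_univ t)] at this
    linarith
  set R := isotropicNormal Γ δ ξ C with hR
  have d1 := key sR fun s => (h.isotropicNormal_relations sΓ s).1
  have d2 := key sΓ fun s => (h.isotropicNormal_relations sΓ s).2.1
  have d3 := key s1 fun s => (h.isotropicNormal_relations sΓ s).2.2.1
  have d4 := key s2 fun s => (h.isotropicNormal_relations sΓ s).2.2.2
  rw [sp_comm (R t)] at d1
  rw [n3] at d2
  rw [n4] at d3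
  rw [h4, sp_smul_right, n3] at d4
  have d1' : sp (der ξ R t) (R t) = 0 := by linarith
  have hs : ∀ X Y, sp X Y = sp Y X := sp_comm
  have hZ : IsNullFrame (R t) (-der ξ Γ t) ((-2 : ℝ) • normalDerivative Γ δ ξ C t) (δ • Γ t)
      (-der ξ (der ξ Γ) t) := by
    unfold normalDerivative
    rw [← hR]
    constructor <;>
      simp only [sp_add_left, sp_add_right, sp_neg_left, sp_neg_right, sp_smul_left, sp_smul_right,
        hs (der ξ Γ t) (Γ t),
        hs (R t) (der ξ R t), hs (der ξ Γ t) (der ξ R t), h1, h2, r1, r2, r3, n1, n2, n3, n4, d1',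
        d2, d3, d4, h.sp_self t] <;> first | ring1 | linear_combination hδ
  obtain ⟨-, -, hd⟩ := h.derivatives sΓ
  obtain ⟨e1, e2⟩ := hd t
  refine ⟨hZ, ?_, ?_⟩
  · rw [h.2.2.1.isNullFrame.det5_eq hZ (a := -der ξ (affX Γ C) t) (b := -der ξ (affY Γ C) t)
      (c := -der ξ (der ξ (affX Γ C)) t) (e := -der ξ (der ξ (affY Γ C)) t) (κ := 1)
      (k := δ * affX Γ C t) (l := δ * affY Γ C t), one_mul]
    · exact h.2.2.1.det5_pos
    · rw [e1]; module
    · rw [e2]; module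
    · conv_lhs => rw [(h.2.2.2 t).1]
      rw [smul_add, smul_add, smul_smul, hδ, smul_smul, smul_smul]
  · rw [← hZ.minor_AQ_neg_iff]
    have := minor_smul_add (-der ξ (affX Γ C) t) (-der ξ (affY Γ C) t)
      (-der ξ (der ξ (affX Γ C)) t) (-der ξ (der ξ (affY Γ C)) t) (C 1 - C 2) (C 4)
    have e3 : minor (-der ξ Γ t) (-der ξ (der ξ Γ) t) = minor (C 1 - C 2) (C 4) := by
      rw [e1, e2, neg_add, neg_add, ← neg_smul, ← neg_smul, ← neg_smul, ← neg_smul, this]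
      linear_combination minor (C 1 - C 2) (C 4) * (h.2.2.2 t).2
    rw [e3, h.2.2.1.isNullFrame.minor_AQ_neg_iff]
    exact h.2.2.1.minor_pos

/-- The scalar products of the vectors `R`, `Γ'`, `S`, `Γ`, `Γ''`. -/
structure IsNormalTable (R W S N W' : R23) : Prop where
  RR : sp R R = 0
  RW : sp R W = 0
  RS : sp R S = 0
  RN : sp R N = 0
  RW' : sp R W' = 1
  WW : sp W W = 0
  WS : sp W S = -1
  WN : sp W N = 0
  WW' : sp W W' = 0
  SS : sp S S = 0
  SN : sp S N = 0
  SW' : sp S W' = 0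
  NN : sp N N = 1
  NW' : sp N W' = 0
  W'W' : sp W' W' = 0

lemma IsCalibrated.isNormalTable (h : IsCalibrated Γ δ ξ C)
    (sΓ : ContMDiff 𝓘(ℝ, ℝ) 𝓘(ℝ, R23) ∞ Γ) (t : L) :
    IsNormalTable (isotropicNormal Γ δ ξ C t) (der ξ Γ t) (normalDerivative Γ δ ξ C t) (Γ t)
      (der ξ (der ξ Γ) t) := by
  have hδ := h.sq_eq
  have hδ0 : δ ≠ 0 := by rintro rfl; norm_num at hδ
  obtain ⟨PP, PA, PB, PN, PQ, AA, AB, AN, AQ, BB, BN, BQ, NN, NQ, QQ⟩ :=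
    (h.isOrientedNullFrame sΓ t).1
  simp only [sp_neg_left, sp_neg_right, sp_smul_left, sp_smul_right, neg_neg, neg_eq_zero,
    mul_eq_zero, hδ0, false_or, neg_inj, show (-2 : ℝ) ≠ 0 by norm_num] at *
  refine ⟨PP, PA, PB, PN, PQ, AA, by linarith, AN, AQ, BB, ?_, BQ, h.sp_self t, ?_, QQ⟩
  · simpa using BN
  · simpa using NQ

omit [IsManifold 𝓘(ℝ, ℝ) ∞ L] in
lemma der_isotropicNormal_eq (Γ : L → R23) (δ : ℝ) (ξ : ∀ t : L, TangentSpace 𝓘(ℝ, ℝ) t)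
    (C : Fin 5 → R23) (t : L) : ∃ κ : ℝ, der ξ (isotropicNormal Γ δ ξ C) t =
      normalDerivative Γ δ ξ C t + κ • der ξ Γ t :=
  ⟨-(1 / 2 * sp (der ξ (isotropicNormal Γ δ ξ C) t) (der ξ (isotropicNormal Γ δ ξ C) t)), by
    unfold normalDerivative; module⟩

lemma IsCalibrated.contMDiff_normalDerivative (h : IsCalibrated Γ δ ξ C)
    (sΓ : ContMDiff 𝓘(ℝ, ℝ) 𝓘(ℝ, R23) ∞ Γ) :
    ContMDiff 𝓘(ℝ, ℝ) 𝓘(ℝ, R23) ∞ (normalDerivative Γ δ ξ C) := by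
  have s1 := contMDiff_der h.2.1 (h.contMDiff_isotropicNormal sΓ)
  have s2 : ContMDiff 𝓘(ℝ, ℝ) 𝓘(ℝ, ℝ) ∞ fun t => sp (der ξ (isotropicNormal Γ δ ξ C) t)
      (der ξ (isotropicNormal Γ δ ξ C) t) :=
    contMDiffOn_univ.mp (contMDiffOn_sp s1.contMDiffOn s1.contMDiffOn)
  exact s1.add ((contMDiff_const.mul s2).smul (contMDiff_der h.2.1 sΓ))

omit [IsManifold 𝓘(ℝ, ℝ) ∞ L] in
/-- Every ray of the plane `span {R, Γ'}` is a value of the tautological map. -/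
lemma exists_tautologicalMap_eq (Γ : L → R23) (δ : ℝ) (ξ : ∀ t : L, TangentSpace 𝓘(ℝ, ℝ) t)
    (C : Fin 5 → R23) (t : L) {a b : ℝ} (hab : a ≠ 0 ∨ b ≠ 0) :
    ∃ (z : Circle) (r : ℝ), 0 < r ∧ (z : ℂ).re = r * a ∧ tautologicalMap Γ δ ξ C (t, z) =
      ray (a • isotropicNormal Γ δ ξ C t + b • der ξ Γ t) := by
  have hpos : 0 < a ^ 2 + (2 * b) ^ 2 := by
    rcases hab with h | h
    · have := pow_pos (abs_pos.mpr h) 2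
      rw [sq_abs] at this
      positivity
    · have := pow_pos (abs_pos.mpr h) 2
      rw [sq_abs] at this
      positivity
  set ρ := √(a ^ 2 + (2 * b) ^ 2) with hρ
  have hρ0 : 0 < ρ := Real.sqrt_pos.mpr hpos
  have hρ2 : ρ ^ 2 = a ^ 2 + (2 * b) ^ 2 := Real.sq_sqrt hpos.le
  set z : ℂ := ⟨ρ⁻¹ * a, ρ⁻¹ * (2 * b)⟩ with hz
  have hz1 : z ∈ Submonoid.unitSphere ℂ := by
    change z ∈ Metric.sphere (0 : ℂ) 1
    rw [mem_sphere_zero_iff_norm, ← pow_eq_one_iff_of_nonneg (norm_nonneg _) two_ne_zero,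
      Complex.sq_norm, Complex.normSq_apply, hz]
    field_simp
    linarith
  refine ⟨⟨z, hz1⟩, ρ⁻¹, inv_pos.mpr hρ0, rfl, ?_⟩
  change ray ((ρ⁻¹ * a) • _ + (1 / 2 * (ρ⁻¹ * (2 * b))) • der ξ Γ t) = _
  rw [← ray_smul (inv_pos.mpr hρ0) (_ + b • der ξ Γ t)]
  congr 1
  module

end Calibrated

/-! ### Exceptional quasi-umbilical immersions -/

section Exceptional

variable {E : Type*} [NormedAddCommGroup E] [NormedSpace ℝ E] {H : Type*} [TopologicalSpace H]
  {I : ModelWithCorners ℝ E H} {X : Type*} [TopologicalSpace X] [ChartedSpace H X]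
  {f : X → R23} {o : ∀ x : X, Orientation ℝ (TangentSpace I x) (Fin 2)} {U U' : Set X} {ε : ℝ}

variable [hE : Fact (Module.finrank ℝ E = 2)]

omit hE in
/-- In an adapted frame field, `dN = -ε ⟨dP, A⟩ A`. -/
lemma NullField.IsAdapted.mvfderiv_N {Φ : NullField X} (h : Φ.IsAdapted I f o ε U) {x : X}
    (hx : x ∈ U) (v : TangentSpace I x) :
    mvfderiv I Φ.N x v = (-ε * dform I Φ.P (Φ.A x) x v) • Φ.A x := by
  rw [h.toIsSecondOrder.toIsFirstOrder.mvfderiv_N hx, h.dN_Q x hx, h.dN_B x hx, h.dN_A x hx]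
  module

lemma NullField.IsFirstOrder.exists_dP_A_ne {Φ : NullField X} (h : Φ.IsFirstOrder I f o U) {x : X}
    (hx : x ∈ U) : ∃ v, dform I Φ.P (Φ.A x) x v ≠ 0 := by
  obtain ⟨v, w, hvw⟩ := exists_isPositivePair (o x)
  obtain ⟨u, -, hu⟩ := exists_covector_values (h.wedge_pos x hx v w hvw).ne' 0 1
  exact ⟨u, by rw [hu]; exact one_ne_zero⟩

lemma NullField.IsAdapted.gaussMap_eventuallyEq {Φ : NullField X} (h : Φ.IsAdapted I f o ε U)
    {x : X}
    (hx : x ∈ U) : gaussMap I f o =ᶠ[𝓝 x] Φ.N := by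
  filter_upwards [h.isOpen.mem_nhds hx] with y hy using h.toIsSecondOrder.gaussMap_eq hy

omit hE in
lemma contMDiffOn_inv_sqrt_posNormSq {P : X → R23} (hP : ContMDiffOn I 𝓘(ℝ, R23) ∞ P U)
    (h0 : ∀ y ∈ U, P y ≠ 0) (h1 : ∀ y ∈ U, sp (P y) (P y) = 0) :
    ContMDiffOn I 𝓘(ℝ, ℝ) ∞ (fun y => (√(posNormSq (P y)))⁻¹) U := by
  refine contMDiffOn_inv_sqrt ?_ fun y hy => posNormSq_pos (h0 y hy) (h1 y hy)
  have hc : ∀ X, ContMDiffOn I 𝓘(ℝ, ℝ) ∞ (fun y => sp (P y) X) U := fun X =>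
    contMDiffOn_sp hP contMDiffOn_const
  exact (((contMDiffOn_mul (hc (stdP 2)) (hc (stdP 2))).add
    (contMDiffOn_mul (hc (stdP 3)) (hc (stdP 3)))).add
    (contMDiffOn_mul (hc (stdP 4)) (hc (stdP 4)))).congr fun y _ => by
      simp only [posNormSq, Pi.add_apply]; ring

/-- The quadratic form `⟨dN, df♯⟩` in adapted frame fields. -/
lemma NullField.IsAdapted.sp_dN_dualMap {Φ : NullField X} (hε : ε ≠ 0) (h : Φ.IsAdapted I f o ε U)
    {x : X} (hx : x ∈ U) : ∃ σ : ℝ, 0 < σ ∧ ∀ v : TangentSpace I x,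
      sp (mvfderiv I (gaussMap I f o) x v) (mvfderiv I (dualMap I f o ε) x v) =
        -ε * dform I Φ.P (Φ.A x) x v * (σ * dform I Φ.Q (Φ.A x) x v) := by
  have h2 := h.toIsSecondOrder
  obtain ⟨dP, dA, dB, dN, dQ⟩ := h2.toIsAlong.mdiff hx
  have hn := (h2.oriented x hx).1
  have hQ : ∀ y ∈ U, Φ.Q y ≠ 0 := fun y hy => (h2.oriented y hy).1.swap.P_ne
  have dσ := mdifferentiableAt_of_contMDiffOn h2.isOpen
    (contMDiffOn_inv_sqrt_posNormSq h2.sQ hQ fun y hy => (h2.oriented y hy).1.QQ) hx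
  have h4 : dualMap I f o ε =ᶠ[𝓝 x] fun y => (√(posNormSq (Φ.Q y)))⁻¹ • Φ.Q y := by
    filter_upwards [h2.isOpen.mem_nhds hx] with y hy using h.dualMap_eq hε hy
  refine ⟨(√(posNormSq (Φ.Q x)))⁻¹,
    inv_pos.mpr (Real.sqrt_pos.mpr (posNormSq_pos (hQ x hx) hn.QQ)), fun v => ?_⟩
  rw [mvfderiv_congr (h.gaussMap_eventuallyEq hx), h.mvfderiv_N hx, mvfderiv_congr h4,
    mvfderiv_smul_apply dσ dQ, sp_smul_left, sp_add_right, sp_smul_right, sp_smul_right, hn.AQ,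
    sp_comm (Φ.A x), ← dform_apply]
  ring

/-- For an exceptional immersion, `⟨dQ, A⟩ = 0` in adapted frame fields. -/
lemma NullField.IsAdapted.dQ_A_eq_zero {Φ : NullField X} (hε : ε ≠ 0) (h : Φ.IsAdapted I f o ε U)
    (hexc : IsExceptionalOn I f o ε U) {x : X} (hx : x ∈ U) (v : TangentSpace I x) :
    dform I Φ.Q (Φ.A x) x v = 0 := by
  have h2 := h.toIsSecondOrder
  obtain ⟨v₀, w₀, hvw⟩ := exists_isPositivePair (o x)
  obtain ⟨c, hc⟩ := exists_coeff_of_wedge_eq_zero (h2.wedge_pos x hx v₀ w₀ hvw).ne' (h.dQ_A x hx)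
  obtain ⟨u, hu⟩ := h2.exists_dP_A_ne hx
  obtain ⟨σ, hσ, h3⟩ := h.sp_dN_dualMap hε hx
  have h4 := h3 u
  rw [hexc x hx u, hc] at h4
  have h6 : c = 0 := by
    by_contra h0
    exact mul_ne_zero (mul_ne_zero (neg_ne_zero.mpr hε) hu)
      (mul_ne_zero hσ.ne' (mul_ne_zero h0 hu)) h4.symm
  rw [hc, h6, zero_mul]

lemma NullField.IsAdapted.isExceptionalOn {Φ : NullField X} (hε : ε ≠ 0)
    (h : Φ.IsAdapted I f o ε U)
    (hQ : ∀ x ∈ U, ∀ v, dform I Φ.Q (Φ.A x) x v = 0) : IsExceptionalOn I f o ε U := by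
  intro x hx v
  obtain ⟨σ, -, h3⟩ := h.sp_dN_dualMap hε hx
  rw [h3, hQ x hx, mul_zero, mul_zero]

/-- For an exceptional immersion, the plane `A ∧ Q` is parallel. -/
lemma NullField.IsAdapted.mvfderiv_A {Φ : NullField X} (hε : ε ≠ 0) (h : Φ.IsAdapted I f o ε U)
    (hexc : IsExceptionalOn I f o ε U) {x : X} (hx : x ∈ U) (v : TangentSpace I x) :
    mvfderiv I Φ.A x v = (-(1 / 2) * dform I Φ.A (Φ.B x) x v) • Φ.A x +
      dform I Φ.P (Φ.A x) x v • Φ.Q x := by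
  have h2 := h.toIsSecondOrder
  have hn := (h2.oriented x hx).1
  obtain ⟨PP, AA, BB, NN, QQ, AP, BP, NP, QP, BA, AN, AQ, BN, BQ, QN⟩ :=
    h2.toIsAlong.dform_relations hx v
  simp only [dform_apply] at *
  have hA := hn.eq_comb (X := mvfderiv I Φ.A x v) AA
    (by rw [AN, ← dform_apply, h.dN_A x hx, neg_zero])
    (by rw [AQ, ← dform_apply, h.dQ_A_eq_zero hε hexc hx, neg_zero])
  rw [AP, neg_neg] at hA
  exact hA

end Exceptional

/-! ### The directrix curve -/

section Directrix

variable {E : Type*} [NormedAddCommGroup E] [NormedSpace ℝ E] [hE : Fact (Module.finrank ℝ E = 2)]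
  {H : Type*} [TopologicalSpace H] {I : ModelWithCorners ℝ E H}
  {X : Type*} [TopologicalSpace X] [ChartedSpace H X]
  {f : X → R23} {o : ∀ x : X, Orientation ℝ (TangentSpace I x) (Fin 2)} {U : Set X} {ε : ℝ}
  {L : Type*} [TopologicalSpace L] [ChartedSpace ℝ L] [IsManifold 𝓘(ℝ, ℝ) ∞ L]
  {π : X → L} {Γ : L → R23} {ξ : ∀ t : L, TangentSpace 𝓘(ℝ, ℝ) t}

/-- The derivatives of the directrix curve in terms of adapted frame fields. -/
lemma NullField.IsAdapted.der_directrix {Φ : NullField X} (hε : ε = 1 ∨ ε = -1)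
    (h : Φ.IsAdapted I f o ε U) (hexc : IsExceptionalOn I f o ε U)
    (sπ : ContMDiff I 𝓘(ℝ, ℝ) ∞ π)
    (hπ : ∀ x, Function.Surjective (mfderiv I 𝓘(ℝ, ℝ) π x))
    (sΓ : ContMDiff 𝓘(ℝ, ℝ) 𝓘(ℝ, R23) ∞ Γ) (hΓ : ∀ x, gaussMap I f o x = Γ (π x)) {V : Set L}
    (hξ : IsFieldOn ξ V) {x : X} (hx : x ∈ U) (hxV : π x ∈ V) :
    ∃ k c : ℝ, k ≠ 0 ∧ der ξ Γ (π x) = k • Φ.A x ∧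
      der ξ (der ξ Γ) (π x) = c • Φ.A x - (ε * k ^ 2) • Φ.Q x := by
  have hε0 : ε ≠ 0 := by rcases hε with rfl | rfl <;> norm_num
  have hεε : ε * ε = 1 := by rcases hε with rfl | rfl <;> norm_num
  have h2 := h.toIsSecondOrder
  have dπ : ∀ y, MDifferentiableAt I 𝓘(ℝ, ℝ) π y := fun y => sπ.mdifferentiableAt (by simp)
  have dΓ : ∀ t, MDifferentiableAt 𝓘(ℝ, ℝ) 𝓘(ℝ, R23) Γ t := fun t => sΓ.mdifferentiableAt (by simp)
  have s1 := contMDiffOn_der hξ (sΓ.contMDiffOn (s := V))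
  set W := U ∩ π ⁻¹' V with hW
  have hWo : IsOpen W := h2.isOpen.inter (hξ.isOpen.preimage sπ.continuous)
  have hfirst : ∀ y ∈ W, ∀ v : TangentSpace I y, mfderiv I 𝓘(ℝ, ℝ) π y v = ξ (π y) →
      der ξ Γ (π y) = (-ε * dform I Φ.P (Φ.A y) y v) • Φ.A y := by
    intro y hy v hv
    have h3 := mvfderiv_comp_mfderiv (I := 𝓘(ℝ, ℝ)) (dΓ (π y)) (dπ y) v
    have h4 : (fun y => Γ (π y)) =ᶠ[𝓝 y] Φ.N := by
      filter_upwards [h.gaussMap_eventuallyEq hy.1] with z hz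
      rw [← hΓ, hz]
    rw [hv, mvfderiv_congr h4, h.mvfderiv_N hy.1] at h3
    exact h3.symm
  obtain ⟨v, hv⟩ := hπ x (ξ (π x))
  have hk : dform I Φ.P (Φ.A x) x v ≠ 0 := by
    intro h0
    obtain ⟨u, hu⟩ := h2.exists_dP_A_ne hx
    obtain ⟨c, hc⟩ := exists_smul_eq_of_ne_zero (hξ.ne_zero _ hxV) (mfderiv I 𝓘(ℝ, ℝ) π x u)
    have h3 := mvfderiv_comp_mfderiv (I := 𝓘(ℝ, ℝ)) (dΓ (π x)) (dπ x) u
    have h4 : (fun y => Γ (π y)) =ᶠ[𝓝 x] Φ.N := by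
      filter_upwards [h.gaussMap_eventuallyEq hx] with z hz
      rw [← hΓ, hz]
    have h5 := hfirst x ⟨hx, hxV⟩ v hv
    rw [h0, mul_zero, zero_smul] at h5
    rw [hc, map_smul, show mvfderiv 𝓘(ℝ, ℝ) Γ (π x) (ξ (π x)) = 0 from h5, smul_zero,
      mvfderiv_congr h4, h.mvfderiv_N hx] at h3
    have hA : Φ.A x ≠ 0 := by
      intro hA
      have := (h2.oriented x hx).1.AB
      rw [hA, sp_zero_left] at this
      norm_num at this
    exact smul_ne_zero (mul_ne_zero (neg_ne_zero.mpr hε0) hu) hA h3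
  -- `Γ' = k A` along the surface, with a smooth `k` that can be differentiated again
  set k : X → ℝ := fun y => -(1 / 2) * sp (der ξ Γ (π y)) (Φ.B y) with hkdef
  have hkA : ∀ y ∈ W, der ξ Γ (π y) = k y • Φ.A y := by
    intro y hy
    obtain ⟨w, hw⟩ := hπ y (ξ (π y))
    have h3 := hfirst y hy w hw
    rw [hkdef]
    simp only
    rw [h3, sp_smul_left, (h2.oriented y hy.1).1.AB]
    module
  have sG : ContMDiffOn I 𝓘(ℝ, R23) ∞ (fun y => der ξ Γ (π y)) W :=
    s1.comp sπ.contMDiffOn fun y hy => hy.2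
  have sk : ContMDiffOn I 𝓘(ℝ, ℝ) ∞ k W :=
    contMDiffOn_mul contMDiffOn_const (contMDiffOn_sp sG (h2.sB.mono inter_subset_left))
  have dk := mdifferentiableAt_of_contMDiffOn hWo sk (x := x) ⟨hx, hxV⟩
  have dA := (h2.toIsAlong.mdiff hx).2.1
  have hkx : k x = -ε * dform I Φ.P (Φ.A x) x v := by
    have h3 := hfirst x ⟨hx, hxV⟩ v hv
    rw [hkdef]
    simp only
    rw [h3, sp_smul_left, (h2.oriented x hx).1.AB]
    ring
  have h3 := mvfderiv_comp_mfderiv (I := 𝓘(ℝ, ℝ))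
    (mdifferentiableAt_of_contMDiffOn hξ.isOpen s1 hxV) (dπ x) v
  have h4 : (fun y => der ξ Γ (π y)) =ᶠ[𝓝 x] fun y => k y • Φ.A y := by
    filter_upwards [hWo.mem_nhds ⟨hx, hxV⟩] with y hy using hkA y hy
  rw [hv, mvfderiv_congr h4, mvfderiv_smul_apply dk dA, h.mvfderiv_A hε0 hexc hx] at h3
  refine ⟨k x, k x * (-(1 / 2) * dform I Φ.A (Φ.B x) x v) + mvfderiv I k x v, ?_,
    hkA x ⟨hx, hxV⟩, ?_⟩
  · rw [hkx]; exact mul_ne_zero (neg_ne_zero.mpr hε0) hk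
  · have h5 : dform I Φ.P (Φ.A x) x v = -ε * k x := by
      rw [hkx]; linear_combination (-dform I Φ.P (Φ.A x) x v) * hεε
    rw [h5] at h3
    refine Eq.trans h3.symm ?_
    module

/-- The directrix curve is biisotropic near the image of every point. -/
lemma NullField.IsAdapted.isIsotropicOn_directrix {Φ : NullField X} (hε : ε = 1 ∨ ε = -1)
    (h : Φ.IsAdapted I f o ε U) (hexc : IsExceptionalOn I f o ε U)
    (sπ : ContMDiff I 𝓘(ℝ, ℝ) ∞ π)
    (hπ : ∀ x, Function.Surjective (mfderiv I 𝓘(ℝ, ℝ) π x)) (hπo : IsOpenMap π)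
    (sΓ : ContMDiff 𝓘(ℝ, ℝ) 𝓘(ℝ, R23) ∞ Γ) (hΓ : ∀ x, gaussMap I f o x = Γ (π x)) {x : X}
    (hx : x ∈ U) :
    ∃ (V : Set L) (ξ : ∀ t : L, TangentSpace 𝓘(ℝ, ℝ) t), π x ∈ V ∧ IsFieldOn ξ V ∧
      IsIsotropicOn Γ ξ V := by
  obtain ⟨V, ξ, hxV, hξ⟩ := exists_isFieldOn (π x)
  have h2 := h.toIsSecondOrder
  have hO : IsOpen (π '' (U ∩ π ⁻¹' V)) :=
    hπo _ (h2.isOpen.inter (hξ.isOpen.preimage sπ.continuous))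
  refine ⟨π '' (U ∩ π ⁻¹' V), ξ, ⟨x, ⟨hx, hxV⟩, rfl⟩, hξ.mono hO ?_, ?_⟩
  · rintro _ ⟨y, hy, rfl⟩
    exact hy.2
  rintro _ ⟨y, ⟨hy, hyV⟩, rfl⟩
  obtain ⟨k, c, hk, e1, e2⟩ := h.der_directrix hε hexc sπ hπ sΓ hΓ hξ hy hyV
  have hn := (h2.oriented y hy).1
  have hQA : sp (Φ.Q y) (Φ.A y) = 0 := by rw [sp_comm, hn.AQ]
  rw [e1, e2]
  refine ⟨by simp [sp_smul_left, sp_smul_right, hn.AA],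
    by simp [sp_sub_left, sp_sub_right, sp_smul_left, sp_smul_right, hn.AA, hn.AQ, hn.QQ, hQA], ?_⟩
  have e3 := minor_smul_add k 0 c (-(ε * k ^ 2)) (Φ.A y) (Φ.Q y)
  rw [zero_smul, add_zero, neg_smul, ← sub_eq_add_neg] at e3
  refine linearIndependent_of_minor_ne_zero ?_
  rw [e3]
  have hε0 : ε ≠ 0 := by rcases hε with rfl | rfl <;> norm_num
  refine mul_ne_zero ?_ (hn.minor_AQ_neg_iff.mpr (h2.oriented y hy).2.2).ne
  have : k * (ε * k ^ 2) ≠ 0 := mul_ne_zero hk (mul_ne_zero hε0 (pow_ne_zero 2 hk))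
  intro h0
  exact this (by linarith)

/-- Calibrated data of the directrix curve have sign `1`: adapted frames are positively oriented. -/
lemma NullField.IsAdapted.sign_eq_one {Φ : NullField X} (hε : ε = 1 ∨ ε = -1)
    (h : Φ.IsAdapted I f o ε U) (hexc : IsExceptionalOn I f o ε U)
    (sπ : ContMDiff I 𝓘(ℝ, ℝ) ∞ π)
    (hπ : ∀ x, Function.Surjective (mfderiv I 𝓘(ℝ, ℝ) π x))
    (sΓ : ContMDiff 𝓘(ℝ, ℝ) 𝓘(ℝ, R23) ∞ Γ) (hΓ : ∀ x, gaussMap I f o x = Γ (π x)) {x : X}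
    (hx : x ∈ U) {δ : ℝ} {C : Fin 5 → R23} (hcal : IsCalibrated Γ δ ξ C) : δ = 1 := by
  have hε0 : ε ≠ 0 := by rcases hε with rfl | rfl <;> norm_num
  have h2 := h.toIsSecondOrder
  have hn := (h2.oriented x hx).1
  have hC := hcal.2.2.1.isNullFrame
  obtain ⟨k, c, hk, e1, e2⟩ := h.der_directrix hε hexc sπ hπ sΓ hΓ hcal.2.1.isFieldOn hx
    (mem_univ _)
  obtain ⟨-, -, hd⟩ := hcal.derivatives sΓ
  obtain ⟨d1, d2⟩ := hd (π x)
  have hN : Φ.N x = δ • C 3 + affX Γ C (π x) • (C 1 - C 2) + affY Γ C (π x) • C 4 := by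
    rw [← (hcal.2.2.2 (π x)).1, ← hΓ]
    exact (h2.gaussMap_eq hx).symm
  have hA : Φ.A x = (k⁻¹ * der ξ (affX Γ C) (π x)) • (C 1 - C 2) +
      (k⁻¹ * der ξ (affY Γ C) (π x)) • C 4 := by
    rw [← smul_smul, ← smul_smul, ← smul_add, ← d1, e1, smul_smul, inv_mul_cancel₀ hk, one_smul]
  have hεk : ε * k ^ 2 ≠ 0 := mul_ne_zero hε0 (pow_ne_zero 2 hk)
  have hQ : Φ.Q x = (ε * k ^ 2)⁻¹ • (c • Φ.A x - der ξ (der ξ Γ) (π x)) := by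
    rw [e2, sub_sub_cancel, smul_smul, inv_mul_cancel₀ hεk, one_smul]
  rw [hA, d2] at hQ
  have key := hC.det5_eq hn hA (Q' := Φ.Q x)
    (c := (ε * k ^ 2)⁻¹ * (c * (k⁻¹ * der ξ (affX Γ C) (π x)) - der ξ (der ξ (affX Γ C)) (π x)))
    (e := (ε * k ^ 2)⁻¹ * (c * (k⁻¹ * der ξ (affY Γ C) (π x)) - der ξ (der ξ (affY Γ C)) (π x)))
    (by rw [hQ]; module) hN
  have h3 := (h2.oriented x hx).2.1
  rw [key] at h3
  have h4 := hcal.2.2.1.det5_pos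
  rcases hcal.1 with h5 | h5
  · exact h5
  · rw [h5] at h3
    linarith

/-- The immersion takes its values in the normal tube of the directrix curve. -/
lemma NullField.IsAdapted.mem_image_tautologicalMap {Φ : NullField X} (hε : ε = 1 ∨ ε = -1)
    (h : Φ.IsAdapted I f o ε U) (hexc : IsExceptionalOn I f o ε U)
    (sπ : ContMDiff I 𝓘(ℝ, ℝ) ∞ π)
    (hπ : ∀ x, Function.Surjective (mfderiv I 𝓘(ℝ, ℝ) π x))
    (sΓ : ContMDiff 𝓘(ℝ, ℝ) 𝓘(ℝ, R23) ∞ Γ) (hΓ : ∀ x, gaussMap I f o x = Γ (π x)) {x : X}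
    (hx : x ∈ U) {δ : ℝ} {C : Fin 5 → R23} (hcal : IsCalibrated Γ δ ξ C) :
    f x ∈ tautologicalMap Γ δ ξ C '' parabolicComponent L ε := by
  have hεε : ε * ε = 1 := by rcases hε with rfl | rfl <;> norm_num
  have h2 := h.toIsSecondOrder
  have hn := (h2.oriented x hx).1
  have hZ := (hcal.isOrientedNullFrame sΓ (π x)).1
  obtain ⟨k, c, hk, e1, e2⟩ := h.der_directrix hε hexc sπ hπ sΓ hΓ hcal.2.1.isFieldOn hx
    (mem_univ _)
  have hN : Γ (π x) = Φ.N x := by rw [← hΓ]; exact h2.gaussMap_eq hx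
  have p1 : sp (Φ.P x) (der ξ Γ (π x)) = 0 := by rw [e1, sp_smul_right, hn.PA, mul_zero]
  have p2 : sp (Φ.P x) (der ξ (der ξ Γ) (π x)) = ε * k ^ 2 := by
    rw [e2, sp_sub_right, sp_smul_right, sp_smul_right, hn.PA, hn.PQ]; ring
  have p3 : sp (Φ.P x) (Γ (π x)) = 0 := by rw [hN, hn.PN]
  set R := isotropicNormal Γ δ ξ C (π x) with hR
  set a := ε * k ^ 2 with ha
  have ha0 : a ≠ 0 := mul_ne_zero (by rcases hε with rfl | rfl <;> norm_num) (pow_ne_zero 2 hk)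
  obtain ⟨b, hb⟩ : ∃ b : ℝ, Φ.P x = a • R + b • der ξ Γ (π x) := by
    have hexp := hZ.expand (Φ.P x)
    rw [sp_neg_right, sp_neg_right, sp_smul_right (δ), p1, p2, p3] at hexp
    have hPP := hn.PP
    obtain ⟨b, q, hbq⟩ : ∃ b q : ℝ, Φ.P x = a • R + b • der ξ Γ (π x) + q • der ξ (der ξ Γ) (π x) :=
      ⟨1 / 2 * sp (Φ.P x) ((-2 : ℝ) • normalDerivative Γ δ ξ C (π x)), sp (Φ.P x) R, by
        conv_lhs => rw [hexp]
        module⟩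
    obtain ⟨n1, n2, n3, n4⟩ := hcal.isotropicNormal_relations sΓ (π x)
    have hQQ := hZ.QQ
    have hAQ := hZ.AQ
    have hAA := hZ.AA
    simp only [sp_neg_left, sp_neg_right, neg_neg] at hQQ hAQ hAA
    rw [← hR] at n1 n3 n4
    rw [hbq] at hPP
    simp only [sp_add_left, sp_add_right, sp_smul_left, sp_smul_right, n1, n3, n4, hQQ, hAQ, hAA,
      sp_comm (der ξ Γ (π x)) R, sp_comm (der ξ (der ξ Γ) (π x)) R,
      sp_comm (der ξ (der ξ Γ) (π x)) (der ξ Γ (π x))] at hPP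
    have hq : q = 0 := by
      have : a * q = 0 := by linarith
      exact (mul_eq_zero.mp this).resolve_left ha0
    exact ⟨b, by rw [hbq, hq, zero_smul, add_zero]⟩
  obtain ⟨z, r, hr, hz, hray⟩ := exists_tautologicalMap_eq Γ δ ξ C (π x) (b := b) (Or.inl ha0)
  refine ⟨(π x, z), ?_, by rw [h2.ray_eq x hx, hb]; exact hray⟩
  change Real.sign (z : ℂ).re = ε
  have hkk : 0 < r * k ^ 2 := by positivity
  rcases hε with h0 | h0
  · rw [hz, Real.sign_of_pos, h0]
    rw [ha, h0]; linarith
  · rw [hz, Real.sign_of_neg, h0]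
    rw [ha, h0]; linarith

end Directrix

/-- The leaf space of an exceptional quasi-umbilical immersion, and its directrix curve: adapted
frame fields near the points of the surface show that the directrix is biisotropic near every point,
so that it has a global normalized line element and therefore calibrated data. -/
theorem exists_directrix {E : Type*} [NormedAddCommGroup E] [NormedSpace ℝ E]
    [FiniteDimensional ℝ E] [hE : Fact (Module.finrank ℝ E = 2)]
    {X : Type*} [TopologicalSpace X] [SecondCountableTopology X] [ConnectedSpace X]
    [ChartedSpace E X] [IsManifold 𝓘(ℝ, E) ∞ X]
    {o : ∀ x : X, Orientation ℝ (TangentSpace 𝓘(ℝ, E) x) (Fin 2)} {f : X → R23} {ε : ℝ}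
    (ho : IsSurfaceOrientation 𝓘(ℝ, E) o) (hf : IsQuasiUmbilicalOn 𝓘(ℝ, E) f o univ)
    (hcan : IsCanonicalOrientationOn 𝓘(ℝ, E) f o univ) (hε : ε = 1 ∨ ε = -1)
    (hhel : HasHelicityOn 𝓘(ℝ, E) f o univ ε) (hexc : IsExceptionalOn 𝓘(ℝ, E) f o ε univ) :
    SecondCountableTopology (LeafSpace 𝓘(ℝ, E) (gaussMap 𝓘(ℝ, E) f o)) ∧
      ∃ (_ : ChartedSpace ℝ (LeafSpace 𝓘(ℝ, E) (gaussMap 𝓘(ℝ, E) f o)))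
        (_ : IsManifold 𝓘(ℝ, ℝ) ∞ (LeafSpace 𝓘(ℝ, E) (gaussMap 𝓘(ℝ, E) f o)))
        (Γ : LeafSpace 𝓘(ℝ, E) (gaussMap 𝓘(ℝ, E) f o) → R23),
        ContMDiff 𝓘(ℝ, E) 𝓘(ℝ, ℝ) ∞ (Quotient.mk (leafSetoid 𝓘(ℝ, E) (gaussMap 𝓘(ℝ, E) f o))) ∧
        (∀ x : X, Function.Surjective (mfderiv 𝓘(ℝ, E) 𝓘(ℝ, ℝ)
          (Quotient.mk (leafSetoid 𝓘(ℝ, E) (gaussMap 𝓘(ℝ, E) f o))) x)) ∧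
        (∀ x : X, gaussMap 𝓘(ℝ, E) f o x = Γ (Quotient.mk _ x)) ∧
        IsBiisotropic Γ ∧
        (∃ ξ C, IsCalibrated Γ 1 ξ C) ∧
        ∀ δ ξ C, IsCalibrated Γ δ ξ C → δ = 1 ∧
          f '' univ ⊆ tautologicalMap Γ δ ξ C '' parabolicComponent _ ε := by
  have had := fun x => exists_isAdapted hε ho hf hcan hhel x
  have hex : ∀ U, IsExceptionalOn 𝓘(ℝ, E) f o ε U := fun U x _ v => hexc x (mem_univ x) v
  have hε0 : ε ≠ 0 := by rcases hε with rfl | rfl <;> norm_num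
  set N := gaussMap 𝓘(ℝ, E) f o with hNdef
  have sN : ContMDiff 𝓘(ℝ, E) 𝓘(ℝ, R23) ∞ N := fun x => by
    obtain ⟨U, hx, Φ, hΦ⟩ := had x
    exact (hΦ.sN.contMDiffAt (hΦ.isOpen.mem_nhds hx)).congr_of_eventuallyEq
      (hΦ.gaussMap_eventuallyEq hx)
  have hrank : HasRankOne (E := E) N := fun x => by
    obtain ⟨U, hx, Φ, hΦ⟩ := had x
    obtain ⟨u, hu⟩ := hΦ.exists_dP_A_ne hx
    refine ⟨(-ε) • dform 𝓘(ℝ, E) Φ.P (Φ.A x) x, Φ.A x, ?_, ?_, fun v => ?_⟩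
    · intro h0
      exact mul_ne_zero (neg_ne_zero.mpr hε0) hu (LinearMap.congr_fun h0 u)
    · intro hA
      have := (hΦ.oriented x hx).1.AB
      rw [hA, sp_zero_left] at this
      norm_num at this
    · rw [hNdef, mvfderiv_congr (hΦ.gaussMap_eventuallyEq hx), hΦ.mvfderiv_N hx]
      rfl
  have hopen := isOpenMap_leafSpace hE.out sN hrank
  refine ⟨TopologicalSpace.Quotient.secondCountableTopology hopen, ?_⟩
  obtain ⟨cs, mf, sπ, hπ, sΓ⟩ := exists_leafSpace_manifold hE.out sN hrank
  set Γ := directrix sN with hΓdef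
  have hΓ : ∀ x, gaussMap 𝓘(ℝ, E) f o x = Γ (Quotient.mk _ x) := fun x => rfl
  have hsph : ∀ t, sp (Γ t) (Γ t) = 1 := by
    intro t
    obtain ⟨x, rfl⟩ := Quotient.exists_rep t
    obtain ⟨U, hx, Φ, hΦ⟩ := had x
    rw [← hΓ, hΦ.toIsSecondOrder.gaussMap_eq hx]
    exact (hΦ.oriented x hx).1.NN
  obtain ⟨ξ, hξ, hiso, hnorm⟩ := exists_global_normalized sΓ hsph fun t => by
    obtain ⟨x, rfl⟩ := Quotient.exists_rep t
    obtain ⟨U, hx, Φ, hΦ⟩ := had x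
    exact hΦ.isIsotropicOn_directrix hε (hex U) sπ hπ hopen sΓ hΓ hx
  have hone : ∀ δ ξ C, IsCalibrated Γ δ ξ C → δ = 1 := fun δ ξ C hcal => by
    obtain ⟨x⟩ : Nonempty X := inferInstance
    obtain ⟨U, hx, Φ, hΦ⟩ := had x
    exact hΦ.sign_eq_one hε (hex U) sπ hπ sΓ hΓ hx hcal
  refine ⟨cs, mf, Γ, sπ, hπ, hΓ, ⟨sΓ, hsph, ξ, hξ, fun t => hiso t trivial⟩, ?_,
    fun δ ξ C hcal => ⟨hone δ ξ C hcal, ?_⟩⟩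
  · obtain ⟨δ, C, hcal⟩ := exists_isCalibrated_of_normalized sΓ hsph hξ hiso hnorm
    have h1 := hone δ ξ C hcal
    rw [h1] at hcal
    exact ⟨ξ, C, hcal⟩
  · rintro _ ⟨x, -, rfl⟩
    obtain ⟨U, hx, Φ, hΦ⟩ := had x
    exact hΦ.mem_image_tautologicalMap hε (hex U) sπ hπ sΓ hΓ hx hcal

/-! ### Surfaces given by a null frame field -/

section Tube

variable {E : Type*} [NormedAddCommGroup E] [NormedSpace ℝ E] {H : Type*} [TopologicalSpace H]
  {I : ModelWithCorners ℝ E H} {X : Type*} [TopologicalSpace X] [ChartedSpace H X]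
  {f : X → R23} {o : ∀ x : X, Orientation ℝ (TangentSpace I x) (Fin 2)} {U : Set X}

lemma signedOrientation_one : signedOrientation I 1 o = o := by
  funext x
  simp [signedOrientation]

lemma signedOrientation_neg_one : signedOrientation I (-1) o = fun x => -o x := by
  funext x
  rw [signedOrientation, if_neg (by norm_num)]

lemma signedOrientation_signedOrientation {δ : ℝ} (hδ : δ = 1 ∨ δ = -1) :
    signedOrientation I δ (signedOrientation I δ o) = o := by
  rcases hδ with rfl | rfl
  · rw [signedOrientation_one, signedOrientation_one]
  · rw [signedOrientation_neg_one, signedOrientation_neg_one]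
    funext x
    exact neg_neg (o x)

variable [hE : Fact (Module.finrank ℝ E = 2)]

omit hE in
lemma isSurfaceOrientation_signedOrientation [IsManifold I ∞ X] {δ : ℝ} (hδ : δ = 1 ∨ δ = -1)
    (ho : IsSurfaceOrientation I o) : IsSurfaceOrientation I (signedOrientation I δ o) := by
  rcases hδ with rfl | rfl
  · rwa [signedOrientation_one]
  · rw [signedOrientation_neg_one]
    intro x
    obtain ⟨U, hU, hx, v, w, hv, hw, hvw⟩ := ho x
    refine ⟨U, hU, hx, w, v, hw, hv, fun y hy => IsPositivePair.swap ?_⟩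
    rw [neg_neg (o y)]
    exact hvw y hy

/-- Two vectors on which some `α ∧ β` does not vanish span the tangent plane. -/
lemma exists_coeff_of_wedge_ne_zero {x : X} {α β : TangentSpace I x →ₗ[ℝ] ℝ}
    {v w : TangentSpace I x} (h : wedge I α β v w ≠ 0) (u : TangentSpace I x) :
    ∃ a b : ℝ, u = a • v + b • w := by
  obtain ⟨b, hv, hw⟩ := exists_basis_of_wedge_ne h
  exact IsPositivePair.exists_coeff (o := b.orientation) ⟨b, hv, hw, rfl⟩ u

/-- A nowhere zero smooth 2-form, here `⟨dP, B⟩ ∧ ⟨dP, A⟩`, orients the surface. -/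
lemma exists_orientation_of_wedge_pos [IsManifold I ∞ X] {P A B : X → R23}
    (sP : ContMDiff I 𝓘(ℝ, R23) ∞ P) (sA : ContMDiff I 𝓘(ℝ, R23) ∞ A)
    (sB : ContMDiff I 𝓘(ℝ, R23) ∞ B)
    (h : ∀ x, ∃ v w, 0 < wedge I (dform I P (B x) x) (dform I P (A x) x) v w) :
    ∃ o : ∀ x : X, Orientation ℝ (TangentSpace I x) (Fin 2), IsSurfaceOrientation I o ∧
      ∀ x v w, IsPositivePair I (o x) v w →
        0 < wedge I (dform I P (B x) x) (dform I P (A x) x) v w := by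
  choose v₀ w₀ h₀ using h
  choose b₀ hv₀ hw₀ using fun x => exists_basis_of_wedge_ne (h₀ x).ne'
  have hpos : ∀ x v w, IsPositivePair I (b₀ x).orientation v w →
      0 < wedge I (dform I P (B x) x) (dform I P (A x) x) v w := by
    intro x v w hvw
    obtain ⟨d, hd, hd'⟩ := IsPositivePair.exists_pos_wedge_eq
      (⟨b₀ x, hv₀ x, hw₀ x, rfl⟩ : IsPositivePair I (b₀ x).orientation (v₀ x) (w₀ x)) hvw
    rw [hd']
    exact mul_pos hd (h₀ x)
  refine ⟨fun x => (b₀ x).orientation, fun x => ?_, hpos⟩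
  have : FiniteDimensional ℝ E := .of_finrank_pos (by rw [hE.out]; norm_num)
  set e := trivializationAt E (TangentSpace I : X → Type _) x with he
  set b := Module.finBasisOfFinrankEq ℝ E hE.out with hb
  have s1 := e.contMDiffOn_localFrame_baseSet (I := I) ∞ b 0
  have s2 := e.contMDiffOn_localFrame_baseSet (I := I) ∞ b 1
  set Ω : X → ℝ := fun y => wedge I (dform I P (B y) y) (dform I P (A y) y)
    (e.localFrame b 0 y) (e.localFrame b 1 y) with hΩ
  have hxe : x ∈ e.baseSet := FiberBundle.mem_baseSet_trivializationAt' x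
  have sΩ : ContMDiffOn I 𝓘(ℝ, ℝ) ∞ Ω e.baseSet :=
    contMDiffOn_wedge (contMDiffOn_dform e.open_baseSet sP.contMDiffOn sB.contMDiffOn s1)
      (contMDiffOn_dform e.open_baseSet sP.contMDiffOn sB.contMDiffOn s2)
      (contMDiffOn_dform e.open_baseSet sP.contMDiffOn sA.contMDiffOn s1)
      (contMDiffOn_dform e.open_baseSet sP.contMDiffOn sA.contMDiffOn s2)
  have hΩx : Ω x ≠ 0 := by
    have hp : IsPositivePair I (e.basisAt b hxe).orientation (e.localFrame b 0 x)
        (e.localFrame b 1 x) :=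
      ⟨e.basisAt b hxe, (e.localFrame_apply_of_mem_baseSet b hxe).symm,
        (e.localFrame_apply_of_mem_baseSet b hxe).symm, rfl⟩
    obtain ⟨d, hd⟩ := hp.exists_wedge_eq (v₀ x) (w₀ x)
    intro h0
    have := h₀ x
    rw [hd] at this
    exact absurd this (by rw [show wedge I _ _ _ _ = Ω x from rfl, h0, mul_zero]; exact lt_irrefl _)
  rcases lt_or_gt_of_ne hΩx with hneg | hpos'
  · refine ⟨e.baseSet ∩ Ω ⁻¹' Iio 0, sΩ.continuousOn.isOpen_inter_preimage e.open_baseSet isOpen_Iio,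
      ⟨hxe, hneg⟩, e.localFrame b 1, e.localFrame b 0, s2.mono inter_subset_left,
      s1.mono inter_subset_left, fun y hy => isPositivePair_of_wedge_pos (hpos y) ?_⟩
    have h1 : Ω y < 0 := hy.2
    simp only [hΩ, wedge] at h1
    unfold wedge
    linarith
  · exact ⟨e.baseSet ∩ Ω ⁻¹' Ioi 0,
      sΩ.continuousOn.isOpen_inter_preimage e.open_baseSet isOpen_Ioi, ⟨hxe, hpos'⟩,
      e.localFrame b 0, e.localFrame b 1, s1.mono inter_subset_left, s2.mono inter_subset_left,
      fun y hy => isPositivePair_of_wedge_pos (hpos y) hy.2⟩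

omit hE in
lemma ray_mem_einsteinUniverse {V : R23} (h : V ≠ 0) (h' : sp V V = 0) :
    ray V ∈ einsteinUniverse := by
  have h1 := posNormSq_pos h h'
  have h2 : posNormSq (ray V) = 1 := by
    rw [ray, posNormSq_smul, inv_pow, Real.sq_sqrt h1.le, inv_mul_cancel₀ h1.ne']
  have h3 := sp_self_eq (ray V)
  rw [show sp (ray V) (ray V) = 0 by rw [ray, sp_smul_left, sp_smul_right, h', mul_zero, mul_zero],
    h2] at h3
  exact ⟨by linarith, h2⟩

/-- A map with a first order frame field is a timelike immersion: in such a frame field,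
`f^* g` is a positive multiple of `-⟨dP, A⟩ ⟨dP, B⟩`. -/
lemma NullField.IsFirstOrder.isTimelikeImmersionOn {Φ : NullField X} (h : Φ.IsFirstOrder I f o U) :
    IsTimelikeImmersionOn I f U := by
  have hne : ∀ y ∈ U, Φ.P y ≠ 0 := fun y hy => (h.oriented y hy).1.P_ne
  refine ⟨(contMDiffOn_smul (contMDiffOn_inv_sqrt_posNormSq h.sP hne fun y hy =>
    (h.oriented y hy).1.PP) h.sP).congr fun y hy => h.ray_eq y hy, fun x hx => ?_⟩
  have hn := (h.oriented x hx).1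
  obtain ⟨ρ, hρ, hfx, hdf⟩ := h.exists_mvfderiv hx
  obtain ⟨v₀, w₀, hvw⟩ := exists_isPositivePair (o x)
  have hw := (h.wedge_pos x hx v₀ w₀ hvw).ne'
  have hρ0 := hρ.ne'
  have hBA : sp (Φ.B x) (Φ.A x) = -2 := by rw [sp_comm, hn.AB]
  have hAP : sp (Φ.A x) (Φ.P x) = 0 := by rw [sp_comm, hn.PA]
  have hBP : sp (Φ.B x) (Φ.P x) = 0 := by rw [sp_comm, hn.PB]
  have hg : ∀ v w, inducedMetric I f x v w = -(ρ ^ 2 / 2) *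
      (dform I Φ.P (Φ.B x) x v * dform I Φ.P (Φ.A x) x w +
        dform I Φ.P (Φ.A x) x v * dform I Φ.P (Φ.B x) x w) := by
    intro v w
    obtain ⟨s, hs⟩ := hdf v
    obtain ⟨t, ht⟩ := hdf w
    unfold inducedMetric
    rw [hs, ht, h.mvfderiv_P hx, h.mvfderiv_P hx]
    simp only [sp_add_left, sp_add_right, sp_sub_left, sp_sub_right, sp_smul_left, sp_smul_right,
      hn.PP, hn.PA, hn.PB, hn.AA, hn.AB, hn.BB, hBA, hAP, hBP]
    ring
  refine ⟨?_, ?_, ?_⟩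
  · rw [h.ray_eq x hx]
    exact ray_mem_einsteinUniverse (hne x hx) hn.PP
  · rw [injective_iff_map_eq_zero]
    intro u hu
    obtain ⟨s, hs⟩ := hdf u
    rw [hu] at hs
    have h1 := congrArg (sp · (Φ.B x)) hs
    have h2 := congrArg (sp · (Φ.A x)) hs
    simp only [sp_zero_left, sp_add_left, sp_smul_left, hn.PA, hn.PB, mul_zero, add_zero,
      ← dform_apply, zero_eq_mul, hρ0, false_or] at h1 h2
    obtain ⟨a, b, rfl⟩ := exists_coeff_of_wedge_ne_zero hw u
    simp only [map_add, map_smul, smul_eq_mul] at h1 h2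
    unfold wedge at hw
    have ha : a * (dform I Φ.P (Φ.B x) x v₀ * dform I Φ.P (Φ.A x) x w₀ -
        dform I Φ.P (Φ.B x) x w₀ * dform I Φ.P (Φ.A x) x v₀) = 0 := by
      linear_combination dform I Φ.P (Φ.A x) x w₀ * h1 - dform I Φ.P (Φ.B x) x w₀ * h2
    have hb : b * (dform I Φ.P (Φ.B x) x v₀ * dform I Φ.P (Φ.A x) x w₀ -
        dform I Φ.P (Φ.B x) x w₀ * dform I Φ.P (Φ.A x) x v₀) = 0 := by
      linear_combination dform I Φ.P (Φ.B x) x v₀ * h2 - dform I Φ.P (Φ.A x) x v₀ * h1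
    replace ha := (mul_eq_zero.mp ha).resolve_right hw
    replace hb := (mul_eq_zero.mp hb).resolve_right hw
    rw [ha, hb, zero_smul, zero_smul, add_zero]
  · obtain ⟨v, hv1, hv2⟩ := exists_covector_values hw ρ⁻¹ ρ⁻¹
    obtain ⟨w, hw1, hw2⟩ := exists_covector_values hw ρ⁻¹ (-ρ⁻¹)
    refine ⟨v, w, ?_, ?_, ?_⟩ <;> rw [hg] <;> simp only [hv1, hv2, hw1, hw2] <;> field_simp <;>
      norm_num

end Tube

/-! ### Differentiation on the normal tube -/

section TubeCalculus

variable {L : Type*} [TopologicalSpace L] [ChartedSpace ℝ L] {V : Type*} [NormedAddCommGroup V]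
  [NormedSpace ℝ V]

instance : Fact (Module.finrank ℝ (ℝ × EuclideanSpace ℝ (Fin 1)) = 2) :=
  ⟨by rw [Module.finrank_prod]; simp⟩

/-- The vector `∂/∂θ`, tangent to the circles of the tube. -/
def angleVector (q : L × Circle) : TangentSpace tubeModel q :=
  mfderiv 𝓘(ℝ, ℝ) tubeModel (fun s : ℝ => (q.1, q.2 * Circle.exp s)) 0 (1 : ℝ)

/-- The vector at `q` that lifts `ξ` and is tangent to the curves `θ = const`. -/
def baseVector (ξ : ∀ t : L, TangentSpace 𝓘(ℝ, ℝ) t) (q : L × Circle) :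
    TangentSpace tubeModel q :=
  mfderiv 𝓘(ℝ, ℝ) tubeModel (fun t : L => (t, q.2)) q.1 (ξ q.1)

lemma mvfderiv_angleVector {F : L × Circle → V} {q : L × Circle}
    (hF : MDifferentiableAt tubeModel 𝓘(ℝ, V) F q) {F' : V}
    (h : HasDerivAt (fun s : ℝ => F (q.1, q.2 * Circle.exp s)) F' 0) :
    mvfderiv tubeModel F q (angleVector q) = F' := by
  have hq : ((q.1, q.2 * Circle.exp 0) : L × Circle) = q := by simp
  have key : ∀ p : L × Circle, p = q → MDifferentiableAt tubeModel 𝓘(ℝ, V) F p ∧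
      mvfderiv tubeModel F p (angleVector q : ℝ × EuclideanSpace ℝ (Fin 1)) =
        mvfderiv tubeModel F q (angleVector q) := by
    rintro p rfl
    exact ⟨hF, rfl⟩
  obtain ⟨k1, k2⟩ := key _ hq
  have hγ : MDifferentiableAt 𝓘(ℝ, ℝ) tubeModel
      (fun s : ℝ => ((q.1, q.2 * Circle.exp s) : L × Circle)) 0 := by
    have h1 : ContMDiff 𝓘(ℝ, ℝ) tubeModel ∞
        (fun s : ℝ => ((q.1, q.2 * Circle.exp s) : L × Circle)) :=
      contMDiff_const.prodMk (contMDiff_const.mul contMDiff_circleExp)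
    exact h1.mdifferentiableAt (by simp)
  rw [← k2]
  have h2 := mvfderiv_comp_mfderiv (I := tubeModel) (g := F)
    (γ := fun s : ℝ => ((q.1, q.2 * Circle.exp s) : L × Circle)) k1 hγ (1 : ℝ)
  refine Eq.trans h2.symm ?_
  change mfderiv 𝓘(ℝ, ℝ) 𝓘(ℝ, V) _ (0 : ℝ) (1 : ℝ) = _
  rw [mfderiv_eq_fderiv]
  change fderiv ℝ (fun s : ℝ => F (q.1, q.2 * Circle.exp s)) 0 1 = F'
  rw [h.hasFDerivAt.fderiv]
  simp

lemma mvfderiv_baseVector {F : L × Circle → V} {q : L × Circle}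
    (hF : MDifferentiableAt tubeModel 𝓘(ℝ, V) F q) (ξ : ∀ t : L, TangentSpace 𝓘(ℝ, ℝ) t) :
    mvfderiv tubeModel F q (baseVector ξ q) = der ξ (fun t => F (t, q.2)) q.1 := by
  have hγ : MDifferentiableAt 𝓘(ℝ, ℝ) tubeModel (fun t : L => ((t, q.2) : L × Circle)) q.1 := by
    have h1 : ContMDiff 𝓘(ℝ, ℝ) tubeModel ∞ (fun t : L => ((t, q.2) : L × Circle)) :=
      contMDiff_id.prodMk contMDiff_const
    exact h1.mdifferentiableAt (by simp)
  exact (mvfderiv_comp_mfderiv (I := tubeModel) (γ := fun t : L => ((t, q.2) : L × Circle)) hF hγ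
    (ξ q.1)).symm

variable (L) in
lemma contMDiff_re : ContMDiff tubeModel 𝓘(ℝ, ℝ) ∞ (fun q : L × Circle => (q.2 : ℂ).re) := by
  have : Fact (Module.finrank ℝ ℂ = 1 + 1) := Complex.finrank_real_complex_fact
  have h1 : ContMDiff (𝓡 1) 𝓘(ℝ, ℂ) ∞ (fun z : Circle => (z : ℂ)) := contMDiff_coe_sphere
  exact Complex.reCLM.contDiff.contMDiff.comp (h1.comp contMDiff_snd)

variable (L) in
lemma contMDiff_im : ContMDiff tubeModel 𝓘(ℝ, ℝ) ∞ (fun q : L × Circle => (q.2 : ℂ).im) := by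
  have : Fact (Module.finrank ℝ ℂ = 1 + 1) := Complex.finrank_real_complex_fact
  have h1 : ContMDiff (𝓡 1) 𝓘(ℝ, ℂ) ∞ (fun z : Circle => (z : ℂ)) := contMDiff_coe_sphere
  exact Complex.imCLM.contDiff.contMDiff.comp (h1.comp contMDiff_snd)

lemma hasDerivAt_re (z : Circle) :
    HasDerivAt (fun s : ℝ => ((z * Circle.exp s : Circle) : ℂ).re) (-(z : ℂ).im) 0 := by
  have h : (fun s : ℝ => ((z * Circle.exp s : Circle) : ℂ).re) =
      fun s => (z : ℂ).re * Real.cos s - (z : ℂ).im * Real.sin s := by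
    funext s
    simp [Complex.exp_ofReal_mul_I_re, Complex.exp_ofReal_mul_I_im]
  rw [h]
  refine (((Real.hasDerivAt_cos 0).const_mul (z : ℂ).re).sub
    ((Real.hasDerivAt_sin 0).const_mul (z : ℂ).im)).congr_deriv ?_
  simp

lemma hasDerivAt_im (z : Circle) :
    HasDerivAt (fun s : ℝ => ((z * Circle.exp s : Circle) : ℂ).im) (z : ℂ).re 0 := by
  have h : (fun s : ℝ => ((z * Circle.exp s : Circle) : ℂ).im) =
      fun s => (z : ℂ).re * Real.sin s + (z : ℂ).im * Real.cos s := by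
    funext s
    simp [Complex.exp_ofReal_mul_I_re, Complex.exp_ofReal_mul_I_im]
  rw [h]
  refine (((Real.hasDerivAt_sin 0).const_mul (z : ℂ).re).add
    ((Real.hasDerivAt_cos 0).const_mul (z : ℂ).im)).congr_deriv ?_
  simp

lemma re_sq_add_im_sq (z : Circle) : (z : ℂ).re ^ 2 + (z : ℂ).im ^ 2 = 1 := by
  have := Circle.normSq_coe z
  rw [Complex.normSq_apply] at this
  linarith

end TubeCalculus

/-! ### Frame fields on the normal tube -/

section TubeFields

variable {L : Type*} [TopologicalSpace L] [ChartedSpace ℝ L] [IsManifold 𝓘(ℝ, ℝ) ∞ L]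
  {Γ : L → R23} {δ : ℝ} {ξ : ∀ t : L, TangentSpace 𝓘(ℝ, ℝ) t} {C : Fin 5 → R23}

/-- The field `cos θ G + sin θ K`. -/
def tubeComb (G K : L → R23) (q : L × Circle) : R23 :=
  (q.2 : ℂ).re • G q.1 + (q.2 : ℂ).im • K q.1

/-- The field `G + (1/2) tan θ K`. -/
def tubeShear (G K : L → R23) (q : L × Circle) : R23 :=
  G q.1 + ((q.2 : ℂ).im / (2 * (q.2 : ℂ).re)) • K q.1

lemma contMDiff_const_smul {E H X V : Type*} [NormedAddCommGroup E] [NormedSpace ℝ E]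
    [TopologicalSpace H] {I : ModelWithCorners ℝ E H} [TopologicalSpace X] [ChartedSpace H X]
    [NormedAddCommGroup V] [NormedSpace ℝ V] {F : X → V} (c : ℝ) (hF : ContMDiff I 𝓘(ℝ, V) ∞ F) :
    ContMDiff I 𝓘(ℝ, V) ∞ (fun x => c • F x) :=
  contMDiffOn_univ.mp (contMDiffOn_smul contMDiffOn_const hF.contMDiffOn)

omit [IsManifold 𝓘(ℝ, ℝ) ∞ L] in
lemma contMDiff_tubeComb {G K : L → R23} (hG : ContMDiff 𝓘(ℝ, ℝ) 𝓘(ℝ, R23) ∞ G)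
    (hK : ContMDiff 𝓘(ℝ, ℝ) 𝓘(ℝ, R23) ∞ K) :
    ContMDiff tubeModel 𝓘(ℝ, R23) ∞ (tubeComb G K) :=
  ((contMDiff_re L).smul (hG.comp contMDiff_fst)).add ((contMDiff_im L).smul
    (hK.comp contMDiff_fst))

omit [IsManifold 𝓘(ℝ, ℝ) ∞ L] in
lemma contMDiffOn_tubeShear {G K : L → R23} (hG : ContMDiff 𝓘(ℝ, ℝ) 𝓘(ℝ, R23) ∞ G)
    (hK : ContMDiff 𝓘(ℝ, ℝ) 𝓘(ℝ, R23) ∞ K) {U : Set (L × Circle)}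
    (hU : ∀ q ∈ U, (q.2 : ℂ).re ≠ 0) :
    ContMDiffOn tubeModel 𝓘(ℝ, R23) ∞ (tubeShear G K) U :=
  (hG.comp contMDiff_fst).contMDiffOn.add ((contMDiffOn_div (contMDiff_im L).contMDiffOn
    (contMDiff_const.mul (contMDiff_re L)).contMDiffOn fun q hq =>
      mul_ne_zero two_ne_zero (hU q hq)).smul (hK.comp contMDiff_fst).contMDiffOn)

omit [IsManifold 𝓘(ℝ, ℝ) ∞ L] in
lemma der_smul_add_smul {G K : L → R23} {t : L} (hG : MDifferentiableAt 𝓘(ℝ, ℝ) 𝓘(ℝ, R23) G t)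
    (hK : MDifferentiableAt 𝓘(ℝ, ℝ) 𝓘(ℝ, R23) K t) (a b : ℝ) :
    der ξ (fun t => a • G t + b • K t) t = a • der ξ G t + b • der ξ K t := by
  unfold der
  rw [mvfderiv_add_apply (f := fun t => a • G t) (g := fun t => b • K t) (hG.const_smul a)
    (hK.const_smul b), mvfderiv_const_smul_apply hG,
    mvfderiv_const_smul_apply hK]

omit [IsManifold 𝓘(ℝ, ℝ) ∞ L] in
lemma mvfderiv_tubeComb (ξ : ∀ t : L, TangentSpace 𝓘(ℝ, ℝ) t) {G K : L → R23}
    (hG : ContMDiff 𝓘(ℝ, ℝ) 𝓘(ℝ, R23) ∞ G)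
    (hK : ContMDiff 𝓘(ℝ, ℝ) 𝓘(ℝ, R23) ∞ K) (q : L × Circle) :
    mvfderiv tubeModel (tubeComb G K) q (angleVector q) =
        -(q.2 : ℂ).im • G q.1 + (q.2 : ℂ).re • K q.1 ∧
      mvfderiv tubeModel (tubeComb G K) q (baseVector ξ q) =
        (q.2 : ℂ).re • der ξ G q.1 + (q.2 : ℂ).im • der ξ K q.1 := by
  have hd := (contMDiff_tubeComb hG hK).mdifferentiableAt (x := q) (by simp)
  refine ⟨mvfderiv_angleVector hd ?_, ?_⟩
  · exact ((hasDerivAt_re q.2).smul_const (G q.1)).add ((hasDerivAt_im q.2).smul_const (K q.1))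
  · rw [mvfderiv_baseVector hd]
    exact der_smul_add_smul (hG.mdifferentiableAt (by simp)) (hK.mdifferentiableAt (by simp)) _ _

omit [IsManifold 𝓘(ℝ, ℝ) ∞ L] in
lemma mvfderiv_tubeShear (ξ : ∀ t : L, TangentSpace 𝓘(ℝ, ℝ) t) {G K : L → R23}
    (hG : ContMDiff 𝓘(ℝ, ℝ) 𝓘(ℝ, R23) ∞ G)
    (hK : ContMDiff 𝓘(ℝ, ℝ) 𝓘(ℝ, R23) ∞ K) {q : L × Circle} (hq : (q.2 : ℂ).re ≠ 0) :
    MDifferentiableAt tubeModel 𝓘(ℝ, R23) (tubeShear G K) q ∧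
    mvfderiv tubeModel (tubeShear G K) q (angleVector q) =
        (1 / (2 * (q.2 : ℂ).re ^ 2)) • K q.1 ∧
      mvfderiv tubeModel (tubeShear G K) q (baseVector ξ q) =
        der ξ G q.1 + ((q.2 : ℂ).im / (2 * (q.2 : ℂ).re)) • der ξ K q.1 := by
  have hd := mdifferentiableAt_of_contMDiffOn
    (isOpen_ne.preimage (contMDiff_re L).continuous) (contMDiffOn_tubeShear hG hK fun q h => h) hq
  refine ⟨hd, mvfderiv_angleVector hd ?_, ?_⟩
  · have h1 : HasDerivAt (fun s : ℝ => ((q.2 * Circle.exp s : Circle) : ℂ).im /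
        (2 * ((q.2 * Circle.exp s : Circle) : ℂ).re)) (1 / (2 * (q.2 : ℂ).re ^ 2)) 0 := by
      have h0 : ((q.2 * Circle.exp 0 : Circle) : ℂ) = q.2 := by simp
      refine ((hasDerivAt_im q.2).div ((hasDerivAt_re q.2).const_mul 2) ?_).congr_deriv ?_
      · rw [h0]
        exact mul_ne_zero two_ne_zero hq
      · rw [h0]
        have := re_sq_add_im_sq q.2
        field_simp
        linarith
    exact (h1.smul_const (K q.1)).const_add (G q.1)
  · rw [mvfderiv_baseVector hd]
    have := der_smul_add_smul (ξ := ξ) (hG.mdifferentiableAt (x := q.1) (by simp))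
      (hK.mdifferentiableAt (x := q.1) (by simp)) 1 ((q.2 : ℂ).im / (2 * (q.2 : ℂ).re))
    simp only [one_smul] at this
    exact this

omit [IsManifold 𝓘(ℝ, ℝ) ∞ L] in
lemma mvfderiv_comp_fst (ξ : ∀ t : L, TangentSpace 𝓘(ℝ, ℝ) t) {G : L → R23}
    (hG : ContMDiff 𝓘(ℝ, ℝ) 𝓘(ℝ, R23) ∞ G) (q : L × Circle) :
    MDifferentiableAt tubeModel 𝓘(ℝ, R23) (fun q : L × Circle => G q.1) q ∧
    mvfderiv tubeModel (fun q : L × Circle => G q.1) q (angleVector q) = 0 ∧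
      mvfderiv tubeModel (fun q : L × Circle => G q.1) q (baseVector ξ q) = der ξ G q.1 := by
  have hd : MDifferentiableAt tubeModel 𝓘(ℝ, R23) (fun q : L × Circle => G q.1) q :=
    (hG.comp contMDiff_fst).mdifferentiableAt (x := q) (by simp)
  exact ⟨hd, mvfderiv_angleVector hd (hasDerivAt_const (0 : ℝ) (G q.1)), mvfderiv_baseVector hd ξ⟩

/-- The second order frame field on the whole tube: the null frame along `Γ`, rotated by `θ`. -/
def tubeField (Γ : L → R23) (δ : ℝ) (ξ : ∀ t : L, TangentSpace 𝓘(ℝ, ℝ) t) (C : Fin 5 → R23) :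
    NullField (L × Circle) where
  P := tubeComb (isotropicNormal Γ δ ξ C) fun t => (1 / 2 : ℝ) • der ξ Γ t
  A := tubeComb (fun t => -der ξ Γ t) fun t => (2 : ℝ) • isotropicNormal Γ δ ξ C t
  B := tubeComb (fun t => (-2 : ℝ) • normalDerivative Γ δ ξ C t) fun t => -der ξ (der ξ Γ) t
  N q := δ • Γ q.1
  Q := tubeComb (fun t => -der ξ (der ξ Γ) t) fun t => (2 : ℝ) • normalDerivative Γ δ ξ C t

lemma IsCalibrated.isAlong_tubeField (h : IsCalibrated Γ δ ξ C)
    (sΓ : ContMDiff 𝓘(ℝ, ℝ) 𝓘(ℝ, R23) ∞ Γ) :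
    (tubeField Γ δ ξ C).IsAlong tubeModel (tautologicalMap Γ δ ξ C) univ := by
  have sR := h.contMDiff_isotropicNormal sΓ
  have s1 := contMDiff_der h.2.1 sΓ
  have s2 := contMDiff_der h.2.1 s1
  have sS := h.contMDiff_normalDerivative sΓ
  refine ⟨isOpen_univ, (contMDiff_tubeComb sR (contMDiff_const_smul _ s1)).contMDiffOn,
    (contMDiff_tubeComb s1.neg (contMDiff_const_smul _ sR)).contMDiffOn,
    (contMDiff_tubeComb (contMDiff_const_smul _ sS) s2.neg).contMDiffOn,
    (contMDiff_const_smul _ (sΓ.comp contMDiff_fst)).contMDiffOn,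
    (contMDiff_tubeComb s2.neg (contMDiff_const_smul _ sS)).contMDiffOn, fun q _ => ?_,
      fun q _ => ?_⟩
  · convert (h.isOrientedNullFrame sΓ q.1).rotate (re_sq_add_im_sq q.2) using 1 <;>
      simp only [tubeField, tubeComb] <;> module
  · simp only [tautologicalMap, tubeField, tubeComb]
    congr 1
    module

/-- The covectors of the second order frame field on `∂/∂θ` and on the lift of `ξ`. -/
lemma IsCalibrated.dform_tubeField (h : IsCalibrated Γ δ ξ C)
    (sΓ : ContMDiff 𝓘(ℝ, ℝ) 𝓘(ℝ, R23) ∞ Γ) (q : L × Circle) :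
    (dform tubeModel (tubeField Γ δ ξ C).P ((tubeField Γ δ ξ C).A q) q (angleVector q) = 0 ∧
      dform tubeModel (tubeField Γ δ ξ C).P ((tubeField Γ δ ξ C).A q) q (baseVector ξ q) = 1) ∧
    dform tubeModel (tubeField Γ δ ξ C).P ((tubeField Γ δ ξ C).B q) q (angleVector q) = 1 ∧
    (dform tubeModel (tubeField Γ δ ξ C).P ((tubeField Γ δ ξ C).N q) q (angleVector q) = 0 ∧
      dform tubeModel (tubeField Γ δ ξ C).P ((tubeField Γ δ ξ C).N q) q (baseVector ξ q) = 0) ∧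
    (dform tubeModel (tubeField Γ δ ξ C).N ((tubeField Γ δ ξ C).A q) q (angleVector q) = 0 ∧
      dform tubeModel (tubeField Γ δ ξ C).N ((tubeField Γ δ ξ C).A q) q (baseVector ξ q) = 0) ∧
    dform tubeModel (tubeField Γ δ ξ C).N ((tubeField Γ δ ξ C).B q) q (angleVector q) = 0 := by
  have sR := h.contMDiff_isotropicNormal sΓ
  have s1 := contMDiff_der h.2.1 sΓ
  obtain ⟨RR, RW, RS, RN, RW', WW, WS, WN, WW', SS, SN, SW', NN, NW', W'W'⟩ :=
    h.isNormalTable sΓ q.1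
  obtain ⟨κ, hκ⟩ := der_isotropicNormal_eq Γ δ ξ C q.1
  obtain ⟨p1, p2⟩ := mvfderiv_tubeComb ξ (K := (1 / 2 : ℝ) • der ξ Γ) sR
    (contMDiff_const_smul _ s1) q
  obtain ⟨dn, n1, n2⟩ := mvfderiv_comp_fst ξ sΓ q
  have hd : der ξ ((1 / 2 : ℝ) • der ξ Γ) q.1 = (1 / 2 : ℝ) • der ξ (der ξ Γ) q.1 :=
    mvfderiv_const_smul_apply (s1.mdifferentiableAt (by simp)) _ _
  rw [hd, hκ] at p2
  have hcs := re_sq_add_im_sq q.2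
  have hs : ∀ X Y, sp X Y = sp Y X := sp_comm
  have eP : (tubeField Γ δ ξ C).P =
    tubeComb (isotropicNormal Γ δ ξ C) ((1 / 2 : ℝ) • der ξ Γ) := rfl
  have m1 : ∀ v, mvfderiv tubeModel (tubeField Γ δ ξ C).N q v =
      δ • mvfderiv tubeModel (fun q : L × Circle => Γ q.1) q v := fun v =>
    mvfderiv_const_smul_apply dn δ v
  simp only [dform_apply, m1, n1, n2, eP, p1, p2, smul_zero, sp_zero_left]
  simp only [tubeField, tubeComb, Pi.smul_apply, sp_add_left, sp_add_right, sp_smul_left,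
    sp_smul_right, sp_neg_right, hs (der ξ Γ q.1) (isotropicNormal Γ δ ξ C q.1),
    hs (normalDerivative Γ δ ξ C q.1) (isotropicNormal Γ δ ξ C q.1),
    hs (normalDerivative Γ δ ξ C q.1) (der ξ Γ q.1),
    hs (der ξ (der ξ Γ) q.1) (isotropicNormal Γ δ ξ C q.1),
    hs (der ξ (der ξ Γ) q.1) (der ξ Γ q.1), hs (der ξ (der ξ Γ) q.1) (Γ q.1),
    RR, RW, RS, RN, RW', WW, WS, WN, WW', SN, NW']
  refine ⟨⟨?_, ?_⟩, ?_, ⟨?_, ?_⟩, ⟨?_, ?_⟩, ?_⟩ <;> first | trivial | ring1 | linear_combination hcs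

lemma IsCalibrated.wedge_tubeField (h : IsCalibrated Γ δ ξ C)
    (sΓ : ContMDiff 𝓘(ℝ, ℝ) 𝓘(ℝ, R23) ∞ Γ) (q : L × Circle) :
    wedge tubeModel (dform tubeModel (tubeField Γ δ ξ C).P ((tubeField Γ δ ξ C).B q) q)
      (dform tubeModel (tubeField Γ δ ξ C).P ((tubeField Γ δ ξ C).A q) q)
      (angleVector q) (baseVector ξ q) = 1 := by
  obtain ⟨⟨a1, a2⟩, b1, -⟩ := h.dform_tubeField sΓ q
  rw [wedge, a1, a2, b1]
  ring

lemma IsCalibrated.exists_tube_coeff (h : IsCalibrated Γ δ ξ C)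
    (sΓ : ContMDiff 𝓘(ℝ, ℝ) 𝓘(ℝ, R23) ∞ Γ) {q : L × Circle} (v : TangentSpace tubeModel q) :
    ∃ a b : ℝ, v = a • angleVector q + b • baseVector ξ q :=
  exists_coeff_of_wedge_ne_zero (by rw [h.wedge_tubeField sΓ]; exact one_ne_zero) v

/-- The tube has an orientation for which the frame field is of second order. -/
lemma IsCalibrated.exists_orientation (h : IsCalibrated Γ δ ξ C)
    (sΓ : ContMDiff 𝓘(ℝ, ℝ) 𝓘(ℝ, R23) ∞ Γ) :
    ∃ o : ∀ q : L × Circle, Orientation ℝ (TangentSpace tubeModel q) (Fin 2),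
      IsSurfaceOrientation tubeModel o ∧
      (∀ q, IsPositivePair tubeModel (o q) (angleVector q) (baseVector ξ q)) ∧
      (tubeField Γ δ ξ C).IsSecondOrder tubeModel (tautologicalMap Γ δ ξ C) o univ := by
  have hal := h.isAlong_tubeField sΓ
  obtain ⟨o, ho, hpos⟩ := exists_orientation_of_wedge_pos (I := tubeModel)
    (contMDiffOn_univ.mp hal.sP) (contMDiffOn_univ.mp hal.sA) (contMDiffOn_univ.mp hal.sB)
    fun q => ⟨angleVector q, baseVector ξ q, by rw [h.wedge_tubeField sΓ]; exact one_pos⟩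
  refine ⟨o, ho, fun q => isPositivePair_of_wedge_pos (hpos q)
    (by rw [h.wedge_tubeField sΓ]; exact one_pos),
    { hal with dP_N := fun q _ v => ?_, wedge_pos := fun q _ => hpos q
               trace := fun q _ v w => ?_ }⟩
  · obtain ⟨-, -, ⟨n1, n2⟩, -⟩ := h.dform_tubeField sΓ q
    obtain ⟨a, b, rfl⟩ := h.exists_tube_coeff sΓ v
    simp only [map_add, map_smul, n1, n2, smul_zero, add_zero]
  · obtain ⟨⟨a1, -⟩, -, -, ⟨na1, na2⟩, nb⟩ := h.dform_tubeField sΓ q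
    obtain ⟨a, b, rfl⟩ := h.exists_tube_coeff sΓ v
    obtain ⟨a', b', rfl⟩ := h.exists_tube_coeff sΓ w
    simp only [wedge, map_add, map_smul, na1, na2, a1, nb, smul_eq_mul]
    ring

/-- The adapted frame field on the parabolic component where `ε cos θ > 0`: the null frame along
`Γ`, sheared by `(1/2) tan θ` so that `P` is a positive multiple of `cos θ R + (1/2) sin θ Γ'`. -/
def parabolicField (Γ : L → R23) (δ : ℝ) (ξ : ∀ t : L, TangentSpace 𝓘(ℝ, ℝ) t)
    (C : Fin 5 → R23) (ε : ℝ) : NullField (L × Circle) where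
  P q := ε • tubeShear (isotropicNormal Γ δ ξ C) (der ξ Γ) q
  A q := (-ε) • der ξ Γ q.1
  B q := (-2 * ε) • tubeShear (normalDerivative Γ δ ξ C) (der ξ (der ξ Γ)) q
  N q := δ • Γ q.1
  Q q := (-ε) • der ξ (der ξ Γ) q.1

omit [TopologicalSpace L] in
variable (L) in
omit [IsManifold 𝓘(ℝ, ℝ) ∞ L] [ChartedSpace ℝ L] in
lemma parabolicComponent_eq {ε : ℝ} (hε : ε = 1 ∨ ε = -1) :
    parabolicComponent L ε = {q | 0 < ε * (q.2 : ℂ).re} := by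
  ext q
  change Real.sign _ = ε ↔ 0 < ε * (q.2 : ℂ).re
  rcases lt_trichotomy (q.2 : ℂ).re 0 with h | h | h
  · rw [Real.sign_of_neg h]
    rcases hε with rfl | rfl <;> constructor <;> intro h' <;> linarith
  · rw [h, Real.sign_zero]
    rcases hε with rfl | rfl <;> constructor <;> intro h' <;> linarith
  · rw [Real.sign_of_pos h]
    rcases hε with rfl | rfl <;> constructor <;> intro h' <;> linarith

lemma IsCalibrated.isAdapted_parabolicField (h : IsCalibrated Γ δ ξ C)
    (sΓ : ContMDiff 𝓘(ℝ, ℝ) 𝓘(ℝ, R23) ∞ Γ) {ε : ℝ} (hε : ε = 1 ∨ ε = -1)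
    {o : ∀ q : L × Circle, Orientation ℝ (TangentSpace tubeModel q) (Fin 2)}
    (ho : ∀ q, IsPositivePair tubeModel (o q) (angleVector q) (baseVector ξ q)) :
    (parabolicField Γ δ ξ C ε).IsAdapted tubeModel (tautologicalMap Γ δ ξ C) o (ε * δ)
      (parabolicComponent L ε) ∧
    ∀ q ∈ parabolicComponent L ε, ∀ v, dform tubeModel (parabolicField Γ δ ξ C ε).Q
      ((parabolicField Γ δ ξ C ε).A q) q v = 0 := by
  have hε2 : ε * ε = 1 := by rcases hε with rfl | rfl <;> norm_num
  have sR := h.contMDiff_isotropicNormal sΓ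
  have s1 := contMDiff_der h.2.1 sΓ
  have s2 := contMDiff_der h.2.1 s1
  have sS := h.contMDiff_normalDerivative sΓ
  rw [parabolicComponent_eq L hε]
  set U : Set (L × Circle) := {q | 0 < ε * (q.2 : ℂ).re} with hU
  have hUc : ∀ q ∈ U, (q.2 : ℂ).re ≠ 0 := fun q hq => right_ne_zero_of_mul (ne_of_gt hq)
  set Φ := parabolicField Γ δ ξ C ε with hΦ
  have hal : Φ.IsAlong tubeModel (tautologicalMap Γ δ ξ C) U := by
    refine ⟨isOpen_lt continuous_const (continuous_const.mul (contMDiff_re L).continuous),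
      contMDiffOn_smul contMDiffOn_const (contMDiffOn_tubeShear sR s1 hUc),
      (contMDiff_const_smul _ (s1.comp contMDiff_fst)).contMDiffOn,
      contMDiffOn_smul contMDiffOn_const (contMDiffOn_tubeShear sS s2 hUc),
      (contMDiff_const_smul _ (sΓ.comp contMDiff_fst)).contMDiffOn,
      (contMDiff_const_smul _ (s2.comp contMDiff_fst)).contMDiffOn, fun q _ => ?_, fun q hq => ?_⟩
    · convert ((h.isOrientedNullFrame sΓ q.1).shear
        ((q.2 : ℂ).im / (2 * (q.2 : ℂ).re))).sign hε2 using 1 <;>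
        simp only [hΦ, parabolicField, tubeShear] <;> module
    · simp only [tautologicalMap, hΦ, parabolicField, tubeShear]
      rw [← ray_smul hq (ε • _)]
      congr 1
      rw [smul_smul, smul_add, smul_smul, show ε * (q.2 : ℂ).re * ε = (q.2 : ℂ).re by
        linear_combination (q.2 : ℂ).re * hε2]
      congr 2
      have := hUc q hq
      field_simp
  -- the covectors of the frame field on `∂/∂θ` and on the lift of `ξ`; here `τ / 2` is the
  -- derivative of `(1/2) tan θ`
  have key : ∀ q ∈ U, ∃ τ : ℝ, 0 < τ ∧
      (dform tubeModel Φ.P (Φ.A q) q (angleVector q) = 0 ∧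
        dform tubeModel Φ.P (Φ.A q) q (baseVector ξ q) = 1) ∧
      dform tubeModel Φ.P (Φ.B q) q (angleVector q) = τ ∧
      (dform tubeModel Φ.P (Φ.N q) q (angleVector q) = 0 ∧
        dform tubeModel Φ.P (Φ.N q) q (baseVector ξ q) = 0) ∧
      (dform tubeModel Φ.P (Φ.Q q) q (angleVector q) = 0 ∧
        dform tubeModel Φ.P (Φ.Q q) q (baseVector ξ q) = 0) ∧
      (dform tubeModel Φ.A (Φ.B q) q (angleVector q) = 0 ∧
        dform tubeModel Φ.A (Φ.B q) q (baseVector ξ q) = 0) ∧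
      (dform tubeModel Φ.N (Φ.A q) q (angleVector q) = 0 ∧
        dform tubeModel Φ.N (Φ.A q) q (baseVector ξ q) = 0) ∧
      (dform tubeModel Φ.N (Φ.B q) q (angleVector q) = 0 ∧
        dform tubeModel Φ.N (Φ.B q) q (baseVector ξ q) = 2 * (ε * δ)) ∧
      (dform tubeModel Φ.N (Φ.Q q) q (angleVector q) = 0 ∧
        dform tubeModel Φ.N (Φ.Q q) q (baseVector ξ q) = 0) ∧
      (dform tubeModel Φ.Q (Φ.A q) q (angleVector q) = 0 ∧
        dform tubeModel Φ.Q (Φ.A q) q (baseVector ξ q) = 0) := by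
    intro q hq
    have hc := hUc q hq
    obtain ⟨RR, RW, RS, RN, RW', WW, WS, WN, WW', SS, SN, SW', NN, NW', W'W'⟩ :=
      h.isNormalTable sΓ q.1
    obtain ⟨κ, hκ⟩ := der_isotropicNormal_eq Γ δ ξ C q.1
    obtain ⟨a, ha⟩ := h.exists_third_derivative sΓ q.1
    obtain ⟨dp, p1, p2⟩ := mvfderiv_tubeShear ξ sR s1 hc
    obtain ⟨dn, n1, n2⟩ := mvfderiv_comp_fst ξ sΓ q
    obtain ⟨da, a1, a2⟩ := mvfderiv_comp_fst ξ s1 q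
    obtain ⟨dq, q1, q2⟩ := mvfderiv_comp_fst ξ s2 q
    rw [hκ] at p2
    rw [ha] at q2
    have mP := mvfderiv_const_smul_apply dp ε
    have mA := mvfderiv_const_smul_apply da (-ε)
    have mN := mvfderiv_const_smul_apply dn δ
    have mQ := mvfderiv_const_smul_apply dq (-ε)
    have hs : ∀ X Y, sp X Y = sp Y X := sp_comm
    have hτ : 0 < 1 / (2 * (q.2 : ℂ).re ^ 2) := by positivity
    refine ⟨2 * (1 / (2 * (q.2 : ℂ).re ^ 2)), by positivity, ?_⟩
    simp only [dform_apply, hΦ, parabolicField, mP, mA, mN, mQ, p1, p2, n1, n2, a1, a2, q1, q2,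
      smul_zero, sp_zero_left]
    simp only [tubeShear, sp_add_left, sp_add_right, sp_smul_left, sp_smul_right,
      hs (normalDerivative Γ δ ξ C q.1) (der ξ Γ q.1),
      hs (der ξ (der ξ Γ) q.1) (normalDerivative Γ δ ξ C q.1),
      hs (der ξ (der ξ Γ) q.1) (der ξ Γ q.1), hs (der ξ (der ξ Γ) q.1) (Γ q.1),
      WW, WS, WN, WW', SN, SW', NW', W'W']
    refine ⟨⟨?_, ?_⟩, ?_, ⟨?_, ?_⟩, ⟨?_, ?_⟩, ⟨?_, ?_⟩, ⟨?_, ?_⟩, ⟨?_, ?_⟩, ⟨?_, ?_⟩, ?_, ?_⟩ <;>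
      first
      | trivial
      | ring1
      | linear_combination hε2
      | linear_combination (2 * (1 / (2 * (q.2 : ℂ).re ^ 2))) * hε2
  have hcoef : ∀ {q : L × Circle} (v : TangentSpace tubeModel q),
      ∃ a b : ℝ, v = a • angleVector q + b • baseVector ξ q := h.exists_tube_coeff sΓ
  have hzero : ∀ {q : L × Circle} {α : TangentSpace tubeModel q →ₗ[ℝ] ℝ},
      α (angleVector q) = 0 ∧ α (baseVector ξ q) = 0 → ∀ v, α v = 0 := by
    rintro q α ⟨h1, h2⟩ v
    obtain ⟨a, b, rfl⟩ := hcoef v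
    rw [map_add, map_smul, map_smul, h1, h2, smul_zero, smul_zero, add_zero]
  have hNB : ∀ q ∈ U, ∀ v, dform tubeModel Φ.N (Φ.B q) q v =
      2 * (ε * δ) * dform tubeModel Φ.P (Φ.A q) q v := by
    intro q hq v
    obtain ⟨τ, -, ⟨a1, a2⟩, -, -, -, -, -, ⟨n1, n2⟩, -⟩ := key q hq
    obtain ⟨a, b, rfl⟩ := hcoef v
    simp only [map_add, map_smul, smul_eq_mul, a1, a2, n1, n2]
    ring
  refine ⟨{ hal with
    dP_N := fun q hq => ?_
    wedge_pos := fun q hq v w hvw => ?_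
    trace := fun q hq v w => ?_
    dN_A := fun q hq => ?_
    dN_B := hNB
    dN_Q := fun q hq => ?_
    dP_Q := fun q hq v => ?_
    dQ_A := fun q hq v w => ?_ }, fun q hq => ?_⟩ <;>
    obtain ⟨τ, hτ, hPA, hPB, hPN, hPQ, hAB, hNA, -, hNQ, hQA⟩ := key q hq
  · exact hzero hPN
  · obtain ⟨d, hd, hd'⟩ := (ho q).exists_pos_wedge_eq hvw
    rw [hd', wedge, hPA.1, hPA.2, hPB, mul_one, mul_zero, sub_zero]
    exact mul_pos hd hτ
  · simp only [wedge, hNB q hq, hzero hNA]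
    ring
  · exact hzero hNA
  · exact hzero hNQ
  · rw [hzero hPQ, hzero hAB, add_zero]
  · simp only [wedge, hzero hQA, zero_mul, sub_zero]
  · exact hzero hQA

end TubeFields

/-! ### The tautological map of the normal tube -/

section Tautological

variable {L : Type*} [TopologicalSpace L] [ChartedSpace ℝ L] [IsManifold 𝓘(ℝ, ℝ) ∞ L]
  {Γ : L → R23} {δ : ℝ} {ξ : ∀ t : L, TangentSpace 𝓘(ℝ, ℝ) t} {C : Fin 5 → R23}

lemma IsBiisotropic.exists_isCalibrated [ConnectedSpace L] (h : IsBiisotropic Γ) :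
    ∃ δ ξ C, IsCalibrated Γ δ ξ C := by
  obtain ⟨sΓ, hΓ, ξ, hξ, hi⟩ := h
  obtain ⟨ξ', hξ', hiso, hnorm⟩ := exists_global_normalized sΓ hΓ
    fun t => ⟨univ, ξ, mem_univ t, hξ.isFieldOn, fun s _ => hi s⟩
  obtain ⟨δ, C, hC⟩ := exists_isCalibrated_of_normalized sΓ hΓ hξ' hiso hnorm
  exact ⟨δ, ξ', C, hC⟩

/-- `a R + b Γ'` determines `a` and `b`. -/
lemma IsCalibrated.sp_comb (h : IsCalibrated Γ δ ξ C)
    (sΓ : ContMDiff 𝓘(ℝ, ℝ) 𝓘(ℝ, R23) ∞ Γ) (t : L) (a b : ℝ) :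
    sp (a • isotropicNormal Γ δ ξ C t + b • der ξ Γ t) (der ξ (der ξ Γ) t) = a ∧
      sp (a • isotropicNormal Γ δ ξ C t + b • der ξ Γ t) (normalDerivative Γ δ ξ C t) = -b ∧
      sp (a • isotropicNormal Γ δ ξ C t + b • der ξ Γ t)
        (a • isotropicNormal Γ δ ξ C t + b • der ξ Γ t) = 0 := by
  have T := h.isNormalTable sΓ t
  refine ⟨?_, ?_, ?_⟩
  · simp [sp_add_left, sp_smul_left, T.RW', T.WW']
  · simp [sp_add_left, sp_smul_left, T.RS, T.WS]
  · simp [sp_add_left, sp_smul_left, sp_add_right, sp_smul_right, T.RR, T.RW, T.WW,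
      sp_comm (der ξ Γ t) (isotropicNormal Γ δ ξ C t)]

lemma IsCalibrated.bijOn_normalTube (h : IsCalibrated Γ δ ξ C)
    (sΓ : ContMDiff 𝓘(ℝ, ℝ) 𝓘(ℝ, R23) ∞ Γ) :
    BijOn (fun q : L × Circle => (q.1, tautologicalMap Γ δ ξ C q)) univ
      (normalTube Γ δ ξ C) := by
  have hne : ∀ (t : L) (z : Circle), (z : ℂ).re • isotropicNormal Γ δ ξ C t +
      (1 / 2 * (z : ℂ).im) • der ξ Γ t ≠ 0 := by
    intro t z h0
    obtain ⟨h1, h2, -⟩ := h.sp_comb sΓ t (z : ℂ).re (1 / 2 * (z : ℂ).im)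
    rw [h0, sp_zero_left] at h1 h2
    have := re_sq_add_im_sq z
    rw [← h1, show (z : ℂ).im = 0 by linarith] at this
    norm_num at this
  refine ⟨fun q _ => ⟨_, ?_, hne q.1 q.2, rfl⟩, ?_, ?_⟩
  · exact Submodule.mem_span_pair.mpr ⟨_, _, rfl⟩
  · rintro ⟨t, z⟩ - ⟨t', w⟩ - hzw
    obtain ⟨rfl, h2⟩ := Prod.mk.inj hzw
    obtain ⟨z1, z2, z3⟩ := h.sp_comb sΓ t (z : ℂ).re (1 / 2 * (z : ℂ).im)
    obtain ⟨w1, w2, w3⟩ := h.sp_comb sΓ t (w : ℂ).re (1 / 2 * (w : ℂ).im)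
    obtain ⟨r, hr, hr'⟩ := exists_pos_smul_of_ray_eq (hne t z) z3 (hne t w) w3 h2
    rw [hr', sp_smul_left] at w1 w2
    rw [z1] at w1
    rw [z2] at w2
    have hz := re_sq_add_im_sq z
    have hw := re_sq_add_im_sq w
    have him : (w : ℂ).im = r * (z : ℂ).im := by linarith
    have hr1 : r = 1 := by
      rw [← w1, him] at hw
      have : (r - 1) * (r + 1) = 0 := by linear_combination hw - r ^ 2 * hz
      rcases mul_eq_zero.mp this with h | h <;> linarith
    rw [hr1, one_mul] at w1 him
    have : z = w := Circle.ext (Complex.ext w1 him.symm)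
    rw [this]
  · rintro ⟨t, p⟩ ⟨V, hV, hV0, hp⟩
    obtain ⟨a, b, rfl⟩ := Submodule.mem_span_pair.mp hV
    have hab : a ≠ 0 ∨ b ≠ 0 := by
      by_contra! h0
      exact hV0 (by rw [h0.1, h0.2, zero_smul, zero_smul, add_zero])
    obtain ⟨z, r, -, -, hz⟩ := exists_tautologicalMap_eq Γ δ ξ C t hab
    exact ⟨(t, z), mem_univ _, Prod.ext rfl (hz.trans hp.symm)⟩

omit [TopologicalSpace L] in
variable (L) in
omit [IsManifold 𝓘(ℝ, ℝ) ∞ L] [ChartedSpace ℝ L] in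
lemma umbilicalCurve_union :
    umbilicalCurve L 1 ∪ umbilicalCurve L (-1) = {q | (q.2 : ℂ).re = 0} := by
  ext q
  change (q.2 : ℂ) = ((1 : ℝ) : ℂ) * Complex.I ∨ (q.2 : ℂ) = ((-1 : ℝ) : ℂ) * Complex.I ↔
    (q.2 : ℂ).re = 0
  have hcs := re_sq_add_im_sq q.2
  simp only [Complex.ext_iff, Complex.re_ofReal_mul, Complex.im_ofReal_mul, Complex.I_re,
    Complex.I_im, mul_zero, mul_one]
  constructor
  · rintro (h | h) <;> exact h.1
  · intro h
    rw [h] at hcs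
    have : ((q.2 : ℂ).im - 1) * ((q.2 : ℂ).im + 1) = 0 := by linear_combination hcs
    rcases mul_eq_zero.mp this with h' | h'
    · exact Or.inl ⟨h, by linarith⟩
    · exact Or.inr ⟨h, by linarith⟩

/-- The image of `dN` is spanned by `Γ'`, and `f` is proportional to `Γ'` where `cos θ = 0`. -/
lemma IsCalibrated.isUmbilicPoint_iff (h : IsCalibrated Γ δ ξ C)
    (sΓ : ContMDiff 𝓘(ℝ, ℝ) 𝓘(ℝ, R23) ∞ Γ)
    {o : ∀ q : L × Circle, Orientation ℝ (TangentSpace tubeModel q) (Fin 2)}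
    (ho : gaussMap tubeModel (tautologicalMap Γ δ ξ C) o = fun q => Γ q.1) (q : L × Circle) :
    IsUmbilicPoint tubeModel (tautologicalMap Γ δ ξ C) o q ↔ (q.2 : ℂ).re = 0 := by
  have hal := h.isAlong_tubeField sΓ
  obtain ⟨-, n1, n2⟩ := mvfderiv_comp_fst ξ sΓ q
  obtain ⟨ρ, hρ, hf, -⟩ := hal.exists_mvfderiv (mem_univ q)
  have hP : (tubeField Γ δ ξ C).P q = (q.2 : ℂ).re • isotropicNormal Γ δ ξ C q.1 +
      (1 / 2 * (q.2 : ℂ).im) • der ξ Γ q.1 := by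
    simp only [tubeField, tubeComb]
    module
  rw [hP] at hf
  unfold IsUmbilicPoint
  rw [ho]
  constructor
  · intro hu
    by_contra hc
    refine hu (baseVector ξ q) ?_
    rw [n2, hf, LinearIndependent.pair_iff]
    intro a b hab
    obtain ⟨h1, h2, -⟩ := h.sp_comb sΓ q.1 (a * ρ * (q.2 : ℂ).re)
      (a * ρ * (1 / 2 * (q.2 : ℂ).im) + b)
    have he : (a * ρ * (q.2 : ℂ).re) • isotropicNormal Γ δ ξ C q.1 +
        (a * ρ * (1 / 2 * (q.2 : ℂ).im) + b) • der ξ Γ q.1 = 0 := by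
      rw [← hab]
      module
    rw [he, sp_zero_left] at h1 h2
    have ha : a = 0 := by simpa [hρ.ne', hc] using h1.symm
    rw [ha] at h2
    exact ⟨ha, by linarith⟩
  · intro hc v hli
    obtain ⟨a, b, rfl⟩ := h.exists_tube_coeff sΓ v
    rw [map_add, map_smul, map_smul, n1, n2, smul_zero, zero_add, hf, hc, zero_smul, zero_add,
      LinearIndependent.pair_iff] at hli
    have him : (q.2 : ℂ).im ≠ 0 := by
      intro h0
      have := re_sq_add_im_sq q.2
      rw [hc, h0] at this
      norm_num at this
    have h1 := (hli b (-(ρ * (1 / 2 * (q.2 : ℂ).im))) (by module)).2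
    simp [hρ.ne', him] at h1

/-- The normal tube of a calibrated curve: all properties follow from `tubeField`, a second order
frame field with `N = δ Γ`, and from `parabolicField`, an adapted one with `Q = -ε Γ''`. For
`δ = -1` the two orientations differ, as reversing the orientation reverses `N`. -/
theorem IsCalibrated.normalTube_geometry (h : IsCalibrated Γ δ ξ C)
    (sΓ : ContMDiff 𝓘(ℝ, ℝ) 𝓘(ℝ, R23) ∞ Γ) :
    BijOn (fun q : L × Circle => (q.1, tautologicalMap Γ δ ξ C q)) univ
      (normalTube Γ δ ξ C) ∧
    IsTimelikeImmersionOn tubeModel (tautologicalMap Γ δ ξ C) univ ∧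
    ∃ o : ∀ q : L × Circle, Orientation ℝ (TangentSpace tubeModel q) (Fin 2),
      IsSurfaceOrientation tubeModel o ∧
      (∀ q, gaussMap tubeModel (tautologicalMap Γ δ ξ C) o q = Γ q.1) ∧
      {q | IsUmbilicPoint tubeModel (tautologicalMap Γ δ ξ C) o q} =
        umbilicalCurve L 1 ∪ umbilicalCurve L (-1) ∧
      ∀ ε : ℝ, ε = 1 ∨ ε = -1 →
        IsQuasiUmbilicalOn tubeModel (tautologicalMap Γ δ ξ C)
          (signedOrientation tubeModel δ o) (parabolicComponent L ε) ∧
        IsCanonicalOrientationOn tubeModel (tautologicalMap Γ δ ξ C)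
          (signedOrientation tubeModel δ o) (parabolicComponent L ε) ∧
        HasHelicityOn tubeModel (tautologicalMap Γ δ ξ C)
          (signedOrientation tubeModel δ o) (parabolicComponent L ε) (ε * δ) ∧
        IsExceptionalOn tubeModel (tautologicalMap Γ δ ξ C)
          (signedOrientation tubeModel δ o) (ε * δ) (parabolicComponent L ε) ∧
        ∀ q ∈ parabolicComponent L ε,
          dualMap tubeModel (tautologicalMap Γ δ ξ C) (signedOrientation tubeModel δ o)
            (ε * δ) q = ray (-ε • der ξ (der ξ Γ) q.1) := by
  obtain ⟨o, ho, hpos, hso⟩ := h.exists_orientation sΓ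
  have hδ := h.1
  have himm := hso.isTimelikeImmersionOn
  have hgauss : gaussMap tubeModel (tautologicalMap Γ δ ξ C) (signedOrientation tubeModel δ o) =
      fun q => Γ q.1 := by
    funext q
    rcases hδ with rfl | rfl
    · rw [signedOrientation_one, hso.gaussMap_eq (mem_univ q)]
      exact one_smul ℝ _
    · rw [signedOrientation_neg_one, hso.flip.gaussMap_eq (mem_univ q)]
      change -((-1 : ℝ) • Γ q.1) = Γ q.1
      rw [neg_one_smul, neg_neg]
  refine ⟨h.bijOn_normalTube sΓ, himm, signedOrientation tubeModel δ o,
    isSurfaceOrientation_signedOrientation hδ ho, fun q => congrFun hgauss q, ?_, fun ε hε => ?_⟩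
  · rw [umbilicalCurve_union]
    ext q
    exact h.isUmbilicPoint_iff sΓ hgauss q
  · rw [signedOrientation_signedOrientation hδ]
    obtain ⟨had, hQ⟩ := h.isAdapted_parabolicField sΓ hε hpos
    have hεδ : ε * δ = 1 ∨ ε * δ = -1 := by
      rcases hε with rfl | rfl <;> rcases hδ with rfl | rfl <;> norm_num
    have hεδ0 : ε * δ ≠ 0 := by rcases hεδ with h | h <;> rw [h] <;> norm_num
    exact ⟨⟨⟨himm.1.mono (subset_univ _), fun q _ => himm.2 q (mem_univ q)⟩,
      fun q hq => had.isQuasiUmbilicPoint hεδ0 hq⟩, fun q hq V V' => had.isPositivePair hεδ0 hq,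
      fun q hq V V' => had.sign_eq hεδ hq, had.isExceptionalOn hεδ0 hQ,
      fun q hq => had.dualMap_eq hεδ0 hq⟩

end Tautological

end Einstein

end

open Einstein in
theorem theoremB :
    -- Normal tubes of biisotropic curves.
    (∀ (L : Type*) [TopologicalSpace L] [T2Space L] [SecondCountableTopology L] [ConnectedSpace L]
      [ChartedSpace ℝ L] [IsManifold 𝓘(ℝ, ℝ) ∞ L] (Γ : L → R23), IsBiisotropic Γ →
      (∃ δ ξ C, IsCalibrated Γ δ ξ C) ∧
      ∀ δ ξ C, IsCalibrated Γ δ ξ C →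
        BijOn (fun q : L × Circle => (q.1, tautologicalMap Γ δ ξ C q)) univ
          (normalTube Γ δ ξ C) ∧
        IsTimelikeImmersionOn tubeModel (tautologicalMap Γ δ ξ C) univ ∧
        ∃ o : ∀ q : L × Circle, Orientation ℝ (TangentSpace tubeModel q) (Fin 2),
          IsSurfaceOrientation tubeModel o ∧
          (∀ q, gaussMap tubeModel (tautologicalMap Γ δ ξ C) o q = Γ q.1) ∧
          {q | IsUmbilicPoint tubeModel (tautologicalMap Γ δ ξ C) o q} =
            umbilicalCurve L 1 ∪ umbilicalCurve L (-1) ∧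
          ∀ ε : ℝ, ε = 1 ∨ ε = -1 →
            IsQuasiUmbilicalOn tubeModel (tautologicalMap Γ δ ξ C)
              (signedOrientation tubeModel δ o) (parabolicComponent L ε) ∧
            IsCanonicalOrientationOn tubeModel (tautologicalMap Γ δ ξ C)
              (signedOrientation tubeModel δ o) (parabolicComponent L ε) ∧
            HasHelicityOn tubeModel (tautologicalMap Γ δ ξ C)
              (signedOrientation tubeModel δ o) (parabolicComponent L ε) (ε * δ) ∧
            IsExceptionalOn tubeModel (tautologicalMap Γ δ ξ C)
              (signedOrientation tubeModel δ o) (ε * δ) (parabolicComponent L ε) ∧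
            ∀ q ∈ parabolicComponent L ε,
              dualMap tubeModel (tautologicalMap Γ δ ξ C) (signedOrientation tubeModel δ o)
                (ε * δ) q = ray (-ε • der ξ (der ξ Γ) q.1)) ∧
    -- Regular exceptional quasi-umbilical immersions.
    (∀ (X : Type*) [TopologicalSpace X] [T2Space X] [SecondCountableTopology X] [ConnectedSpace X]
      [ChartedSpace (EuclideanSpace ℝ (Fin 2)) X] [IsManifold (𝓡 2) ∞ X]
      (o : ∀ x : X, Orientation ℝ (TangentSpace (𝓡 2) x) (Fin 2)) (f : X → R23) (ε : ℝ),
      IsSurfaceOrientation (𝓡 2) o → IsQuasiUmbilicalOn (𝓡 2) f o univ →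
      IsCanonicalOrientationOn (𝓡 2) f o univ →
      (ε = 1 ∨ ε = -1) → HasHelicityOn (𝓡 2) f o univ ε →
      IsExceptionalOn (𝓡 2) f o ε univ →
      T2Space (LeafSpace (𝓡 2) (gaussMap (𝓡 2) f o)) →
      SecondCountableTopology (LeafSpace (𝓡 2) (gaussMap (𝓡 2) f o)) ∧
      -- the leaf space is a 1-manifold, onto which the surface submerses
      ∃ (_ : ChartedSpace ℝ (LeafSpace (𝓡 2) (gaussMap (𝓡 2) f o)))
        (_ : IsManifold 𝓘(ℝ, ℝ) ∞ (LeafSpace (𝓡 2) (gaussMap (𝓡 2) f o)))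
        (Γ : LeafSpace (𝓡 2) (gaussMap (𝓡 2) f o) → R23),
        ContMDiff (𝓡 2) 𝓘(ℝ, ℝ) ∞ (Quotient.mk (leafSetoid (𝓡 2) (gaussMap (𝓡 2) f o))) ∧
        (∀ x : X, Function.Surjective (mfderiv (𝓡 2) 𝓘(ℝ, ℝ)
          (Quotient.mk (leafSetoid (𝓡 2) (gaussMap (𝓡 2) f o))) x)) ∧
        -- `Γ` is the directrix curve
        (∀ x : X, gaussMap (𝓡 2) f o x = Γ (Quotient.mk _ x)) ∧
        IsBiisotropic Γ ∧
        (∃ ξ C, IsCalibrated Γ 1 ξ C) ∧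
        ∀ δ ξ C, IsCalibrated Γ δ ξ C → δ = 1 ∧
          f '' univ ⊆ tautologicalMap Γ δ ξ C '' parabolicComponent _ ε) := by
  refine ⟨fun L _ _ _ _ _ _ Γ hΓ => ⟨hΓ.exists_isCalibrated, fun δ ξ C h =>
    h.normalTube_geometry hΓ.1⟩, fun X _ _ _ _ _ _ o f ε ho hf hcan hε hhel hexc _ => ?_⟩
  have : Fact (Module.finrank ℝ (EuclideanSpace ℝ (Fin 2)) = 2) := ⟨by simp⟩
  exact exists_directrix ho hf hcan hε hhel hexc
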